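/- **Setting.** Let $C$ be a smooth projective geometrically irreducible curve over the finite field $\mathbb{F}_q$ with a rational point $\infty\in C(\mathbb{F}_q)$, let $Q$ be its function field, $A=\Gamma(C\setminus\{\infty\},\mathcal{O}_C)$, and let $z$ denote a uniformizer at $\infty$. For a place $v$ of $Q$ let $A_v$ and $Q_v$ be the completions, and $\mathbb{F}_v$ the residue field. Let $L\supset\mathbb{F}_q$ be a finite field with separable closure $L^{\rm sep}$, $C_L=C\times_{\mathbb{F}_q}L$, $A_L=A\otimes_{\mathbb{F}_q}L$, and let $\sigma$ be the endomorphism that is the identity on $C$ (or $A$) and the $q$-Frobenius on $L$. *Abelian $\tau$-sheaves.* Let $c:\operatorname{Spec}L\to C$ be an $\mathbb{F}_q$-morphism with image $\mathrm{chr}$. An abelian $\tau$-sheaf $\mathcal{F}=(\mathcal{F}_i,\Pi_i,\tau_i)_{i\in\mathbb{Z}}$ of rank $r$, dimension $d$ and characteristic $c$ consists of locally free sheaves $\mathcal{F}_i$ of rank $r$ on $C_L$ and injective morphisms $\Pi_i:\mathcal{F}_i\to\mathcal{F}_{i+1}$, $\tau_i:\sigma^*\mathcal{F}_i\to\mathcal{F}_{i+1}$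 with $\Pi_{i+1}\tau_i=\tau_{i+1}\,\sigma^*\Pi_i$, such that (i) for some integers $k,l>0$ with $ld=kr$ the map $\Pi_{i+l-1}\circ\dots\circ\Pi_i$ identifies $\mathcal{F}_i$ with $\mathcal{F}_{i+l}(-k\infty)$ for all $i$; (ii) $\operatorname{coker}\Pi_i$ and $\operatorname{coker}\tau_i$ have $L$-dimension $d$, and $\operatorname{coker}\tau_i$ is annihilated by the $d$-th power of the ideal sheaf of the graph of $c$. Morphisms are families of maps commuting with all $\Pi_i$ and $\tau_i$. A quasi-morphism $\mathcal{F}\to\mathcal{F}'$ is a morphism $\mathcal{F}\to\mathcal{F}'(D)$ for an effective divisor $D$ on $C$ (modulo enlarging $D$); for $\mathcal{F},\mathcal{F}'$ of the same weight $d/r$ it is a quasi-isogeny if it is an isomorphism at the generic point of $C_L$. $\operatorname{QEnd}(\mathcal{F})$ is the $Q$-algebra of quasi-endomorphisms. $\mathcal{F}$ is simple if $\mathcal{F}\ne0$ and its only quotient $\tau$-sheaves are $0$ and $\mathcal{F}$; it is semisimple if it is quasi-isogenous to a finite direct sum of simple ones. *Tate modules.* For a module $M$ with a $\sigma$-semilinear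 map $\tau$ put $T_vM=\varprojlim_n\bigl((M/v^nM)\otimes_LL^{\rm sep}\bigr)^{\tau}$ and $V_vM=T_vM\otimes_{A_v}Q_v$. For $v\ne\mathrm{chr},\infty$ let $V_v\mathcal{F}$ be formed from $M=\Gamma(C_L\setminus\infty,\mathcal{F}_0)$ with $\Pi_0^{-1}\tau_0$. For $v=\infty\neq\mathrm{chr}$ and any $k,l$ as in (i), let $V_\infty\mathcal{F}$ be formed from the stalk at $\infty$ of $\mathcal{F}_0\oplus\dots\oplus\mathcal{F}_{l-1}$, with $\tau$ given by the $\tau_i:\sigma^*\mathcal{F}_i\to\mathcal{F}_{i+1}$ for $0\le i<l-1$ and by $\sigma^*\mathcal{F}_{l-1}\xrightarrow{\tau_{l-1}}\mathcal{F}_l\xrightarrow{z^k}\mathcal{F}_0$. A quasi-endomorphism $f$ of $\mathcal{F}$ induces endomorphisms $V_vf$ and $V_\infty f$ (acting on $\bigoplus\mathcal{F}_i$ diagonally). *Reduced norm.* If $E\cong\prod_iE_i$ is a finite-dimensional semisimple $Q$-algebra with $E_i$ central simple over the finite field extension $F_i$ of $Q$, and $\alpha_i:E_i\otimes_{F_i}K_i\cong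 M_{n_i}(K_i)$ are splittings, the reduced norm of $f=(f_i)\in E$ is $N(f)=\prod_iN_{F_i/Q}\bigl(\det\alpha_i(f_i\otimes1)\bigr)\in Q$; it does not depend on the choices. *Pure Anderson motives.* Let $c^*:A\to L$ be an $\mathbb{F}_q$-homomorphism and $J=(a\otimes1-1\otimes c^*(a):a\in A)\subset A_L$. A pure Anderson motive $\underline{M}=(M,\tau)$ of rank $r$, dimension $d$ and characteristic $c^*$ is a locally free $A_L$-module $M$ of rank $r$ with an injective $A_L$-linear map $\tau:\sigma^*M\to M$ whose cokernel has $L$-dimension $d$ and is annihilated by $J^d$, such that $M$ extends to a locally free sheaf $\mathcal{M}$ on $C_L$ for which, for some $k,l>0$, $\tau^l$ induces an isomorphism $(\sigma^*)^l\mathcal{M}_\infty\to\mathcal{M}(k\infty)_\infty$. Morphisms are $A_L$-linear maps commuting with $\tau$; an isogeny is an injective morphism with torsion cokernel. $\underline{M}$ is simple if it is nonzero and its only quotient motives are $0$ and $\underline{M}$; it is semisimple if it is isogenous to a finite direct sum of simple ones. $N(f)$ for $f\in\operatorname{End}(\underline{M})$ is the reduced norm of $f$ in $\operatorname{End}(\underline{M})\otimes_AQ$.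 The degree of an isogeny $f$ is the ideal $\deg(f)=\prod_vv^{\dim_L(\operatorname{coker}f)_v/[\mathbb{F}_v:\mathbb{F}_q]}$ of $A$, where $v$ runs over the maximal ideals of $A$ and $(\operatorname{coker}f)_v$ is the $v$-primary part. **Theorem 1.** Let $\mathcal{F}$ be a semisimple abelian $\tau$-sheaf over the finite field $L$; if $\mathrm{chr}=\infty$, assume that the $Q$-algebra $\operatorname{QEnd}(\mathcal{F})$ is semisimple (so that its reduced norm is defined; for $\mathrm{chr}\ne\infty$ this is automatic). Let $f\in\operatorname{QEnd}(\mathcal{F})$ be a quasi-isogeny. Then the reduced norm $N(f)\in Q$ of $f$ is defined and 1. for every place $v\neq\mathrm{chr},\infty$ of $Q$, $V_v\mathcal{F}$ has dimension $\operatorname{rk}\mathcal{F}$ over $Q_v$ and $N(f)=\det V_vf$; 2. if $\mathrm{chr}\ne\infty$ then for all $k,l$ as in (i) and all $z$, $V_\infty\mathcal{F}$ has dimension $l\cdot\operatorname{rk}\mathcal{F}$ over $Q_\infty$ and $N(f)^l=\det V_\infty f$. **Theorem 2.** Let $\underline{M}$ be a semisimple pure Anderson motive of rank $r$ over the finite field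 $L$ and let $f\in\operatorname{End}(\underline{M})$ be an isogeny. Then $N(f)$ is defined and lies in $A$, the cokernels of $f$ and of $N(f)$ on $\underline{M}$ have finite dimension over $L$, and 1. $\dim_L\operatorname{coker}N(f)=r\cdot\dim_L\operatorname{coker}f$; 2. $\deg(f)=N(f)\cdot A$; in particular $\deg(f)$ is principal, with the canonical generator $N(f)$; 3. there is a unique $f^\vee\in\operatorname{End}(\underline{M})$ with $f\circ f^\vee=N(f)=f^\vee\circ f$, and $f^\vee$ is an isogeny (the dual isogeny). -/

import Mathlib

open scoped TensorProduct nonZeroDivisors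

universe u

namespace AndersonMotive

/-! ### The curve `C`

A smooth projective geometrically irreducible curve `C` over a finite field `Fq` with a rational
point `∞` is given by its function field `Q`, the ring `A = Γ(C ∖ {∞}, O_C)`, which is a Dedekind
domain of finite type over `Fq` with fraction field `Q` (typeclass arguments in the theorem),
and the local ring `O` at `∞`. The closed points of `C` are the places of `Q`, that is, the
nontrivial valuation rings of `Q`, and those different from `∞` are the ones containing `A`. -/

/-- The point `∞ ∈ C(Fq)`: a nontrivial valuation ring `O` of `Q` with residue field `Fq` such that
`Spec A` consists of all places of `Q` other than `O`. -/
structure PlaceAtInfty (Fq A Q : Type u) [Field Fq] [CommRing A] [Field Q] [Algebra Fq Q]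
    [Algebra A Q] where
  O : ValuationSubring Q
  ne_top : O ≠ ⊤
  rational : ∀ x ∈ O, ∃ a : Fq, x - algebraMap Fq Q a ∈ O.nonunits
  complement : ∀ R : ValuationSubring Q, R ≠ ⊤ → (R ≠ O ↔ ∀ a : A, algebraMap A Q a ∈ R)

/-- `z` is a uniformizing parameter at `∞`. -/
def PlaceAtInfty.IsUniformizer {Fq A Q : Type u} [Field Fq] [CommRing A] [Field Q] [Algebra Fq Q]
    [Algebra A Q] (P : PlaceAtInfty Fq A Q) (z : Q) : Prop :=
  z ∈ P.O.nonunits ∧ ∀ x ∈ P.O.nonunits, ∃ y ∈ P.O, x = z * y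

theorem PlaceAtInfty.IsUniformizer.ne_zero {Fq A Q : Type u} [Field Fq] [CommRing A] [Field Q]
    [Algebra Fq Q] [Algebra A Q] {P : PlaceAtInfty Fq A Q} {z : Q} (hz : P.IsUniformizer z) :
    z ≠ 0 := by
  rintro rfl
  refine P.ne_top (eq_top_iff.2 fun x _ => ?_)
  rcases P.O.mem_or_inv_mem x with h | h
  · exact h
  · by_cases hx : x ∈ P.O
    · exact hx
    · have hn : x⁻¹ ∈ P.O.nonunits := by
        rw [ValuationSubring.mem_nonunits_iff]
        refine (P.O.valuation_le_one_iff _ |>.2 h).lt_of_ne fun h1 => hx ?_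
        rw [← P.O.valuation_le_one_iff]
        rw [map_inv₀, inv_eq_one] at h1
        exact h1.le
      obtain ⟨y, -, hy⟩ := hz.2 _ hn
      rw [zero_mul, inv_eq_zero] at hy
      exact hy ▸ P.O.zero_mem

/-- An `Fq`-morphism `c : Spec L → C` for a field `L` over `Fq`: either it factors through `Spec A`
and is given by an `Fq`-algebra homomorphism `A → L`, or its image is the rational point `∞`. -/
inductive Characteristic (Fq A L : Type u) [Field Fq] [CommRing A] [Field L] [Algebra Fq A]
    [Algebra Fq L] : Type u
  | affine (c : A →ₐ[Fq] L) : Characteristic Fq A L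
  | infty : Characteristic Fq A L

/-! ### Lattices

Modules over `R ⊗ L` (for an `Fq`-algebra `R`) are written as abelian groups with commuting actions
of `R` and `L` that agree on `Fq`. -/

section Lattice

variable (R Q L U : Type u) [CommRing R] [Field Q] [Algebra R Q] [Field L] [AddCommGroup U]
  [Module Q U] [Module L U]

/-- An `R ⊗ L`-submodule of the `Q ⊗ L`-module `U`: an `L`-subspace stable under `R`. -/
structure BiSub extends Submodule L U where
  r_smul_mem : ∀ (a : R) (x : U), x ∈ toSubmodule → algebraMap R Q a • x ∈ toSubmodule

variable {R Q L U}

instance BiSub.smulR (N : BiSub R Q L U) : SMul R N.toSubmodule :=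
  ⟨fun a x => ⟨algebraMap R Q a • x.1, N.r_smul_mem a x.1 x.2⟩⟩

theorem BiSub.coe_smulR (N : BiSub R Q L U) (a : R) (x : N.toSubmodule) :
    ((a • x : N.toSubmodule) : U) = algebraMap R Q a • (x : U) := rfl

instance BiSub.moduleR (N : BiSub R Q L U) : Module R N.toSubmodule where
  one_smul x := Subtype.ext (by simp [BiSub.coe_smulR])
  mul_smul a b x := Subtype.ext (by simp [BiSub.coe_smulR, mul_smul])
  smul_zero a := Subtype.ext (by simp [BiSub.coe_smulR])
  smul_add a x y := Subtype.ext (by simp [BiSub.coe_smulR])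
  add_smul a b x := Subtype.ext (by simp [BiSub.coe_smulR, add_smul])
  zero_smul x := Subtype.ext (by simp [BiSub.coe_smulR])

instance BiSub.smulCommClass [SMulCommClass Q L U] (N : BiSub R Q L U) :
    SMulCommClass R L N.toSubmodule where
  smul_comm a b x := Subtype.ext (by
    rw [BiSub.coe_smulR, Submodule.coe_smul, Submodule.coe_smul, BiSub.coe_smulR, smul_comm])

/-- `N` is an `R ⊗ L`-lattice in `U`: it is finitely generated over `R ⊗ L` and generates `U` over
`Q ⊗ L`. (For `R = A` and `R = O` the ring `R ⊗ L` is a Dedekind domain with fraction field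
`Q ⊗ L`, so lattices are precisely the locally free modules with generic fibre `U`.) -/
def BiSub.IsLattice (N : BiSub R Q L U) : Prop :=
  (∃ S : Finset U, N.toSubmodule =
    Submodule.span L {y : U | ∃ a : R, ∃ s ∈ S, y = algebraMap R Q a • s}) ∧
  Submodule.span L {y : U | ∃ a : Q, ∃ x ∈ N.toSubmodule, y = a • x} = ⊤

/-- A `Q`-linear map which maps `N` to `N`, restricted to an `R`-linear endomorphism of `N`. -/
def BiSub.restrict (N : BiSub R Q L U) (f : U →ₗ[Q] U)
    (hf : ∀ x ∈ N.toSubmodule, f x ∈ N.toSubmodule) : N.toSubmodule →ₗ[R] N.toSubmodule where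
  toFun x := ⟨f x.1, hf x.1 x.2⟩
  map_add' x y := Subtype.ext (by simp)
  map_smul' a x := Subtype.ext (by simp [BiSub.coe_smulR])

/-- `dim_L (N / N')` for `L`-subspaces `N' ≤ N` of `U`. -/
noncomputable def relDim (N' N : Submodule L U) : ℕ := Module.finrank L (N ⧸ N'.submoduleOf N)

end Lattice

/-! ### Tate modules

`R` is a commutative ring, `I` an ideal, `M` an `R ⊗ L`-module, and `τ : M → M` is `σ`-semilinear
(`R`-linear and `q`-Frobenius semilinear over `L`), which is the same as a linear map `σ^*M → M`. -/

section Tate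

variable {Fq R L M : Type u} [Field Fq] [Fintype Fq] [CommRing R] [Field L] [Algebra Fq L]
  [AddCommGroup M] [Module R M] [Module L M] [SMulCommClass R L M]

instance leftModuleComm : SMulCommClass L R M := SMulCommClass.symm R L M

/-- The map `g ⊗ ψ` on `M ⊗_L L^sep`, where `g` is semilinear with respect to `β : L → L` and `ψ` is
an endomorphism of `L^sep` extending `β`. -/
noncomputable def sepExt (g : M →ₗ[R] M) (ψ : SeparableClosure L →+* SeparableClosure L) (β : L → L)
    (hg : ∀ (b : L) (x : M), g (b • x) = β b • g x)
    (hψ : ∀ b : L, ψ (algebraMap L (SeparableClosure L) b) =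
      algebraMap L (SeparableClosure L) (β b)) :
    M ⊗[L] SeparableClosure L →ₗ[R] M ⊗[L] SeparableClosure L :=
  let F : M ⊗[L] SeparableClosure L →+ M ⊗[L] SeparableClosure L :=
    TensorProduct.liftAddHom
      (AddMonoidHom.mk' (fun x => AddMonoidHom.mk' (fun y => g x ⊗ₜ[L] ψ y)
          (fun y y' => by rw [map_add, TensorProduct.tmul_add]))
        (fun x x' => by ext y; simp [TensorProduct.add_tmul]))
      (fun b x y => by
        simp [hg, Algebra.smul_def, hψ]
        rw [← Algebra.smul_def, TensorProduct.smul_tmul])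
  { F with
    map_smul' := fun a x => by
      change F (a • x) = a • F x
      induction x with
      | zero => simp
      | add x y hx hy => rw [smul_add, map_add, hx, hy, map_add, smul_add]
      | tmul x y =>
        rw [TensorProduct.smul_tmul']
        change g (a • x) ⊗ₜ[L] ψ y = a • (g x ⊗ₜ[L] ψ y)
        rw [map_smul, TensorProduct.smul_tmul'] }

/-- `τ ⊗ Frob_q` on `M ⊗_L L^sep`. -/
noncomputable def sepFrob (τ : M →ₗ[R] M)
    (hτ : ∀ (b : L) (x : M), τ (b • x) = b ^ Fintype.card Fq • τ x) :
    M ⊗[L] SeparableClosure L →ₗ[R] M ⊗[L] SeparableClosure L :=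
  sepExt τ (FiniteField.frobeniusAlgHom Fq (SeparableClosure L)).toRingHom
    (fun b => b ^ Fintype.card Fq) hτ (fun b => by simp)

/-- The `I`-adic Tate module `lim_n ((M / Iⁿ M) ⊗_L L^sep)^τ`, a module over the `I`-adic completion
`lim_n R / Iⁿ` of `R`. -/
noncomputable def tateModule (I : Ideal R) (τ : M →ₗ[R] M)
    (hτ : ∀ (b : L) (x : M), τ (b • x) = b ^ Fintype.card Fq • τ x) :
    Submodule (AdicCompletion I R) (AdicCompletion I (M ⊗[L] SeparableClosure L)) :=
  LinearMap.eqLocus (AdicCompletion.map I (sepFrob τ hτ)) LinearMap.id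

/-- The endomorphism of the Tate module induced by an endomorphism `g` of `(M, τ)`. -/
noncomputable def tateMap (I : Ideal R) (τ : M →ₗ[R] M)
    (hτ : ∀ (b : L) (x : M), τ (b • x) = b ^ Fintype.card Fq • τ x)
    (g : M →ₗ[R] M) (hg : ∀ (b : L) (x : M), g (b • x) = b • g x)
    (hgτ : ∀ x, g (τ x) = τ (g x)) :
    tateModule I τ hτ →ₗ[AdicCompletion I R] tateModule I τ hτ :=
  (AdicCompletion.map I (sepExt g (RingHom.id _) id hg (fun _ => rfl))).restrict (by
    intro x hx
    have key : sepFrob τ hτ ∘ₗ sepExt g (RingHom.id _) id hg (fun _ => rfl) =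
        sepExt g (RingHom.id _) id hg (fun _ => rfl) ∘ₗ sepFrob τ hτ := by
      ext t
      induction t with
      | zero => simp
      | add x y hx hy => simp only [map_add, hx, hy]
      | tmul x y =>
        change τ (g x) ⊗ₜ[L] _ = g (τ x) ⊗ₜ[L] _
        rw [hgτ]; rfl
    change AdicCompletion.map I (sepFrob τ hτ) _ = _
    have hx' : AdicCompletion.map I (sepFrob τ hτ) x = x := hx
    rw [AdicCompletion.map_comp_apply, key, ← AdicCompletion.map_comp_apply, hx']
    rfl)

variable (Q : Type u) [Field Q] [Algebra R Q]

/-- For a Dedekind domain `R` with fraction field `Q` and a maximal ideal `I = v` this is the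
completion `Q_v` of `Q`, namely the localization `R_v ⊗_R Q = R_v[1/v]` of `R_v = lim_n R / vⁿ`. -/
abbrev ComplField (I : Ideal R) : Type u := AdicCompletion I R ⊗[R] Q

/-- The inclusion `Q → Q_v`. -/
noncomputable def toCompl (I : Ideal R) : Q →ₐ[R] ComplField Q I :=
  Algebra.TensorProduct.includeRight

/-- The rational Tate module `V = T ⊗_{R_v} Q_v`. -/
abbrev ratTateModule (I : Ideal R) (τ : M →ₗ[R] M)
    (hτ : ∀ (b : L) (x : M), τ (b • x) = b ^ Fintype.card Fq • τ x) : Type u :=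
  ComplField Q I ⊗[AdicCompletion I R] tateModule I τ hτ

/-- The endomorphism of `V` induced by `s⁻¹ g`, for an endomorphism `g` of `(M, τ)`. -/
noncomputable def ratTateMap (I : Ideal R) (τ : M →ₗ[R] M)
    (hτ : ∀ (b : L) (x : M), τ (b • x) = b ^ Fintype.card Fq • τ x)
    (g : M →ₗ[R] M) (hg : ∀ (b : L) (x : M), g (b • x) = b • g x)
    (hgτ : ∀ x, g (τ x) = τ (g x)) (s : R) :
    ratTateModule Q I τ hτ →ₗ[ComplField Q I] ratTateModule Q I τ hτ :=
  toCompl Q I (algebraMap R Q s)⁻¹ • (tateMap I τ hτ g hg hgτ).baseChange (ComplField Q I)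

end Tate

/-! ### Reduced norms -/

section ReducedNorm

/-- A decomposition `E ≅ ∏ E_i` of a finite dimensional semisimple `Q`-algebra `E` into central
simple algebras `E_i` over finite field extensions `F_i` of `Q`, with splitting fields `K_i` and
splittings `α_i : K_i ⊗_{F_i} E_i ≅ M_{n_i}(K_i)`. -/
structure Splitting (Q E : Type u) [Field Q] [Ring E] [Algebra Q E] where
  m : ℕ
  F : Fin m → Type u
  B : Fin m → Type u
  K : Fin m → Type u
  [fieldF : ∀ i, Field (F i)]
  [algF : ∀ i, Algebra Q (F i)]
  [finF : ∀ i, FiniteDimensional Q (F i)]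
  [ringB : ∀ i, Ring (B i)]
  [algB : ∀ i, Algebra (F i) (B i)]
  [algQB : ∀ i, Algebra Q (B i)]
  [towerB : ∀ i, IsScalarTower Q (F i) (B i)]
  [finB : ∀ i, FiniteDimensional (F i) (B i)]
  [centralB : ∀ i, Algebra.IsCentral (F i) (B i)]
  [simpleB : ∀ i, IsSimpleRing (B i)]
  [fieldK : ∀ i, Field (K i)]
  [algK : ∀ i, Algebra (F i) (K i)]
  n : Fin m → ℕ
  e : E ≃ₐ[Q] (∀ i, B i)
  α : ∀ i, K i ⊗[F i] B i ≃ₐ[K i] Matrix (Fin (n i)) (Fin (n i)) (K i)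

attribute [instance] Splitting.fieldF Splitting.algF Splitting.finF Splitting.ringB Splitting.algB
  Splitting.algQB Splitting.towerB Splitting.finB Splitting.centralB Splitting.simpleB
  Splitting.fieldK Splitting.algK

/-- `x` is the reduced norm `nr_{E/Q}(f) = ∏ N_{F_i/Q}(det α_i(1 ⊗ f_i))`, computed from some
decomposition and some splittings. -/
def IsReducedNorm (Q E : Type u) [Field Q] [Ring E] [Algebra Q E] (f : E) (x : Q) : Prop :=
  ∃ (D : Splitting Q E) (y : ∀ i, D.F i),
    (∀ i, algebraMap (D.F i) (D.K i) (y i) = (D.α i (1 ⊗ₜ[D.F i] (D.e f i))).det) ∧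
    x = ∏ i, Algebra.norm Q (y i)

end ReducedNorm

/-! ### Abelian `τ`-sheaves -/

/-- A `Q ⊗ L`-module `V` with a `σ`-semilinear endomorphism `φ`. -/
structure FrobSpace (Fq Q L : Type u) [Field Fq] [Fintype Fq] [Field Q] [Field L] [Algebra Fq Q]
    [Algebra Fq L] where
  V : Type u
  [addCommGroup : AddCommGroup V]
  [modQ : Module Q V]
  [modL : Module L V]
  [modFq : Module Fq V]
  [towerQ : IsScalarTower Fq Q V]
  [towerL : IsScalarTower Fq L V]
  [comm : SMulCommClass Q L V]
  φ : V →ₗ[Q] V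
  φ_smul : ∀ (b : L) (x : V), φ (b • x) = b ^ Fintype.card Fq • φ x

attribute [instance] FrobSpace.addCommGroup FrobSpace.modQ FrobSpace.modL FrobSpace.modFq
  FrobSpace.towerQ FrobSpace.towerL FrobSpace.comm

/-- The dimension of `V` over the field `Q ⊗ L`. -/
noncomputable def FrobSpace.qlRank {Fq Q L : Type u} [Field Fq] [Fintype Fq] [Field Q] [Field L]
    [Algebra Fq Q] [Algebra Fq L] (N : FrobSpace Fq Q L) : ℕ :=
  letI : Module (Q ⊗[Fq] L) N.V := TensorProduct.Algebra.module
  Module.finrank (Q ⊗[Fq] L) N.V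

section Objects

variable {Fq A Q L : Type u} [Field Fq] [Fintype Fq] [CommRing A] [Field Q] [Algebra Fq A]
  [Algebra Fq Q] [Algebra A Q] [Field L] [Algebra Fq L]

/-- For `c : A → L` the generators `a ⊗ 1 - 1 ⊗ c(a)` of the ideal `J`, acting on `V`. -/
def jAct {V : Type u} [AddCommGroup V] [Module Q V] [Module L V] (c : A →ₐ[Fq] L) (a : A) (x : V) :
    V := algebraMap A Q a • x - c a • x

/-- An abelian `τ`-sheaf `(F_i, Π_i, τ_i)` on `C` over the finite field `L`.

A locally free sheaf `F_i` on `C_L` with generic fibre `V` is given by the `A ⊗ L`-lattice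
`aff i = Γ(C_L ∖ ∞, F_i)` and the `O ⊗ L`-lattice `inf i = (F_i)_∞` in `V`. The morphisms `Π_i`
are injective between sheaves of the same rank, hence isomorphisms at the generic point; the generic
fibres of all `F_i` are identified through them, so that `Π_i` is the inclusion `F_i ⊂ F_{i+1}` and
all `τ_i` are restrictions of one `σ`-semilinear map `φ`. Since `L` is perfect, the image of
`σ^*F_i` in `F_{i+1}` is spanned over `L` by `φ(F_i)`. -/
structure AbelianTauSheaf (P : PlaceAtInfty Fq A Q) (c : Characteristic Fq A L) extends
    FrobSpace Fq Q L where
  rank : ℕ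
  dim : ℕ
  aff : ℤ → BiSub A Q L V
  inf : ℤ → BiSub P.O Q L V
  aff_lattice : ∀ i, (aff i).IsLattice
  inf_lattice : ∀ i, (inf i).IsLattice
  rank_eq : toFrobSpace.qlRank = rank
  φ_injective : Function.Injective φ
  aff_mono : ∀ i, (aff i).toSubmodule ≤ (aff (i + 1)).toSubmodule
  inf_mono : ∀ i, (inf i).toSubmodule ≤ (inf (i + 1)).toSubmodule
  aff_φ : ∀ i, ∀ x ∈ (aff i).toSubmodule, φ x ∈ (aff (i + 1)).toSubmodule
  inf_φ : ∀ i, ∀ x ∈ (inf i).toSubmodule, φ x ∈ (inf (i + 1)).toSubmodule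
  /-- `Π_{i+l-1} ∘ ⋯ ∘ Π_i` identifies `F_i` with `F_{i+l}(-k·∞)` -/
  periodic : ∃ k l : ℕ, 0 < k ∧ 0 < l ∧ l * dim = k * rank ∧ ∀ i,
    (aff i).toSubmodule = (aff (i + l)).toSubmodule ∧
    ∀ z, P.IsUniformizer z → ∀ x : V,
      x ∈ (inf i).toSubmodule ↔ (z ^ k)⁻¹ • x ∈ (inf (i + l)).toSubmodule
  /-- `dim_L coker Π_i = d` -/
  dim_coker_incl : ∀ i, relDim (aff i).toSubmodule (aff (i + 1)).toSubmodule +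
    relDim (inf i).toSubmodule (inf (i + 1)).toSubmodule = dim
  /-- `dim_L coker τ_i = d` -/
  dim_coker_τ : ∀ i,
    relDim (Submodule.span L (φ '' ((aff i).toSubmodule : Set V))) (aff (i + 1)).toSubmodule +
    relDim (Submodule.span L (φ '' ((inf i).toSubmodule : Set V))) (inf (i + 1)).toSubmodule = dim
  /-- `coker τ_i` is annihilated by the `d`-th power of the ideal sheaf of the graph of `c` -/
  annihilated : ∀ i, match c with
    | Characteristic.affine c =>
      (∀ a : Fin dim → A, ∀ x ∈ (aff (i + 1)).toSubmodule,
        (List.ofFn a).foldr (fun b y => jAct (Q := Q) c b y) x ∈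
          Submodule.span L (φ '' ((aff i).toSubmodule : Set V))) ∧
      (inf (i + 1)).toSubmodule ≤ Submodule.span L (φ '' ((inf i).toSubmodule : Set V))
    | Characteristic.infty =>
      (aff (i + 1)).toSubmodule ≤ Submodule.span L (φ '' ((aff i).toSubmodule : Set V)) ∧
      ∀ z, P.IsUniformizer z → ∀ x ∈ (inf (i + 1)).toSubmodule,
        z ^ dim • x ∈ Submodule.span L (φ '' ((inf i).toSubmodule : Set V))

namespace AbelianTauSheaf

variable {P : PlaceAtInfty Fq A Q} {c : Characteristic Fq A L}

/-- The pair `(k, l)` satisfies the periodicity condition for `F`. -/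
structure IsPeriod (F : AbelianTauSheaf P c) (k l : ℕ) : Prop where
  k_pos : 0 < k
  l_pos : 0 < l
  slope : l * F.dim = k * F.rank
  aff_eq : ∀ i, (F.aff i).toSubmodule = (F.aff (i + l)).toSubmodule
  inf_eq : ∀ i, ∀ z, P.IsUniformizer z → ∀ x : F.V,
    x ∈ (F.inf i).toSubmodule ↔ (z ^ k)⁻¹ • x ∈ (F.inf (i + l)).toSubmodule

theorem aff_le (F : AbelianTauSheaf P c) (i : ℤ) (n : ℕ) :
    (F.aff i).toSubmodule ≤ (F.aff (i + n)).toSubmodule := by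
  induction n with
  | zero => simp
  | succ n ih =>
    refine ih.trans ?_
    have := F.aff_mono (i + n)
    rwa [add_assoc] at this

/-- Since `coker Π_0` is supported at `∞`, the map `Π_0⁻¹ ∘ τ_0` preserves `Γ(C_L ∖ ∞, F_0)`. -/
theorem φ_mem_aff_zero (F : AbelianTauSheaf P c) :
    ∀ x ∈ (F.aff 0).toSubmodule, F.φ x ∈ (F.aff 0).toSubmodule := by
  intro x hx
  obtain ⟨k, l, -, hl, -, h⟩ := F.periodic
  obtain ⟨m, rfl⟩ : ∃ m, l = m + 1 := ⟨l - 1, by omega⟩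
  have h1 := F.aff_φ 0 x hx
  have h2 := F.aff_le (0 + 1) m h1
  rw [(h 0).1]
  have e : (0 : ℤ) + ((m + 1 : ℕ) : ℤ) = 0 + 1 + (m : ℤ) := by push_cast; ring
  rw [e]; exact h2

/-- A morphism of abelian `τ`-sheaves: it is determined by the map on generic fibres. -/
structure IsMorphism (F F' : AbelianTauSheaf P c) (f : F.V →ₗ[Q] F'.V) : Prop where
  map_smul_L : ∀ (b : L) (x : F.V), f (b • x) = b • f x
  comm_φ : ∀ x, f (F.φ x) = F'.φ (f x)
  aff_mem : ∀ i, ∀ x ∈ (F.aff i).toSubmodule, f x ∈ (F'.aff i).toSubmodule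
  inf_mem : ∀ i, ∀ x ∈ (F.inf i).toSubmodule, f x ∈ (F'.inf i).toSubmodule

/-- `F` is simple: it is nonzero and its only quotient `τ`-sheaves are `0` and `F`. -/
def IsSimple (F : AbelianTauSheaf P c) : Prop :=
  Nontrivial F.V ∧ ∀ (F' : AbelianTauSheaf P c) (f : F.V →ₗ[Q] F'.V), IsMorphism F F' f →
    (∀ i, ∀ y ∈ (F'.aff i).toSubmodule, ∃ x ∈ (F.aff i).toSubmodule, f x = y) →
    (∀ i, ∀ y ∈ (F'.inf i).toSubmodule, ∃ x ∈ (F.inf i).toSubmodule, f x = y) →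
    Subsingleton F'.V ∨ Function.Injective f

/-- `F` is semisimple: there is a quasi-isogeny `f` from `F` to a finite direct sum of simple
abelian `τ`-sheaves `S_j` (of the weight of `F`). That is, `f` is an isomorphism of generic fibres
compatible with `φ` that maps `F` to `(⊕ S_j)(D)` for an effective divisor `D` on `C`; here `D`
has a local equation `t` at `∞` and is bounded on `Spec A` by the divisor of some `s ≠ 0`. -/
def IsSemisimple (F : AbelianTauSheaf P c) : Prop :=
  ∃ (n : ℕ) (S : Fin n → AbelianTauSheaf P c) (f : F.V →ₗ[Q] ∀ j, (S j).V),
    (∀ j, (S j).IsSimple) ∧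
    (∀ j, (S j).dim * F.rank = F.dim * (S j).rank) ∧
    Function.Bijective f ∧
    (∀ (b : L) (x : F.V), f (b • x) = b • f x) ∧
    (∀ x j, f (F.φ x) j = (S j).φ (f x j)) ∧
    ∃ s : A, s ≠ 0 ∧ ∃ t : P.O, t ≠ 0 ∧ ∀ i j,
      (∀ x ∈ (F.aff i).toSubmodule, algebraMap A Q s • f x j ∈ ((S j).aff i).toSubmodule) ∧
      (∀ x ∈ (F.inf i).toSubmodule, algebraMap P.O Q t • f x j ∈ ((S j).inf i).toSubmodule)

/-- The `Q`-algebra `QEnd(F)` of quasi-endomorphisms: morphisms `F → F(D)` for effective divisors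
`D` on `C`, identified with their maps on the generic fibre. As above `D` is bounded by the divisor
of some `s ≠ 0` on `Spec A` and has a local equation `t` at `∞`. -/
def QEnd [IsFractionRing A Q] [IsDomain A] (F : AbelianTauSheaf P c) :
    Subalgebra Q (Module.End Q F.V) where
  carrier := {f | (∀ (b : L) (x : F.V), f (b • x) = b • f x) ∧ (∀ x, f (F.φ x) = F.φ (f x)) ∧
    ∃ s : A, s ≠ 0 ∧ ∃ t : P.O, t ≠ 0 ∧ ∀ i,
      (∀ x ∈ (F.aff i).toSubmodule, algebraMap A Q s • f x ∈ (F.aff i).toSubmodule) ∧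
      (∀ x ∈ (F.inf i).toSubmodule, algebraMap P.O Q t • f x ∈ (F.inf i).toSubmodule)}
  mul_mem' := by
    rintro f g ⟨hf1, hf2, s, hs, t, ht, h⟩ ⟨hg1, hg2, s', hs', t', ht', h'⟩
    refine ⟨fun b x => by simp [hf1, hg1], fun x => by simp [hf2, hg2], s * s',
      mul_ne_zero hs hs', t * t', mul_ne_zero ht ht', fun i => ⟨fun x hx => ?_, fun x hx => ?_⟩⟩
    · have := (h i).1 _ ((h' i).1 x hx)
      rwa [map_smul, smul_smul, ← map_mul] at this
    · have := (h i).2 _ ((h' i).2 x hx)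
      rwa [map_smul, smul_smul, ← map_mul] at this
  add_mem' := by
    rintro f g ⟨hf1, hf2, s, hs, t, ht, h⟩ ⟨hg1, hg2, s', hs', t', ht', h'⟩
    refine ⟨fun b x => by simp [hf1, hg1], fun x => by simp [hf2, hg2], s * s',
      mul_ne_zero hs hs', t * t', mul_ne_zero ht ht', fun i => ⟨fun x hx => ?_, fun x hx => ?_⟩⟩
    · have h1 := (F.aff i).r_smul_mem s' _ ((h i).1 x hx)
      have h2 := (F.aff i).r_smul_mem s _ ((h' i).1 x hx)
      rw [smul_smul, ← map_mul] at h1 h2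
      rw [LinearMap.add_apply, smul_add]
      rw [mul_comm] at h1
      exact Submodule.add_mem _ h1 h2
    · have h1 := (F.inf i).r_smul_mem t' _ ((h i).2 x hx)
      have h2 := (F.inf i).r_smul_mem t _ ((h' i).2 x hx)
      rw [smul_smul, ← map_mul] at h1 h2
      rw [LinearMap.add_apply, smul_add]
      rw [mul_comm] at h1
      exact Submodule.add_mem _ h1 h2
  algebraMap_mem' := by
    intro q
    obtain ⟨a, s, hs, rfl⟩ := IsFractionRing.div_surjective (A := A) q
    obtain ⟨b, t, ht, hbt⟩ := IsFractionRing.div_surjective (A := P.O)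
      (algebraMap A Q a / algebraMap A Q s)
    have hs0 : algebraMap A Q s ≠ 0 := by
      simpa using nonZeroDivisors.ne_zero hs
    have ht0 : algebraMap P.O Q t ≠ 0 := by
      simpa using nonZeroDivisors.ne_zero ht
    refine ⟨fun c x => by
      rw [Module.algebraMap_end_apply, Module.algebraMap_end_apply, smul_comm],
      fun x => by simp, s, nonZeroDivisors.ne_zero hs, t,
      nonZeroDivisors.ne_zero ht, fun i => ⟨fun x hx => ?_, fun x hx => ?_⟩⟩
    · rw [Module.algebraMap_end_apply, smul_smul, mul_div_cancel₀ _ hs0]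
      exact (F.aff i).r_smul_mem a x hx
    · rw [Module.algebraMap_end_apply, smul_smul, ← hbt, mul_div_cancel₀ _ ht0]
      exact (F.inf i).r_smul_mem b x hx

/-- `f` is a quasi-isogeny: it is an isomorphism at the generic point of `C_L`. -/
def IsQuasiIsogeny [IsFractionRing A Q] [IsDomain A] (F : AbelianTauSheaf P c) (f : F.QEnd) : Prop :=
  Function.Bijective f.1

/-! #### The Tate module at a place `v ≠ ∞`, formed from `Γ(C_L ∖ ∞, F_0)` with `Π_0⁻¹ ∘ τ_0` -/

/-- `Π_0⁻¹ ∘ τ_0` on `Γ(C_L ∖ ∞, F_0)`. -/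
def affτ (F : AbelianTauSheaf P c) : (F.aff 0).toSubmodule →ₗ[A] (F.aff 0).toSubmodule :=
  (F.aff 0).restrict F.φ F.φ_mem_aff_zero

theorem affτ_smul (F : AbelianTauSheaf P c) (b : L) (x : (F.aff 0).toSubmodule) :
    F.affτ (b • x) = b ^ Fintype.card Fq • F.affτ x :=
  Subtype.ext (F.φ_smul b x.1)

/-- The rational `v`-adic Tate module `V_v F`. -/
abbrev affTate (F : AbelianTauSheaf P c) (v : Ideal A) : Type u :=
  ratTateModule Q v F.affτ F.affτ_smul

section

variable [IsFractionRing A Q] [IsDomain A]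

/-- Some `s ≠ 0` for which `s f` has no poles on `Spec A`. -/
noncomputable def affDenom (F : AbelianTauSheaf P c) (f : F.QEnd) : A := f.2.2.2.choose

theorem affDenom_spec (F : AbelianTauSheaf P c) (f : F.QEnd) :
    ∀ x ∈ (F.aff 0).toSubmodule,
      (algebraMap A Q (F.affDenom f) • f.1) x ∈ (F.aff 0).toSubmodule :=
  let h := f.2.2.2.choose_spec.2
  (h.choose_spec.2 0).1

theorem affDenom_ne_zero (F : AbelianTauSheaf P c) (f : F.QEnd) : F.affDenom f ≠ 0 :=
  f.2.2.2.choose_spec.1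

/-- `s f` as an endomorphism of `Γ(C_L ∖ ∞, F_0)`. -/
noncomputable def affMap (F : AbelianTauSheaf P c) (f : F.QEnd) :
    (F.aff 0).toSubmodule →ₗ[A] (F.aff 0).toSubmodule :=
  (F.aff 0).restrict (algebraMap A Q (F.affDenom f) • f.1) (F.affDenom_spec f)

/-- `V_v f = s⁻¹ V_v (s f)`, which does not depend on `s`. -/
noncomputable def affTateMap (F : AbelianTauSheaf P c) (v : Ideal A) (f : F.QEnd) :
    F.affTate v →ₗ[ComplField Q v] F.affTate v :=
  ratTateMap Q v F.affτ F.affτ_smul (F.affMap f)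
    (fun b x => Subtype.ext (by
      change algebraMap A Q (F.affDenom f) • f.1 (b • x.1) =
        b • algebraMap A Q (F.affDenom f) • f.1 x.1
      rw [f.2.1, smul_comm]))
    (fun x => Subtype.ext (by
      change algebraMap A Q (F.affDenom f) • f.1 (F.φ x.1) =
        F.φ (algebraMap A Q (F.affDenom f) • f.1 x.1)
      rw [f.2.2.1, map_smul]))
    (F.affDenom f)

end

/-! #### The Tate module at `∞`, formed from `F_0 ⊕ ⋯ ⊕ F_{l-1}`

The semilinear map `τ` on the sum has the components `τ_i : F_i → F_{i+1}` for `i < l - 1`, and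
`F_{l-1} → F_l → F_0` where the second map is multiplication by `z ^ k`. -/

/-- The predecessor of an index, in cyclic order. -/
def prev {l : ℕ} (i : Fin l) : Fin l :=
  if i.1 = 0 then ⟨l - 1, by have := i.2; omega⟩ else ⟨i.1 - 1, by have := i.2; omega⟩

/-- The stalk of `F_0 ⊕ ⋯ ⊕ F_{l-1}` at `∞`. -/
def bigInf (F : AbelianTauSheaf P c) (l : ℕ) : BiSub P.O Q L (Fin l → F.V) where
  carrier := {x | ∀ i : Fin l, x i ∈ (F.inf (i : ℕ)).toSubmodule}
  add_mem' := fun hx hy i => Submodule.add_mem _ (hx i) (hy i)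
  zero_mem' := fun _ => Submodule.zero_mem _
  smul_mem' := fun b _ hx i => Submodule.smul_mem _ b (hx i)
  r_smul_mem := fun a _ hx i => (F.inf (i : ℕ)).r_smul_mem a _ (hx i)

/-- The semilinear map `τ` on the generic fibre of `F_0 ⊕ ⋯ ⊕ F_{l-1}`. -/
def bigφ (F : AbelianTauSheaf P c) (k l : ℕ) (z : Q) : (Fin l → F.V) →ₗ[Q] (Fin l → F.V) :=
  LinearMap.pi fun i =>
    (if i.1 = 0 then z ^ k else 1) • (F.φ ∘ₗ LinearMap.proj (prev i))

theorem bigφ_apply (F : AbelianTauSheaf P c) (k l : ℕ) (z : Q) (x : Fin l → F.V) (i : Fin l) :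
    F.bigφ k l z x i = (if i.1 = 0 then z ^ k else 1) • F.φ (x (prev i)) := rfl

theorem bigφ_mem (F : AbelianTauSheaf P c) {k l : ℕ} {z : Q} (h : F.IsPeriod k l)
    (hz : P.IsUniformizer z) (hz0 : z ≠ 0) :
    ∀ x ∈ (F.bigInf l).toSubmodule, F.bigφ k l z x ∈ (F.bigInf l).toSubmodule := by
  intro x hx i
  rw [bigφ_apply]
  have h1 := F.inf_φ _ _ (hx (prev i))
  by_cases hi : i.1 = 0
  · have e : ((prev i : ℕ) : ℤ) + 1 = (i : ℕ) + (l : ℤ) := by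
      have := i.2
      simp only [prev, hi, if_true]
      omega
    rw [if_pos hi, h.inf_eq _ z hz, smul_smul, inv_mul_cancel₀ (pow_ne_zero _ hz0), one_smul]
    rwa [e] at h1
  · have e : ((prev i : ℕ) : ℤ) + 1 = (i : ℕ) := by
      simp only [prev, hi, if_false]
      omega
    rw [if_neg hi, one_smul]
    rwa [e] at h1

/-- `τ` on the stalk of `F_0 ⊕ ⋯ ⊕ F_{l-1}` at `∞`. -/
def infτ (F : AbelianTauSheaf P c) {k l : ℕ} {z : Q} (h : F.IsPeriod k l)
    (hz : P.IsUniformizer z) :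
    (F.bigInf l).toSubmodule →ₗ[P.O] (F.bigInf l).toSubmodule :=
  (F.bigInf l).restrict (F.bigφ k l z) (F.bigφ_mem h hz hz.ne_zero)

theorem infτ_smul (F : AbelianTauSheaf P c) {k l : ℕ} {z : Q} (h : F.IsPeriod k l)
    (hz : P.IsUniformizer z) (b : L) (x : (F.bigInf l).toSubmodule) :
    F.infτ h hz (b • x) = b ^ Fintype.card Fq • F.infτ h hz x :=
  Subtype.ext (funext fun i => by
    change (if i.1 = 0 then z ^ k else 1) • F.φ (b • x.1 (prev i)) =
      b ^ Fintype.card Fq • (if i.1 = 0 then z ^ k else 1) • F.φ (x.1 (prev i))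
    rw [F.φ_smul, smul_comm])

/-- The rational `∞`-adic Tate module `V_∞ F`, which depends on `k`, `l` and `z`. -/
abbrev infTate (F : AbelianTauSheaf P c) {k l : ℕ} {z : Q} (h : F.IsPeriod k l)
    (hz : P.IsUniformizer z) : Type u :=
  ratTateModule Q (IsLocalRing.maximalIdeal P.O) (F.infτ h hz) (F.infτ_smul h hz)

section

variable [IsFractionRing A Q] [IsDomain A]

/-- Some `t ≠ 0` in `O` for which `t f` has no pole at `∞`. -/
noncomputable def infDenom (F : AbelianTauSheaf P c) (f : F.QEnd) : P.O :=
  f.2.2.2.choose_spec.2.choose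

theorem infDenom_ne_zero (F : AbelianTauSheaf P c) (f : F.QEnd) : F.infDenom f ≠ 0 :=
  f.2.2.2.choose_spec.2.choose_spec.1

theorem infDenom_spec (F : AbelianTauSheaf P c) (f : F.QEnd) (l : ℕ) :
    ∀ x ∈ (F.bigInf l).toSubmodule,
      (algebraMap P.O Q (F.infDenom f) • f.1.compLeft (Fin l)) x ∈ (F.bigInf l).toSubmodule :=
  fun x hx i => (f.2.2.2.choose_spec.2.choose_spec.2 (i : ℕ)).2 (x i) (hx i)

/-- `t f` acting diagonally on the stalk of `F_0 ⊕ ⋯ ⊕ F_{l-1}` at `∞`. -/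
noncomputable def infMap (F : AbelianTauSheaf P c) (f : F.QEnd) (l : ℕ) :
    (F.bigInf l).toSubmodule →ₗ[P.O] (F.bigInf l).toSubmodule :=
  (F.bigInf l).restrict (algebraMap P.O Q (F.infDenom f) • f.1.compLeft (Fin l))
    (F.infDenom_spec f l)

/-- `V_∞ f = t⁻¹ V_∞ (t f)`, which does not depend on `t`. -/
noncomputable def infTateMap (F : AbelianTauSheaf P c) {k l : ℕ} {z : Q} (h : F.IsPeriod k l)
    (hz : P.IsUniformizer z) (f : F.QEnd) :
    F.infTate h hz →ₗ[ComplField Q (IsLocalRing.maximalIdeal P.O)] F.infTate h hz :=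
  ratTateMap Q (IsLocalRing.maximalIdeal P.O) (F.infτ h hz) (F.infτ_smul h hz) (F.infMap f l)
    (fun b x => Subtype.ext (funext fun i => by
      change algebraMap P.O Q (F.infDenom f) • f.1 (b • x.1 i) =
        b • algebraMap P.O Q (F.infDenom f) • f.1 (x.1 i)
      rw [f.2.1, smul_comm]))
    (fun x => Subtype.ext (funext fun i => by
      change algebraMap P.O Q (F.infDenom f) •
          f.1 ((if i.1 = 0 then z ^ k else 1) • F.φ (x.1 (prev i))) =
        (if i.1 = 0 then z ^ k else 1) •
          F.φ (algebraMap P.O Q (F.infDenom f) • f.1 (x.1 (prev i)))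
      rw [map_smul, f.2.2.1, map_smul, smul_comm]))
    (F.infDenom f)

end

end AbelianTauSheaf

/-! ### Pure Anderson motives -/

/-- A pure Anderson motive `(M, τ)` of characteristic `c` over the finite field `L`. As before,
`A ⊗ L`-modules are abelian groups with commuting actions of `A` and `L`, the map `τ : σ^*M → M` is
given by a semilinear map `M → M`, and the image of `σ^*M` is spanned over `L` by its image. -/
structure PureAndersonMotive (P : PlaceAtInfty Fq A Q) (c : A →ₐ[Fq] L) where
  M : Type u
  [addCommGroup : AddCommGroup M]
  [modA : Module A M]
  [modL : Module L M]
  [modFq : Module Fq M]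
  [towerA : IsScalarTower Fq A M]
  [towerL : IsScalarTower Fq L M]
  [comm : SMulCommClass A L M]
  rank : ℕ
  dim : ℕ
  τ : M →ₗ[A] M
  τ_smul : ∀ (b : L) (x : M), τ (b • x) = b ^ Fintype.card Fq • τ x
  τ_injective : Function.Injective τ
  /-- `M` is locally free of rank `rank` over `A ⊗ L` -/
  locally_free :
    letI : Module (A ⊗[Fq] L) M := TensorProduct.Algebra.module
    Module.Finite (A ⊗[Fq] L) M ∧ Module.Projective (A ⊗[Fq] L) M ∧
      ∀ p : PrimeSpectrum (A ⊗[Fq] L), Module.rankAtStalk (R := A ⊗[Fq] L) M p = rank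
  coker_finite : FiniteDimensional L (M ⧸ Submodule.span L (Set.range τ))
  dim_coker : Module.finrank L (M ⧸ Submodule.span L (Set.range τ)) = dim
  /-- `coker τ` is annihilated by the `d`-th power of the ideal generated by all
  `a ⊗ 1 - 1 ⊗ c(a)` -/
  annihilated : ∀ (a : Fin dim → A) (x : M),
    (List.ofFn a).foldr (fun b y => b • y - c b • y) x ∈ Submodule.span L (Set.range τ)
  /-- purity: in the generic fibre `N = M ⊗_A Q` of `M`, with the extension `φ` of `τ`, there is an
  `O ⊗ L`-lattice `W` such that `τ ^ l` maps `(σ^l)^* W` isomorphically to `z ^ (-k) W` -/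
  pure : ∃ (N : FrobSpace Fq Q L) (ι : M →ₗ[L] N.V), Function.Injective ι ∧
    (∀ (a : A) (x : M), ι (a • x) = algebraMap A Q a • ι x) ∧
    (∀ x, ι (τ x) = N.φ (ι x)) ∧
    (∀ y : N.V, ∃ a : A, a ≠ 0 ∧ ∃ x : M, algebraMap A Q a • y = ι x) ∧
    ∃ W : BiSub P.O Q L N.V, W.IsLattice ∧ ∃ k l : ℕ, 0 < k ∧ 0 < l ∧
      ∀ z, P.IsUniformizer z → ∀ y : N.V,
        y ∈ Submodule.span L ((N.φ)^[l] '' (W.toSubmodule : Set N.V)) ↔ z ^ k • y ∈ W.toSubmodule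

attribute [instance] PureAndersonMotive.addCommGroup PureAndersonMotive.modA
  PureAndersonMotive.modL PureAndersonMotive.modFq PureAndersonMotive.towerA
  PureAndersonMotive.towerL PureAndersonMotive.comm

/-- A linear map between `A ⊗ L`-modules has torsion cokernel. -/
def TorsionCoker (Fq A L : Type u) [Field Fq] [CommRing A] [Algebra Fq A] [Field L] [Algebra Fq L]
    {M M' : Type u} [AddCommGroup M] [AddCommGroup M'] [Module A M] [Module A M'] [Module L M']
    [Module Fq M'] [IsScalarTower Fq A M'] [IsScalarTower Fq L M'] [SMulCommClass A L M']
    (f : M →ₗ[A] M') : Prop :=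
  letI : Module (A ⊗[Fq] L) M' := TensorProduct.Algebra.module
  ∀ y : M', ∃ s ∈ (A ⊗[Fq] L)⁰, s • y ∈ Set.range f

namespace PureAndersonMotive

variable {P : PlaceAtInfty Fq A Q} {c : A →ₐ[Fq] L}

/-- A morphism of pure Anderson motives of the same characteristic. -/
structure IsMorphism (M M' : PureAndersonMotive P c) (f : M.M →ₗ[A] M'.M) : Prop where
  map_smul_L : ∀ (b : L) (x : M.M), f (b • x) = b • f x
  comm_τ : ∀ x, f (M.τ x) = M'.τ (f x)

/-- `M` is simple: it is nonzero and its only quotient motives are `0` and `M`. -/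
def IsSimple (M : PureAndersonMotive P c) : Prop :=
  Nontrivial M.M ∧ ∀ (M' : PureAndersonMotive P c) (f : M.M →ₗ[A] M'.M), IsMorphism M M' f →
    Function.Surjective f → Subsingleton M'.M ∨ Function.Injective f

/-- `M` is semisimple: there is an isogeny from `M` to a finite direct sum of simple pure Anderson
motives. -/
def IsSemisimple (M : PureAndersonMotive P c) : Prop :=
  ∃ (n : ℕ) (S : Fin n → PureAndersonMotive P c) (f : M.M →ₗ[A] ∀ j, (S j).M),
    (∀ j, (S j).IsSimple) ∧
    (∀ (b : L) (x : M.M), f (b • x) = b • f x) ∧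
    (∀ x j, f (M.τ x) j = (S j).τ (f x j)) ∧
    Function.Injective f ∧ TorsionCoker Fq A L f

/-- The `A`-algebra `End(M)`. -/
def End (M : PureAndersonMotive P c) : Subalgebra A (Module.End A M.M) where
  carrier := {f | IsMorphism M M f}
  mul_mem' := by
    rintro f g ⟨hf1, hf2⟩ ⟨hg1, hg2⟩
    exact ⟨fun b x => by simp [hf1, hg1], fun x => by simp [hf2, hg2]⟩
  add_mem' := by
    rintro f g ⟨hf1, hf2⟩ ⟨hg1, hg2⟩
    exact ⟨fun b x => by simp [hf1, hg1], fun x => by simp [hf2, hg2]⟩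
  algebraMap_mem' := fun a =>
    ⟨fun b x => by
      rw [Module.algebraMap_end_apply, Module.algebraMap_end_apply, smul_comm],
      fun x => by simp⟩

/-- `f` is an isogeny: it is injective with torsion cokernel. -/
def IsIsogeny (M : PureAndersonMotive P c) (f : M.End) : Prop :=
  Function.Injective f.1 ∧ TorsionCoker Fq A L f.1

/-- The image of `f`, as an `L`-subspace. -/
def image (M : PureAndersonMotive P c) (f : M.End) : Submodule L M.M where
  carrier := Set.range f.1
  add_mem' := by
    rintro _ _ ⟨x, rfl⟩ ⟨y, rfl⟩
    exact ⟨x + y, map_add _ _ _⟩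
  zero_mem' := ⟨0, map_zero _⟩
  smul_mem' := by
    rintro b _ ⟨x, rfl⟩
    exact ⟨b • x, f.2.1 b x⟩

/-- The cokernel of `f`. -/
abbrev Coker (M : PureAndersonMotive P c) (f : M.End) : Type u := M.M ⧸ M.image f

/-- The preimage in `M` of the `v`-primary part of `coker f`. -/
def primary (M : PureAndersonMotive P c) (f : M.End) (v : Ideal A) : Submodule L M.M where
  carrier := {x | ∃ n : ℕ, ∀ a ∈ v ^ n, a • x ∈ M.image f}
  add_mem' := by
    rintro x y ⟨n, hn⟩ ⟨m, hm⟩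
    refine ⟨n + m, fun a ha => ?_⟩
    rw [smul_add]
    exact Submodule.add_mem _ (hn a (Ideal.pow_le_pow_right (Nat.le_add_right n m) ha))
      (hm a (Ideal.pow_le_pow_right (Nat.le_add_left m n) ha))
  zero_mem' := ⟨0, fun a _ => by rw [smul_zero]; exact Submodule.zero_mem _⟩
  smul_mem' := by
    rintro b x ⟨n, hn⟩
    refine ⟨n, fun a ha => ?_⟩
    rw [smul_comm]
    exact Submodule.smul_mem _ b (hn a ha)

/-- The degree `∏_v v ^ (dim_L (coker f)_v / [F_v : Fq])` of an isogeny `f`, an ideal of `A`. -/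
noncomputable def deg [IsDomain A] (M : PureAndersonMotive P c) (f : M.End) : Ideal A :=
  ∏ᶠ v : IsDedekindDomain.HeightOneSpectrum A,
    v.asIdeal ^ (relDim (M.image f) (M.primary f v.asIdeal) /
      Module.finrank Fq (A ⧸ v.asIdeal))

end PureAndersonMotive

end Objects

end AndersonMotive

/-! Write e = [L : Fq]. Everything takes place in the generic fibre V, a vector space over the field
Q ⊗ L with an injective σ-semilinear map φ. Maps of generic fibres have bounded denominators, so
QEnd(F), and likewise Q ⊗ End(M), is the full commutant of L and φ in End_Q(V)
(`AbelianTauSheaf.QEnd_eq`, `IsGenericFibre.exists_end_equiv`).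

On this commutant the reduced norm is the determinant over Q ⊗ L. The determinant has values in Q:
the characteristic polynomial of a map commuting with φ is σ-invariant, and Q is the fixed field of
σ (`exists_tensorDet`). For the comparison, a simple factor of the commutant is extended to a field
Ω containing L. There the space splits into eigenspaces of L, which φ permutes cyclically, and the
commutant becomes the endomorphism algebra of one eigenspace (`exists_commutant_algHom`,
`exists_splitting_of_embedding`). This yields an equality of e-th powers only. To remove the root of
unity, f is replaced by 1 + s(f - 1): both sides become polynomials in s with value 1 at s = 0, and
such polynomials are determined by their e-th powers (`poly_eq_of_pow_eval_eq`). The same device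
makes the determinants on Tate modules exact.

At a place away from the characteristic, τ is bijective on the finite module M / Iⁿ, so π = τ^e has
finite order N there. If θ generates a normal basis of the extension of L of degree N, then m ↦ ∑
πⁱ(m) ⊗ Frobⁱ(θ) identifies M / Iⁿ with the fixed points of the e-th power of the Frobenius on (M /
Iⁿ) ⊗ L^sep. Trace-compatible θ's allow passage to the limit, and Galois descent from the e-th power
to the Frobenius itself costs e copies: the e-fold sum of the Tate module is the completion of M
(`exists_tate_equiv`). Dimensions and determinants follow.

Semisimplicity of the commutant for chr ≠ ∞ rests on the fact that a simple object has a simple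
generic fibre, that is, that a quotient of V underlies a quotient object. For τ-sheaves this
requires numerical identities between colengths at infinity and on the affine part; they come from
counting indices of lattices (`relDim_chain`), using that A and the ring O at infinity almost fill Q
and have almost no intersection.

For a motive, N(f) is up to sign the constant term of a factor of a characteristic polynomial of an
endomorphism of a projective A-module, hence lies in A, and Cayley–Hamilton provides the dual
isogeny. The colength statements hold because over a principal localization of A the cokernel of f
is as large as the quotient by its determinant (`index_range_eq`), and the determinant over Q is
N(f)^e. -/

namespace AndersonMotive

/-! ### Taking roots of determinant identities -/

section PolynomialIdentities

open Polynomial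

/-- Polynomials over the fraction field form an integrally closed domain, so equal e-th powers make
p and r divide each other; they differ by a constant, which the value at 0 shows to be 1. -/
theorem poly_eq_of_pow_eval_eq {S : Type*} [CommRing S] [IsDomain S] {p r : S[X]} {e : ℕ}
    (he : e ≠ 0) (hp : p.eval 0 = 1) (hr : r.eval 0 = 1) {T : Set S} (hT : T.Infinite)
    (h : ∀ s ∈ T, p.eval s ^ e = r.eval s ^ e) : p = r := by
  have h1 : p ^ e = r ^ e := by
    refine Polynomial.eq_of_infinite_eval_eq _ _ (hT.mono fun s hs => ?_)
    simpa using h s hs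
  let ι := algebraMap S (FractionRing S)
  have h2 : p.map ι ^ e = r.map ι ^ e := by rw [← Polynomial.map_pow, h1, Polynomial.map_pow]
  have h3 : Associated (p.map ι) (r.map ι) :=
    associated_of_dvd_dvd ((IsIntegrallyClosed.pow_dvd_pow_iff he).1 (dvd_of_eq h2))
      ((IsIntegrallyClosed.pow_dvd_pow_iff he).1 (dvd_of_eq h2.symm))
  obtain ⟨c, hc⟩ := h3
  obtain ⟨a, -, ha⟩ := Polynomial.isUnit_iff.1 c.isUnit
  have h4 := congrArg (Polynomial.eval 0) hc
  rw [← ha, Polynomial.eval_mul, Polynomial.eval_C, ← map_zero ι, Polynomial.eval_map_apply,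
    Polynomial.eval_map_apply, hp, hr, map_one, one_mul] at h4
  rw [← ha, h4, map_one, mul_one] at hc
  exact Polynomial.map_injective ι (IsFractionRing.injective S (FractionRing S)) hc

/-- Along the line from 1 to f the determinant is a polynomial in the parameter, with value 1 at 0
and det f at 1: the input for `poly_eq_of_pow_eval_eq`. -/
theorem exists_poly_det_homotopy {S W : Type*} [CommRing S] [AddCommGroup W] [Module S W]
    [Module.Free S W] [Module.Finite S W] (f : W →ₗ[S] W) :
    ∃ p : S[X], ∀ s : S, p.eval s = LinearMap.det (1 + s • (f - 1)) := by
  classical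
  cases subsingleton_or_nontrivial S
  · exact ⟨0, fun s => Subsingleton.elim _ _⟩
  let b := Module.finBasis S W
  let F := LinearMap.toMatrix b b (f - 1)
  refine ⟨(1 + (X : S[X]) • F.map C).det, fun s => ?_⟩
  rw [← LinearMap.det_toMatrix b, ← coe_evalRingHom, RingHom.map_det]
  congr 1
  ext i j
  simp [F, Matrix.one_apply, LinearMap.toMatrix_one]
  split_ifs <;> simp

end PolynomialIdentities

/-! ### Characteristic polynomials of maps commuting with a semilinear map -/

section Semilinear

open Polynomial

variable {Q K V : Type*} [Field Q] [Field K] [Algebra Q K] [AddCommGroup V] [Module K V]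
  [FiniteDimensional K V]

/-- An injective semilinear φ carries a basis to a basis. Since f commutes with φ, its matrix in the
new basis is σ applied to the old matrix, and both have the same characteristic polynomial. -/
theorem charpoly_map_eq_of_semilinear (σ : K ≃+* K) (φ : V →+ V) (hφ : Function.Injective φ)
    (hσ : ∀ (k : K) (x : V), φ (k • x) = σ k • φ x) (f : V →ₗ[K] V) (hf : ∀ x, f (φ x) = φ (f x)) :
    f.charpoly.map (σ : K →+* K) = f.charpoly := by
  classical
  let b := Module.finBasis K V
  have hli : LinearIndependent K (fun i => φ (b i)) := by
    refine b.linearIndependent.map_of_injective_injective σ.symm φ ?_ ?_ ?_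
    · intro r hr; simpa using hr
    · intro m hm; exact hφ (by simpa using hm)
    · intro r m; rw [hσ]; simp
  let b' := basisOfLinearIndependentOfCardEqFinrank' (fun i => φ (b i)) hli (by simp)
  have hb' : ∀ i, b' i = φ (b i) := fun i => by simp [b']
  have key : LinearMap.toMatrix b' b' f = (LinearMap.toMatrix b b f).map σ := by
    ext i j
    rw [LinearMap.toMatrix_apply, hb', hf, ← b.sum_repr (f (b j)), map_sum, map_sum,
      Finsupp.finsetSum_apply]
    simp only [hσ, ← hb', map_smul, Finsupp.smul_apply, Module.Basis.repr_self,
      Matrix.map_apply, LinearMap.toMatrix_apply]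
    simp [Finsupp.single_apply]
  rw [← LinearMap.charpoly_toMatrix f b, ← Matrix.charpoly_map]
  conv_rhs => rw [LinearMap.charpoly_toMatrix, ← LinearMap.charpoly_toMatrix f b', key]
  rfl

theorem exists_charpoly_eq_map (σ : K ≃+* K) (hfix : ∀ k, σ k = k → ∃ q : Q, algebraMap Q K q = k)
    (φ : V →+ V) (hφ : Function.Injective φ)
    (hσ : ∀ (k : K) (x : V), φ (k • x) = σ k • φ x) (f : V →ₗ[K] V) (hf : ∀ x, f (φ x) = φ (f x)) :
    ∃ χ : Q[X], χ.map (algebraMap Q K) = f.charpoly := by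
  have h := charpoly_map_eq_of_semilinear σ φ hφ hσ f hf
  have : f.charpoly ∈ Polynomial.lifts (algebraMap Q K) := by
    rw [Polynomial.lifts_iff_coeff_lifts]
    intro n
    have := congrArg (fun p => p.coeff n) h
    simp only [coeff_map] at this
    exact hfix _ this
  exact (Polynomial.mem_lifts _).1 this

theorem det_restrictScalars_eq_pow [FiniteDimensional Q K] [Module Q V] [IsScalarTower Q K V]
    (f : V →ₗ[K] V) {n : Q} (hn : algebraMap Q K n = LinearMap.det f) :
    LinearMap.det (f.restrictScalars Q) = n ^ Module.finrank Q K := by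
  rw [LinearMap.det_restrictScalars, ← hn, Algebra.norm_algebraMap]

end Semilinear

/-! ### Left multiplication in split algebras -/

section MatrixAlgebra

/-- In the basis of matrix units, left multiplication by a is the Kronecker product a ⊗ 1. -/
theorem det_mulLeft_matrix {K : Type*} [Field K] (n : ℕ) (a : Matrix (Fin n) (Fin n) K) :
    LinearMap.det (LinearMap.mulLeft K a) = a.det ^ n := by
  let b := Matrix.stdBasis K (Fin n) (Fin n)
  rw [← LinearMap.det_toMatrix b]
  have : LinearMap.toMatrix b b (LinearMap.mulLeft K a) = Matrix.kronecker a (1 : Matrix (Fin n) (Fin n) K) := by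
    ext ⟨i, j⟩ ⟨k, l⟩
    simp [b, LinearMap.toMatrix_apply, Matrix.stdBasis_eq_single, Matrix.one_apply]
    change (a * Matrix.single k l (1 : K)) i j = _
    rw [Matrix.mul_apply, Finset.sum_eq_single k]
    · simp [Matrix.single_apply, eq_comm]
    · intro x _ hx
      simp [hx.symm]
    · simp
  rw [this, Matrix.kronecker, Matrix.det_kronecker]
  simp

/-- The left side does not mention the splitting; this is what later allows two splittings to be
compared. -/
theorem det_mulLeft_eq_pow {F B K : Type*} [Field F] [Ring B] [Algebra F B] [FiniteDimensional F B]
    [Field K] [Algebra F K] {n : ℕ} (α : K ⊗[F] B ≃ₐ[K] Matrix (Fin n) (Fin n) K) (b : B) :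
    algebraMap F K (LinearMap.det (LinearMap.mulLeft F b)) = (α (1 ⊗ₜ b)).det ^ n := by
  rw [← det_mulLeft_matrix, ← LinearMap.det_baseChange]
  have : LinearMap.mulLeft K (α (1 ⊗ₜ b)) =
    α.toLinearEquiv ∘ₗ (LinearMap.mulLeft F b).baseChange K ∘ₗ α.toLinearEquiv.symm := by
    ext1 x
    obtain ⟨y, rfl⟩ := α.surjective x
    simp
    rw [← map_mul]
    congr 1
    induction y with
    | zero => simp
    | add x y hx hy => simp [mul_add, hx, hy]
    | tmul x y => simp
  rw [this, LinearMap.det_conj]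

end MatrixAlgebra

/-! ### The constant field of Q and the field Q ⊗ L -/

section ConstantField

variable {Fq A Q : Type u} [Field Fq] [Fintype Fq] [CommRing A] [Field Q] [Algebra Fq Q]
  [Algebra A Q]

theorem PlaceAtInfty.algebraMap_mem (P : PlaceAtInfty Fq A Q) (a : Fq) :
    algebraMap Fq Q a ∈ P.O := by
  by_cases ha : a = 0
  · simp [ha, P.O.zero_mem]
  · rw [← P.O.valuation_le_one_iff]
    have h1 : (P.O.valuation (algebraMap Fq Q a)) ^ (Fintype.card Fq - 1) = 1 := by
      rw [← map_pow, ← map_pow, FiniteField.pow_card_sub_one_eq_one a ha, map_one, map_one]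
    have : Fintype.card Fq - 1 ≠ 0 := by
      have := Fintype.one_lt_card (α := Fq); omega
    exact le_of_not_gt fun h => (one_lt_pow₀ h this).ne' h1

theorem PlaceAtInfty.mem_of_isIntegral (P : PlaceAtInfty Fq A Q) {x : Q} (hx : IsIntegral Fq x) :
    x ∈ P.O := by
  let i : Fq →+* P.O := (algebraMap Fq Q).codRestrict P.O.toSubring P.algebraMap_mem
  have h : IsIntegral P.O x := by
    obtain ⟨p, hp, hpx⟩ := hx
    refine ⟨p.map i, hp.map i, ?_⟩
    rw [Polynomial.eval₂_map]
    exact hpx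
  obtain ⟨y, rfl⟩ := IsIntegrallyClosed.isIntegral_iff.1 h
  exact y.2

/-- Fq is algebraically closed in Q, because ∞ is rational: x has a residue a in Fq, and a nonzero x
- a would be a nonunit of O whose inverse is integral over Fq, hence also in O. -/
theorem PlaceAtInfty.exists_algebraMap_eq (P : PlaceAtInfty Fq A Q) {x : Q}
    (hx : IsIntegral Fq x) : ∃ a : Fq, algebraMap Fq Q a = x := by
  obtain ⟨a, ha⟩ := P.rational x (P.mem_of_isIntegral hx)
  refine ⟨a, ?_⟩
  by_contra hne
  have h0 : x - algebraMap Fq Q a ≠ 0 := fun h => hne (sub_eq_zero.1 h).symm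
  have h1 : IsIntegral Fq (x - algebraMap Fq Q a)⁻¹ := (hx.sub isIntegral_algebraMap).inv
  have h2 := P.mem_of_isIntegral h1
  rw [ValuationSubring.mem_nonunits_iff] at ha
  rw [← P.O.valuation_le_one_iff, map_inv₀] at h2
  have h3 : P.O.valuation (x - algebraMap Fq Q a) ≠ 0 := by simpa using h0
  exact absurd ((inv_le_one₀ (zero_lt_iff.2 h3)).1 h2) (not_le.2 ha)

variable {L : Type u} [Field L] [Algebra Fq L]

/-- The minimal polynomial over Q of a generator of L has coefficients integral over Fq, hence in
Fq, so its degree does not drop. Therefore Q ⊗ L embeds into an algebraic closure of Q, and a domain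
integral over a field is a field. -/
theorem PlaceAtInfty.isField_tensor (P : PlaceAtInfty Fq A Q) [Finite L] :
    IsField (Q ⊗[Fq] L) := by
  have : Module.Finite Fq L := Module.Finite.of_finite
  let Ω := AlgebraicClosure Q
  let j : L →ₐ[Fq] Ω := IsAlgClosed.lift
  let pb := Field.powerBasisOfFiniteOfSeparable Fq L
  let β : Ω := j pb.gen
  have hβ : IsIntegral Q β := (pb.isIntegral_gen.map j).tower_top
  have hle : pb.dim ≤ (minpoly Q β).natDegree := by
    have hdvd : minpoly Q β ∣ (minpoly Fq pb.gen).map (algebraMap Fq Q) := by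
      apply minpoly.dvd
      rw [Polynomial.aeval_map_algebraMap, Polynomial.aeval_algHom_apply, minpoly.aeval, map_zero]
    have hl := integralClosure.mem_lifts_of_monic_of_dvd_map Q (minpoly.monic pb.isIntegral_gen)
      (minpoly.monic hβ) hdvd
    have hl' : minpoly Q β ∈ Polynomial.lifts (algebraMap Fq Q) := by
      rw [Polynomial.lifts_iff_coeff_lifts] at hl ⊢
      intro n
      obtain ⟨y, hy⟩ := hl n
      obtain ⟨a, ha⟩ := P.exists_algebraMap_eq y.2
      exact ⟨a, ha.trans hy⟩
    obtain ⟨p, hp⟩ := (Polynomial.mem_lifts _).1 hl'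
    have h0 : Polynomial.aeval pb.gen p = 0 := by
      apply (map_eq_zero_iff j j.toRingHom.injective).1
      rw [← Polynomial.aeval_algHom_apply, ← Polynomial.aeval_map_algebraMap Q, hp, minpoly.aeval]
    have hp0 : p ≠ 0 := by
      rintro rfl
      rw [Polynomial.map_zero] at hp
      exact minpoly.ne_zero hβ hp.symm
    rw [← pb.natDegree_minpoly, ← hp, Polynomial.natDegree_map]
    exact Polynomial.natDegree_le_of_dvd (minpoly.dvd _ _ h0) hp0
  let T : Q ⊗[Fq] L →ₐ[Q] Ω := Algebra.TensorProduct.lift (Algebra.ofId Q Ω) j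
    (fun _ _ => mul_comm _ _)
  have hTm : ∀ (x : Q) (y : L), T (x ⊗ₜ y) = algebraMap Q Ω x * j y := fun _ _ =>
    Algebra.TensorProduct.lift_tmul ..
  have hT : Function.Injective T := by
    let B := Algebra.TensorProduct.basis Q pb.basis
    refine (LinearMap.ker_eq_bot (f := T.toLinearMap)).1 ?_
    have hli : LinearIndependent Q (T.toLinearMap ∘ B) := by
      have := (linearIndependent_pow (K := Q) β).comp (Fin.castLE hle) (Fin.castLE_injective hle)
      convert this using 1
      ext i
      simp only [B, β, Algebra.TensorProduct.basis_apply, Function.comp_apply,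
        AlgHom.toLinearMap_apply]
      rw [hTm]
      simp
    rw [LinearMap.ker_eq_bot']
    intro m hm
    rw [← B.sum_repr m] at hm ⊢
    rw [map_sum] at hm
    have := Fintype.linearIndependent_iff.1 hli (fun i => B.repr m i) (by simpa using hm)
    simp [this]
  have : IsDomain (Q ⊗[Fq] L) := hT.isDomain T.toRingHom
  exact isField_of_isIntegral_of_isField' (R := Q) (Field.toIsField Q)

variable (Fq Q L) in
/-- The `q`-Frobenius of the second factor of `Q ⊗ L`. -/
noncomputable def frobTensor [Finite L] : (Q ⊗[Fq] L) ≃ₐ[Q] (Q ⊗[Fq] L) :=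
  Algebra.TensorProduct.congr AlgEquiv.refl
    (AlgEquiv.ofBijective (FiniteField.frobeniusAlgHom Fq L)
      (Finite.injective_iff_bijective.1 (RingHom.injective _)))

theorem frobTensor_tmul [Finite L] (x : Q) (b : L) :
    frobTensor Fq Q L (x ⊗ₜ b) = x ⊗ₜ (b ^ Fintype.card Fq) := rfl

/-- The fixed field of the Frobenius on L is Fq, i.e. Fq → L → L is exact with second map Frob - 1.
Tensoring with the flat module Q preserves this. -/
theorem exists_of_frobTensor_eq [Finite L] {k : Q ⊗[Fq] L} (h : frobTensor Fq Q L k = k) :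
    ∃ x : Q, algebraMap Q (Q ⊗[Fq] L) x = k := by
  have ex : Function.Exact (Algebra.linearMap Fq L)
      ((FiniteField.frobeniusAlgHom Fq L).toLinearMap - (LinearMap.id : L →ₗ[Fq] L)) := by
    intro y
    constructor
    · intro hy
      have : y ^ Fintype.card Fq = y := by simpa [sub_eq_zero] using hy
      have hr : y ∈ ((Polynomial.X ^ Fintype.card Fq - Polynomial.X : Polynomial Fq).map
          (algebraMap Fq L)).roots := by
        rw [Polynomial.mem_roots']
        refine ⟨?_, by simp [this]⟩
        rw [Polynomial.map_ne_zero_iff (algebraMap Fq L).injective]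
        exact FiniteField.X_pow_card_sub_X_ne_zero _ Fintype.one_lt_card
      -- The polynomial X^q - X already splits over Fq, so its roots in L come from Fq.
      have hs : (Polynomial.X ^ Fintype.card Fq - Polynomial.X : Polynomial Fq).Splits := by
        rw [Polynomial.splits_iff_card_roots, FiniteField.roots_X_pow_card_sub_X,
          FiniteField.X_pow_card_sub_X_natDegree_eq _ Fintype.one_lt_card]
        rfl
      rw [hs.roots_map] at hr
      obtain ⟨a, -, ha⟩ := Multiset.mem_map.1 hr
      exact ⟨a, ha⟩
    · rintro ⟨a, rfl⟩
      simp
  have ex' := Module.Flat.lTensor_exact Q ex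
  have : (LinearMap.lTensor Q ((FiniteField.frobeniusAlgHom Fq L).toLinearMap - (LinearMap.id : L →ₗ[Fq] L))) k
      = 0 := by
    rw [LinearMap.lTensor_sub, LinearMap.sub_apply, LinearMap.lTensor_id, LinearMap.id_apply,
      sub_eq_zero]
    exact h
  obtain ⟨y, rfl⟩ := (ex' k).1 this
  refine ⟨TensorProduct.rid Fq Q y, ?_⟩
  clear h this
  induction y with
  | zero => simp
  | tmul x a =>
    rw [TensorProduct.rid_tmul, Algebra.TensorProduct.algebraMap_apply, LinearMap.lTensor_tmul,
      Algebra.linearMap_apply, Algebra.algebraMap_eq_smul_one a, TensorProduct.tmul_smul,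
      TensorProduct.smul_tmul']
    rfl
  | add x y hx hy => rw [map_add, map_add, hx, hy, map_add]

end ConstantField

/-- A finite Q would be integral over Fq and hence contained in O. -/
theorem PlaceAtInfty.infinite {Fq A Q : Type u} [Field Fq] [Fintype Fq] [CommRing A] [Field Q]
    [Algebra Fq Q] [Algebra A Q] (P : PlaceAtInfty Fq A Q) : Infinite Q := by
  by_contra h
  rw [not_infinite_iff_finite] at h
  refine P.ne_top (eq_top_iff.2 fun x _ => P.mem_of_isIntegral ?_)
  have : Module.Finite Fq Q := Module.Finite.of_finite
  exact Algebra.IsIntegral.isIntegral x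

/-! ### The determinant over Q ⊗ L on the commutant of L and φ -/

namespace FrobSpace

variable {Fq Q L : Type u} [Field Fq] [Fintype Fq] [Field Q] [Field L] [Algebra Fq Q]
  [Algebra Fq L]

/-- The algebra of `Q ⊗ L`-linear endomorphisms commuting with `φ`. -/
def commutant (N : FrobSpace Fq Q L) : Subalgebra Q (Module.End Q N.V) where
  carrier := {f | (∀ (b : L) (x : N.V), f (b • x) = b • f x) ∧ ∀ x, f (N.φ x) = N.φ (f x)}
  mul_mem' := by
    rintro f g ⟨hf1, hf2⟩ ⟨hg1, hg2⟩
    exact ⟨fun b x => by simp [hf1, hg1], fun x => by simp [hf2, hg2]⟩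
  add_mem' := by
    rintro f g ⟨hf1, hf2⟩ ⟨hg1, hg2⟩
    exact ⟨fun b x => by simp [hf1, hg1], fun x => by simp [hf2, hg2]⟩
  algebraMap_mem' := fun q =>
    ⟨fun b x => by
      rw [Module.algebraMap_end_apply, Module.algebraMap_end_apply, smul_comm], fun x => by
      rw [Module.algebraMap_end_apply, Module.algebraMap_end_apply, map_smul]⟩

variable (N : FrobSpace Fq Q L)

instance tensorModule : Module (Q ⊗[Fq] L) N.V := TensorProduct.Algebra.module

theorem tmul_smul' (a : Q) (b : L) (x : N.V) : (a ⊗ₜ[Fq] b) • x = a • b • x :=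
  TensorProduct.Algebra.smul_def a b x

instance tensorTower : IsScalarTower Q (Q ⊗[Fq] L) N.V where
  smul_assoc a k x := by
    induction k with
    | zero => simp
    | add k k' h h' => rw [smul_add, add_smul, h, h', add_smul, smul_add]
    | tmul c b => rw [TensorProduct.smul_tmul', N.tmul_smul', N.tmul_smul', smul_eq_mul, mul_smul]

/-- An element of the commutant as a `Q ⊗ L`-linear map. -/
def toTensorLinear {N : FrobSpace Fq Q L} (f : Module.End Q N.V)
    (hf : ∀ (b : L) (x : N.V), f (b • x) = b • f x) : N.V →ₗ[Q ⊗[Fq] L] N.V where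
  toFun := f
  map_add' := map_add f
  map_smul' k x := by
    induction k with
    | zero => simp
    | add k k' h h' => rw [add_smul, map_add, h, h', RingHom.id_apply, RingHom.id_apply,
        RingHom.id_apply, add_smul]
    | tmul c b => rw [N.tmul_smul', map_smul, hf, RingHom.id_apply, N.tmul_smul']

theorem φ_tensor_smul [Finite L] (k : Q ⊗[Fq] L) (x : N.V) :
    N.φ (k • x) = frobTensor Fq Q L k • N.φ x := by
  induction k with
  | zero => simp
  | add k k' h h' => rw [add_smul, map_add, h, h', map_add, add_smul]
  | tmul c b => rw [N.tmul_smul', map_smul, N.φ_smul, frobTensor_tmul, N.tmul_smul']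

open Polynomial

theorem finrank_eq {A : Type u} [CommRing A] [Algebra A Q] (P : PlaceAtInfty Fq A Q) [Finite L] :
    Module.finrank Q N.V = Module.finrank Fq L * N.qlRank := by
  let := P.isField_tensor (L := L) |>.toField
  have := Module.finrank_mul_finrank Q (Q ⊗[Fq] L) N.V
  rw [← this, Module.finrank_baseChange]
  rfl

/-- The determinant over `Q ⊗ L` on the commutant takes values in `Q`. -/
theorem exists_tensorDet {A : Type u} [CommRing A] [Algebra A Q] (P : PlaceAtInfty Fq A Q)
    [Finite L] [FiniteDimensional Q N.V] (hφ : Function.Injective N.φ) :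
    ∃ d : Module.End Q N.V → Q,
      (∀ f ∈ N.commutant, LinearMap.det f = d f ^ Module.finrank Fq L) ∧
      d 1 = 1 ∧
      (∀ f ∈ N.commutant, ∃ p : Q[X], ∀ q : Q, p.eval q = d (1 + q • (f - 1))) ∧
      ∀ f ∈ N.commutant, ∃ χ : Q[X], χ.Monic ∧ χ ^ Module.finrank Fq L = LinearMap.charpoly f ∧
        aeval f χ = 0 ∧ d f = (-1) ^ χ.natDegree * χ.coeff 0 := by
  classical
  let := P.isField_tensor (L := L) |>.toField
  have hfin : FiniteDimensional (Q ⊗[Fq] L) N.V := Module.Finite.of_restrictScalars_finite Q _ _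
  have hK : Module.finrank Q (Q ⊗[Fq] L) = Module.finrank Fq L := Module.finrank_baseChange
  have hKf : FiniteDimensional Q (Q ⊗[Fq] L) := inferInstance
  let σ : (Q ⊗[Fq] L) ≃+* (Q ⊗[Fq] L) := (frobTensor Fq Q L).toRingEquiv
  have hfix : ∀ k : Q ⊗[Fq] L, σ k = k → ∃ q : Q, algebraMap Q (Q ⊗[Fq] L) q = k :=
    fun k hk => exists_of_frobTensor_eq hk
  have hex : ∀ f ∈ N.commutant, ∃ χ : Q[X], ∃ F : N.V →ₗ[Q ⊗[Fq] L] N.V, (∀ x, F x = f x) ∧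
      χ.map (algebraMap Q (Q ⊗[Fq] L)) = F.charpoly := by
    intro f hf
    obtain ⟨χ, hχ⟩ := exists_charpoly_eq_map σ hfix N.φ.toAddMonoidHom hφ N.φ_tensor_smul
      (toTensorLinear f hf.1) hf.2
    exact ⟨χ, _, fun x => rfl, hχ⟩
  choose! χ F hF hχ using hex
  have hdet : ∀ f (hf : f ∈ N.commutant),
      algebraMap Q (Q ⊗[Fq] L) ((-1) ^ (χ f).natDegree * (χ f).coeff 0) = LinearMap.det (F f) := by
    intro f hf
    rw [LinearMap.det_eq_sign_charpoly_coeff, ← hχ f hf, ← LinearMap.charpoly_natDegree (F f),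
      ← hχ f hf, map_mul, map_pow, map_neg, map_one, Polynomial.coeff_map,
      Polynomial.natDegree_map]
  have hFeq : ∀ f ∈ N.commutant, (F f).restrictScalars Q = f := fun f hf =>
    LinearMap.ext fun x => hF f hf x
  have hmon : ∀ f ∈ N.commutant, (χ f).Monic := by
    intro f hf
    have := LinearMap.charpoly_monic (F f)
    rw [← hχ f hf] at this
    exact (Polynomial.monic_map_iff).1 this
  have hsub : ∀ f ∈ N.commutant, ∀ q : Q, algebraMap Q _ q - f ∈ N.commutant := fun f hf q =>
    sub_mem (N.commutant.algebraMap_mem q) hf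
  have heval : ∀ f ∈ N.commutant, ∀ q : Q, algebraMap Q (Q ⊗[Fq] L) ((χ f).eval q) =
      LinearMap.det (F (algebraMap Q _ q - f)) := by
    intro f hf q
    rw [← Polynomial.eval_map_apply, hχ f hf, LinearMap.eval_charpoly]
    congr 1
    ext x
    rw [hF _ (hsub f hf q), LinearMap.sub_apply, LinearMap.sub_apply, hF f hf]
    congr 1
    exact (algebraMap_smul (Q ⊗[Fq] L) q x)
  have hdd : ∀ f ∈ N.commutant, LinearMap.det f =
      ((-1) ^ (χ f).natDegree * (χ f).coeff 0) ^ Module.finrank Fq L := by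
    intro f hf
    have := det_restrictScalars_eq_pow (F f) (hdet f hf)
    rwa [hFeq f hf, hK] at this
  have hinf := P.infinite
  refine ⟨fun f => (-1) ^ (χ f).natDegree * (χ f).coeff 0, hdd, ?_, ?_, ?_⟩
  · apply (algebraMap Q (Q ⊗[Fq] L)).injective
    have h1 := N.commutant.one_mem
    rw [hdet _ h1, map_one]
    have : F 1 = 1 := LinearMap.ext fun x => hF 1 h1 x
    rw [this, map_one]
  · intro f hf
    have hg : 1 - f ∈ N.commutant := sub_mem N.commutant.one_mem hf
    -- For q ≠ 0, det (1 + q (f - 1)) = q^r χ_{1-f}(1/q) with r the dimension over Q ⊗ L, and this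
    -- is the reversed polynomial at q.
    refine ⟨(χ (1 - f)).reverse, fun q => ?_⟩
    have hh : 1 + q • (f - 1) ∈ N.commutant :=
      add_mem N.commutant.one_mem (Subalgebra.smul_mem _ (sub_mem hf N.commutant.one_mem) q)
    apply (algebraMap Q (Q ⊗[Fq] L)).injective
    rw [hdet _ hh]
    by_cases hq : q = 0
    · subst hq
      have h1 : F (1 + (0 : Q) • (f - 1)) = 1 := LinearMap.ext fun x => by
        rw [hF _ hh]; simp
      rw [h1, map_one, ← coeff_zero_eq_eval_zero, coeff_zero_reverse, hmon _ hg, map_one]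
    · have h1 : F (1 + q • (f - 1)) =
          algebraMap Q (Q ⊗[Fq] L) q • F (algebraMap Q _ q⁻¹ - (1 - f)) :=
        LinearMap.ext fun x => by
          rw [hF _ hh, LinearMap.smul_apply, hF _ (hsub _ hg _), algebraMap_smul]
          simp only [LinearMap.add_apply, LinearMap.smul_apply, LinearMap.sub_apply,
            Module.End.one_apply, Module.algebraMap_end_apply, smul_sub, smul_smul,
            mul_inv_cancel₀ hq, one_smul]
          abel
      rw [h1, LinearMap.det_smul, ← heval _ hg, ← map_pow, ← map_mul]
      congr 1
      let : Invertible q⁻¹ := invertibleOfNonzero (inv_ne_zero hq)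
      have h2 := Polynomial.eval₂_reverse_mul_pow (RingHom.id Q) q⁻¹ (χ (1 - f))
      have h3 : (χ (1 - f)).natDegree = Module.finrank (Q ⊗[Fq] L) N.V := by
        rw [← LinearMap.charpoly_natDegree (F (1 - f)), ← hχ _ hg, Polynomial.natDegree_map]
      rw [invOf_eq_inv, inv_inv, h3] at h2
      change eval q _ * _ = eval q⁻¹ _ at h2
      rw [← h2, mul_comm, mul_assoc, ← mul_pow, inv_mul_cancel₀ hq, one_pow, mul_one]
  · intro f hf
    refine ⟨χ f, hmon f hf, ?_, ?_, rfl⟩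
    · refine Polynomial.eq_of_infinite_eval_eq _ _ (Set.infinite_univ.mono fun q _ => ?_)
      change eval q _ = eval q _
      have h := det_restrictScalars_eq_pow (F (algebraMap Q _ q - f)) (heval f hf q)
      rw [hFeq _ (hsub f hf q), hK] at h
      rw [LinearMap.eval_charpoly, h, eval_pow]
    · have := LinearMap.aeval_self_charpoly (F f)
      rw [← hχ f hf, Polynomial.aeval_map_algebraMap] at this
      have h2 : ∀ p : Q[X], ∀ x, aeval (F f) p x = aeval f p x := by
        intro p x
        have h3 := Polynomial.aeval_endomorphism f x p
        have h4 : ∀ n : ℕ, ∀ x, (F f ^ n) x = (f ^ n) x := by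
          intro n
          induction n with
          | zero => simp
          | succ n ih => intro x; rw [pow_succ, pow_succ, Module.End.mul_apply,
              Module.End.mul_apply, hF f hf, ih]
        rw [h3, Polynomial.aeval_eq_sum_range, LinearMap.sum_apply, Polynomial.sum_over_range]
        · simp only [LinearMap.smul_apply, h4]
        · simp
      exact LinearMap.ext fun x => by rw [← h2, this]; rfl

end FrobSpace

/-! ### Eigenspaces of L over a field containing L -/

section Eigenspaces

variable {Fq L Ω W : Type*} [Field Fq] [Fintype Fq] [Field L] [Finite L] [Algebra Fq L]
  [Field Ω] [AddCommGroup W] [Module Ω W] [FiniteDimensional Ω W]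

/-- The subspace on which `L` acts through the embedding `ι`. -/
def eigenPart (ι : L →+* Ω) (ρ : L →+* Module.End Ω W) : Submodule Ω W where
  carrier := {x | ∀ b, ρ b x = ι b • x}
  add_mem' hx hy b := by rw [map_add, hx, hy, smul_add]
  zero_mem' b := by simp
  smul_mem' c x hx b := by rw [map_smul, hx, smul_comm]

variable (Fq) in
/-- The map `(x_i) ↦ ∑ φ^i x_i`. -/
noncomputable def sumPow (ι : L →+* Ω) (ρ : L →+* Module.End Ω W) (φ : Module.End Ω W) :
    (Fin (Module.finrank Fq L) → eigenPart ι ρ) →ₗ[Ω] W :=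
  ∑ i : Fin (Module.finrank Fq L), (φ ^ (i : ℕ)) ∘ₗ (eigenPart ι ρ).subtype ∘ₗ LinearMap.proj i

omit [Fintype Fq] [Finite L] [FiniteDimensional Ω W] in
theorem sumPow_apply (ι : L →+* Ω) (ρ : L →+* Module.End Ω W) (φ : Module.End Ω W)
    (x : Fin (Module.finrank Fq L) → eigenPart ι ρ) :
    sumPow Fq ι ρ φ x = ∑ i : Fin (Module.finrank Fq L), (φ ^ (i : ℕ)) (x i : W) := by
  simp [sumPow]

variable {ι : L →+* Ω} {ρ : L →+* Module.End Ω W} {φ : Module.End Ω W}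

local notation "fr" => FiniteField.frobeniusAlgEquivOfAlgebraic Fq L

omit [FiniteDimensional Ω W] in
theorem pow_comm_scalar (hφρ : ∀ b x, φ (ρ b x) = ρ (fr b) (φ x)) (i : ℕ) (b : L) (x : W) :
    (φ ^ i) (ρ b x) = ρ ((fr ^ i) b) ((φ ^ i) x) := by
  induction i generalizing b x with
  | zero => simp
  | succ i ih => rw [pow_succ, pow_succ, Module.End.mul_apply, hφρ, ih]; rfl

omit [FiniteDimensional Ω W] in
-- The powers of φ permute the eigenspaces of L: φ^i sends that of ι to that of ι ∘ Frob^(-i).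
theorem scalar_pow_apply (hφρ : ∀ b x, φ (ρ b x) = ρ (fr b) (φ x)) (i : ℕ) (b : L)
    (x : eigenPart ι ρ) :
    ρ b ((φ ^ i) (x : W)) = ι ((fr ^ i)⁻¹ b) • (φ ^ i) (x : W) := by
  have h1 := pow_comm_scalar hφρ i ((fr ^ i)⁻¹ b) (x : W)
  rw [x.2, map_smul] at h1
  have h2 : (fr ^ i) ((fr ^ i)⁻¹ b) = b := by
    rw [← AlgEquiv.mul_apply, mul_inv_cancel]; rfl
  rw [h2] at h1
  exact h1.symm

/-- Injectivity is Dedekind's independence of the distinct characters ι ∘ Frob^(-i). For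
surjectivity let b and b* be dual bases of L for the trace form. Then p = ∑ ι(b*_k) ρ(b_k) has
values in the ι-eigenspace, and the sum of the conjugates φ^i p φ^(-i) is the identity because ∑
Tr(b_k) b*_k = 1. -/
theorem sumPow_bijective (hρ : ∀ a : Fq, ρ (algebraMap Fq L a) = ι (algebraMap Fq L a) • 1)
    (hφρ : ∀ b x, φ (ρ b x) = ρ (fr b) (φ x)) (hφ : Function.Injective φ) :
    Function.Bijective (sumPow Fq ι ρ φ) := by
  classical
  have : Module.Finite Fq L := Module.Finite.of_finite
  have hpinj : ∀ i : ℕ, Function.Injective (φ ^ i) := fun i => by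
    rw [Module.End.coe_pow]; exact hφ.iterate i
  constructor
  · rw [← LinearMap.ker_eq_bot, LinearMap.ker_eq_bot']
    intro x hx
    rw [sumPow_apply] at hx
    let χ : Fin (Module.finrank Fq L) → (L →* Ω) := fun i =>
      (ι : L →* Ω).comp (((fr ^ (i : ℕ))⁻¹ : L ≃ₐ[Fq] L) : L →* L)
    have hχ : Function.Injective χ := by
      intro i j hij
      apply (FiniteField.bijective_frobeniusAlgEquivOfAlgebraic_pow Fq L).1
      apply inv_injective
      ext b
      exact ι.injective (DFunLike.congr_fun hij b)
    have hli := (linearIndependent_monoidHom L Ω).comp χ hχ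
    have hmem : ∀ (i : Fin (Module.finrank Fq L)) (b : L),
        ρ b ((φ ^ (i : ℕ)) (x i : W)) = χ i b • (φ ^ (i : ℕ)) (x i : W) :=
      fun i b => scalar_pow_apply hφρ i b (x i)
    let B := Module.finBasis Ω W
    have hz : ∀ i : Fin (Module.finrank Fq L), (φ ^ (i : ℕ)) (x i : W) = 0 := by
      intro i
      refine B.ext_elem fun m => ?_
      rw [map_zero, Finsupp.zero_apply]
      refine Fintype.linearIndependent_iff.1 hli
        (fun i => B.repr ((φ ^ (i : ℕ)) (x i : W)) m) ?_ i
      ext b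
      have h3 := congrArg (ρ b) hx
      rw [map_sum, map_zero] at h3
      simp only [hmem] at h3
      have h4 := congrArg (fun w => B.repr w m) h3
      simpa [mul_comm] using h4
    ext i
    exact hpinj i (by rw [hz i]; simp)
  · intro x
    let b := Module.finBasis Fq L
    let p : W → W := fun x => ∑ k, ι (b.traceDual k) • ρ (b k) x
    have hp : ∀ x, p x ∈ eigenPart ι ρ := by
      intro x c
      have h1 : ∀ z : L, ∑ m, Algebra.trace Fq L (z * b.traceDual m) • b m = z := by
        intro z
        have := b.traceDual.traceDual.sum_repr z
        simp only [Module.Basis.traceDual_repr_apply, Algebra.traceForm_apply] at this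
        rwa [b.traceDual_traceDual] at this
      have h2 : ∀ m, c * b.traceDual m =
          ∑ k, Algebra.trace Fq L (c * b k * b.traceDual m) • b.traceDual k := by
        intro m
        conv_lhs => rw [← b.traceDual.sum_repr (c * b.traceDual m)]
        refine Finset.sum_congr rfl fun k _ => ?_
        rw [Module.Basis.traceDual_repr_apply, Algebra.traceForm_apply]
        congr 2
        ring
      have h3 : ∀ (a : Fq) (l : L), ρ (a • l) = ι (algebraMap Fq L a) • ρ l := by
        intro a l
        rw [Algebra.smul_def, map_mul, hρ, smul_mul_assoc, one_mul]
      calc ρ c (p x) = ∑ k, ι (b.traceDual k) • ρ (c * b k) x := by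
            simp [p, map_sum, map_smul]
        _ = ∑ k, ∑ m, ι (b.traceDual k) •
              ι (algebraMap Fq L (Algebra.trace Fq L (c * b k * b.traceDual m))) • ρ (b m) x := by
            refine Finset.sum_congr rfl fun k _ => ?_
            rw [← Finset.smul_sum]
            congr 1
            conv_lhs => rw [← h1 (c * b k)]
            rw [map_sum, LinearMap.sum_apply]
            simp only [h3, LinearMap.smul_apply]
        _ = ∑ m, ι (c * b.traceDual m) • ρ (b m) x := by
            rw [Finset.sum_comm]
            refine Finset.sum_congr rfl fun m _ => ?_
            rw [h2 m, map_sum, Finset.sum_smul]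
            refine Finset.sum_congr rfl fun k _ => ?_
            rw [smul_smul, Algebra.smul_def, ι.map_mul, mul_comm (ι _) (ι _)]
        _ = ι c • p x := by
            simp [p, Finset.smul_sum, smul_smul]
    have hpsurj : ∀ i : ℕ, Function.Surjective (φ ^ i) := fun i =>
      LinearMap.injective_iff_surjective.1 (hpinj i)
    -- Here y i is φ^(-i) x, and the components of the preimage of x are p (y i).
    choose y hy using fun i : ℕ => hpsurj i x
    refine ⟨fun i => ⟨p (y i), hp _⟩, ?_⟩
    rw [sumPow_apply]
    have h4 : ∀ i : ℕ, (φ ^ i) (p (y i)) = ∑ k, ι (b.traceDual k) • ρ (b k ^ (Nat.card Fq ^ i)) x := by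
      intro i
      simp only [p, map_sum, map_smul, pow_comm_scalar hφρ, hy]
      refine Finset.sum_congr rfl fun k _ => ?_
      congr 3
      rw [AlgEquiv.coe_pow, FiniteField.coe_frobeniusAlgEquivOfAlgebraic_iterate,
        Nat.card_eq_fintype_card]
    simp only [h4]
    rw [Finset.sum_comm]
    have h5 : ∀ k, ∑ i : Fin (Module.finrank Fq L), ι (b.traceDual k) • ρ (b k ^ (Nat.card Fq ^ (i : ℕ))) x
        = ι (Algebra.trace Fq L (b k) • b.traceDual k) • x := by
      intro k
      rw [← Finset.smul_sum, ← LinearMap.sum_apply, ← map_sum,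
        ← Finset.sum_range (fun i => b k ^ (Nat.card Fq ^ i)),
        ← FiniteField.algebraMap_trace_eq_sum_pow, hρ, LinearMap.smul_apply, Module.End.one_apply,
        smul_smul, Algebra.smul_def, ι.map_mul, mul_comm]
    simp only [h5]
    rw [← Finset.sum_smul, ← map_sum]
    have h6 : ∑ k, Algebra.trace Fq L (b k) • b.traceDual k = 1 := by
      conv_rhs => rw [← b.traceDual.sum_repr 1]
      refine Finset.sum_congr rfl fun k _ => ?_
      rw [Module.Basis.traceDual_repr_apply, Algebra.traceForm_apply, one_mul]
    rw [h6, map_one, one_smul]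

/-- W is a sum of e copies of the eigenspace, moved around by φ. A map commuting with L and φ
preserves the eigenspace and is determined there. Conversely, an endomorphism of the eigenspace acts
diagonally on the copies, and this commutes with φ because φ^e is a scalar. -/
theorem exists_commutant_algHom
    (hρ : ∀ a : Fq, ρ (algebraMap Fq L a) = ι (algebraMap Fq L a) • 1)
    (hφρ : ∀ b x, φ (ρ b x) = ρ (fr b) (φ x)) (hφ : Function.Injective φ)
    {c : Ω} (hc : ∀ x, (φ ^ Module.finrank Fq L) x = c • x) :
    ∃ Λ : Module.End Ω (eigenPart ι ρ) →ₐ[Ω] Module.End Ω W, Function.Injective Λ ∧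
      (∀ g : Module.End Ω W, (∀ b x, g (ρ b x) = ρ b (g x)) → (∀ x, g (φ x) = φ (g x)) →
        g ∈ Λ.range) ∧
      (∀ h b x, Λ h (ρ b x) = ρ b (Λ h x)) ∧ (∀ h x, Λ h (φ x) = φ (Λ h x)) ∧
      ∀ h, LinearMap.det (Λ h) = LinearMap.det h ^ Module.finrank Fq L := by
  classical
  have : Module.Finite Fq L := Module.Finite.of_finite
  let Θ := LinearEquiv.ofBijective _ (sumPow_bijective hρ hφρ hφ)
  let diag : Module.End Ω (eigenPart ι ρ) →ₐ[Ω]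
      Module.End Ω (Fin (Module.finrank Fq L) → eigenPart ι ρ) :=
    AlgHom.ofLinearMap
      { toFun := fun h => LinearMap.pi fun i => h ∘ₗ LinearMap.proj i
        map_add' := fun h h' => rfl
        map_smul' := fun c h => rfl } rfl (fun h h' => rfl)
  have hdiag : ∀ h x i, diag h x i = h (x i) := fun h x i => rfl
  let Λ := (Θ.conjAlgEquiv Ω).toAlgHom.comp diag
  have hΛ : ∀ h, Λ h = Θ.toLinearMap ∘ₗ diag h ∘ₗ Θ.symm.toLinearMap := fun h => rfl
  have hΛΘ : ∀ h x, Λ h (Θ x) = Θ (diag h x) := fun h x => by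
    rw [hΛ]; simp
  have hΘ : ∀ y, Θ y = ∑ i : Fin (Module.finrank Fq L), (φ ^ (i : ℕ)) (y i : W) :=
    sumPow_apply ι ρ φ
  have hΛpow : ∀ h (i : Fin (Module.finrank Fq L)) (x : eigenPart ι ρ),
      Λ h ((φ ^ (i : ℕ)) (x : W)) = (φ ^ (i : ℕ)) (h x : W) := by
    intro h i x
    have h1 : ∀ z : eigenPart ι ρ, Θ (Pi.single i z) = (φ ^ (i : ℕ)) (z : W) := by
      intro z
      rw [hΘ, Finset.sum_eq_single i]
      · simp
      · intro j _ hj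
        simp [Pi.single_eq_of_ne hj]
      · simp
    rw [← h1, hΛΘ, ← h1]
    congr 1
    ext j
    rw [hdiag]
    by_cases hj : j = i
    · subst hj; simp
    · simp [Pi.single_eq_of_ne hj]
  -- The exponent i = e is included: φ takes the last copy back to the first one, up to the scalar
  -- c.
  have hΛpow' : ∀ h (i : ℕ) (_ : i ≤ Module.finrank Fq L) (x : eigenPart ι ρ),
      Λ h ((φ ^ i) (x : W)) = (φ ^ i) (h x : W) := by
    intro h i hi x
    rcases hi.lt_or_eq with hi | rfl
    · exact hΛpow h ⟨i, hi⟩ x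
    · have h0 := hΛpow h ⟨0, Module.finrank_pos⟩ x
      simp only [pow_zero, Module.End.one_apply] at h0
      rw [hc, hc, map_smul, h0]
  refine ⟨Λ, ?_, ?_, ?_, ?_, ?_⟩
  · intro h h' hh
    ext x
    have h1 := congrArg (fun g => g (Θ fun _ => x)) hh
    simp only [hΛΘ] at h1
    have h2 := congrFun (Θ.injective h1) ⟨0, Module.finrank_pos⟩
    rw [hdiag, hdiag] at h2
    rw [h2]
  · intro g hg1 hg2
    have hg3 : ∀ x ∈ eigenPart ι ρ, g x ∈ eigenPart ι ρ := by
      intro x hx b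
      rw [← hg1, hx, map_smul]
    have hg4 : ∀ (i : ℕ) x, g ((φ ^ i) x) = (φ ^ i) (g x) := by
      intro i
      induction i with
      | zero => simp
      | succ i ih => intro x; rw [pow_succ, Module.End.mul_apply, ih, hg2, Module.End.mul_apply]
    refine ⟨g.restrict hg3, ?_⟩
    ext x
    obtain ⟨y, rfl⟩ := Θ.surjective x
    change Λ _ (Θ y) = _
    rw [hΛΘ]
    change sumPow Fq ι ρ φ _ = g (sumPow Fq ι ρ φ _)
    rw [sumPow_apply, sumPow_apply, map_sum]
    refine Finset.sum_congr rfl fun i _ => ?_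
    rw [hg4, hdiag]
    rfl
  · intro h b x
    obtain ⟨y, rfl⟩ := Θ.surjective x
    rw [hΘ, map_sum, map_sum, map_sum, map_sum]
    refine Finset.sum_congr rfl fun i _ => ?_
    rw [scalar_pow_apply hφρ, map_smul, hΛpow, scalar_pow_apply hφρ]
  · intro h x
    obtain ⟨y, rfl⟩ := Θ.surjective x
    rw [hΘ, map_sum, map_sum, map_sum, map_sum]
    refine Finset.sum_congr rfl fun i _ => ?_
    have e1 : ∀ z : W, φ ((φ ^ (i : ℕ)) z) = (φ ^ ((i : ℕ) + 1)) z := fun z => by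
      rw [pow_succ']; rfl
    rw [hΛpow, e1, e1, hΛpow' h _ i.2]
  · intro h
    rw [hΛ, LinearMap.det_conj]
    change LinearMap.det (LinearMap.pi fun i => h ∘ₗ LinearMap.proj i) = _
    rw [LinearMap.det_pi]
    simp

end Eigenspaces

/-! ### Splitting a central simple factor of the commutant -/

section CentralSimple

variable {Fq L F V B : Type u} [Field Fq] [Fintype Fq] [Field L] [Finite L] [Algebra Fq L]
  [Field F] [Algebra Fq F] [AddCommGroup V] [Module F V] [FiniteDimensional F V]
  [Ring B] [Algebra F B]

local notation "fr" => FiniteField.frobeniusAlgEquivOfAlgebraic Fq L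

theorem exists_sum_tmul {Ω M : Type*} [Field Ω] [Algebra F Ω] [AddCommGroup M] [Module F M]
    {κ : Type*} (ω : Module.Basis κ F Ω) (y : Ω ⊗[F] M) :
    ∃ (g : κ →₀ M), y = g.sum fun k m => ω k ⊗ₜ m := by
  classical
  refine ⟨TensorProduct.equivFinsuppOfBasisLeft ω y, ?_⟩
  conv_lhs => rw [← (TensorProduct.equivFinsuppOfBasisLeft ω).symm_apply_apply y]
  rw [TensorProduct.equivFinsuppOfBasisLeft_symm_apply]

theorem eq_of_sum_tmul {Ω M : Type*} [Field Ω] [Algebra F Ω] [AddCommGroup M] [Module F M]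
    {κ : Type*} (ω : Module.Basis κ F Ω) (g g' : κ →₀ M)
    (h : (g.sum fun k m => ω k ⊗ₜ[F] m) = g'.sum fun k m => ω k ⊗ₜ[F] m) : g = g' := by
  classical
  refine (TensorProduct.equivFinsuppOfBasisLeft (N := M) ω).symm.injective ?_
  rw [TensorProduct.equivFinsuppOfBasisLeft_symm_apply,
    TensorProduct.equivFinsuppOfBasisLeft_symm_apply, h]

/-- The map `Ω ⊗ End V → End (Ω ⊗ V)`. -/
noncomputable def endBaseChange (F V Ω : Type*) [Field F] [AddCommGroup V] [Module F V] [Field Ω]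
    [Algebra F Ω] : Ω ⊗[F] Module.End F V →ₐ[Ω] Module.End Ω (Ω ⊗[F] V) :=
  Algebra.TensorProduct.lift (Algebra.ofId _ _) (Module.End.baseChangeHom F Ω V)
    (fun _ _ => Algebra.commutes _ _)

theorem endBaseChange_tmul {F V Ω : Type*} [Field F] [AddCommGroup V] [Module F V] [Field Ω]
    [Algebra F Ω] (c : Ω) (g : Module.End F V) :
    endBaseChange F V Ω (c ⊗ₜ g) = c • g.baseChange Ω :=
  (Algebra.TensorProduct.lift_tmul _ _ _ c g).trans (Algebra.smul_def c _).symm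

theorem endBaseChange_bijective {F V Ω : Type*} [Field F] [AddCommGroup V] [Module F V] [Field Ω]
    [Algebra F Ω] [FiniteDimensional F V] : Function.Bijective (endBaseChange F V Ω) := by
  have h := IsBaseChange.end (TensorProduct.isBaseChange F V Ω)
  have : (endBaseChange F V Ω).toLinearMap = h.equiv.toLinearMap := by
    refine TensorProduct.AlgebraTensorModule.ext fun c g => ?_
    refine (endBaseChange_tmul c g).trans ?_
    refine Eq.trans ?_ (h.equiv_tmul c g).symm
    congr 1
    refine TensorProduct.AlgebraTensorModule.ext fun d x => ?_
    have e : (d ⊗ₜ[F] x : Ω ⊗[F] V) = d • TensorProduct.mk F Ω V 1 x := by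
      rw [TensorProduct.mk_apply, TensorProduct.smul_tmul', smul_eq_mul, mul_one]
    rw [e, map_smul, map_smul, IsBaseChange.endHom_comp_apply]
    simp
  have hf : (endBaseChange F V Ω : _ → _) = h.equiv := funext fun x => DFunLike.congr_fun this x
  rw [hf]
  exact h.equiv.bijective

omit [Algebra Fq F] [FiniteDimensional F V] in
-- The e-th power of the Frobenius is the identity on L, so φ^e commutes with L and with φ and
-- belongs to the commutant B. There it is central, since all of B commutes with φ; so it is a
-- scalar in F.
theorem exists_scalar_of_commutant
    (ρ : L →+* Module.End F V) (φ : Module.End F V) (hφρ : ∀ b x, φ (ρ b x) = ρ (fr b) (φ x))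
    [Algebra.IsCentral F B] (a : B →ₐ[F] Module.End F V) (ha : Function.Injective a)
    (hrange : ∀ g, g ∈ a.range ↔ (∀ b x, g (ρ b x) = ρ b (g x)) ∧ ∀ x, g (φ x) = φ (g x)) :
    ∃ c : F, ∀ x, (φ ^ Module.finrank Fq L) x = c • x := by
  have : Module.Finite Fq L := Module.Finite.of_finite
  have hiter : ∀ (i : ℕ) b x, (φ ^ i) (ρ b x) = ρ ((fr ^ i) b) ((φ ^ i) x) := by
    intro i
    induction i with
    | zero => simp
    | succ i ih => intro b x; rw [pow_succ, pow_succ, Module.End.mul_apply, hφρ, ih]; rfl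
  have hfr : ∀ b : L, (fr ^ Module.finrank Fq L) b = b := by
    intro b
    rw [AlgEquiv.coe_pow, FiniteField.coe_frobeniusAlgEquivOfAlgebraic_iterate,
      ← Nat.card_eq_fintype_card, ← Module.natCard_eq_pow_finrank]
    have := Fintype.ofFinite L
    rw [Nat.card_eq_fintype_card]
    exact FiniteField.pow_card b
  have hmem : φ ^ Module.finrank Fq L ∈ a.range := by
    rw [hrange]
    refine ⟨fun b x => by rw [hiter, hfr], fun x => ?_⟩
    rw [← Module.End.mul_apply, ← pow_succ, pow_succ']
    rfl
  obtain ⟨π, hπ⟩ := hmem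
  replace hπ : a π = φ ^ Module.finrank Fq L := hπ
  have hcen : π ∈ Subalgebra.center F B := by
    rw [Subalgebra.mem_center_iff]
    intro b
    apply ha
    have hb := (hrange (a b)).1 ⟨b, rfl⟩
    have hb' : ∀ (i : ℕ) x, a b ((φ ^ i) x) = (φ ^ i) (a b x) := by
      intro i
      induction i with
      | zero => simp
      | succ i ih => intro x; rw [pow_succ, Module.End.mul_apply, ih, hb.2, Module.End.mul_apply]
    rw [map_mul, map_mul, hπ]
    exact LinearMap.ext fun x => hb' _ x
  rw [Algebra.IsCentral.center_eq_bot] at hcen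
  obtain ⟨c, hc⟩ := Algebra.mem_bot.1 hcen
  refine ⟨c, fun x => ?_⟩
  rw [← hπ, ← hc, AlgHom.commutes, Module.algebraMap_end_apply]

/-- The base change of a commutant is the commutant of the base changes. -/
theorem mem_range_baseChange_iff {Ω : Type u} [Field Ω] [Algebra F Ω]
    (a : B →ₐ[F] Module.End F V) {S : Type*} (s : S → Module.End F V)
    (hrange : ∀ g, g ∈ a.range ↔ ∀ i, g * s i = s i * g) (g : Module.End Ω (Ω ⊗[F] V)) :
    g ∈ ((endBaseChange F V Ω).comp (Algebra.TensorProduct.map (AlgHom.id Ω Ω) a)).range ↔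
      ∀ i, g * (s i).baseChange Ω = (s i).baseChange Ω * g := by
  constructor
  · rintro ⟨y, rfl⟩ i
    change (endBaseChange F V Ω) (Algebra.TensorProduct.map (AlgHom.id Ω Ω) a y) * _ =
      _ * (endBaseChange F V Ω) (Algebra.TensorProduct.map (AlgHom.id Ω Ω) a y)
    induction y with
    | zero => simp
    | add x y hx hy => simp only [map_add, add_mul, mul_add, hx, hy]
    | tmul d b =>
      rw [Algebra.TensorProduct.map_tmul, endBaseChange_tmul, smul_mul_assoc, mul_smul_comm,
        ← LinearMap.baseChange_mul, ← LinearMap.baseChange_mul, (hrange (a b)).1 ⟨b, rfl⟩ i]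
  · intro h
    obtain ⟨y, rfl⟩ := endBaseChange_bijective.2 g
    -- Expanded in an F-basis of Ω, an operator commutes with the base changes if and only if each
    -- of its coefficients commutes with the original maps.
    let ω := Module.Basis.ofVectorSpace F Ω
    obtain ⟨G, rfl⟩ := exists_sum_tmul ω y
    have hG : ∀ k, G k ∈ a.range := by
      intro k
      rw [hrange]
      intro i
      have h0 : endBaseChange F V Ω ((G.mapRange (fun g => g * s i) (by simp)).sum
          fun k m => ω k ⊗ₜ m) = endBaseChange F V Ω ((G.mapRange (fun g => s i * g)
            (by simp)).sum fun k m => ω k ⊗ₜ m) := by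
        have := h i
        rw [Finsupp.sum, map_sum, Finset.sum_mul, Finset.mul_sum] at this
        rw [Finsupp.sum_mapRange_index (by simp), Finsupp.sum_mapRange_index (by simp),
          Finsupp.sum, Finsupp.sum, map_sum, map_sum]
        refine Eq.trans (Finset.sum_congr rfl fun k _ => ?_)
          (this.trans (Finset.sum_congr rfl fun k _ => ?_))
        · rw [endBaseChange_tmul, endBaseChange_tmul, smul_mul_assoc, LinearMap.baseChange_mul]
        · rw [endBaseChange_tmul, endBaseChange_tmul, mul_smul_comm, LinearMap.baseChange_mul]
      have h1 := eq_of_sum_tmul ω _ _ (endBaseChange_bijective.1 h0)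
      exact DFunLike.congr_fun h1 k
    choose b hb using hG
    refine ⟨∑ k ∈ G.support, ω k ⊗ₜ b k, ?_⟩
    change endBaseChange F V Ω (Algebra.TensorProduct.map (AlgHom.id Ω Ω) a _) = _
    rw [map_sum, Finsupp.sum]
    congr 1
    refine Finset.sum_congr rfl fun k _ => ?_
    rw [Algebra.TensorProduct.map_tmul]
    exact congrArg (fun t => ω k ⊗ₜ[F] t) (hb k)

theorem exists_end_equiv_matrix (Ω W : Type*) [Field Ω] [AddCommGroup W] [Module Ω W]
    [FiniteDimensional Ω W] : ∃ (m : ℕ) (β : Module.End Ω W ≃ₐ[Ω] Matrix (Fin m) (Fin m) Ω),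
      ∀ f, (β f).det = LinearMap.det f :=
  ⟨Module.finrank Ω W, LinearMap.toMatrixAlgEquiv (Module.finBasis Ω W),
    fun _ => LinearMap.det_toMatrix _ _⟩

/-- A central simple algebra acting as the full commutant of `L` and `φ` is split by every field
extension into which `L` embeds, compatibly with determinants. -/
theorem exists_splitting_of_embedding {Ω : Type u} [Field Ω] [Algebra F Ω] (ι : L →+* Ω)
    (hι : ∀ a : Fq, ι (algebraMap Fq L a) = algebraMap F Ω (algebraMap Fq F a))
    (ρ : L →+* Module.End F V) (hρ : ∀ a : Fq, ρ (algebraMap Fq L a) = algebraMap Fq F a • 1)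
    (φ : Module.End F V) (hφρ : ∀ b x, φ (ρ b x) = ρ (fr b) (φ x)) (hφ : Function.Injective φ)
    [Algebra.IsCentral F B] (a : B →ₐ[F] Module.End F V) (ha : Function.Injective a)
    (hrange : ∀ g, g ∈ a.range ↔ (∀ b x, g (ρ b x) = ρ b (g x)) ∧ ∀ x, g (φ x) = φ (g x)) :
    ∃ (m : ℕ) (α : Ω ⊗[F] B ≃ₐ[Ω] Matrix (Fin m) (Fin m) Ω),
      ∀ b, algebraMap F Ω (LinearMap.det (a b)) = (α (1 ⊗ₜ b)).det ^ Module.finrank Fq L := by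
  classical
  obtain ⟨ρΩ, hρΩ⟩ : ∃ ρΩ : L →+* Module.End Ω (Ω ⊗[F] V), ∀ b, ρΩ b = (ρ b).baseChange Ω :=
    ⟨((Module.End.baseChangeHom F Ω V : _ →ₐ[F] _) : _ →+* _).comp ρ, fun b => rfl⟩
  obtain ⟨φΩ, hφΩ⟩ : ∃ φΩ : Module.End Ω (Ω ⊗[F] V), φΩ = φ.baseChange Ω := ⟨_, rfl⟩
  have h1 : ∀ c : Fq, ρΩ (algebraMap Fq L c) = ι (algebraMap Fq L c) • 1 := by
    intro c
    rw [hρΩ, hρ, LinearMap.baseChange_smul, hι, LinearMap.baseChange_one]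
    refine LinearMap.ext fun x => ?_
    exact (algebraMap_smul Ω (algebraMap Fq F c) x).symm
  have h2 : ∀ b x, φΩ (ρΩ b x) = ρΩ (fr b) (φΩ x) := by
    intro b x
    induction x with
    | zero => simp
    | add x y hx hy => simp only [map_add, hx, hy]
    | tmul c x => simp [hρΩ, hφΩ, hφρ]
  have h3 : Function.Injective φΩ := by
    rw [hφΩ]
    exact Module.Flat.lTensor_preserves_injective_linearMap (M := Ω) φ hφ
  obtain ⟨c, hc⟩ := exists_scalar_of_commutant ρ φ hφρ a ha hrange
  have h4 : ∀ x, (φΩ ^ Module.finrank Fq L) x = algebraMap F Ω c • x := by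
    intro x
    have : φΩ ^ Module.finrank Fq L = (φ ^ Module.finrank Fq L).baseChange Ω := by
      rw [hφΩ]
      exact (map_pow (Module.End.baseChangeHom F Ω V) φ _).symm
    rw [this, algebraMap_smul]
    induction x with
    | zero => simp
    | add x y hx hy => simp only [map_add, hx, hy, smul_add]
    | tmul d x => simp [hc]
  obtain ⟨Λ, hΛ1, hΛ2, hΛ3, hΛ4, hΛ5⟩ := exists_commutant_algHom h1 h2 h3 h4
  let aΩ : Ω ⊗[F] B →ₐ[Ω] Module.End Ω (Ω ⊗[F] V) :=
    (endBaseChange F V Ω).comp (Algebra.TensorProduct.map (AlgHom.id Ω Ω) a)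
  have haΩ : Function.Injective aΩ := by
    have h5 : Function.Injective (Algebra.TensorProduct.map (AlgHom.id Ω Ω) a) :=
      Module.Flat.lTensor_preserves_injective_linearMap (M := Ω) a.toLinearMap ha
    exact endBaseChange_bijective.1.comp h5
  -- Both ranges are the commutant of L and φ on Ω ⊗ V. This identifies Ω ⊗ B with the endomorphism
  -- algebra of one eigenspace, and `hΛ5` gives the e-th power.
  have hrΩ : aΩ.range = Λ.range := by
    ext g
    -- The index `none` stands for φ and `some b` for the scalar b in L.
    rw [mem_range_baseChange_iff (Ω := Ω) a (fun o : Option L => o.elim φ ρ)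
      (fun g => (hrange g).trans ⟨fun h i => ?_, fun h => ⟨fun b x => ?_, fun x => ?_⟩⟩)]
    · constructor
      · intro h
        refine hΛ2 g (fun b x => ?_) (fun x => ?_)
        · rw [hρΩ]
          exact LinearMap.congr_fun (h (some b)) x
        · rw [hφΩ]
          exact LinearMap.congr_fun (h none) x
      · rintro ⟨y, rfl⟩ (_ | b)
        · change Λ y * φ.baseChange Ω = φ.baseChange Ω * Λ y
          rw [← hφΩ]
          exact LinearMap.ext fun x => hΛ4 y x
        · change Λ y * (ρ b).baseChange Ω = (ρ b).baseChange Ω * Λ y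
          rw [← hρΩ]
          exact LinearMap.ext fun x => hΛ3 y b x
    · rcases i with _ | b
      · exact LinearMap.ext fun x => h.2 x
      · exact LinearMap.ext fun x => h.1 b x
    · exact LinearMap.congr_fun (h (some b)) x
    · exact LinearMap.congr_fun (h none) x
  let α1 : Ω ⊗[F] B ≃ₐ[Ω] Module.End Ω (eigenPart ι ρΩ) :=
    (AlgEquiv.ofInjective aΩ haΩ).trans
      ((Subalgebra.equivOfEq _ _ hrΩ).trans (AlgEquiv.ofInjective Λ hΛ1).symm)
  have hα1 : ∀ y, Λ (α1 y) = aΩ y := by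
    intro y
    have := (AlgEquiv.ofInjective Λ hΛ1).apply_symm_apply
      (Subalgebra.equivOfEq _ _ hrΩ (AlgEquiv.ofInjective aΩ haΩ y))
    exact congrArg Subtype.val this
  obtain ⟨m, β, hβ⟩ := exists_end_equiv_matrix Ω (eigenPart ι ρΩ)
  refine ⟨m, α1.trans β, fun b => ?_⟩
  rw [AlgEquiv.trans_apply, hβ, ← hΛ5, hα1]
  have h7 : aΩ (1 ⊗ₜ b) = (a b).baseChange Ω := by
    refine (endBaseChange_tmul (1 : Ω) (a b)).trans (one_smul _ _)
  rw [h7, LinearMap.det_baseChange]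

open Polynomial in
theorem exists_poly_det_matrix {K : Type*} [Field K] {n : ℕ} (M : Matrix (Fin n) (Fin n) K) :
    ∃ p : K[X], ∀ s, p.eval s = (1 + s • (M - 1)).det := by
  obtain ⟨p, hp⟩ := exists_poly_det_homotopy (Matrix.toLin' M)
  refine ⟨p, fun s => ?_⟩
  have : Matrix.toLin' (1 + s • (M - 1)) = 1 + s • (Matrix.toLin' M - 1) := by
    rw [map_add, map_smul, map_sub, Matrix.toLin'_one]
    rfl
  rw [hp, ← LinearMap.det_toLin', this]

theorem homotopy_tmul {K : Type*} [Field K] [Algebra F K] {n : ℕ}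
    (α : K ⊗[F] B ≃ₐ[K] Matrix (Fin n) (Fin n) K) (b : B) (c : F) :
    α (1 ⊗ₜ (1 + c • (b - 1))) = 1 + algebraMap F K c • (α (1 ⊗ₜ b) - 1) := by
  have : (1 ⊗ₜ[F] (1 + c • (b - 1)) : K ⊗[F] B) =
      1 + algebraMap F K c • ((1 ⊗ₜ b) - 1) := by
    rw [TensorProduct.tmul_add, TensorProduct.tmul_smul, TensorProduct.tmul_sub, algebraMap_smul]
    rfl
  rw [this, map_add, map_smul, map_sub, map_one]

theorem splitting_sq {K : Type*} [Field K] [Algebra F K] {n : ℕ}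
    (α : K ⊗[F] B ≃ₐ[K] Matrix (Fin n) (Fin n) K) : n * n = Module.finrank F B := by
  have := α.toLinearEquiv.finrank_eq
  rw [Module.finrank_baseChange, Module.finrank_matrix] at this
  simp at this
  exact this.symm

open Polynomial in
/-- The reduced norm of `1 + X (b - 1)` is a polynomial over `F`, whose value at `1` can be computed
from any splitting, and which is an `e`-th root of the determinant on `V`. -/
theorem exists_normPoly [Infinite F]
    (ρ : L →+* Module.End F V) (hρ : ∀ a : Fq, ρ (algebraMap Fq L a) = algebraMap Fq F a • 1)
    (φ : Module.End F V) (hφρ : ∀ b x, φ (ρ b x) = ρ (fr b) (φ x)) (hφ : Function.Injective φ)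
    [Algebra.IsCentral F B] [IsSimpleRing B] [FiniteDimensional F B]
    (a : B →ₐ[F] Module.End F V) (ha : Function.Injective a)
    (hrange : ∀ g, g ∈ a.range ↔ (∀ b x, g (ρ b x) = ρ b (g x)) ∧ ∀ x, g (φ x) = φ (g x)) (b : B) :
    ∃ Y : F[X], Y.eval 0 = 1 ∧
      (∀ c, Y.eval c ^ Module.finrank Fq L = LinearMap.det (1 + c • (a b - 1))) ∧
      (∀ (K : Type u) [Field K] [Algebra F K] (n : ℕ)
        (α : K ⊗[F] B ≃ₐ[K] Matrix (Fin n) (Fin n) K),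
        algebraMap F K (Y.eval 1) = (α (1 ⊗ₜ b)).det) ∧
      ∃ (K : Type u) (_ : Field K) (_ : Algebra F K) (n : ℕ),
        Nonempty (K ⊗[F] B ≃ₐ[K] Matrix (Fin n) (Fin n) K) := by
  have : Module.Finite Fq L := Module.Finite.of_finite
  have he : Module.finrank Fq L ≠ 0 := Module.finrank_pos.ne'
  let ι : L →ₐ[Fq] SeparableClosure F := IsSepClosed.lift
  have hι : ∀ c : Fq, (ι : L →+* SeparableClosure F) (algebraMap Fq L c) =
      algebraMap F (SeparableClosure F) (algebraMap Fq F c) := by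
    intro c
    rw [← IsScalarTower.algebraMap_apply]
    exact ι.commutes c
  obtain ⟨m, α₀, hα₀⟩ := exists_splitting_of_embedding (ι : L →+* SeparableClosure F) hι ρ hρ φ hφρ
    hφ a ha hrange
  have hinf : ∀ (K : Type u) [Field K] [Algebra F K], (Set.range (algebraMap F K)).Infinite :=
    fun K _ _ => Set.infinite_range_of_injective (algebraMap F K).injective
  obtain ⟨p, hp⟩ := exists_poly_det_matrix (α₀ (1 ⊗ₜ b))
  have hp0 : p.eval 0 = 1 := by rw [hp]; simp
  have hpe : ∀ c : F, p.eval (algebraMap F _ c) ^ Module.finrank Fq L =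
      algebraMap F _ (LinearMap.det (a (1 + c • (b - 1)))) := by
    intro c
    rw [hα₀, homotopy_tmul, hp]
  -- At points of F the e-th power of p has values in F. So p and its conjugate have equal e-th
  -- powers there, hence coincide, and p descends to F.
  have hfix : ∀ g : SeparableClosure F ≃ₐ[F] SeparableClosure F,
      p.map (g : SeparableClosure F →+* SeparableClosure F) = p := by
    intro g
    have hev : ∀ c : F, (p.map (g : SeparableClosure F →+* SeparableClosure F)).eval
        (algebraMap F _ c) = g (p.eval (algebraMap F _ c)) := by
      intro c
      have := Polynomial.eval_map_apply (f := (g : SeparableClosure F →+* SeparableClosure F))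
        (p := p) (algebraMap F _ c)
      simpa using this
    refine poly_eq_of_pow_eval_eq he ?_ hp0 (hinf (SeparableClosure F)) ?_
    · have := hev 0
      rw [map_zero, hp0, map_one] at this
      exact this
    · rintro _ ⟨c, rfl⟩
      rw [hev, ← map_pow, hpe, AlgEquiv.commutes]
  obtain ⟨Y, hY⟩ : ∃ Y : F[X], Y.map (algebraMap F (SeparableClosure F)) = p := by
    rw [← Polynomial.mem_lifts, Polynomial.lifts_iff_coeff_lifts]
    intro k
    refine (InfiniteGalois.mem_range_algebraMap_iff_fixed _).2 fun g => ?_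
    have := congrArg (Polynomial.coeff · k) (hfix g)
    simpa using this
  have hYe : ∀ c, algebraMap F (SeparableClosure F) (Y.eval c) =
      p.eval (algebraMap F _ c) := by
    intro c
    rw [← hY, Polynomial.eval_map_apply]
  have hY0 : Y.eval 0 = 1 := by
    apply (algebraMap F (SeparableClosure F)).injective
    rw [hYe, map_zero, hp0, map_one]
  refine ⟨Y, hY0, fun c => ?_, fun K _ _ n α => ?_, ⟨_, _, _, m, ⟨α₀⟩⟩⟩
  · apply (algebraMap F (SeparableClosure F)).injective
    rw [map_pow, hYe, hpe, map_add, map_smul, map_sub, map_one]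
  · have hnm : n = m := by
      have := (splitting_sq α).trans (splitting_sq α₀).symm
      exact Nat.mul_self_inj.1 this
    have hm : m ≠ 0 := by
      rintro rfl
      have := splitting_sq α₀
      have h1 : 0 < Module.finrank F B := Module.finrank_pos
      omega
    -- An arbitrary splitting is compared with the one over the separable closure through left
    -- multiplication on B, whose determinant is the m-th power of the split determinant in either
    -- case.
    have hYm : ∀ c, Y.eval c ^ m =
        LinearMap.det (LinearMap.mulLeft F (1 + c • (b - 1) : B)) := by
      intro c
      apply (algebraMap F (SeparableClosure F)).injective
      rw [map_pow, hYe, det_mulLeft_eq_pow α₀, homotopy_tmul, hp]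
    obtain ⟨r, hr⟩ := exists_poly_det_matrix (α (1 ⊗ₜ b))
    have hrY : Y.map (algebraMap F K) = r := by
      refine poly_eq_of_pow_eval_eq hm ?_ ?_ (hinf K) ?_
      · have := Polynomial.eval_map_apply (f := algebraMap F K) (p := Y) 0
        rw [map_zero, hY0, map_one] at this
        exact this
      · rw [hr]; simp
      · rintro _ ⟨c, rfl⟩
        rw [Polynomial.eval_map_apply, ← map_pow, hYm, det_mulLeft_eq_pow α, homotopy_tmul, hr]
        exact congrArg _ hnm
    rw [← Polynomial.eval_map_apply, hrY, hr, map_one, one_smul, add_sub_cancel]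

end CentralSimple

/-! ### Norms from the centre of a factor down to Q -/

section RestrictNorm

open Polynomial in
-- The norm is the determinant of multiplication, and the matrix of multiplication by Y(q) has
-- entries polynomial in q.
theorem exists_poly_norm {Q F : Type*} [Field Q] [Field F] [Algebra Q F] [FiniteDimensional Q F]
    (Y : F[X]) : ∃ R : Q[X], ∀ q, R.eval q = Algebra.norm Q (Y.eval (algebraMap Q F q)) := by
  classical
  let b := Module.finBasis Q F
  let T : Matrix _ _ Q[X] := fun i j =>
    ∑ k ∈ Finset.range (Y.natDegree + 1), C (Algebra.leftMulMatrix b (Y.coeff k) i j) * X ^ k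
  refine ⟨T.det, fun q => ?_⟩
  rw [Algebra.norm_eq_matrix_det b, ← Polynomial.coe_evalRingHom, RingHom.map_det]
  congr 1
  ext i j
  rw [RingHom.mapMatrix_apply, Matrix.map_apply, Polynomial.coe_evalRingHom,
    Polynomial.eval_finsetSum, Polynomial.eval_eq_sum_range, map_sum, Matrix.sum_apply]
  refine Finset.sum_congr rfl fun k _ => ?_
  have : Y.coeff k * algebraMap Q F q ^ k = q ^ k • Y.coeff k := by
    rw [← map_pow, mul_comm, Algebra.smul_def]
  rw [this, map_smul, Matrix.smul_apply, smul_eq_mul, Polynomial.eval_mul, Polynomial.eval_C,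
    Polynomial.eval_pow, Polynomial.eval_X, mul_comm]

theorem det_pi_map {Q ι : Type*} [Field Q] [Fintype ι] [LinearOrder ι] {U : ι → Type*} [∀ i, AddCommGroup (U i)]
    [∀ i, Module Q (U i)] [∀ i, FiniteDimensional Q (U i)] (f : ∀ i, U i →ₗ[Q] U i) :
    LinearMap.det (LinearMap.pi fun i => f i ∘ₗ LinearMap.proj i) =
      ∏ i, LinearMap.det (f i) := by
  classical
  let b := fun i => Module.finBasis Q (U i)
  rw [← LinearMap.det_toMatrix (Pi.basis b)]
  have : LinearMap.toMatrix (Pi.basis b) (Pi.basis b)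
      (LinearMap.pi fun i => f i ∘ₗ LinearMap.proj i) =
      Matrix.blockDiagonal' fun i => LinearMap.toMatrix (b i) (b i) (f i) := by
    ext ⟨i, k⟩ ⟨j, k'⟩
    rw [LinearMap.toMatrix_apply, Pi.basis_repr, Pi.basis_apply]
    by_cases h : i = j
    · subst h
      rw [Matrix.blockDiagonal'_apply_eq, LinearMap.toMatrix_apply]
      simp
    · rw [Matrix.blockDiagonal'_apply_ne _ _ _ h]
      simp [Pi.single_eq_of_ne h]
  rw [this, (Matrix.blockTriangular_blockDiagonal' _).det_fintype]
  refine Finset.prod_congr rfl fun i _ => ?_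
  rw [← LinearMap.det_toMatrix (b i)]
  let E : Fin (Module.finrank Q (U i)) ≃ {x : Σ i, Fin (Module.finrank Q (U i)) // x.1 = i} :=
    { toFun := fun k => ⟨⟨i, k⟩, rfl⟩
      invFun := fun x => x.2 ▸ x.1.2
      left_inv := fun k => rfl
      right_inv := fun ⟨⟨j, k⟩, h⟩ => by cases h; rfl }
  rw [← Matrix.det_submatrix_equiv_self E]
  congr 1
  ext k k'
  exact (Matrix.blockDiagonal'_apply_eq
    (fun i => LinearMap.toMatrix (b i) (b i) (f i)) i k k')

variable {Fq L Q F U B : Type u} [Field Fq] [Fintype Fq] [Field L] [Finite L] [Algebra Fq L]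
  [Field Q] [Algebra Fq Q] [Field F] [Algebra Q F] [FiniteDimensional Q F]
  [Ring B] [Algebra F B] [Algebra Q B] [IsScalarTower Q F B]
  [FiniteDimensional F B] [Algebra.IsCentral F B] [IsSimpleRing B]
  [AddCommGroup U] [Module Q U] [FiniteDimensional Q U] [Infinite Q]

local notation "fr" => FiniteField.frobeniusAlgEquivOfAlgebraic Fq L

open Polynomial in
-- The centre F of B makes U an F-vector space on which L and φ act F-linearly, because they commute
-- with B. So `exists_normPoly` applies over F, and taking the norm to Q turns determinants over F
-- into determinants over Q.
theorem exists_normPoly_restrict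
    (ρ : L →+* Module.End Q U) (hρ : ∀ a : Fq, ρ (algebraMap Fq L a) = algebraMap Fq Q a • 1)
    (φ : Module.End Q U) (hφρ : ∀ b x, φ (ρ b x) = ρ (fr b) (φ x)) (hφ : Function.Injective φ)
    (a : B →ₐ[Q] Module.End Q U) (ha : Function.Injective a)
    (hrange : ∀ g, g ∈ a.range ↔ (∀ b x, g (ρ b x) = ρ b (g x)) ∧ ∀ x, g (φ x) = φ (g x)) (b : B) :
    ∃ (y : F) (R : Q[X]), R.eval 0 = 1 ∧
      (∀ q, R.eval q ^ Module.finrank Fq L = LinearMap.det (1 + q • (a b - 1))) ∧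
      R.eval 1 = Algebra.norm Q y ∧
      (∀ (K : Type u) [Field K] [Algebra F K] (n : ℕ)
        (α : K ⊗[F] B ≃ₐ[K] Matrix (Fin n) (Fin n) K),
        algebraMap F K y = (α (1 ⊗ₜ b)).det) ∧
      ∃ (K : Type u) (_ : Field K) (_ : Algebra F K) (n : ℕ),
        Nonempty (K ⊗[F] B ≃ₐ[K] Matrix (Fin n) (Fin n) K) := by
  let _ : Algebra Fq F := ((algebraMap Q F).comp (algebraMap Fq Q)).toAlgebra
  let _ : Module F U := Module.compHom U ((a : B →+* Module.End Q U).comp (algebraMap F B))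
  have hsm : ∀ (c : F) (u : U), c • u = a (algebraMap F B c) u := fun _ _ => rfl
  have : IsScalarTower Q F U := ⟨fun q c u => by
    rw [hsm, hsm, Algebra.algebraMap_eq_smul_one, smul_assoc, map_smul,
      Algebra.algebraMap_eq_smul_one]; rfl⟩
  have : FiniteDimensional F U := Module.Finite.of_restrictScalars_finite Q F U
  have hFinf : Infinite F := Infinite.of_injective _ (algebraMap Q F).injective
  have hac : ∀ b' : B, (∀ b x, a b' (ρ b x) = ρ b (a b' x)) ∧ ∀ x, a b' (φ x) = φ (a b' x) :=
    fun b' => (hrange _).1 ⟨b', rfl⟩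
  let lift : ∀ g : Module.End Q U, (∀ c : F, ∀ u, g (c • u) = c • g u) → Module.End F U :=
    fun g hg => { toFun := g, map_add' := map_add g, map_smul' := hg }
  let ρF : L →+* Module.End F U :=
    { toFun := fun b => lift (ρ b) fun c u => ((hac _).1 b u).symm
      map_one' := by ext x; change ρ 1 x = x; rw [map_one]; rfl
      map_mul' := fun b b' => by ext x; change ρ (b * b') x = ρ b (ρ b' x); rw [map_mul]; rfl
      map_zero' := by ext x; change ρ 0 x = 0; rw [map_zero]; rfl
      map_add' := fun b b' => by ext x; change ρ (b + b') x = ρ b x + ρ b' x; rw [map_add]; rfl }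
  let φF : Module.End F U := lift φ fun c u => ((hac _).2 u).symm
  let aF : B →ₐ[F] Module.End F U :=
    { toFun := fun b => lift (a b) fun c u => by
        rw [hsm, hsm, ← Module.End.mul_apply, ← Module.End.mul_apply, ← map_mul, ← map_mul,
          Algebra.commutes]
      map_one' := by ext x; change a 1 x = x; rw [map_one]; rfl
      map_mul' := fun b b' => by ext x; change a (b * b') x = a b (a b' x); rw [map_mul]; rfl
      map_zero' := by ext x; change a 0 x = 0; rw [map_zero]; rfl
      map_add' := fun b b' => by ext x; change a (b + b') x = a b x + a b' x; rw [map_add]; rfl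
      commutes' := fun c => by ext x; rfl }
  have hρF : ∀ c : Fq, ρF (algebraMap Fq L c) = algebraMap Fq F c • 1 := fun c => by
    refine LinearMap.ext fun x => ?_
    change ρ (algebraMap Fq L c) x = (algebraMap Q F (algebraMap Fq Q c)) • x
    rw [hρ]; exact (algebraMap_smul F (algebraMap Fq Q c) x).symm
  obtain ⟨Y, hY0, hYe, hYα, hK⟩ := exists_normPoly (Fq := Fq) (F := F) (B := B) ρF
    hρF φF hφρ hφ aF
    (fun b b' h => ha (LinearMap.ext fun x => LinearMap.congr_fun h x))
    (fun g => by
      constructor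
      · rintro ⟨b', rfl⟩
        exact hac b'
      · intro h
        obtain ⟨b', hb'⟩ := (hrange (g.restrictScalars Q)).2 h
        exact ⟨b', LinearMap.ext fun x => LinearMap.congr_fun hb' x⟩) b
  obtain ⟨R, hR⟩ := exists_poly_norm (Q := Q) Y
  refine ⟨Y.eval 1, R, ?_, fun q => ?_, ?_, hYα, hK⟩
  · rw [hR, map_zero, hY0, map_one]
  · rw [hR, ← map_pow, hYe, ← LinearMap.det_restrictScalars]
    congr 1
    refine LinearMap.ext fun x => ?_
    change x + algebraMap Q F q • (a b x - x) = x + q • (a b x - x)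
    rw [algebraMap_smul]
  · rw [hR, map_one]

end RestrictNorm

/-! ### The reduced norm on a semisimple commutant -/

namespace FrobSpace

variable {Fq Q L : Type u} [Field Fq] [Fintype Fq] [Field Q] [Field L] [Algebra Fq Q]
  [Algebra Fq L] (N : FrobSpace Fq Q L) [FiniteDimensional Q N.V]

/-- The action of a factor `B i` of the commutant on the corresponding summand of `V`. -/
theorem exists_factor_action {ι : Type*} [Fintype ι] [LinearOrder ι] {B : ι → Type u}
    [∀ i, Ring (B i)] [∀ i, Algebra Q (B i)] (e : N.commutant ≃ₐ[Q] ∀ i, B i) :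
    ∃ (U : ι → Submodule Q N.V) (a : ∀ i, B i →ₐ[Q] Module.End Q (U i)),
      (∀ i (b : L), ∀ x ∈ U i, b • x ∈ U i) ∧ (∀ i, ∀ x ∈ U i, N.φ x ∈ U i) ∧
      (∀ i, Function.Injective (a i)) ∧
      (∀ i (g : Module.End Q (U i)), g ∈ (a i).range ↔
        (∀ (b : L) (x y : U i), (y : N.V) = b • (x : N.V) → (g y : N.V) = b • (g x : N.V)) ∧
        ∀ x y : U i, (y : N.V) = N.φ x → (g y : N.V) = N.φ (g x)) ∧
      ∀ (f : N.commutant) (q : Q), LinearMap.det (1 + q • (f.1 - 1)) =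
        ∏ i, LinearMap.det (1 + q • (a i (e f i) - 1)) := by
  -- The elements s i 1 are the orthogonal central idempotents of the decomposition; their images U
  -- i are the summands of V.
  let s : ∀ i, B i → N.commutant := fun i b => e.symm (Pi.single i b)
  have hs_mul : ∀ i b b', s i (b * b') = s i b * s i b' := fun i b b' => by
    rw [← map_mul, ← Pi.single_mul]
  have hs_add : ∀ i b b', s i (b + b') = s i b + s i b' := fun i b b' => by
    rw [← map_add, ← Pi.single_add]
  have hs_smul : ∀ i (q : Q) b, s i (q • b) = q • s i b := fun i q b => by
    rw [← map_smul, ← Pi.single_smul]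
  have hs_zero : ∀ i, s i 0 = 0 := fun i => by
    simp only [s, Pi.single_zero, map_zero]
  have hs_ne : ∀ i j b b', i ≠ j → s i b * s j b' = 0 := fun i j b b' h => by
    rw [← map_mul]
    have : (Pi.single i b * Pi.single j b' : ∀ i, B i) = 0 := by
      ext k
      by_cases hk : k = i
      · subst hk; simp [Pi.single_eq_of_ne h]
      · simp [Pi.single_eq_of_ne hk]
    rw [this, map_zero]
  have hs_sum : ∀ f, ∑ i, s i (e f i) = f := fun f => by
    rw [← map_sum, Finset.univ_sum_single, AlgEquiv.symm_apply_apply]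
  have hs_left : ∀ i f, f * s i 1 = s i (e f i) := fun i f => by
    apply e.injective
    rw [map_mul, AlgEquiv.apply_symm_apply, AlgEquiv.apply_symm_apply]
    ext j
    by_cases h : j = i
    · subst h; simp
    · simp [Pi.single_eq_of_ne h]
  have hs_right : ∀ i f, s i 1 * f = s i (e f i) := fun i f => by
    apply e.injective
    rw [map_mul, AlgEquiv.apply_symm_apply, AlgEquiv.apply_symm_apply]
    ext j
    by_cases h : j = i
    · subst h; simp
    · simp [Pi.single_eq_of_ne h]
  have hmul : ∀ (f g : N.commutant) x, f.1 (g.1 x) = (f * g).1 x := fun _ _ _ => rfl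
  let U : ι → Submodule Q N.V := fun i => LinearMap.range (s i 1).1
  have hU : ∀ i (x : N.V), x ∈ U i ↔ (s i 1).1 x = x := by
    intro i x
    constructor
    · rintro ⟨y, rfl⟩
      rw [hmul, ← hs_mul, one_mul]
    · intro h; exact ⟨x, h⟩
  have hmap : ∀ i b x, (s i b).1 x ∈ U i := by
    intro i b x
    rw [hU, hmul, ← hs_mul, one_mul]
  let a : ∀ i, B i →ₐ[Q] Module.End Q (U i) := fun i => AlgHom.ofLinearMap
    { toFun := fun b => (s i b).1.restrict fun x _ => hmap i b x
      map_add' := fun b b' => by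
        ext x; change (s i (b + b')).1 x = (s i b).1 x + (s i b').1 x; rw [hs_add]; rfl
      map_smul' := fun q b => by
        ext x; change (s i (q • b)).1 x = q • (s i b).1 x; rw [hs_smul]; rfl }
    (by ext x; exact (hU i x).1 x.2)
    (fun b b' => by
      ext x; change (s i (b * b')).1 x = (s i b).1 ((s i b').1 x); rw [hs_mul]; rfl)
  have ha : ∀ i b (x : U i), (a i b x : N.V) = (s i b).1 x := fun i b x => rfl
  refine ⟨U, a, fun i b x hx => ?_, fun i x hx => ?_, fun i b b' h => ?_, fun i g => ?_,
    fun f q => ?_⟩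
  · rw [hU, (s i 1).2.1, (hU i x).1 hx]
  · rw [hU, (s i 1).2.2, (hU i x).1 hx]
  · have : s i b = s i b' := by
      refine Subtype.ext (LinearMap.ext fun x => ?_)
      have := congrArg Subtype.val (LinearMap.congr_fun h ⟨(s i 1).1 x, hmap i 1 x⟩)
      rw [ha, ha] at this
      change (s i b).1 ((s i 1).1 x) = (s i b').1 ((s i 1).1 x) at this
      rwa [hmul, hmul, ← hs_mul, ← hs_mul, mul_one, mul_one] at this
    exact Pi.single_injective i (e.symm.injective this)
  · constructor
    · rintro ⟨b, rfl⟩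
      refine ⟨fun c x y h => ?_, fun x y h => ?_⟩
      · change (s i b).1 y = c • (s i b).1 x
        rw [h, (s i b).2.1]
      · change (s i b).1 y = N.φ ((s i b).1 x)
        rw [h, (s i b).2.2]
    · rintro ⟨h1, h2⟩
      -- An endomorphism of U i commuting with L and φ is extended by zero on the other summands,
      -- which gives an element of the commutant.
      let g' : N.commutant := ⟨(U i).subtype ∘ₗ g ∘ₗ
        (s i 1).1.codRestrict (U i) (hmap i 1), fun c x => h1 _ _ _ ((s i 1).2.1 c x),
        fun x => h2 _ _ ((s i 1).2.2 x)⟩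
      refine ⟨e g' i, LinearMap.ext fun x => Subtype.ext ?_⟩
      change (s i (e g' i)).1 x = g x
      rw [← hs_left, ← hmul, (hU i x).1 x.2]
      change ((g _ : U i) : N.V) = _
      congr 2
      exact Subtype.ext ((hU i x).1 x.2)
  · let Θ : N.V ≃ₗ[Q] ∀ i, U i := LinearEquiv.ofLinearMap
      (LinearMap.pi fun i => (s i 1).1.codRestrict (U i) (hmap i 1))
      (∑ i, (U i).subtype ∘ₗ LinearMap.proj i)
      (by
        refine LinearMap.ext fun u => funext fun i => Subtype.ext ?_
        change (s i 1).1 ((∑ j, (U j).subtype ∘ₗ LinearMap.proj j) u) = u i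
        rw [LinearMap.sum_apply, map_sum, Finset.sum_eq_single i]
        · exact (hU i _).1 (u i).2
        · intro j _ hj
          change (s i 1).1 (u j : N.V) = 0
          rw [← (hU j _).1 (u j).2, hmul, hs_ne i j _ _ hj.symm]
          rfl
        · simp)
      (by
        refine LinearMap.ext fun x => ?_
        change (∑ j, (U j).subtype ∘ₗ LinearMap.proj j) _ = x
        rw [LinearMap.sum_apply]
        have h1 := congrArg Subtype.val (hs_sum 1)
        rw [AddSubmonoidClass.coe_finsetSum] at h1
        have h2 := LinearMap.congr_fun h1 x
        rw [LinearMap.sum_apply] at h2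
        refine Eq.trans (Finset.sum_congr rfl fun i _ => ?_) h2
        rw [map_one]; rfl)
    rw [← LinearMap.det_conj (1 + q • (f.1 - 1)) Θ, ← det_pi_map]
    congr 1
    refine LinearMap.ext fun u => funext fun i => Subtype.ext ?_
    obtain ⟨x, rfl⟩ := Θ.surjective u
    change (s i 1).1 ((1 + q • (f.1 - 1)) (Θ.symm (Θ x))) =
      (s i 1).1 x + q • ((s i (e f i)).1 ((s i 1).1 x) - (s i 1).1 x)
    rw [LinearEquiv.symm_apply_apply, hmul (s i (e f i)), ← hs_mul, mul_one, ← hs_right, ← hmul]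
    simp

variable {N}

open Polynomial in
/-- For a decomposition of the commutant into central simple algebras, the product of the norms of
the reduced norms of the components is the determinant over `Q ⊗ L`. -/
theorem exists_reduced_components [Finite L] [Infinite Q] (hφ : Function.Injective N.φ) {m : ℕ}
    {F B : Fin m → Type u} [∀ i, Field (F i)] [∀ i, Algebra Q (F i)]
    [∀ i, FiniteDimensional Q (F i)] [∀ i, Ring (B i)] [∀ i, Algebra (F i) (B i)]
    [∀ i, Algebra Q (B i)] [∀ i, IsScalarTower Q (F i) (B i)] [∀ i, FiniteDimensional (F i) (B i)]
    [∀ i, Algebra.IsCentral (F i) (B i)] [∀ i, IsSimpleRing (B i)]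
    (e : N.commutant ≃ₐ[Q] ∀ i, B i) (f : N.commutant) {p : Q[X]} (hp0 : p.eval 0 = 1)
    (hp : ∀ q, p.eval q ^ Module.finrank Fq L = LinearMap.det (1 + q • (f.1 - 1))) :
    ∃ y : ∀ i, F i, p.eval 1 = ∏ i, Algebra.norm Q (y i) ∧
      ∀ i, (∀ (K : Type u) [Field K] [Algebra (F i) K] (n : ℕ)
        (α : K ⊗[F i] B i ≃ₐ[K] Matrix (Fin n) (Fin n) K),
        algebraMap (F i) K (y i) = (α (1 ⊗ₜ (e f i))).det) ∧
      ∃ (K : Type u) (_ : Field K) (_ : Algebra (F i) K) (n : ℕ),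
        Nonempty (K ⊗[F i] B i ≃ₐ[K] Matrix (Fin n) (Fin n) K) := by
  have : Module.Finite Fq L := Module.Finite.of_finite
  obtain ⟨U, a, hUL, hUφ, ha, hrange, hdet⟩ := N.exists_factor_action e
  let ρ : ∀ i, L →+* Module.End Q (U i) := fun i =>
    { toFun := fun b =>
        { toFun := fun x => ⟨b • x.1, hUL i b x.1 x.2⟩
          map_add' := fun x y => Subtype.ext (smul_add _ _ _)
          map_smul' := fun q x => Subtype.ext (smul_comm b q x.1) }
      map_one' := by ext x; exact one_smul L x.1
      map_mul' := fun b b' => by ext x; exact mul_smul b b' x.1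
      map_zero' := by ext x; exact zero_smul L x.1
      map_add' := fun b b' => by ext x; exact add_smul b b' x.1 }
  let φ : ∀ i, Module.End Q (U i) := fun i => N.φ.restrict (hUφ i)
  have key := fun i => exists_normPoly_restrict (Fq := Fq) (F := F i) (ρ i)
    (fun c => by
      ext x
      change algebraMap Fq L c • (x : N.V) = algebraMap Fq Q c • (x : N.V)
      rw [algebraMap_smul, algebraMap_smul]) (φ i)
    (fun b x => Subtype.ext (by
      change N.φ (b • x.1) = (FiniteField.frobeniusAlgEquivOfAlgebraic Fq L b) • N.φ x.1
      rw [N.φ_smul]; rfl))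
    (fun x y h => Subtype.ext (hφ (congrArg Subtype.val h))) (a i) (ha i)
    (fun g => (hrange i g).trans
      ⟨fun h => ⟨fun b x => Subtype.ext (h.1 b x _ rfl), fun x => Subtype.ext (h.2 x _ rfl)⟩,
       fun h => ⟨fun b x y hy => by
          rw [show y = ρ i b x from Subtype.ext hy, h.1]; rfl, fun x y hy => by
          rw [show y = φ i x from Subtype.ext hy, h.2]; rfl⟩⟩) (e f i)
  choose y R hR0 hRe hR1 hα hK using key
  refine ⟨y, ?_, fun i => ⟨hα i, hK i⟩⟩
  -- Both sides have value 1 at 0, and their e-th powers agree on Q because determinants multiply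
  -- over the summands.
  have hpR : p = ∏ i, R i := by
    refine poly_eq_of_pow_eval_eq (Module.finrank_pos (R := Fq) (M := L)).ne' hp0 ?_
      (Set.infinite_univ (α := Q)) fun q _ => ?_
    · rw [Polynomial.eval_prod]; exact Finset.prod_eq_one fun i _ => hR0 i
    · rw [hp, hdet, Polynomial.eval_prod, ← Finset.prod_pow]
      exact Finset.prod_congr rfl fun i _ => (hRe i q).symm
  rw [hpR, Polynomial.eval_prod]
  exact Finset.prod_congr rfl fun i _ => hR1 i

theorem isReducedNorm_congr {E E' : Type u} [Ring E] [Algebra Q E] [Ring E'] [Algebra Q E']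
    (e : E ≃ₐ[Q] E') (f : E) (x : Q) : IsReducedNorm Q E f x ↔ IsReducedNorm Q E' (e f) x := by
  have key : ∀ {E E' : Type u} [Ring E] [Algebra Q E] [Ring E'] [Algebra Q E']
      (e : E ≃ₐ[Q] E') (f : E), IsReducedNorm Q E f x → IsReducedNorm Q E' (e f) x := by
    rintro E E' _ _ _ _ e f ⟨D, y, h, hx⟩
    refine ⟨{ D with e := e.symm.trans D.e }, y, fun i => ?_, hx⟩
    rw [h]
    change _ = (D.α i (1 ⊗ₜ[D.F i] (D.e (e.symm (e f)) i))).det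
    rw [AlgEquiv.symm_apply_apply]
  refine ⟨key e f, fun h => ?_⟩
  have := key e.symm _ h
  rwa [AlgEquiv.symm_apply_apply] at this

/-- F is the centre of B, which is a field because B is simple. -/
theorem exists_center_field (Q B : Type u) [Field Q] [Ring B] [Algebra Q B] [FiniteDimensional Q B]
    [IsSimpleRing B] :
    ∃ (F : Type u) (_ : Field F) (_ : Algebra Q F) (_ : FiniteDimensional Q F)
      (_ : Algebra F B) (_ : IsScalarTower Q F B) (_ : FiniteDimensional F B),
      Algebra.IsCentral F B := by
  have key : ∀ (C : Type u) [CommRing C] [Algebra Q C] [FiniteDimensional Q C] [Algebra C B]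
      [IsScalarTower Q C B] (_ : IsField C) (_ : Algebra.IsCentral C B), ∃ (F : Type u)
      (_ : Field F) (_ : Algebra Q F) (_ : FiniteDimensional Q F) (_ : Algebra F B)
      (_ : IsScalarTower Q F B) (_ : FiniteDimensional F B), Algebra.IsCentral F B := by
    intro C _ hQC hfin hCB htower hC hcen
    exact ⟨C, hC.toField, hQC, hfin, hCB, htower, Module.Finite.of_restrictScalars_finite Q C B,
      hcen⟩
  let alg : Algebra (Subalgebra.center Q B) B :=
    (Subalgebra.center Q B).val.toRingHom.toAlgebra'
      fun c x => (Subalgebra.mem_center_iff.1 c.2 x).symm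
  refine @key (Subalgebra.center Q B) inferInstance inferInstance inferInstance alg
    ⟨fun q c x => ?_⟩ (IsSimpleRing.isField_center B)
    (@Algebra.IsCentral.mk _ _ _ _ alg fun x hx => ?_)
  · change (q • (c : B)) * x = q • ((c : B) * x)
    rw [smul_mul_assoc]
  · rw [Subalgebra.mem_center_iff] at hx
    exact ⟨⟨x, Subalgebra.mem_center_iff.2 hx⟩, rfl⟩

/-- A semisimple finite dimensional algebra is a product of central simple algebras. -/
theorem exists_central_decomposition (Q E : Type u) [Field Q] [Ring E] [Algebra Q E]
    [FiniteDimensional Q E] [IsSemisimpleRing E] :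
    ∃ (m : ℕ) (F B : Fin m → Type u) (_ : ∀ i, Field (F i)) (_ : ∀ i, Algebra Q (F i))
      (_ : ∀ i, FiniteDimensional Q (F i)) (_ : ∀ i, Ring (B i)) (_ : ∀ i, Algebra (F i) (B i))
      (_ : ∀ i, Algebra Q (B i)) (_ : ∀ i, IsScalarTower Q (F i) (B i))
      (_ : ∀ i, FiniteDimensional (F i) (B i)) (_ : ∀ i, Algebra.IsCentral (F i) (B i))
      (_ : ∀ i, IsSimpleRing (B i)), Nonempty (E ≃ₐ[Q] ∀ i, B i) := by
  obtain ⟨m, D, d, _, _, _, hd, ⟨e⟩⟩ :=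
    IsSemisimpleRing.exists_algEquiv_pi_matrix_divisionRing_finite Q E
  have hsimple : ∀ i, IsSimpleRing (Matrix (Fin (d i)) (Fin (d i)) (D i)) := fun i => by
    have := hd i
    infer_instance
  have := fun i => exists_center_field Q (Matrix (Fin (d i)) (Fin (d i)) (D i))
  choose F h1 h2 h3 h4 h5 h6 h7 using this
  exact ⟨m, F, _, h1, h2, h3, inferInstance, h4, inferInstance, h5, h6, h7, hsimple, ⟨e⟩⟩

/-- The reduced norm on a semisimple commutant is the determinant over `Q ⊗ L`. -/
theorem isReducedNorm_iff {A : Type u} [CommRing A] [Algebra A Q] (P : PlaceAtInfty Fq A Q)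
    [Finite L] (hφ : Function.Injective N.φ) [IsSemisimpleRing N.commutant]
    {d : Module.End Q N.V → Q}
    (hd : ∀ f ∈ N.commutant, LinearMap.det f = d f ^ Module.finrank Fq L) (hd1 : d 1 = 1)
    (hdp : ∀ f ∈ N.commutant, ∃ p : Polynomial Q, ∀ q, p.eval q = d (1 + q • (f - 1)))
    (f : N.commutant) (x : Q) : IsReducedNorm Q N.commutant f x ↔ x = d f.1 := by
  have : Infinite Q := P.infinite
  obtain ⟨p, hp⟩ := hdp f.1 f.2
  have hp0 : p.eval 0 = 1 := by rw [hp, zero_smul, add_zero, hd1]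
  have hp1 : p.eval 1 = d f.1 := by rw [hp, one_smul, add_sub_cancel]
  have hpe : ∀ q, p.eval q ^ Module.finrank Fq L = LinearMap.det (1 + q • (f.1 - 1)) := by
    intro q
    rw [hp, ← hd]
    exact N.commutant.add_mem N.commutant.one_mem
      (N.commutant.smul_mem (N.commutant.sub_mem f.2 N.commutant.one_mem) q)
  constructor
  · rintro ⟨D, y, hy, rfl⟩
    obtain ⟨y', hy', h⟩ := exists_reduced_components (F := D.F) hφ D.e f hp0 hpe
    rw [← hp1, hy']
    refine Finset.prod_congr rfl fun i _ => ?_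
    congr 1
    apply (algebraMap (D.F i) (D.K i)).injective
    rw [hy, (h i).1]
  · rintro rfl
    obtain ⟨m, F, B, _, _, _, _, _, _, _, _, _, _, ⟨e⟩⟩ := exists_central_decomposition Q N.commutant
    obtain ⟨y, hy, h⟩ := exists_reduced_components (F := F) hφ e f hp0 hpe
    choose h1 K _ _ n hα using h
    exact ⟨{ m := m, F := F, B := B, K := K, n := n, e := e, α := fun i => (hα i).some }, y,
      fun i => h1 i _ _ _, by rw [← hp1, hy]⟩

end FrobSpace

/-! ### Trace-compatible normal bases in the separable closure of L -/

theorem exists_inverse_sequence {α : Type u} (S : ℕ → Set α) (hfin : ∀ n, (S n).Finite)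
    (hne : ∀ n, (S n).Nonempty) (f : ℕ → α → α) (hf : ∀ n, ∀ x ∈ S (n + 1), f n x ∈ S n) :
    ∃ x : ℕ → α, (∀ n, x n ∈ S n) ∧ ∀ n, f n (x (n + 1)) = x n := by
  let F : CategoryTheory.Functor ℕᵒᵖ (Type u) := CategoryTheory.Functor.ofOpSequence (X := fun n => S n)
    (fun n => TypeCat.ofHom fun x => ⟨f n x.1, hf n x.1 x.2⟩)
  have h1 : ∀ j : ℕᵒᵖ, Finite (F.obj j) := fun j => (hfin j.unop).to_subtype
  have h2 : ∀ j : ℕᵒᵖ, Nonempty (F.obj j) := fun j => (hne j.unop).to_subtype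
  obtain ⟨u, hu⟩ := nonempty_sections_of_finite_inverse_system F
  refine ⟨fun n => (u (Opposite.op n) : S n).1, fun n => (u (Opposite.op n) : S n).2, fun n => ?_⟩
  have := hu (CategoryTheory.homOfLE (Nat.le_add_right n 1)).op
  rw [CategoryTheory.Functor.ofOpSequence_map_homOfLE_succ] at this
  exact congrArg Subtype.val this

section NormalGenerators

variable (L : Type u) [Field L] [Finite L]

/-- The Frobenius of `L^sep` over `L`, as an `L`-linear map. -/
noncomputable def sepFrobL : Module.End L (SeparableClosure L) :=
  letI := Fintype.ofFinite L
  (FiniteField.frobeniusAlgHom L (SeparableClosure L)).toLinearMap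

theorem sepFrobL_apply (y : SeparableClosure L) : sepFrobL L y = y ^ Nat.card L := by
  have := Fintype.ofFinite L
  rw [Nat.card_eq_fintype_card]
  simp only [sepFrobL, AlgHom.toLinearMap_apply, FiniteField.coe_frobeniusAlgHom]
  rw [Fintype.card_eq_nat_card, Fintype.card_eq_nat_card]

theorem sepFrobL_pow_apply (N : ℕ) (y : SeparableClosure L) :
    (sepFrobL L ^ N) y = y ^ Nat.card L ^ N := by
  induction N with
  | zero => simp
  | succ N ih => rw [pow_succ', Module.End.mul_apply, ih, sepFrobL_apply, ← pow_mul, ← pow_succ]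

/-- The generators of normal bases over `L` of the extension of degree `N`. -/
def normalGenerators (N : ℕ) : Set (SeparableClosure L) :=
  {θ | (sepFrobL L ^ N) θ = θ ∧ LinearIndependent L fun i : Fin N => (sepFrobL L ^ (i : ℕ)) θ}

open Polynomial in
theorem finite_fixed {N : ℕ} (hN : N ≠ 0) :
    {y : SeparableClosure L | (sepFrobL L ^ N) y = y}.Finite ∧
      {y : SeparableClosure L | (sepFrobL L ^ N) y = y}.ncard ≤ Nat.card L ^ N := by
  classical
  have h1 : 1 < Nat.card L ^ N := Nat.one_lt_pow hN Finite.one_lt_card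
  have hp : (X ^ Nat.card L ^ N - X : (SeparableClosure L)[X]) ≠ 0 :=
    FiniteField.X_pow_card_sub_X_ne_zero _ h1
  have hs : {y : SeparableClosure L | (sepFrobL L ^ N) y = y} ⊆
      ((X ^ Nat.card L ^ N - X : (SeparableClosure L)[X]).roots.toFinset : Set _) := by
    intro y hy
    have hy' : (sepFrobL L ^ N) y = y := hy
    rw [sepFrobL_pow_apply] at hy'
    simp [hp, hy']
  refine ⟨(Finset.finite_toSet _).subset hs, ?_⟩
  refine (Set.ncard_le_ncard hs (Finset.finite_toSet _)).trans ?_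
  rw [Set.ncard_coe_finset]
  refine (Multiset.toFinset_card_le _).trans ((Polynomial.card_roots' _).trans ?_)
  rw [FiniteField.X_pow_card_sub_X_natDegree_eq _ h1]

/-- The normal basis theorem for the extension of degree N, whose Galois group consists of the
powers of Frobenius, carried into the separable closure. -/
theorem normalGenerators_nonempty {N : ℕ} (hN : N ≠ 0) : (normalGenerators L N).Nonempty := by
  obtain ⟨p, hp⟩ := CharP.exists L
  have : Fact p.Prime := ⟨CharP.char_is_prime L p⟩
  have : NeZero N := ⟨hN⟩
  have := Fintype.ofFinite L
  let k := FiniteField.Extension L p N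
  let j : k →ₐ[L] SeparableClosure L := IsSepClosed.lift
  let θ₀ : k := IsGalois.normalBasis L k 1
  have hj : ∀ i, (sepFrobL L ^ i) (j θ₀) = j ((FiniteField.Extension.frob L p N ^ i) θ₀) := by
    intro i
    rw [sepFrobL_pow_apply, FiniteField.Extension.frob_iterate_apply, map_pow]
  have hinj : Function.Injective fun i : Fin N => FiniteField.Extension.frob L p N ^ (i : ℕ) := by
    intro i i' h
    have := (FiniteField.bijective_frobeniusAlgEquivOfAlgebraic_pow L k).1
      (a₁ := ⟨i, by rw [FiniteField.finrank_extension]; exact i.2⟩)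
      (a₂ := ⟨i', by rw [FiniteField.finrank_extension]; exact i'.2⟩) (by
        refine AlgEquiv.ext fun x => ?_
        have hx := AlgEquiv.congr_fun h x
        simp only [FiniteField.Extension.frob_iterate_apply] at hx
        simpa only [AlgEquiv.coe_pow, FiniteField.coe_frobeniusAlgEquivOfAlgebraic_iterate,
          Fintype.card_eq_nat_card] using hx)
    exact Fin.ext (by simpa using this)
  refine ⟨j θ₀, ?_, ?_⟩
  · rw [sepFrobL_pow_apply, ← map_pow]
    congr 1
    have := Fintype.ofFinite k
    rw [← FiniteField.natCard_extension L p N, Nat.card_eq_fintype_card]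
    exact FiniteField.pow_card θ₀
  · have h1 := (IsGalois.normalBasis L k).linearIndependent.comp _ hinj
    rw [Fintype.linearIndependent_iff] at h1 ⊢
    intro g hg
    refine h1 g ((map_eq_zero_iff j j.injective).1 ?_)
    rw [map_sum, ← hg]
    refine Finset.sum_congr rfl fun i _ => ?_
    rw [hj, Function.comp_apply, IsGalois.normalBasis_apply]
    exact map_smul j _ _

variable {L}

/-- The sum is the trace from degree N d to degree N. A linear relation between the first N
conjugates of the trace is a relation between the conjugates of θ with exponents i + N j, with
coefficients independent of j, hence trivial. -/
theorem trace_mem_normalGenerators {N d : ℕ} (hd : d ≠ 0) {θ : SeparableClosure L}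
    (hθ : θ ∈ normalGenerators L (N * d)) :
    ∑ j ∈ Finset.range d, (sepFrobL L ^ (N * j)) θ ∈ normalGenerators L N := by
  constructor
  · obtain ⟨d, rfl⟩ := Nat.exists_eq_succ_of_ne_zero hd
    rw [map_sum, Finset.sum_range_succ, Finset.sum_range_succ']
    congr 1
    · refine Finset.sum_congr rfl fun j _ => ?_
      rw [← Module.End.mul_apply, ← pow_add]
      congr 2; ring
    · rw [← Module.End.mul_apply, ← pow_add]
      have := hθ.1
      rw [Nat.mul_succ, add_comm] at this
      rw [this]; simp
  · rw [Fintype.linearIndependent_iff]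
    intro g hg i
    have hinj : Function.Injective fun x : Fin d × Fin N => finProdFinEquiv x :=
      finProdFinEquiv.injective
    have h1 := hθ.2
    have h2 : LinearIndependent L fun x : Fin d × Fin N =>
        (sepFrobL L ^ ((x.2 : ℕ) + N * x.1)) θ := by
      have := h1.comp (fun x : Fin d × Fin N => Fin.cast (mul_comm d N) (finProdFinEquiv x))
        (by intro x y h; exact finProdFinEquiv.injective (Fin.cast_injective _ h))
      exact this
    rw [Fintype.linearIndependent_iff] at h2
    refine h2 (fun x => g x.2) ?_ (⟨0, Nat.pos_of_ne_zero hd⟩, i)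
    rw [Fintype.sum_prod_type, Finset.sum_comm, ← hg]
    refine Finset.sum_congr rfl fun i _ => ?_
    change ∑ x : Fin d, g i • (sepFrobL L ^ ((i : ℕ) + N * x)) θ = _
    rw [← Finset.smul_sum, map_sum, Finset.sum_range]
    congr 1
    refine Finset.sum_congr rfl fun j _ => ?_
    rw [pow_add]; rfl

/-- Trace compatible normal bases. -/
theorem exists_normal_tower (N : ℕ → ℕ) (hN : ∀ n, N n ≠ 0) (hdvd : ∀ n, N n ∣ N (n + 1)) :
    ∃ θ : ℕ → SeparableClosure L, (∀ n, θ n ∈ normalGenerators L (N n)) ∧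
      ∀ n, ∑ j ∈ Finset.range (N (n + 1) / N n), (sepFrobL L ^ (N n * j)) (θ (n + 1)) = θ n :=
  exists_inverse_sequence (fun n => normalGenerators L (N n))
    (fun n => (finite_fixed L (hN n)).1.subset fun _ h => h.1)
    (fun n => normalGenerators_nonempty L (hN n))
    (fun n θ => ∑ j ∈ Finset.range (N (n + 1) / N n), (sepFrobL L ^ (N n * j)) θ)
    (fun n θ hθ => trace_mem_normalGenerators
      (Nat.div_pos (Nat.le_of_dvd (Nat.pos_of_ne_zero (hN _)) (hdvd n))
        (Nat.pos_of_ne_zero (hN n))).ne' (by rwa [Nat.mul_div_cancel' (hdvd n)]))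

/-- By counting: the fixed space of Frob^N has at most |L|^N elements and contains N independent
conjugates of θ. -/
theorem mem_span_normal {N : ℕ} (hN : N ≠ 0) {θ : SeparableClosure L}
    (hθ : θ ∈ normalGenerators L N) {y : SeparableClosure L} (hy : (sepFrobL L ^ N) y = y) :
    y ∈ Submodule.span L (Set.range fun i : Fin N => (sepFrobL L ^ (i : ℕ)) θ) := by
  let W : Submodule L (SeparableClosure L) := LinearMap.eqLocus (sepFrobL L ^ N) LinearMap.id
  obtain ⟨h1, h2⟩ := finite_fixed L hN
  have hWfin : Finite W := h1.to_subtype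
  have hle : Submodule.span L (Set.range fun i : Fin N => (sepFrobL L ^ (i : ℕ)) θ) ≤ W := by
    rw [Submodule.span_le]
    rintro _ ⟨i, rfl⟩
    change (sepFrobL L ^ N) ((sepFrobL L ^ (i : ℕ)) θ) = (sepFrobL L ^ (i : ℕ)) θ
    rw [← Module.End.mul_apply, ← pow_add, add_comm, pow_add, Module.End.mul_apply, hθ.1]
  have : Module.Finite L W := Module.Finite.of_finite
  have hfr : Module.finrank L W ≤ N := by
    have h3 : Nat.card W ≤ Nat.card L ^ N := h2
    rw [Module.natCard_eq_pow_finrank (K := L)] at h3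
    exact (Nat.pow_le_pow_iff_right Finite.one_lt_card).1 h3
  rw [Submodule.eq_of_le_of_finrank_le hle
    (by rw [finrank_span_eq_card hθ.2, Fintype.card_fin]; exact hfr)]
  exact hy

/-- A left inverse up to the span of a normal basis. -/
theorem exists_normal_projection {N : ℕ} (hN : N ≠ 0) {θ : SeparableClosure L}
    (hθ : θ ∈ normalGenerators L N) :
    ∃ (s : Fin N → SeparableClosure L →ₗ[L] L) (p : Module.End L (SeparableClosure L)),
      (∀ i j : Fin N, s i ((sepFrobL L ^ (j : ℕ)) θ) = if i = j then 1 else 0) ∧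
      ∀ y, y = p ((sepFrobL L ^ N) y - y) + ∑ i, s i y • (sepFrobL L ^ (i : ℕ)) θ := by
  obtain ⟨S, hS⟩ := LinearMap.exists_leftInverse_of_injective
    (Finsupp.linearCombination L fun i : Fin N => (sepFrobL L ^ (i : ℕ)) θ)
    (LinearMap.ker_eq_bot.2 hθ.2)
  -- W is the fixed space of Frob^N. The map q inverts Frob^N - 1 modulo W, and r is induced by 1 -
  -- E, where E projects onto the span of the conjugates of θ and is the identity on W. So y - E y
  -- depends only on Frob^N y - y.
  let W : Submodule L (SeparableClosure L) := LinearMap.ker (sepFrobL L ^ N - LinearMap.id)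
  obtain ⟨q, hq⟩ := LinearMap.exists_leftInverse_of_injective
    (W.liftQ (sepFrobL L ^ N - LinearMap.id) le_rfl)
    (by rw [Submodule.ker_liftQ_eq_bot]; exact le_rfl)
  let E : Module.End L (SeparableClosure L) :=
    Finsupp.linearCombination L (fun i : Fin N => (sepFrobL L ^ (i : ℕ)) θ) ∘ₗ S
  have hE : ∀ y ∈ W, E y = y := by
    intro y hy
    have hy' : (sepFrobL L ^ N) y = y := sub_eq_zero.1 hy
    have := mem_span_normal hN hθ hy'
    rw [Finsupp.mem_span_range_iff_exists_finsupp] at this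
    obtain ⟨c, rfl⟩ := this
    have h2 := LinearMap.congr_fun hS c
    change Finsupp.linearCombination L _ (S (Finsupp.linearCombination L _ c)) = _
    have h3 : S (Finsupp.linearCombination L (fun i : Fin N => (sepFrobL L ^ (i : ℕ)) θ) c) = c := h2
    rw [h3]; rfl
  let r : SeparableClosure L ⧸ W →ₗ[L] SeparableClosure L :=
    W.liftQ (LinearMap.id - E) (fun y hy => by
      rw [LinearMap.mem_ker, LinearMap.sub_apply, hE y hy]; simp)
  refine ⟨fun i => Finsupp.lapply i ∘ₗ S, r ∘ₗ q, fun i j => ?_, fun y => ?_⟩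
  · have h2 := LinearMap.congr_fun hS (Finsupp.single j 1)
    simp only [LinearMap.comp_apply, Finsupp.linearCombination_single, one_smul,
      LinearMap.id_apply] at h2
    rw [LinearMap.comp_apply, h2, Finsupp.lapply_apply, Finsupp.single_apply]
    simp [eq_comm]
  · have h1 : q ((sepFrobL L ^ N) y - y) = W.mkQ y := by
      have := LinearMap.congr_fun hq (W.mkQ y)
      simpa using this
    rw [LinearMap.comp_apply, h1]
    have h2 : r (W.mkQ y) = y - E y := by simp [r]
    rw [h2]
    have h3 : E y = ∑ i, (Finsupp.lapply i ∘ₗ S) y • (sepFrobL L ^ (i : ℕ)) θ := by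
      change Finsupp.linearCombination L _ (S y) = _
      rw [Finsupp.linearCombination_apply, Finsupp.sum_fintype _ _ (by simp)]
      rfl
    rw [← h3]; abel

end NormalGenerators

/-! ### Galois descent from the e-th power of a semilinear map -/

section Descent

variable {Fq L : Type u} [Field Fq] [Fintype Fq] [Field L] [Finite L] [Algebra Fq L]
  {S Y : Type u} [CommRing S] [AddCommGroup Y] [Module S Y]

/-- Galois descent for a semilinear map `γ`: the fixed points of `γ ^ e` are `e` copies of the fixed
points of `γ`. -/
theorem exists_descent_equiv (ρ : L →+* Module.End S Y) (γ : Module.End S Y)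
    (hγ : ∀ b y, γ (ρ b y) = ρ (b ^ Fintype.card Fq) (γ y)) :
    ∃ Ψ : (Fin (Module.finrank Fq L) → LinearMap.eqLocus γ LinearMap.id) ≃ₗ[S]
        LinearMap.eqLocus (γ ^ Module.finrank Fq L) LinearMap.id,
      ∃ b : Fin (Module.finrank Fq L) → L, ∀ t, (Ψ t : Y) = ∑ j, ρ (b j) (t j) := by
  have : Module.Finite Fq L := Module.Finite.of_finite
  have hiter : ∀ (i : ℕ) b y, (γ ^ i) (ρ b y) = ρ (b ^ Fintype.card Fq ^ i) ((γ ^ i) y) := by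
    intro i
    induction i with
    | zero => simp
    | succ i ih =>
      intro b y
      rw [pow_succ', Module.End.mul_apply, ih, hγ, ← pow_mul, ← pow_succ, Module.End.mul_apply]
  have hcard : ∀ b : L, b ^ Fintype.card Fq ^ Module.finrank Fq L = b := by
    intro b
    have := Fintype.ofFinite L
    rw [← Nat.card_eq_fintype_card, ← Module.natCard_eq_pow_finrank, Nat.card_eq_fintype_card]
    exact FiniteField.pow_card b
  let b : Module.Basis (Fin (Module.finrank Fq L)) Fq L := Module.finBasis Fq L
  let b' := b.traceDual
  -- Trace duality says that the matrices of Frobenius conjugates of b' and b are inverse to each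
  -- other. In this order the product is the trace pairing; in the opposite order it is `h2`.
  have h1 : ∀ j k, ∑ i : Fin (Module.finrank Fq L),
      (b' k) ^ Fintype.card Fq ^ (i : ℕ) * (b j) ^ Fintype.card Fq ^ (i : ℕ) =
        if j = k then 1 else 0 := by
    intro j k
    have h := FiniteField.algebraMap_trace_eq_sum_pow Fq L (b j * b' k)
    have h2 : Algebra.trace Fq L (b j * b' k) = if j = k then 1 else 0 :=
      b.trace_mul_traceDual j k
    rw [h2, Finset.sum_range] at h
    rw [← Fintype.card_eq_nat_card] at h
    simp only [mul_pow] at h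
    rw [← map_one (algebraMap Fq L), ← map_zero (algebraMap Fq L), ← apply_ite, h]
    exact Finset.sum_congr rfl fun i _ => mul_comm _ _
  have h2 : ∀ i i' : Fin (Module.finrank Fq L), ∑ k,
      (b k) ^ Fintype.card Fq ^ (i : ℕ) * (b' k) ^ Fintype.card Fq ^ (i' : ℕ) =
        if i = i' then 1 else 0 := by
    let A1 : Matrix (Fin (Module.finrank Fq L)) (Fin (Module.finrank Fq L)) L :=
      fun k i => (b' k) ^ Fintype.card Fq ^ (i : ℕ)
    let A2 : Matrix (Fin (Module.finrank Fq L)) (Fin (Module.finrank Fq L)) L :=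
      fun i j => (b j) ^ Fintype.card Fq ^ (i : ℕ)
    have hA : A1 * A2 = 1 := by
      ext k j
      rw [Matrix.mul_apply, Matrix.one_apply, h1]
      simp [eq_comm]
    have hA' := mul_eq_one_comm.1 hA
    intro i i'
    have := congrFun (congrFun hA' i) i'
    rw [Matrix.mul_apply, Matrix.one_apply] at this
    exact this
  have hpos : 0 < Module.finrank Fq L := Module.finrank_pos
  have hU : ∀ t : Fin (Module.finrank Fq L) → LinearMap.eqLocus γ LinearMap.id,
      ∑ j, ρ (b j) (t j) ∈ LinearMap.eqLocus (γ ^ Module.finrank Fq L) LinearMap.id := by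
    intro t
    refine Submodule.sum_mem _ fun j _ => ?_
    change (γ ^ Module.finrank Fq L) (ρ (b j) (t j)) = ρ (b j) (t j)
    have htj : ∀ i : ℕ, (γ ^ i) (t j : Y) = t j := by
      intro i
      induction i with
      | zero => simp
      | succ i ih =>
        rw [pow_succ, Module.End.mul_apply]
        have : γ (t j) = (t j : Y) := (t j).2
        rw [this, ih]
    rw [hiter, hcard, htj]
  have hV : ∀ u ∈ LinearMap.eqLocus (γ ^ Module.finrank Fq L) LinearMap.id, ∀ k,
      ∑ i : Fin (Module.finrank Fq L), (γ ^ (i : ℕ)) (ρ (b' k) u) ∈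
        LinearMap.eqLocus γ LinearMap.id := by
    intro u hu k
    change γ _ = _
    rw [LinearMap.id_apply, map_sum, ← Finset.sum_range (fun i => γ ((γ ^ i) (ρ (b' k) u))),
      ← Finset.sum_range (fun i => (γ ^ i) (ρ (b' k) u))]
    obtain ⟨m, hm⟩ := Nat.exists_eq_succ_of_ne_zero hpos.ne'
    have hu' : (γ ^ Module.finrank Fq L) (ρ (b' k) u) = ρ (b' k) u := by
      rw [hiter, hcard]; congr 1
    generalize ρ (b' k) u = w at hu' ⊢
    rw [hm] at hu' ⊢
    rw [Finset.sum_range_succ, Finset.sum_range_succ']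
    congr 1
    · refine Finset.sum_congr rfl fun i _ => ?_
      rw [pow_succ', Module.End.mul_apply]
    · rw [← Module.End.mul_apply, ← pow_succ']
      exact hu'
  -- The inverse sends u to the family of its twisted traces ∑ γ^i (b'_k u).
  refine ⟨LinearEquiv.ofLinearMap
    ((∑ j, (ρ (b j)) ∘ₗ Submodule.subtype _ ∘ₗ LinearMap.proj j).codRestrict _ fun t => by
      rw [LinearMap.sum_apply]; exact hU t)
    (LinearMap.pi fun k => ((∑ i : Fin (Module.finrank Fq L), (γ ^ (i : ℕ)) * ρ (b' k)).comp
      (Submodule.subtype _)).codRestrict _ fun u => by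
        rw [LinearMap.comp_apply, LinearMap.sum_apply]; exact hV u.1 u.2 k) ?_ ?_, b, fun t => ?_⟩
  · refine LinearMap.ext fun u => Subtype.ext ?_
    change (∑ j, (ρ (b j)) ∘ₗ Submodule.subtype _ ∘ₗ LinearMap.proj j) _ = (u : Y)
    rw [LinearMap.sum_apply]
    have : ∀ j, ρ (b j) ((∑ i : Fin (Module.finrank Fq L), (γ ^ (i : ℕ)) * ρ (b' j)) (u : Y)) =
        ∑ i : Fin (Module.finrank Fq L),
          ρ ((b j) ^ Fintype.card Fq ^ 0 * (b' j) ^ Fintype.card Fq ^ (i : ℕ))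
            ((γ ^ (i : ℕ)) (u : Y)) := by
      intro j
      rw [LinearMap.sum_apply, map_sum]
      refine Finset.sum_congr rfl fun i _ => ?_
      rw [Module.End.mul_apply, hiter, pow_zero, pow_one, map_mul, Module.End.mul_apply]
    refine (Finset.sum_congr rfl fun j _ => this j).trans ?_
    rw [Finset.sum_comm]
    have h3 : ∀ i : Fin (Module.finrank Fq L), ∑ j,
        ρ ((b j) ^ Fintype.card Fq ^ 0 * (b' j) ^ Fintype.card Fq ^ (i : ℕ)) ((γ ^ (i : ℕ)) (u : Y))
        = if ⟨0, hpos⟩ = i then (u : Y) else 0 := by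
      intro i
      rw [← LinearMap.sum_apply, ← map_sum, h2 ⟨0, hpos⟩ i]
      split_ifs with h
      · subst h; simp
      · simp
    rw [Finset.sum_congr rfl fun i _ => h3 i]
    simp
  · refine LinearMap.ext fun t => funext fun k => Subtype.ext ?_
    change (∑ i : Fin (Module.finrank Fq L), (γ ^ (i : ℕ)) * ρ (b' k))
      ((∑ j, (ρ (b j)) ∘ₗ Submodule.subtype _ ∘ₗ LinearMap.proj j) t) = t k
    rw [LinearMap.sum_apply, LinearMap.sum_apply]
    have htj : ∀ (i : ℕ) j, (γ ^ i) (t j : Y) = t j := by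
      intro i j
      induction i with
      | zero => simp
      | succ i ih =>
        rw [pow_succ, Module.End.mul_apply]
        have : γ (t j) = (t j : Y) := (t j).2
        rw [this, ih]
    have h3 : ∀ i : Fin (Module.finrank Fq L), ((γ ^ (i : ℕ)) * ρ (b' k))
        (∑ j, (ρ (b j) ∘ₗ Submodule.subtype _ ∘ₗ LinearMap.proj j) t) =
        ∑ j, ρ ((b' k) ^ Fintype.card Fq ^ (i : ℕ) * (b j) ^ Fintype.card Fq ^ (i : ℕ)) (t j) := by
      intro i
      rw [map_sum]
      refine Finset.sum_congr rfl fun j _ => ?_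
      change (γ ^ (i : ℕ)) (ρ (b' k) (ρ (b j) (t j))) = _
      rw [hiter, hiter, htj, map_mul, Module.End.mul_apply]
    rw [Finset.sum_congr rfl fun i _ => h3 i, Finset.sum_comm]
    have h4 : ∀ j, ∑ i : Fin (Module.finrank Fq L),
        ρ ((b' k) ^ Fintype.card Fq ^ (i : ℕ) * (b j) ^ Fintype.card Fq ^ (i : ℕ)) (t j : Y) =
        if j = k then (t j : Y) else 0 := by
      intro j
      rw [← LinearMap.sum_apply, ← map_sum, h1]
      split_ifs with h <;> simp
    rw [Finset.sum_congr rfl fun j _ => h4 j]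
    simp
  · change (∑ j, (ρ (b j)) ∘ₗ Submodule.subtype _ ∘ₗ LinearMap.proj j) t = _
    rw [LinearMap.sum_apply]; rfl

end Descent

/-! ### Maps of completions given level by level -/

section MapSeq

variable {R M N : Type u} [CommRing R] [AddCommGroup M] [Module R M] [AddCommGroup N] [Module R N]
  (I : Ideal R)

theorem mem_smul_top_of_map (J : Ideal R) (f : M →ₗ[R] N) {x : M}
    (hx : x ∈ (J • ⊤ : Submodule R M)) : f x ∈ (J • ⊤ : Submodule R N) :=
  Submodule.smul_top_le_comap_smul_top J f hx

/-- The map on completions induced by a sequence of linear maps which is compatible modulo the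
powers of `I`. -/
noncomputable def mapSeq (f : ℕ → M →ₗ[R] N)
    (hf : ∀ m n, m ≤ n → ∀ x, f n x - f m x ∈ (I ^ m • ⊤ : Submodule R N)) :
    AdicCompletion I M →ₗ[AdicCompletion I R] AdicCompletion I N where
  __ := AdicCompletion.lift I
    (fun n ↦ LinearMap.reduceModIdeal (I ^ n) (f n) ∘ₗ AdicCompletion.eval I M n)
    (fun {m n} hmn ↦ by
      refine LinearMap.ext fun x => ?_
      obtain ⟨y, hy⟩ := Submodule.Quotient.mk_surjective _ (x.val n)
      have h1 := AdicCompletion.transitionMap_comp_eval_apply I M hmn x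
      simp only [← hy] at h1
      simp only [LinearMap.comp_apply, AdicCompletion.eval_apply, ← hy]
      rw [← h1]
      exact (Submodule.Quotient.eq _).2 (hf m n hmn y))
  map_smul' r x := by
    refine AdicCompletion.ext fun n => ?_
    change LinearMap.reduceModIdeal (I ^ n) (f n) ((r • x).val n) =
      r.val n • LinearMap.reduceModIdeal (I ^ n) (f n) (x.val n)
    obtain ⟨a, ha⟩ := Submodule.Quotient.mk_surjective _ (r.val n)
    obtain ⟨y, hy⟩ := Submodule.Quotient.mk_surjective _ (x.val n)
    have h1 : (r • x).val n = r.val n • x.val n := rfl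
    rw [h1, ← ha, ← hy]
    exact congrArg (Submodule.Quotient.mk (p := (I ^ n • ⊤ : Submodule R N))) (map_smul (f n) a y)

theorem mapSeq_val (f : ℕ → M →ₗ[R] N)
    (hf : ∀ m n, m ≤ n → ∀ x, f n x - f m x ∈ (I ^ m • ⊤ : Submodule R N))
    (x : AdicCompletion I M) (n : ℕ) :
    (mapSeq I f hf x).val n = LinearMap.reduceModIdeal (I ^ n) (f n) (x.val n) := rfl

theorem mapSeq_comp_map (f : ℕ → M →ₗ[R] N)
    (hf : ∀ m n, m ≤ n → ∀ x, f n x - f m x ∈ (I ^ m • ⊤ : Submodule R N))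
    (g : M →ₗ[R] M) (h : N →ₗ[R] N) (hgh : ∀ n x, f n (g x) = h (f n x))
    (x : AdicCompletion I M) :
    mapSeq I f hf (AdicCompletion.map I g x) = AdicCompletion.map I h (mapSeq I f hf x) := by
  refine AdicCompletion.ext fun n => ?_
  rw [mapSeq_val, AdicCompletion.map_val_apply, AdicCompletion.map_val_apply, mapSeq_val]
  obtain ⟨y, hy⟩ := Submodule.Quotient.mk_surjective _ (x.val n)
  rw [← hy]
  exact congrArg _ (hgh n y)

theorem map_pow_eq (g : M →ₗ[R] M) (n : ℕ) :
    (AdicCompletion.map I g : Module.End (AdicCompletion I R) (AdicCompletion I M)) ^ n =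
      AdicCompletion.map I ((g : Module.End R M) ^ n : Module.End R M) := by
  induction n with
  | zero => rw [pow_zero, pow_zero]; exact (AdicCompletion.map_id I M).symm
  | succ n ih =>
    rw [pow_succ, pow_succ, ih]
    exact AdicCompletion.map_comp I g _

/-- A compatible sequence of maps is bijective onto a submodule of fixed points if this is so modulo
all powers of `I`. -/
theorem exists_equiv_eqLocus (f : ℕ → M →ₗ[R] N)
    (hf : ∀ m n, m ≤ n → ∀ x, f n x - f m x ∈ (I ^ m • ⊤ : Submodule R N)) (γ : N →ₗ[R] N)
    (h1 : ∀ n x, γ (f n x) - f n x ∈ (I ^ n • ⊤ : Submodule R N))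
    (h2 : ∀ n x, f n x ∈ (I ^ n • ⊤ : Submodule R N) → x ∈ (I ^ n • ⊤ : Submodule R M))
    (h3 : ∀ n y, γ y - y ∈ (I ^ n • ⊤ : Submodule R N) →
      ∃ x, y - f n x ∈ (I ^ n • ⊤ : Submodule R N)) :
    ∃ Ψ : AdicCompletion I M ≃ₗ[AdicCompletion I R]
        LinearMap.eqLocus (AdicCompletion.map I γ) LinearMap.id,
      ∀ x, (Ψ x : AdicCompletion I N) = mapSeq I f hf x := by
  have hmem : ∀ x, mapSeq I f hf x ∈ LinearMap.eqLocus (AdicCompletion.map I γ) LinearMap.id := by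
    intro x
    change AdicCompletion.map I γ _ = _
    refine AdicCompletion.ext fun n => ?_
    rw [AdicCompletion.map_val_apply, LinearMap.id_apply, mapSeq_val]
    obtain ⟨y, hy⟩ := Submodule.Quotient.mk_surjective _ (x.val n)
    rw [← hy]
    exact (Submodule.Quotient.eq _).2 (h1 n y)
  have hinj : ∀ n (x x' : M), f n x - f n x' ∈ (I ^ n • ⊤ : Submodule R N) →
      x - x' ∈ (I ^ n • ⊤ : Submodule R M) := by
    intro n x x' h
    rw [← map_sub] at h
    exact h2 n _ h
  refine ⟨LinearEquiv.ofBijective ((mapSeq I f hf).codRestrict _ hmem) ⟨fun x x' h => ?_,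
    fun u => ?_⟩, fun x => rfl⟩
  · refine AdicCompletion.ext fun n => ?_
    have h := congrArg (fun t => (t : AdicCompletion I N).val n) (congrArg Subtype.val h)
    change (mapSeq I f hf x).val n = (mapSeq I f hf x').val n at h
    rw [mapSeq_val, mapSeq_val] at h
    obtain ⟨y, hy⟩ := Submodule.Quotient.mk_surjective _ (x.val n)
    obtain ⟨y', hy'⟩ := Submodule.Quotient.mk_surjective _ (x'.val n)
    rw [← hy, ← hy'] at h ⊢
    exact (Submodule.Quotient.eq _).2 (hinj n _ _ ((Submodule.Quotient.eq _).1 h))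
  · have key : ∀ n, ∃ x : M, LinearMap.reduceModIdeal (I ^ n) (f n) (Submodule.Quotient.mk x) =
        (u : AdicCompletion I N).val n := by
      intro n
      obtain ⟨y, hy⟩ := Submodule.Quotient.mk_surjective _ ((u : AdicCompletion I N).val n)
      have hu : AdicCompletion.map I γ u = (u : AdicCompletion I N) := u.2
      have hn := congrArg (fun t => t.val n) hu
      simp only [AdicCompletion.map_val_apply] at hn
      rw [← hy] at hn
      obtain ⟨x, hx⟩ := h3 n y ((Submodule.Quotient.eq _).1 hn)
      refine ⟨x, ?_⟩
      rw [← hy]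
      exact ((Submodule.Quotient.eq _).2 hx).symm
    choose x hx using key
    -- Injectivity modulo I^m forces the preimages chosen at the various levels to be compatible.
    have hcomp : ∀ m n, m ≤ n → x n - x m ∈ (I ^ m • ⊤ : Submodule R M) := by
      intro m n hmn
      apply hinj
      have e1 := AdicCompletion.transitionMap_comp_eval_apply I N hmn (u : AdicCompletion I N)
      rw [← hx, ← hx] at e1
      have e2 : f n (x n) - f m (x m) ∈ (I ^ m • ⊤ : Submodule R N) :=
        (Submodule.Quotient.eq _).1 e1
      have e3 := Submodule.sub_mem _ e2 (hf m n hmn (x n))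
      rw [sub_sub_sub_cancel_left] at e3
      have := Submodule.neg_mem _ e3
      rwa [neg_sub] at this
    refine ⟨⟨fun n => Submodule.Quotient.mk (x n), fun {m n} hmn =>
      (Submodule.Quotient.eq _).2 (hcomp m n hmn)⟩, Subtype.ext (AdicCompletion.ext fun n => hx n)⟩

end MapSeq

/-! ### The Tate module and the completion of M -/

section TensorSep

variable {Fq R L M : Type u} [Field Fq] [Fintype Fq] [CommRing R] [Field L] [Algebra Fq L]
  [AddCommGroup M] [Module R M] [Module L M] [SMulCommClass R L M]

/-- The map `M ⊗ L^sep → M` given by a linear form on `L^sep`. -/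
noncomputable def contr (s : SeparableClosure L →ₗ[L] L) : M ⊗[L] SeparableClosure L →ₗ[R] M where
  toFun x := TensorProduct.rid L M (s.lTensor M x)
  map_add' x y := by rw [map_add, map_add]
  map_smul' a x := by
    induction x with
    | zero => simp
    | add x y hx hy => simp only [smul_add, map_add, hx, hy]
    | tmul m y =>
      rw [TensorProduct.smul_tmul', LinearMap.lTensor_tmul, TensorProduct.rid_tmul,
        LinearMap.lTensor_tmul, TensorProduct.rid_tmul, smul_comm]; rfl

theorem contr_tmul (s : SeparableClosure L →ₗ[L] L) (m : M) (y : SeparableClosure L) :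
    contr (R := R) s (m ⊗ₜ y) = s y • m := by
  change TensorProduct.rid L M (s.lTensor M (m ⊗ₜ y)) = _
  rw [LinearMap.lTensor_tmul, TensorProduct.rid_tmul]

/-- The map `1 ⊗ h` on `M ⊗ L^sep`. -/
noncomputable def rightMap (h : Module.End L (SeparableClosure L)) :
    M ⊗[L] SeparableClosure L →ₗ[R] M ⊗[L] SeparableClosure L where
  toFun := h.lTensor M
  map_add' := map_add _
  map_smul' a x := by
    induction x with
    | zero => simp
    | add x y hx hy => simp only [smul_add, map_add, hx, hy]
    | tmul m y => rw [TensorProduct.smul_tmul', LinearMap.lTensor_tmul, LinearMap.lTensor_tmul]; rfl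

theorem rightMap_tmul (h : Module.End L (SeparableClosure L)) (m : M) (y : SeparableClosure L) :
    rightMap (R := R) h (m ⊗ₜ y) = m ⊗ₜ h y := LinearMap.lTensor_tmul _ _ _ _

/-- The map `m ↦ m ⊗ y`. -/
noncomputable def inclAt (y : SeparableClosure L) : M →ₗ[R] M ⊗[L] SeparableClosure L where
  toFun m := m ⊗ₜ y
  map_add' m m' := TensorProduct.add_tmul m m' y
  map_smul' a m := (TensorProduct.smul_tmul' a m y).symm

theorem sepFrob_tmul (τ : M →ₗ[R] M) (hτ : ∀ (b : L) (x : M), τ (b • x) = b ^ Fintype.card Fq • τ x)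
    (m : M) (y : SeparableClosure L) :
    sepFrob τ hτ (m ⊗ₜ y) = τ m ⊗ₜ (y ^ Fintype.card Fq) := rfl

variable [Finite L]

omit [Finite L] in
theorem sepFrob_pow_tmul (τ : M →ₗ[R] M)
    (hτ : ∀ (b : L) (x : M), τ (b • x) = b ^ Fintype.card Fq • τ x)
    (m : M) (y : SeparableClosure L) (i : ℕ) :
    ((sepFrob τ hτ : Module.End R _) ^ i) (m ⊗ₜ y) =
      ((τ : Module.End R M) ^ i) m ⊗ₜ (y ^ Fintype.card Fq ^ i) := by
  induction i with
  | zero => simp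
  | succ i ih =>
    rw [pow_succ', Module.End.mul_apply, ih, sepFrob_tmul, ← pow_mul, ← pow_succ,
      pow_succ' (τ : Module.End R M) i]
    rfl

/-- Passing to the e-th power replaces the q-Frobenius by the |L|-Frobenius, which is L-linear. This
is why the fixed points of the e-th power are computed first. -/
theorem sepFrob_pow_finrank (τ : M →ₗ[R] M)
    (hτ : ∀ (b : L) (x : M), τ (b • x) = b ^ Fintype.card Fq • τ x)
    (m : M) (y : SeparableClosure L) :
    ((sepFrob τ hτ : Module.End R _) ^ Module.finrank Fq L) (m ⊗ₜ y) =
      ((τ : Module.End R M) ^ Module.finrank Fq L) m ⊗ₜ sepFrobL L y := by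
  have : Module.Finite Fq L := Module.Finite.of_finite
  rw [sepFrob_pow_tmul, sepFrobL_apply, Module.natCard_eq_pow_finrank (K := Fq),
    Nat.card_eq_fintype_card]

/-- The sum `∑ πⁱ(m) ⊗ θ^(σ^i)` for a generator `θ` of a normal basis. -/
noncomputable def normalMap (π : Module.End R M) (N : ℕ) (θ : SeparableClosure L) :
    M →ₗ[R] M ⊗[L] SeparableClosure L :=
  ∑ i : Fin N, inclAt ((sepFrobL L ^ (i : ℕ)) θ) ∘ₗ (π ^ (i : ℕ) : Module.End R M)

theorem normalMap_apply (π : Module.End R M) (N : ℕ) (θ : SeparableClosure L) (m : M) :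
    normalMap π N θ m = ∑ i : Fin N, (π ^ (i : ℕ)) m ⊗ₜ (sepFrobL L ^ (i : ℕ)) θ := by
  rw [normalMap, LinearMap.sum_apply]; rfl

variable {J : Ideal R}

theorem pow_mul_sub_mem {π : Module.End R M} {N : ℕ}
    (hπ : ∀ x, (π ^ N) x - x ∈ (J • ⊤ : Submodule R M)) (j : ℕ) (x : M) :
    (π ^ (N * j)) x - x ∈ (J • ⊤ : Submodule R M) := by
  induction j with
  | zero => simp
  | succ j ih =>
    rw [Nat.mul_succ, add_comm, pow_add, Module.End.mul_apply]
    have := Submodule.add_mem _ (hπ ((π ^ (N * j)) x)) ih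
    rwa [sub_add_sub_cancel] at this

omit [Finite L] in
theorem tmul_mem_smul_top {x : M} (hx : x ∈ (J • ⊤ : Submodule R M)) (y : SeparableClosure L) :
    x ⊗ₜ y ∈ (J • ⊤ : Submodule R (M ⊗[L] SeparableClosure L)) :=
  mem_smul_top_of_map J (inclAt y) hx

/-- Since π^N is the identity modulo J, the terms of the long sum may be grouped by their exponents
modulo N, and each group collects the conjugates of θ into a conjugate of its trace. Hence
trace-compatible generators give compatible maps. -/
theorem normalMap_sub_mem {π : Module.End R M} {N d : ℕ}
    (hπ : ∀ x, (π ^ N) x - x ∈ (J • ⊤ : Submodule R M)) (θ : SeparableClosure L) (m : M) :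
    normalMap π (N * d) θ m -
      normalMap π N (∑ j ∈ Finset.range d, (sepFrobL L ^ (N * j)) θ) m ∈
        (J • ⊤ : Submodule R (M ⊗[L] SeparableClosure L)) := by
  rw [normalMap_apply, normalMap_apply]
  have h1 : ∑ i : Fin (N * d), (π ^ (i : ℕ)) m ⊗ₜ[L] (sepFrobL L ^ (i : ℕ)) θ =
      ∑ i : Fin N, ∑ j : Fin d, (π ^ ((i : ℕ) + N * j)) m ⊗ₜ (sepFrobL L ^ ((i : ℕ) + N * j)) θ := by
    rw [Finset.sum_comm, ← Fintype.sum_prod_type']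
    let E : Fin d × Fin N ≃ Fin (N * d) := finProdFinEquiv.trans (finCongr (mul_comm d N))
    rw [← E.sum_comp]
    rfl
  have h2 : ∀ i : Fin N, (π ^ (i : ℕ)) m ⊗ₜ[L] (sepFrobL L ^ (i : ℕ))
      (∑ j ∈ Finset.range d, (sepFrobL L ^ (N * j)) θ) =
      ∑ j : Fin d, (π ^ (i : ℕ)) m ⊗ₜ (sepFrobL L ^ ((i : ℕ) + N * j)) θ := by
    intro i
    rw [map_sum, TensorProduct.tmul_sum, Finset.sum_range]
    refine Finset.sum_congr rfl fun j _ => ?_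
    rw [pow_add]; rfl
  rw [h1, Finset.sum_congr rfl fun i _ => h2 i, ← Finset.sum_sub_distrib]
  refine Submodule.sum_mem _ fun i _ => ?_
  rw [← Finset.sum_sub_distrib]
  refine Submodule.sum_mem _ fun j _ => ?_
  rw [← TensorProduct.sub_tmul]
  refine tmul_mem_smul_top ?_ _
  rw [pow_add, Module.End.mul_apply, ← map_sub]
  exact mem_smul_top_of_map J _ (pow_mul_sub_mem hπ j m)

/-- Modulo `J`, the map `normalMap` is a bijection from `M / J` onto the fixed points of
`γ = π ⊗ σ`. -/
theorem normalMap_spec {π : Module.End R M} {N : ℕ} (hN : N ≠ 0)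
    (hπ : ∀ x, (π ^ N) x - x ∈ (J • ⊤ : Submodule R M)) {θ : SeparableClosure L}
    (hθ : θ ∈ normalGenerators L N) (γ : Module.End R (M ⊗[L] SeparableClosure L))
    (hγ : ∀ m y, γ (m ⊗ₜ y) = π m ⊗ₜ sepFrobL L y) :
    (∀ m, γ (normalMap π N θ m) - normalMap π N θ m ∈
      (J • ⊤ : Submodule R (M ⊗[L] SeparableClosure L))) ∧
    (∀ m, normalMap π N θ m ∈ (J • ⊤ : Submodule R (M ⊗[L] SeparableClosure L)) →
      m ∈ (J • ⊤ : Submodule R M)) ∧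
    (∀ x, γ x - x ∈ (J • ⊤ : Submodule R (M ⊗[L] SeparableClosure L)) →
      ∃ m, x - normalMap π N θ m ∈ (J • ⊤ : Submodule R (M ⊗[L] SeparableClosure L))) := by
  obtain ⟨s, p, hs, hp⟩ := exists_normal_projection hN hθ
  have hsum : ∀ (a : Fin N → M) (i : Fin N),
      contr (R := R) (s i) (∑ j, a j ⊗ₜ (sepFrobL L ^ (j : ℕ)) θ) = a i := by
    intro a i
    rw [map_sum]
    simp only [contr_tmul, hs]
    simp
  have hγi : ∀ (i : ℕ) m y, (γ ^ i) (m ⊗ₜ y) = (π ^ i) m ⊗ₜ (sepFrobL L ^ i) y := by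
    intro i
    induction i with
    | zero => simp
    | succ i ih =>
      intro m y
      rw [pow_succ', Module.End.mul_apply, ih, hγ, pow_succ' π, pow_succ' (sepFrobL L)]; rfl
  obtain ⟨N', rfl⟩ := Nat.exists_eq_succ_of_ne_zero hN
  refine ⟨fun m => ?_, fun m hm => ?_, fun x hx => ?_⟩
  · have h4 : normalMap π (N' + 1) θ m = ∑ i ∈ Finset.range (N' + 1), (γ ^ i) (m ⊗ₜ θ) := by
      rw [normalMap_apply, Finset.sum_range]
      exact Finset.sum_congr rfl fun i _ => (hγi i m θ).symm
    -- The map γ shifts the summands by one, so the difference telescopes.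
    have h5 : γ (normalMap π (N' + 1) θ m) - normalMap π (N' + 1) θ m =
        (γ ^ (N' + 1)) (m ⊗ₜ θ) - m ⊗ₜ θ := by
      rw [h4, map_sum, ← Finset.sum_sub_distrib]
      refine Eq.trans (Finset.sum_congr rfl fun i _ => ?_)
        (Finset.sum_range_sub (fun i => (γ ^ i) (m ⊗ₜ θ)) (N' + 1))
      rw [pow_succ', Module.End.mul_apply]
    rw [h5, hγi, hθ.1, ← TensorProduct.sub_tmul]
    exact tmul_mem_smul_top (hπ m) _
  · have := mem_smul_top_of_map J (contr (R := R) (s 0)) hm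
    rw [normalMap_apply, hsum] at this
    simpa using this
  · have hxi : ∀ i : ℕ, (γ ^ i) x - x ∈ (J • ⊤ : Submodule R (M ⊗[L] SeparableClosure L)) := by
      intro i
      induction i with
      | zero => simp
      | succ i ih =>
        have := Submodule.add_mem _ (mem_smul_top_of_map J (γ ^ i) hx) ih
        rwa [map_sub, sub_add_sub_cancel, ← Module.End.mul_apply, ← pow_succ] at this
    have hγN : ∀ x, (γ ^ (N' + 1)) x - rightMap (R := R) (sepFrobL L ^ (N' + 1)) x ∈
        (J • ⊤ : Submodule R (M ⊗[L] SeparableClosure L)) := by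
      intro x
      induction x with
      | zero => simp
      | add x y hx hy =>
        rw [map_add, map_add, add_sub_add_comm]
        exact Submodule.add_mem _ hx hy
      | tmul m y =>
        rw [hγi, rightMap_tmul, ← TensorProduct.sub_tmul]
        exact tmul_mem_smul_top (hπ m) _
    -- The decomposition of `exists_normal_projection` in the second factor. For x fixed modulo J
    -- the first term lies in J, so that x is given modulo J by its coordinates along the conjugates
    -- of θ.
    have hdec : x = rightMap (R := R) p (rightMap (R := R) (sepFrobL L ^ (N' + 1)) x - x) +
        ∑ i : Fin (N' + 1), contr (R := R) (s i) x ⊗ₜ (sepFrobL L ^ (i : ℕ)) θ := by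
      clear hx hxi
      induction x with
      | zero => simp
      | add x y hx hy =>
        conv_lhs => rw [hx, hy]
        simp only [map_add, TensorProduct.add_tmul, Finset.sum_add_distrib, map_sub]
        abel
      | tmul m y =>
        rw [rightMap_tmul, ← TensorProduct.tmul_sub, rightMap_tmul]
        conv_lhs => rw [hp y]
        rw [TensorProduct.tmul_add, TensorProduct.tmul_sum]
        congr 1
        refine Finset.sum_congr rfl fun i _ => ?_
        rw [contr_tmul, TensorProduct.smul_tmul]
    have hx' : x - ∑ i : Fin (N' + 1), contr (R := R) (s i) x ⊗ₜ (sepFrobL L ^ (i : ℕ)) θ ∈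
        (J • ⊤ : Submodule R (M ⊗[L] SeparableClosure L)) := by
      have h4 := Submodule.sub_mem _ (hxi (N' + 1)) (hγN x)
      rw [sub_sub_sub_cancel_left] at h4
      rw [sub_eq_of_eq_add hdec]
      exact mem_smul_top_of_map J (rightMap (R := R) p) h4
    obtain ⟨a, ha⟩ : ∃ a : Fin (N' + 1) → M, a = fun i => contr (R := R) (s i) x := ⟨_, rfl⟩
    replace hx' : x - ∑ i : Fin (N' + 1), a i ⊗ₜ (sepFrobL L ^ (i : ℕ)) θ ∈
        (J • ⊤ : Submodule R (M ⊗[L] SeparableClosure L)) := by rw [ha]; exact hx'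
    -- Comparing coordinates of γ x and x shows that a (j + 1) is π (a j) modulo J. Inductively a i
    -- is π^i (a 0), and x is the image of a 0.
    have hstep : ∀ j : Fin N', π (a j.castSucc) - a j.succ ∈ (J • ⊤ : Submodule R M) := by
      intro j
      have h4 := Submodule.sub_mem _ hx (Submodule.sub_mem _ (mem_smul_top_of_map J γ hx') hx')
      have h5 := mem_smul_top_of_map J (contr (R := R) (s j.succ)) h4
      have h6 : contr (R := R) (s j.succ)
          (γ (∑ i : Fin (N' + 1), a i ⊗ₜ (sepFrobL L ^ (i : ℕ)) θ)) = π (a j.castSucc) := by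
        rw [map_sum, map_sum, Fin.sum_univ_castSucc]
        have h7 : ∀ i : Fin N', contr (R := R) (s j.succ)
            (γ (a i.castSucc ⊗ₜ (sepFrobL L ^ (i.castSucc : ℕ)) θ)) =
            if j = i then π (a i.castSucc) else 0 := by
          intro i
          rw [hγ, contr_tmul, ← Module.End.mul_apply, ← pow_succ']
          have := hs j.succ i.succ
          rw [Fin.val_succ] at this
          rw [Fin.val_castSucc, this]
          simp [Fin.succ_inj]
        -- The last summand is moved to a multiple of θ, whose coordinate has index 0.
        have h8 : contr (R := R) (s j.succ)
            (γ (a (Fin.last N') ⊗ₜ (sepFrobL L ^ ((Fin.last N' : Fin (N' + 1)) : ℕ)) θ)) = 0 := by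
          rw [hγ, contr_tmul, ← Module.End.mul_apply, ← pow_succ', Fin.val_last, hθ.1]
          have := hs j.succ 0
          rw [Fin.val_zero, pow_zero, Module.End.one_apply, if_neg (Fin.succ_ne_zero j)] at this
          rw [this, zero_smul]
        rw [Finset.sum_congr rfl fun i _ => h7 i, h8]
        simp
      have h9 : contr (R := R) (s j.succ)
          (x - ∑ i : Fin (N' + 1), a i ⊗ₜ (sepFrobL L ^ (i : ℕ)) θ) =
            contr (R := R) (s j.succ) x - a j.succ :=
        (map_sub (contr (R := R) (s j.succ)) _ _).trans (congrArg _ (hsum a j.succ))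
      rw [map_sub, map_sub, map_sub, map_sub, map_sub, h6, h9] at h5
      convert h5 using 1
      abel
    have hall : ∀ (i : ℕ) (hi : i < N' + 1),
        (π ^ i) (a 0) - a ⟨i, hi⟩ ∈ (J • ⊤ : Submodule R M) := by
      intro i
      induction i with
      | zero => intro _; simp
      | succ i ih =>
        intro hi
        have h4 := Submodule.add_mem _ (mem_smul_top_of_map J π (ih (by omega)))
          (hstep ⟨i, by omega⟩)
        rw [map_sub, ← Module.End.mul_apply, ← pow_succ'] at h4
        have h5 := sub_add_sub_cancel ((π ^ (i + 1)) (a 0)) (π (a ⟨i, by omega⟩)) (a ⟨i + 1, hi⟩)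
        rw [← h5]
        exact h4
    refine ⟨a 0, ?_⟩
    rw [← sub_sub_sub_cancel_right _ _ (∑ i, a i ⊗ₜ[L] (sepFrobL L ^ (i : ℕ)) θ)]
    refine Submodule.sub_mem _ hx' ?_
    rw [normalMap_apply, ← Finset.sum_sub_distrib]
    refine Submodule.sum_mem _ fun i _ => ?_
    rw [← TensorProduct.sub_tmul]
    exact tmul_mem_smul_top (hall i i.2) _

omit [Finite L] in
theorem rightMap_comp (h h' : Module.End L (SeparableClosure L)) :
    (rightMap (R := R) (M := M) (h * h')) = rightMap h ∘ₗ rightMap h' := by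
  ext x
  induction x with
  | zero => simp
  | add x y hx hy => rw [map_add, map_add, hx, hy]
  | tmul m y => rw [LinearMap.comp_apply, rightMap_tmul, rightMap_tmul, rightMap_tmul]; rfl

omit [Finite L] in
theorem map_add_adic {N : Type u} [AddCommGroup N] [Module R N] (I : Ideal R)
    (f g : N →ₗ[R] N) :
    AdicCompletion.map I (f + g) = AdicCompletion.map I f + AdicCompletion.map I g := by
  refine LinearMap.ext fun x => AdicCompletion.ext fun n => ?_
  rw [LinearMap.add_apply, AdicCompletion.val_add_apply, AdicCompletion.map_val_apply,
    AdicCompletion.map_val_apply, AdicCompletion.map_val_apply]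
  obtain ⟨y, hy⟩ := Submodule.Quotient.mk_surjective (I ^ n • ⊤ : Submodule R N) (x.val n)
  rw [← hy]; rfl

omit [Finite L] in
theorem rightMap_add (h h' : Module.End L (SeparableClosure L)) :
    (rightMap (R := R) (M := M) (h + h')) = rightMap h + rightMap h' := by
  ext x
  induction x with
  | zero => simp
  | add x y hx hy => rw [map_add, map_add, hx, hy]
  | tmul m y =>
    rw [LinearMap.add_apply, rightMap_tmul, rightMap_tmul, rightMap_tmul, LinearMap.add_apply,
      TensorProduct.tmul_add]

/-- The action of `L` on the completion of `M ⊗ L^sep`. -/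
noncomputable def sepAct (I : Ideal R) : L →+* Module.End (AdicCompletion I R)
    (AdicCompletion I (M ⊗[L] SeparableClosure L)) where
  toFun b := AdicCompletion.map I (rightMap (algebraMap L (Module.End L (SeparableClosure L)) b))
  map_one' := by
    rw [map_one]
    have : rightMap (R := R) (M := M) (1 : Module.End L (SeparableClosure L)) = LinearMap.id := by
      ext x
      induction x with
      | zero => simp
      | add x y hx hy => rw [map_add, hx, hy, map_add]
      | tmul m y => rw [rightMap_tmul]; rfl
    rw [this]
    exact AdicCompletion.map_id I _
  map_mul' b b' := by
    rw [map_mul, rightMap_comp]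
    exact (AdicCompletion.map_comp I _ _).symm
  map_zero' := by
    rw [map_zero]
    have h := map_add_adic I (rightMap (R := R) (M := M) (0 : Module.End L (SeparableClosure L)))
      (rightMap 0)
    rw [← rightMap_add, add_zero] at h
    exact left_eq_add.1 h
  map_add' b b' := by rw [map_add, rightMap_add, map_add_adic]

omit [Finite L] in
theorem sepAct_apply (I : Ideal R) (b : L) : sepAct (M := M) I b =
    AdicCompletion.map I (rightMap (algebraMap L (Module.End L (SeparableClosure L)) b)) := rfl

omit [Finite L] in
theorem map_sepFrob_sepAct (I : Ideal R) (τ : M →ₗ[R] M)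
    (hτ : ∀ (b : L) (x : M), τ (b • x) = b ^ Fintype.card Fq • τ x) (b : L)
    (x : AdicCompletion I (M ⊗[L] SeparableClosure L)) :
    AdicCompletion.map I (sepFrob τ hτ) (sepAct I b x) =
      sepAct I (b ^ Fintype.card Fq) (AdicCompletion.map I (sepFrob τ hτ) x) := by
  rw [sepAct_apply, sepAct_apply, AdicCompletion.map_comp_apply, AdicCompletion.map_comp_apply]
  congr 2
  ext x
  induction x with
  | zero => simp
  | add x y hx hy => rw [map_add, map_add, hx, hy]
  | tmul m y =>
    rw [LinearMap.comp_apply, LinearMap.comp_apply, rightMap_tmul, sepFrob_tmul, sepFrob_tmul,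
      rightMap_tmul, Module.algebraMap_end_apply, Module.algebraMap_end_apply, smul_pow]

omit [Finite L] in
theorem sepAct_comm (I : Ideal R) (g : M →ₗ[R] M)
    (hg : ∀ (b : L) (x : M), g (b • x) = b • g x) (b : L)
    (x : AdicCompletion I (M ⊗[L] SeparableClosure L)) :
    sepAct I b (AdicCompletion.map I (sepExt g (RingHom.id _) id hg (fun _ => rfl)) x) =
      AdicCompletion.map I (sepExt g (RingHom.id _) id hg (fun _ => rfl)) (sepAct I b x) := by
  rw [sepAct_apply, AdicCompletion.map_comp_apply, AdicCompletion.map_comp_apply]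
  congr 2
  ext x
  induction x with
  | zero => simp
  | add x y hx hy => rw [map_add, map_add, hx, hy]
  | tmul m y => rfl

/-- The Tate module of `(M, τ)`: a sum of `[L : Fq]` copies of it is isomorphic to the completion
of `M`, compatibly with endomorphisms. -/
theorem exists_tate_equiv (I : Ideal R) (τ : M →ₗ[R] M)
    (hτ : ∀ (b : L) (x : M), τ (b • x) = b ^ Fintype.card Fq • τ x)
    (hfin : ∀ n, Finite (M ⧸ (I ^ n • ⊤ : Submodule R M)))
    (hsurj : ∀ n x, ∃ y, τ y - x ∈ (I ^ n • ⊤ : Submodule R M)) :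
    ∃ Ψ : (Fin (Module.finrank Fq L) → tateModule I τ hτ) ≃ₗ[AdicCompletion I R]
        AdicCompletion I M,
      ∀ (g : M →ₗ[R] M) (hg : ∀ (b : L) (x : M), g (b • x) = b • g x)
        (hgτ : ∀ x, g (τ x) = τ (g x)) t,
        Ψ (fun j => tateMap I τ hτ g hg hgτ (t j)) = AdicCompletion.map I g (Ψ t) := by
  obtain ⟨π, hπ⟩ : ∃ π : Module.End R M, π = (τ : Module.End R M) ^ Module.finrank Fq L :=
    ⟨_, rfl⟩
  -- On the finite module M / Iⁿ the surjective map τ is bijective, so π acts as a permutation of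
  -- finite order.
  have hbij : ∀ n, Function.Bijective (((I ^ n • ⊤ : Submodule R M)).mapQ _ π
      (Submodule.smul_top_le_comap_smul_top _ π)) := by
    intro n
    have := hfin n
    refine Finite.injective_iff_bijective.1 (Finite.injective_iff_surjective.2 ?_)
    have h1 : ∀ (i : ℕ) x, ∃ y, ((τ : Module.End R M) ^ i) y - x ∈ (I ^ n • ⊤ : Submodule R M) := by
      intro i
      induction i with
      | zero => intro x; exact ⟨x, by simp⟩
      | succ i ih =>
        intro x
        obtain ⟨y, hy⟩ := ih x
        obtain ⟨w, hw⟩ := hsurj n y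
        refine ⟨w, ?_⟩
        have := Submodule.add_mem _ (mem_smul_top_of_map _ ((τ : Module.End R M) ^ i) hw) hy
        rwa [map_sub, sub_add_sub_cancel, ← Module.End.mul_apply, ← pow_succ] at this
    intro q
    obtain ⟨x, rfl⟩ := Submodule.Quotient.mk_surjective _ q
    obtain ⟨y, hy⟩ := h1 (Module.finrank Fq L) x
    rw [← hπ] at hy
    exact ⟨Submodule.Quotient.mk y, (Submodule.Quotient.eq _).2 hy⟩
  have hord : ∀ n, ∃ N ≠ 0, ∀ x, (π ^ N) x - x ∈ (I ^ n • ⊤ : Submodule R M) := by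
    intro n
    have := hfin n
    let p : Equiv.Perm (M ⧸ (I ^ n • ⊤ : Submodule R M)) := Equiv.ofBijective _ (hbij n)
    refine ⟨orderOf p, (orderOf_pos p).ne', fun x => ?_⟩
    have h1 : ∀ i : ℕ, (p ^ i) (Submodule.Quotient.mk x) = Submodule.Quotient.mk ((π ^ i) x) := by
      intro i
      induction i with
      | zero => simp
      | succ i ih =>
        rw [pow_succ', Equiv.Perm.mul_apply, ih, pow_succ', Module.End.mul_apply]
        rfl
    have h2 := h1 (orderOf p)
    rw [pow_orderOf_eq_one, Equiv.Perm.one_apply] at h2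
    exact (Submodule.Quotient.eq _).1 h2.symm
  choose N₀ hN₀ hN₀π using hord
  -- Accumulated products make the exponents divide one another, as the tower of normal bases
  -- requires.
  obtain ⟨N, hN⟩ : ∃ N : ℕ → ℕ, N = fun n => ∏ i ∈ Finset.range (n + 1), N₀ i := ⟨_, rfl⟩
  have hNne : ∀ n, N n ≠ 0 := fun n => by
    rw [hN]; exact Finset.prod_ne_zero_iff.2 fun i _ => hN₀ i
  have hNdvd : ∀ n, N n ∣ N (n + 1) := fun n => by
    rw [hN]; exact ⟨_, Finset.prod_range_succ _ _⟩
  have hNπ : ∀ n x, (π ^ N n) x - x ∈ (I ^ n • ⊤ : Submodule R M) := by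
    intro n x
    obtain ⟨c, hc⟩ : N₀ n ∣ N n := by
      rw [hN]; exact Finset.dvd_prod_of_mem _ (Finset.self_mem_range_succ n)
    rw [hc]
    exact pow_mul_sub_mem (hN₀π n) c x
  obtain ⟨θ, hθ, hθtr⟩ := exists_normal_tower (L := L) N hNne hNdvd
  have hcompat : ∀ m n, m ≤ n → ∀ x, normalMap π (N n) (θ n) x - normalMap π (N m) (θ m) x ∈
      (I ^ m • ⊤ : Submodule R (M ⊗[L] SeparableClosure L)) := by
    intro m n hmn x
    induction n, hmn using Nat.le_induction with
    | base => simp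
    | succ n hmn ih =>
      have h1 := normalMap_sub_mem (d := N (n + 1) / N n) (hNπ n) (θ (n + 1)) x
      rw [hθtr, Nat.mul_div_cancel' (hNdvd n)] at h1
      have h2 := Submodule.smul_mono_left (N := (⊤ : Submodule R (M ⊗[L] SeparableClosure L)))
        (Ideal.pow_le_pow_right (I := I) hmn) h1
      have := Submodule.add_mem _ h2 ih
      rwa [sub_add_sub_cancel] at this
  obtain ⟨γ, hγ⟩ : ∃ γ : Module.End R (M ⊗[L] SeparableClosure L),
      γ = (sepFrob τ hτ : Module.End R _) ^ Module.finrank Fq L := ⟨_, rfl⟩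
  have hspec := fun n => normalMap_spec (hNne n) (hNπ n) (hθ n) γ (fun m y => by
    rw [hγ, sepFrob_pow_finrank, hπ])
  obtain ⟨Ψ₁, hΨ₁⟩ := exists_equiv_eqLocus I (fun n => normalMap π (N n) (θ n)) hcompat γ
    (fun n => (hspec n).1) (fun n => (hspec n).2.1) (fun n => (hspec n).2.2)
  obtain ⟨Ψ₂, b, hΨ₂⟩ := exists_descent_equiv (sepAct (R := R) (M := M) (L := L) I)
    (AdicCompletion.map I (sepFrob τ hτ)) (map_sepFrob_sepAct I τ hτ)
  have hloc : LinearMap.eqLocus ((AdicCompletion.map I (sepFrob τ hτ) : Module.End _ _) ^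
      Module.finrank Fq L) LinearMap.id = LinearMap.eqLocus (AdicCompletion.map I γ)
        LinearMap.id := by
    rw [map_pow_eq, hγ]
  obtain ⟨Ψ₃, hΨ₃⟩ : ∃ Ψ₃ : (Fin (Module.finrank Fq L) → tateModule I τ hτ) ≃ₗ[AdicCompletion I R]
      LinearMap.eqLocus (AdicCompletion.map I γ) LinearMap.id,
      ∀ t, (Ψ₃ t : AdicCompletion I (M ⊗[L] SeparableClosure L)) =
        ∑ j, sepAct I (b j) (t j : AdicCompletion I (M ⊗[L] SeparableClosure L)) :=
    ⟨Ψ₂.trans (LinearEquiv.ofEq _ _ hloc), hΨ₂⟩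
  -- Ψ₃ identifies e copies of the Tate module with the fixed points of γ, and Ψ₁ identifies the
  -- completion of M with these same fixed points.
  refine ⟨Ψ₃.trans Ψ₁.symm, fun g hg hgτ t => ?_⟩
  have hgπ : ∀ (i : ℕ) x, g ((π ^ i) x) = (π ^ i) (g x) := by
    have h1 : Commute (g : Module.End R M) π := by
      rw [hπ]
      exact Commute.pow_right (LinearMap.ext hgτ) _
    intro i x
    exact LinearMap.congr_fun (h1.pow_right i).eq x
  have key : ∀ x, mapSeq I (fun n => normalMap π (N n) (θ n)) hcompat (AdicCompletion.map I g x) =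
      AdicCompletion.map I (sepExt g (RingHom.id _) id hg (fun _ => rfl))
        (mapSeq I (fun n => normalMap π (N n) (θ n)) hcompat x) := by
    refine mapSeq_comp_map I _ hcompat g _ fun n x => ?_
    rw [normalMap_apply, normalMap_apply, map_sum]
    refine Finset.sum_congr rfl fun i _ => ?_
    rw [← hgπ]; rfl
  obtain ⟨w, hw⟩ := Ψ₁.surjective (Ψ₃ t)
  rw [LinearEquiv.trans_apply, LinearEquiv.trans_apply, ← hw, LinearEquiv.symm_apply_apply,
    LinearEquiv.symm_apply_eq]
  refine Subtype.ext ?_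
  rw [hΨ₁, key, ← hΨ₁, hw, hΨ₃, hΨ₃, map_sum]
  refine Finset.sum_congr rfl fun j _ => ?_
  exact sepAct_comm I g hg (b j) _

end TensorSep

/-! ### Completions of Dedekind domains -/

section Completion

variable {R : Type u} [CommRing R] [IsDedekindDomain R] (I : Ideal R) [hI : I.IsMaximal]

/-- The multiplicities of I in principal ideals add under multiplication. -/
theorem mem_pow_or_mem_pow (h0 : I ≠ ⊥) {a b : R} {m n : ℕ} (h : a * b ∈ I ^ (m + n)) :
    a ∈ I ^ m ∨ b ∈ I ^ n := by
  classical
  have hp : Prime I := Ideal.prime_of_isPrime h0 hI.isPrime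
  by_contra! hab
  simp only [← Ideal.dvd_span_singleton] at h hab
  rw [← Ideal.span_singleton_mul_span_singleton, pow_dvd_iff_le_emultiplicity,
    emultiplicity_mul hp] at h
  rw [pow_dvd_iff_le_emultiplicity, pow_dvd_iff_le_emultiplicity, not_le, not_le] at hab
  have := ENat.add_lt_add hab.1 hab.2
  rw [Nat.cast_add] at h
  exact absurd h (not_le.2 this)

/-- If x is nonzero at level m and y at level n, then `mem_pow_or_mem_pow` shows that x y is nonzero
at level m + n. -/
theorem adicCompletion_isDomain (h0 : I ≠ ⊥) : IsDomain (AdicCompletion I R) := by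
  have : NoZeroDivisors (AdicCompletion I R) := by
    refine ⟨fun {x y} hxy => ?_⟩
    by_contra! h
    have key : ∀ x : AdicCompletion I R, x ≠ 0 → ∃ n, x.val n ≠ 0 := by
      intro x hx
      by_contra! h
      exact hx (AdicCompletion.ext h)
    obtain ⟨m, hm⟩ := key x h.1
    obtain ⟨n, hn⟩ := key y h.2
    obtain ⟨a, ha⟩ := Submodule.Quotient.mk_surjective _ (x.val (m + n))
    obtain ⟨b, hb⟩ := Submodule.Quotient.mk_surjective _ (y.val (m + n))
    have h1 := congrArg (fun t => t.val (m + n)) hxy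
    simp only [AdicCompletion.val_mul, ← ha, ← hb] at h1
    have h2 : a * b ∈ (I ^ (m + n) • ⊤ : Ideal R) := (Submodule.Quotient.mk_eq_zero _).1 h1
    rw [smul_eq_mul, Ideal.mul_top] at h2
    have h3 := AdicCompletion.transitionMap_comp_eval_apply I R (Nat.le_add_right m n) x
    have h4 := AdicCompletion.transitionMap_comp_eval_apply I R (Nat.le_add_left n m) y
    rw [← ha] at h3
    rw [← hb] at h4
    rcases mem_pow_or_mem_pow I h0 h2 with h | h
    · refine hm (h3.symm.trans ((Submodule.Quotient.mk_eq_zero _).2 ?_))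
      rwa [smul_eq_mul, Ideal.mul_top]
    · refine hn (h4.symm.trans ((Submodule.Quotient.mk_eq_zero _).2 ?_))
      rwa [smul_eq_mul, Ideal.mul_top]
  have : Nontrivial (AdicCompletion I R) := by
    refine ⟨0, 1, fun h => ?_⟩
    have h1 := congrArg (fun t => t.val 1) h
    have h2 : (1 : R) ∈ (I ^ 1 • ⊤ : Ideal R) := (Submodule.Quotient.mk_eq_zero _).1 h1.symm
    rw [smul_eq_mul, Ideal.mul_top, pow_one] at h2
    exact hI.ne_top ((Ideal.eq_top_iff_one I).2 h2)
  exact NoZeroDivisors.to_isDomain _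

theorem adicCompletion_isLocalRing : IsLocalRing (AdicCompletion I R) := by
  have hfg : I.FG := IsNoetherian.noetherian I
  have := AdicCompletion.isAdicComplete_self I hfg
  have := AdicCompletion.isMaximal_map_of_le I I le_rfl hfg
  exact isLocalRing_of_isAdicComplete_maximal (I.map (algebraMap R (AdicCompletion I R)))

variable (Q : Type u) [Field Q] [Algebra R Q] [IsFractionRing R Q]

/-- This ring is a localization of the completion at the nonzero elements of R, which stay nonzero
because R is I-adically separated. Being a domain is what lets `poly_eq_of_pow_eval_eq` be applied
over it. -/
theorem complField_isDomain (h0 : I ≠ ⊥) : IsDomain (ComplField Q I) := by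
  have := adicCompletion_isDomain I h0
  have hloc : IsLocalization (Algebra.algebraMapSubmonoid (AdicCompletion I R) R⁰)
      (ComplField Q I) := inferInstance
  have : IsHausdorff I R := IsHausdorff.of_isDomain I hI.ne_top
  refine IsLocalization.isDomain_of_le_nonZeroDivisors (ComplField Q I)
    (M := Algebra.algebraMapSubmonoid (AdicCompletion I R) R⁰) ?_
  rintro _ ⟨r, hr, rfl⟩
  rw [mem_nonZeroDivisors_iff_ne_zero]
  intro h
  refine nonZeroDivisors.ne_zero hr (AdicCompletion.of_injective I R ?_)
  rw [map_zero]
  exact h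

end Completion

/-! ### Rational Tate modules: rank and determinants -/

section Free

variable {R S T M : Type u} [CommRing R] [CommRing S] [IsLocalRing S] [AddCommGroup T] [Module S T]
  [AddCommGroup M] [Module S M]

/-- T is a direct summand of a finite flat module, hence finite and flat, and over a local ring this
means free. -/
theorem free_of_pi_equiv [Module.Finite S M] [Module.Flat S M] {e : ℕ} (he : e ≠ 0)
    (Ψ : (Fin e → T) ≃ₗ[S] M) : Module.Finite S T ∧ Module.Free S T := by
  have h1 : Module.Finite S (Fin e → T) := Module.Finite.equiv Ψ.symm
  have h2 : Module.Flat S (Fin e → T) := Module.Flat.of_linearEquiv Ψ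
  obtain ⟨e, rfl⟩ := Nat.exists_eq_succ_of_ne_zero he
  have h3 : Module.Finite S T :=
    Module.Finite.of_surjective (LinearMap.proj (R := S) (φ := fun _ : Fin (e + 1) => T) 0)
      (fun x => ⟨fun _ => x, rfl⟩)
  have h4 : Module.Flat S T :=
    Module.Flat.of_retract (LinearMap.single S (fun _ : Fin (e + 1) => T) 0) (LinearMap.proj 0)
      (LinearMap.ext fun x => by simp)
  exact ⟨h3, Module.free_of_flat_of_isLocalRing⟩

end Free

section RationalTate

variable {R Q M V T : Type u} [CommRing R] [Field Q] [Algebra R Q] [AddCommGroup M] [Module R M]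
  [AddCommGroup V] [Module Q V] [Module R V] [IsScalarTower R Q V] (I : Ideal R)
  [AddCommGroup T] [Module (AdicCompletion I R) T]

attribute [local instance] Algebra.TensorProduct.rightAlgebra

/-- The comparison of a base change of a localization with a base change of the module. -/
theorem exists_localized_baseChange_equiv [IsFractionRing R Q] (ι : M →ₗ[R] V)
    [IsLocalizedModule R⁰ ι] (C : Type u) [CommRing C] [Algebra R C] [Algebra Q C]
    [IsScalarTower R Q C] :
    ∃ Θ : C ⊗[R] M ≃ₗ[C] C ⊗[Q] V, ∀ c m, Θ (c ⊗ₜ m) = c ⊗ₜ ι m := by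
  have hb : IsBaseChange Q ι := IsLocalizedModule.isBaseChange R⁰ Q ι
  refine ⟨(TensorProduct.AlgebraTensorModule.cancelBaseChange R Q C C M).symm.trans
    (TensorProduct.AlgebraTensorModule.congr (LinearEquiv.refl C C) hb.equiv), fun c m => ?_⟩
  rw [LinearEquiv.trans_apply, TensorProduct.AlgebraTensorModule.cancelBaseChange_symm_tmul,
    TensorProduct.AlgebraTensorModule.congr_tmul, IsBaseChange.equiv_tmul, one_smul]
  rfl

omit [AddCommGroup V] [Module Q V] [Module R V] [IsScalarTower R Q V] [Field Q] [Algebra R Q]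

theorem exists_pi_baseChange_equiv (S C T : Type u) [CommRing S] [CommRing C] [Algebra S C]
    [AddCommGroup T] [Module S T] (e : ℕ) :
    ∃ E : C ⊗[S] (Fin e → T) ≃ₗ[C] (Fin e → C ⊗[S] T), ∀ (X : T →ₗ[S] T) t,
      E ((X.compLeft (Fin e)).baseChange C t) = fun j => X.baseChange C (E t j) := by
  refine ⟨TensorProduct.piRight S C C (fun _ : Fin e => T), fun X t => ?_⟩
  induction t with
  | zero => ext; simp
  | add x y hx hy =>
    rw [map_add, map_add, hx, hy, map_add]
    ext j
    rw [Pi.add_apply, Pi.add_apply, map_add]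
  | tmul c t => rfl

theorem exists_cancelBaseChange_equiv (R S C M : Type u) [CommRing R] [CommRing S] [CommRing C]
    [Algebra R S] [Algebra S C] [Algebra R C] [IsScalarTower R S C] [AddCommGroup M] [Module R M] :
    ∃ E : C ⊗[S] (S ⊗[R] M) ≃ₗ[C] C ⊗[R] M, ∀ (g : M →ₗ[R] M) t,
      E ((g.baseChange S).baseChange C t) = g.baseChange C (E t) := by
  refine ⟨TensorProduct.AlgebraTensorModule.cancelBaseChange R S C C M, fun g t => ?_⟩
  obtain ⟨t, rfl⟩ :=
    (TensorProduct.AlgebraTensorModule.cancelBaseChange R S C C M).symm.surjective t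
  rw [LinearEquiv.apply_symm_apply]
  induction t with
  | zero => simp
  | add x y hx hy => rw [map_add, map_add, map_add, hx, hy, map_add]
  | tmul c m =>
    rw [TensorProduct.AlgebraTensorModule.cancelBaseChange_symm_tmul, LinearMap.baseChange_tmul,
      LinearMap.baseChange_tmul, TensorProduct.AlgebraTensorModule.cancelBaseChange_tmul,
      LinearMap.baseChange_tmul, one_smul]

theorem exists_congr_baseChange_equiv (S C T N : Type u) [CommRing S] [CommRing C] [Algebra S C]
    [AddCommGroup T] [Module S T] [AddCommGroup N] [Module S N] (Ψ : T ≃ₗ[S] N) :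
    ∃ E : C ⊗[S] T ≃ₗ[C] C ⊗[S] N, ∀ (X : T →ₗ[S] T) (g : N →ₗ[S] N),
      (∀ t, Ψ (X t) = g (Ψ t)) → ∀ t, E (X.baseChange C t) = g.baseChange C (E t) := by
  refine ⟨TensorProduct.AlgebraTensorModule.congr (LinearEquiv.refl C C) Ψ, fun X g h t => ?_⟩
  induction t with
  | zero => simp
  | add x y hx hy => rw [map_add, map_add, map_add, hx, hy, map_add]
  | tmul c m =>
    rw [LinearMap.baseChange_tmul, TensorProduct.AlgebraTensorModule.congr_tmul,
      TensorProduct.AlgebraTensorModule.congr_tmul, LinearMap.baseChange_tmul, h]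

theorem exists_completion_equiv [IsNoetherianRing R] [Module.Finite R M] :
    ∃ E : AdicCompletion I M ≃ₗ[AdicCompletion I R] AdicCompletion I R ⊗[R] M,
      ∀ (g : M →ₗ[R] M) t, E (AdicCompletion.map I g t) =
        g.baseChange (AdicCompletion I R) (E t) := by
  refine ⟨(AdicCompletion.ofTensorProductEquivOfFiniteNoetherian I M).symm, fun g t => ?_⟩
  obtain ⟨t, rfl⟩ := (AdicCompletion.ofTensorProductEquivOfFiniteNoetherian I M).surjective t
  rw [LinearEquiv.symm_apply_apply, LinearEquiv.symm_apply_eq,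
    AdicCompletion.ofTensorProductEquivOfFiniteNoetherian_apply,
    AdicCompletion.ofTensorProductEquivOfFiniteNoetherian_apply]
  exact LinearMap.congr_fun (AdicCompletion.ofTensorProduct_naturality I g) t

variable [Field Q] [Algebra R Q] [AddCommGroup V] [Module Q V] [Module R V] [IsScalarTower R Q V]

theorem exists_generic_equiv [IsFractionRing R Q] (ι : M →ₗ[R] V) [IsLocalizedModule R⁰ ι] :
    ∃ Θ : ComplField Q I ⊗[R] M ≃ₗ[ComplField Q I] ComplField Q I ⊗[Q] V,
      ∀ (g : M →ₗ[R] M) (f : V →ₗ[Q] V) (s : Q), s ≠ 0 → (∀ x, ι (g x) = s • f (ι x)) →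
        ∀ t, toCompl Q I s⁻¹ • Θ (g.baseChange (ComplField Q I) t) =
          f.baseChange (ComplField Q I) (Θ t) := by
  obtain ⟨Θ, hΘ⟩ := exists_localized_baseChange_equiv (Q := Q) ι (ComplField Q I)
  refine ⟨Θ, fun g f s hs hg t => ?_⟩
  induction t with
  | zero => simp
  | add x y hx hy => rw [map_add, map_add, smul_add, hx, hy, map_add, map_add]
  | tmul c m =>
    rw [LinearMap.baseChange_tmul, hΘ, hΘ, LinearMap.baseChange_tmul, hg,
      ← TensorProduct.smul_tmul, TensorProduct.smul_tmul']
    congr 1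
    change toCompl Q I s⁻¹ * (toCompl Q I s * c) = c
    rw [← mul_assoc, ← map_mul, inv_mul_cancel₀ hs, map_one, one_mul]

/-- If copies of `T` form the completion of `M`, then the same copies of `T ⊗ Q_v` form
`V ⊗ Q_v`. -/
theorem exists_rational_equiv [IsNoetherianRing R] [IsFractionRing R Q] [Module.Finite R M]
    (ι : M →ₗ[R] V) [IsLocalizedModule R⁰ ι] {e : ℕ}
    (Ψ : (Fin e → T) ≃ₗ[AdicCompletion I R] AdicCompletion I M) :
    ∃ Ψ' : (Fin e → ComplField Q I ⊗[AdicCompletion I R] T) ≃ₗ[ComplField Q I]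
        ComplField Q I ⊗[Q] V,
      ∀ (X : T →ₗ[AdicCompletion I R] T) (g : M →ₗ[R] M) (f : V →ₗ[Q] V) (s : Q), s ≠ 0 →
        (∀ x, ι (g x) = s • f (ι x)) →
        (∀ t, Ψ (fun j => X (t j)) = AdicCompletion.map I g (Ψ t)) →
        ∀ t, Ψ' (fun j => (toCompl Q I s⁻¹ • X.baseChange (ComplField Q I)) (t j)) =
          f.baseChange (ComplField Q I) (Ψ' t) := by
  obtain ⟨E0, h0⟩ := exists_completion_equiv (R := R) (M := M) I
  obtain ⟨E1, h1⟩ := exists_pi_baseChange_equiv (AdicCompletion I R) (ComplField Q I) T e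
  obtain ⟨E2, h2⟩ := exists_congr_baseChange_equiv (AdicCompletion I R) (ComplField Q I) _ _
    (Ψ.trans E0)
  obtain ⟨E3, h3⟩ := exists_cancelBaseChange_equiv R (AdicCompletion I R) (ComplField Q I) M
  obtain ⟨Θ, h4⟩ := exists_generic_equiv (Q := Q) I ι
  refine ⟨(E1.symm.trans E2).trans (E3.trans Θ), fun X g f s hs hg hX t => ?_⟩
  obtain ⟨t, rfl⟩ := E1.surjective t
  have h5 : (fun j => (toCompl Q I s⁻¹ • X.baseChange (ComplField Q I)) (E1 t j)) =
      toCompl Q I s⁻¹ • E1 ((X.compLeft (Fin e)).baseChange (ComplField Q I) t) := by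
    rw [h1]; rfl
  have h6 := h2 (X.compLeft (Fin e)) (g.baseChange (AdicCompletion I R)) (fun t => by
    rw [LinearEquiv.trans_apply, LinearEquiv.trans_apply, ← h0, ← hX]; rfl)
  rw [h5, map_smul]
  simp only [LinearEquiv.trans_apply, LinearEquiv.symm_apply_apply]
  rw [h6, h3, h4 g f s hs hg]

end RationalTate

theorem det_pow_eq_of_pi_equiv {C W W' : Type u} [CommRing C] [AddCommGroup W] [Module C W]
    [Module.Finite C W] [Module.Free C W] [AddCommGroup W'] [Module C W'] {e : ℕ}
    (Ψ : (Fin e → W) ≃ₗ[C] W') (Y : W →ₗ[C] W) (G : W' →ₗ[C] W')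
    (h : ∀ t, Ψ (fun j => Y (t j)) = G (Ψ t)) : LinearMap.det Y ^ e = LinearMap.det G := by
  have h1 : G = Ψ.toLinearMap ∘ₗ LinearMap.pi (fun i => Y ∘ₗ LinearMap.proj i) ∘ₗ
      Ψ.symm.toLinearMap := by
    ext x
    obtain ⟨t, rfl⟩ := Ψ.surjective x
    simp only [LinearMap.comp_apply, LinearEquiv.coe_coe, LinearEquiv.symm_apply_apply]
    exact (h t).symm
  rw [h1, LinearMap.det_conj, LinearMap.det_pi]
  simp

/-- The determinant of `X` is known exactly, and not only up to roots of unity, when the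
determinants of the homotopy `1 + q (f - 1)` have a polynomial root. -/
theorem det_eq_of_baseChange_equiv {Q C V W : Type u} [Field Q] [Infinite Q] [CommRing C]
    [IsDomain C] [Algebra Q C] [AddCommGroup V] [Module Q V] [FiniteDimensional Q V]
    [AddCommGroup W] [Module C W] [Module.Finite C W] [Module.Free C W] {e : ℕ} (he : e ≠ 0)
    (Ψ : (Fin e → W) ≃ₗ[C] C ⊗[Q] V) (X : W →ₗ[C] W) (f : Module.End Q V)
    (h : ∀ t, Ψ (fun j => X (t j)) = f.baseChange C (Ψ t)) (p : Polynomial Q)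
    (hp0 : p.eval 0 = 1) (hp : ∀ q : Q, p.eval q ^ e = LinearMap.det (1 + q • (f - 1))) :
    LinearMap.det X = algebraMap Q C (p.eval 1) := by
  obtain ⟨r, hr⟩ := exists_poly_det_homotopy X
  have h2 : p.map (algebraMap Q C) = r := by
    refine poly_eq_of_pow_eval_eq he (T := Set.range (algebraMap Q C)) ?_ ?_
      (Set.infinite_range_of_injective (algebraMap Q C).injective) ?_
    · rw [← map_zero (algebraMap Q C), Polynomial.eval_map_apply, hp0, map_one]
    · rw [hr, zero_smul, add_zero, map_one]
    · rintro _ ⟨q, rfl⟩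
      rw [Polynomial.eval_map_apply, ← map_pow, hp, hr, ← LinearMap.det_baseChange]
      refine (det_pow_eq_of_pi_equiv Ψ _ _ fun t => ?_).symm
      have h5 : (fun j => (1 + algebraMap Q C q • (X - 1) : Module.End C W) (t j)) =
          t + algebraMap Q C q • ((fun j => X (t j)) - t) := rfl
      rw [h5, map_add, map_smul, map_sub, h]
      generalize Ψ t = x
      induction x with
      | zero => simp
      | add x y hx hy =>
        rw [map_add, map_add, ← hx, ← hy, add_sub_add_comm, smul_add, add_add_add_comm]
      | tmul c v =>
        rw [LinearMap.baseChange_tmul, LinearMap.baseChange_tmul, ← TensorProduct.tmul_sub,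
          algebraMap_smul, ← TensorProduct.tmul_smul, ← TensorProduct.tmul_add]
        rfl
  have h3 := hr 1
  rw [one_smul, add_sub_cancel, ← h2, ← map_one (algebraMap Q C),
    Polynomial.eval_map_apply] at h3
  exact h3.symm

section TateMain

variable {R Q M V : Type u} [CommRing R] [IsDedekindDomain R] [Field Q] [Algebra R Q]
  [IsFractionRing R Q] [Infinite Q] [AddCommGroup M] [Module R M] [Module.Finite R M]
  [Module.IsTorsionFree R M] [AddCommGroup V] [Module Q V] [FiniteDimensional Q V] [Module R V]
  [IsScalarTower R Q V] (I : Ideal R) [hI : I.IsMaximal] [Finite (R ⧸ I)]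
  {Fq L : Type u} [Field Fq] [Fintype Fq] [Field L] [Finite L] [Algebra Fq L] [Module L M]
  [SMulCommClass R L M]

attribute [local instance] Algebra.TensorProduct.rightAlgebra

/-- Tate modules of lattices: their dimension and the determinants of their endomorphisms. -/
theorem tate_free_and_det (h0 : I ≠ ⊥) (ι : M →ₗ[R] V) [IsLocalizedModule R⁰ ι]
    (τ : M →ₗ[R] M) (hτ : ∀ (b : L) (x : M), τ (b • x) = b ^ Fintype.card Fq • τ x)
    (hsurj : ∀ n x, ∃ y, τ y - x ∈ (I ^ n • ⊤ : Submodule R M)) :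
    Module.Finite (ComplField Q I) (ratTateModule Q I τ hτ) ∧
    Module.Free (ComplField Q I) (ratTateModule Q I τ hτ) ∧
    Module.finrank Fq L * Module.finrank (ComplField Q I) (ratTateModule Q I τ hτ) =
      Module.finrank Q V ∧
    ∀ (g : M →ₗ[R] M) (hg : ∀ (b : L) (x : M), g (b • x) = b • g x)
      (hgτ : ∀ x, g (τ x) = τ (g x)) (s : R) (f : Module.End Q V) (p : Polynomial Q),
      s ≠ 0 → (∀ x, ι (g x) = algebraMap R Q s • f (ι x)) → p.eval 0 = 1 →
      (∀ q : Q, p.eval q ^ Module.finrank Fq L = LinearMap.det (1 + q • (f - 1))) →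
      LinearMap.det (ratTateMap Q I τ hτ g hg hgτ s) = toCompl Q I (p.eval 1) := by
  have hdS := adicCompletion_isDomain I h0
  have hlS := adicCompletion_isLocalRing I
  have hdC := complField_isDomain I Q h0
  have : Module.Finite Fq L := Module.Finite.of_finite
  have he : Module.finrank Fq L ≠ 0 := Module.finrank_pos.ne'
  have hfin : ∀ n, Finite (M ⧸ (I ^ n • ⊤ : Submodule R M)) := by
    intro n
    have : Finite (R ⧸ I ^ n) := Ideal.finite_quotient_pow (IsNoetherian.noetherian I) n
    exact Module.finite_of_finite (R ⧸ I ^ n)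
  obtain ⟨Ψ₀, hΨ₀⟩ := exists_tate_equiv I τ hτ hfin hsurj
  obtain ⟨E0, -⟩ := exists_completion_equiv (R := R) (M := M) I
  obtain ⟨hT1, hT2⟩ := free_of_pi_equiv he (Ψ₀.trans E0)
  obtain ⟨Ψ, hΨ⟩ := exists_rational_equiv (Q := Q) I ι Ψ₀
  refine ⟨inferInstance, inferInstance, ?_, fun g hg hgτ s f p hs hgf hp0 hp => ?_⟩
  · have := Ψ.finrank_eq
    rw [Module.finrank_pi_fintype, Finset.sum_const, Finset.card_univ, Fintype.card_fin,
      smul_eq_mul] at this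
    exact this.trans Module.finrank_baseChange
  · have hs' : algebraMap R Q s ≠ 0 := by
      rwa [Ne, IsFractionRing.to_map_eq_zero_iff]
    exact det_eq_of_baseChange_equiv he Ψ (ratTateMap Q I τ hτ g hg hgτ s) f
      (hΨ (tateMap I τ hτ g hg hgτ) g f _ hs' hgf (fun t => hΨ₀ g hg hgτ t)) p hp0 hp

end TateMain

/-! ### The local ring at infinity is a discrete valuation ring -/

section Curve

open Polynomial

variable {Fq A Q : Type u} [Field Fq] [Fintype Fq] [CommRing A] [IsDedekindDomain A]
  [Algebra Fq A] [Algebra.FiniteType Fq A] [Field Q] [Algebra Fq Q] [Algebra A Q]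
  [IsScalarTower Fq A Q] [IsFractionRing A Q]

variable (Fq A) in
omit [Fintype Fq] in
/-- Noether normalization for affine curves. -/
theorem exists_integral_coordinate :
    ∃ t : A, (aeval t : Fq[X] →ₐ[Fq] A).toRingHom.IsIntegral := by
  obtain ⟨s, g, hg, hint⟩ := exists_integral_inj_algHom_of_fg Fq A
  -- Two coordinates are impossible in dimension one: a prime of A over (X_i) is nonzero, hence
  -- maximal, so (X_i) would be maximal, but X_j has no inverse modulo X_i.
  have hs : ∀ i j : Fin s, i = j := by
    by_contra! h
    obtain ⟨i, j, hij⟩ := h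
    algebraize [g.toRingHom]
    have : Algebra.IsIntegral (MvPolynomial (Fin s) Fq) A := ⟨hint⟩
    let ε : MvPolynomial (Fin s) Fq →ₐ[Fq] Fq := MvPolynomial.aeval (fun _ => 0)
    let p : Ideal (MvPolynomial (Fin s) Fq) := Ideal.span {MvPolynomial.X i}
    have hp : p.IsPrime := (Ideal.span_singleton_prime (MvPolynomial.X_ne_zero i)).2
      (MvPolynomial.X_prime)
    obtain ⟨P, -, hP, hPp⟩ := Ideal.exists_ideal_over_prime_of_isIntegral p (⊥ : Ideal A) (by
      intro x hx
      rw [Ideal.mem_comap, Ideal.mem_bot] at hx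
      have : x = 0 := hg (hx.trans (map_zero g).symm)
      rw [this]; exact p.zero_mem)
    have hP0 : P ≠ ⊥ := by
      rintro rfl
      have h1 : MvPolynomial.X i ∈ p := Ideal.mem_span_singleton_self _
      rw [← hPp, Ideal.mem_comap, Ideal.mem_bot] at h1
      exact MvPolynomial.X_ne_zero i (hg (h1.trans (map_zero g).symm))
    have hPm : P.IsMaximal := hP.isMaximal hP0
    have hpm : p.IsMaximal := hPp ▸ Ideal.isMaximal_comap_of_isIntegral_of_isMaximal P
    have hj : MvPolynomial.X j ∉ p := by
      intro h
      obtain ⟨q, hq⟩ := Ideal.mem_span_singleton.1 h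
      have := congrArg (MvPolynomial.aeval (fun l => if l = j then (1 : Fq) else 0)) hq
      simp [hij] at this
    obtain ⟨y, w, hw, hy⟩ := hpm.exists_inv hj
    obtain ⟨q, rfl⟩ := Ideal.mem_span_singleton.1 hw
    have := congrArg ε hy
    simp [ε] at this
  obtain ⟨t, ht⟩ : ∃ t, ∀ i, g (MvPolynomial.X i) = t := by
    by_cases h : Nonempty (Fin s)
    · exact ⟨g (MvPolynomial.X h.some), fun i => by rw [hs i h.some]⟩
    · exact ⟨0, fun i => (h ⟨i⟩).elim⟩
  refine ⟨t, fun a => ?_⟩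
  have h1 : g = (aeval t).comp (MvPolynomial.aeval fun _ => (X : Fq[X])) := by
    ext i
    simp [ht]
  obtain ⟨p, hp, hpa⟩ := hint a
  refine ⟨p.map (MvPolynomial.aeval fun _ => (X : Fq[X])).toRingHom, hp.map _, ?_⟩
  rw [eval₂_map]
  rw [h1] at hpa
  exact hpa

omit [Fintype Fq] [IsDedekindDomain A] [Algebra.FiniteType Fq A] [Algebra Fq Q]
  [IsScalarTower Fq A Q] [IsFractionRing A Q] in
theorem isIntegral_of_coordinate {t : A} (ht : (aeval t : Fq[X] →ₐ[Fq] A).toRingHom.IsIntegral)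
    {S : Type u} [CommRing S] [Algebra S Q] (f : Fq[X] →+* S)
    (hf : (algebraMap S Q).comp f = (algebraMap A Q).comp (aeval t : Fq[X] →ₐ[Fq] A).toRingHom)
    (a : A) : IsIntegral S (algebraMap A Q a) := by
  obtain ⟨p, hp, hpa⟩ := ht a
  refine ⟨p.map f, hp.map _, ?_⟩
  rw [eval₂_map, hf, ← Polynomial.hom_eval₂, hpa, map_zero]

open IntermediateField in
omit [Fintype Fq] [IsDedekindDomain A] in
/-- The function field is finite over the field generated by a coordinate. -/
theorem finiteDimensional_of_coordinate {t : A}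
    (ht : (aeval t : Fq[X] →ₐ[Fq] A).toRingHom.IsIntegral) :
    FiniteDimensional (Fq⟮algebraMap A Q t⟯) Q := by
  let K₀ := Fq⟮algebraMap A Q t⟯
  have hint : ∀ a : A, IsIntegral K₀ (algebraMap A Q a) := by
    refine isIntegral_of_coordinate ht
      (aeval (AdjoinSimple.gen Fq (algebraMap A Q t)) : Fq[X] →ₐ[Fq] K₀).toRingHom ?_
    refine Polynomial.ringHom_ext (fun c => ?_) ?_
    · simp [IsScalarTower.algebraMap_apply Fq A Q]
    · simp
  obtain ⟨S, hS⟩ := ‹Algebra.FiniteType Fq A›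
  have h1 : FiniteDimensional K₀ (adjoin K₀ (algebraMap A Q '' (S : Set A))) :=
    finiteDimensional_adjoin (by rintro _ ⟨a, -, rfl⟩; exact hint a)
  have h2 : adjoin K₀ (algebraMap A Q '' (S : Set A)) = ⊤ := by
    rw [eq_top_iff]
    rintro q -
    have h3 : ∀ a : A, algebraMap A Q a ∈ adjoin K₀ (algebraMap A Q '' (S : Set A)) := by
      intro a
      have h4 : a ∈ Algebra.adjoin Fq (S : Set A) := hS ▸ Algebra.mem_top
      induction h4 using Algebra.adjoin_induction with
      | mem x hx => exact subset_adjoin _ _ ⟨x, hx, rfl⟩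
      | algebraMap c =>
        rw [← IsScalarTower.algebraMap_apply]
        exact (adjoin K₀ _).algebraMap_mem (algebraMap Fq K₀ c)
      | add x y _ _ hx hy => rw [map_add]; exact add_mem hx hy
      | mul x y _ _ hx hy => rw [map_mul]; exact mul_mem hx hy
    obtain ⟨a, s, -, rfl⟩ := IsFractionRing.div_surjective (A := A) q
    exact div_mem (h3 a) (h3 s)
  rw [h2] at h1
  exact Module.Finite.equiv (topEquiv (F := K₀) (E := Q)).toLinearEquiv

variable (P : PlaceAtInfty Fq A Q)

omit [Fintype Fq] [IsDedekindDomain A] [Algebra.FiniteType Fq A] [IsFractionRing A Q]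
  [Algebra Fq A] [IsScalarTower Fq A Q] in
theorem PlaceAtInfty.exists_notMem : ∃ a : A, algebraMap A Q a ∉ P.O := by
  by_contra! h
  exact (P.complement P.O P.ne_top).2 h rfl

omit [IsDedekindDomain A] [Algebra.FiniteType Fq A] [IsFractionRing A Q] in
-- If t were in O, then A, being integral over Fq[t], would be contained in the integrally closed
-- ring O.
theorem PlaceAtInfty.coordinate_notMem {t : A}
    (ht : (aeval t : Fq[X] →ₐ[Fq] A).toRingHom.IsIntegral) : algebraMap A Q t ∉ P.O := by
  intro h
  obtain ⟨a, ha⟩ := P.exists_notMem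
  let i : Fq →+* P.O := (algebraMap Fq Q).codRestrict P.O.toSubring P.algebraMap_mem
  have h1 := isIntegral_of_coordinate (S := P.O) (Q := Q) ht
    (Polynomial.eval₂RingHom i (⟨algebraMap A Q t, h⟩ : P.O)) (by
      refine Polynomial.ringHom_ext (fun c => ?_) ?_
      · simp [← IsScalarTower.algebraMap_apply Fq A Q]
        rfl
      · simp) a
  obtain ⟨b, hb⟩ := IsIntegrallyClosed.isIntegral_iff.1 h1
  exact ha (hb ▸ b.2)

omit [IsDedekindDomain A] [Algebra.FiniteType Fq A] [IsFractionRing A Q] [CommRing A]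
  [Algebra Fq A] [Algebra A Q] [IsScalarTower Fq A Q] in
theorem valuation_algebraMap [CommRing A] [Algebra A Q] (P : PlaceAtInfty Fq A Q) {c : Fq}
    (hc : c ≠ 0) : P.O.valuation (algebraMap Fq Q c) = 1 := by
  refine le_antisymm ((P.O.valuation_le_one_iff _).2 (P.algebraMap_mem c)) ?_
  have h1 := (P.O.valuation_le_one_iff _).2 (P.algebraMap_mem c⁻¹)
  rw [map_inv₀, map_inv₀] at h1
  have h2 : P.O.valuation (algebraMap Fq Q c) ≠ 0 := by simpa using hc
  exact (inv_le_one₀ (zero_lt_iff.2 h2)).1 h1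

variable {x : Q}

omit [IsDedekindDomain A] [Algebra.FiniteType Fq A] [IsFractionRing A Q] [Algebra Fq A]
  [IsScalarTower Fq A Q] in
/-- A nonzero polynomial in a function `x` vanishing at infinity is a power of `x` times a unit with
constant residue. -/
theorem PlaceAtInfty.aeval_eq (hx : P.O.valuation x < 1) {p : Fq[X]} (hp : p ≠ 0) :
    ∃ (k : ℕ) (u : Q) (c : Fq) (w : Q), c ≠ 0 ∧ w ∈ P.O ∧ u = algebraMap Fq Q c + x * w ∧
      P.O.valuation u = 1 ∧ aeval x p = x ^ k * u := by
  obtain ⟨q, hq, hq'⟩ := Polynomial.exists_eq_pow_rootMultiplicity_mul_and_not_dvd p hp 0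
  rw [map_zero, sub_zero] at hq hq'
  rw [X_dvd_iff] at hq'
  have hw : aeval x q.divX ∈ P.O := by
    rw [aeval_eq_sum_range]
    refine sum_mem fun i _ => ?_
    rw [Algebra.smul_def]
    exact mul_mem (P.algebraMap_mem _) (pow_mem ((P.O.valuation_le_one_iff _).1 hx.le) _)
  have h1 : aeval x q = algebraMap Fq Q (q.coeff 0) + x * aeval x q.divX := by
    conv_lhs => rw [← divX_mul_X_add q]
    rw [map_add, map_mul, aeval_X, aeval_C]; ring
  refine ⟨p.rootMultiplicity 0, aeval x q, q.coeff 0, _, hq', hw, h1, ?_, ?_⟩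
  · rw [h1, Valuation.map_add_eq_of_lt_left, valuation_algebraMap P hq']
    rw [valuation_algebraMap P hq', map_mul]
    exact mul_lt_one_of_nonneg_of_lt_one_left zero_le hx ((P.O.valuation_le_one_iff _).2 hw)
  · conv_lhs => rw [hq]
    rw [map_mul, map_pow, aeval_X]

open IntermediateField

omit [IsDedekindDomain A] [Algebra.FiniteType Fq A] [IsFractionRing A Q] [Algebra Fq A]
  [IsScalarTower Fq A Q] in
-- Numerator and denominator are powers of x times units with constant residue. The quotient lies in
-- O only if the exponent of x is nonnegative, and then it is constant modulo x.
theorem PlaceAtInfty.exists_residue (hx : P.O.valuation x < 1) (hx0 : x ≠ 0) {k : Q}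
    (hk : k ∈ Fq⟮x⟯) (hkO : k ∈ P.O) : ∃ c : Fq, ∃ y ∈ P.O, k - algebraMap Fq Q c = x * y := by
  obtain ⟨r, s, rfl⟩ := (mem_adjoin_simple_iff _ _).1 hk
  by_cases hr : aeval x r / aeval x s = 0
  · exact ⟨0, 0, P.O.zero_mem, by rw [hr]; simp⟩
  have hr0 : r ≠ 0 := by rintro rfl; simp at hr
  have hs0 : s ≠ 0 := by rintro rfl; simp at hr
  obtain ⟨a, u, c, u', hc, hu', hu, hvu, hra⟩ := P.aeval_eq hx hr0
  obtain ⟨b, w, d, w', hd, hw', hw, hvw, hsb⟩ := P.aeval_eq hx hs0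
  have hw0 : w ≠ 0 := by rintro rfl; simp at hvw
  have hu0 : u ≠ 0 := by rintro rfl; simp at hvu
  have hwO : w⁻¹ ∈ P.O := by
    rw [← P.O.valuation_le_one_iff, map_inv₀, hvw, inv_one]
  have huO : u ∈ P.O := by rw [← P.O.valuation_le_one_iff, hvu]
  have hxO : x ∈ P.O := (P.O.valuation_le_one_iff _).1 hx.le
  rw [hra, hsb] at hkO ⊢
  rcases lt_trichotomy a b with h | h | h
  · exfalso
    obtain ⟨i, rfl⟩ := Nat.exists_eq_add_of_lt h
    have h1 : u = x ^ (i + 1) * w * (x ^ a * u / (x ^ (a + i + 1) * w)) := by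
      rw [mul_div_assoc', eq_div_iff (mul_ne_zero (pow_ne_zero _ hx0) hw0)]
      ring
    have h2 := congrArg P.O.valuation h1
    rw [hvu, map_mul, map_mul, hvw, mul_one, map_pow] at h2
    have h3 := (P.O.valuation_le_one_iff _).2 hkO
    have h4 : P.O.valuation x ^ (i + 1) < 1 := pow_lt_one₀ zero_le hx (Nat.succ_ne_zero i)
    exact absurd h2 (mul_lt_one_of_nonneg_of_lt_one_left zero_le h4 h3).ne'
  · subst h
    have hd0 : algebraMap Fq Q d ≠ 0 := by simpa using hd
    refine ⟨c / d, (u' * algebraMap Fq Q d - algebraMap Fq Q c * w') *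
      (w⁻¹ * algebraMap Fq Q d⁻¹), mul_mem (sub_mem (mul_mem hu' (P.algebraMap_mem d))
        (mul_mem (P.algebraMap_mem c) hw')) (mul_mem hwO (P.algebraMap_mem _)), ?_⟩
    rw [map_div₀, map_inv₀]
    field_simp
    rw [hu, hw]; ring
  · obtain ⟨i, rfl⟩ := Nat.exists_eq_add_of_lt h
    refine ⟨0, x ^ i * u * w⁻¹, mul_mem (mul_mem (pow_mem hxO _) huO) hwO, ?_⟩
    rw [map_zero, sub_zero, div_eq_iff (mul_ne_zero (pow_ne_zero _ hx0) hw0)]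
    field_simp
    ring

omit [IsDedekindDomain A] [Algebra.FiniteType Fq A] [IsFractionRing A Q] [Algebra Fq A]
  [IsScalarTower Fq A Q] in
/-- Functions which are linearly independent modulo `x` are linearly independent over `Fq(x)`. -/
theorem PlaceAtInfty.linearIndependent_of_residue (hx : P.O.valuation x < 1) (hx0 : x ≠ 0) {m : ℕ}
    {o : Fin m → Q} (ho : ∀ j, o j ∈ P.O)
    (hind : ∀ c : Fin m → Fq, (∃ y ∈ P.O, ∑ j, algebraMap Fq Q (c j) * o j = x * y) → c = 0) :
    LinearIndependent (Fq⟮x⟯) o := by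
  rw [Fintype.linearIndependent_iff]
  intro g hg
  by_contra! hne
  obtain ⟨i, hi⟩ := hne
  -- After division by a coefficient of maximal valuation all coefficients lie in O and have
  -- residues in Fq modulo x. The residue at j₀ is 1, so a nontrivial relation modulo x would
  -- result.
  obtain ⟨j₀, -, hj₀⟩ := Finset.exists_max_image Finset.univ
    (fun j => P.O.valuation (g j : Q)) ⟨i, Finset.mem_univ i⟩
  have hgj : (g j₀ : Q) ≠ 0 := by
    intro h
    have h1 := hj₀ i (Finset.mem_univ i)
    rw [h, map_zero, le_zero_iff, map_eq_zero] at h1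
    exact hi (Subtype.ext h1)
  have h1 : ∀ j, ∃ c : Fq, ∃ y ∈ P.O, (g j / g j₀ : Q) - algebraMap Fq Q c = x * y := by
    intro j
    refine P.exists_residue hx hx0 (div_mem (g j).2 (g j₀).2) ?_
    rw [← P.O.valuation_le_one_iff, map_div₀]
    exact div_le_one_of_le₀ (hj₀ j (Finset.mem_univ j)) zero_le
  choose c y hy hc using h1
  have h2 : c = 0 := by
    refine hind c ⟨-∑ j, y j * o j, neg_mem (sum_mem fun j _ => mul_mem (hy j) (ho j)), ?_⟩
    have h3 : ∑ j, (g j / g j₀ : Q) * o j = 0 := by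
      have : ∑ j, (g j : Q) * o j = 0 := hg
      simp only [div_mul_eq_mul_div, ← Finset.sum_div, this, zero_div]
    have h4 : ∀ j, algebraMap Fq Q (c j) = (g j / g j₀ : Q) - x * y j := fun j => by
      rw [← hc]; ring
    simp only [h4, sub_mul, Finset.sum_sub_distrib, h3, mul_assoc, ← Finset.mul_sum]
    ring
  have h5 := hc j₀
  rw [h2, Pi.zero_apply, map_zero, sub_zero, div_self hgj] at h5
  have h6 := congrArg P.O.valuation h5
  rw [map_one, map_mul] at h6
  exact absurd h6 (mul_lt_one_of_nonneg_of_lt_one_left zero_le hx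
    ((P.O.valuation_le_one_iff _).2 (hy j₀))).ne'

omit [IsDedekindDomain A] [Algebra.FiniteType Fq A] [IsFractionRing A Q] [Algebra Fq A]
  [IsScalarTower Fq A Q] in
-- By `PlaceAtInfty.linearIndependent_of_residue` a family independent modulo x has at most [Q :
-- Fq(x)] members; a longest one spans O modulo x.
theorem PlaceAtInfty.exists_residue_basis (hx : P.O.valuation x < 1) (hx0 : x ≠ 0)
    [FiniteDimensional (Fq⟮x⟯) Q] :
    ∃ (m : ℕ) (o : Fin m → Q), (∀ j, o j ∈ P.O) ∧
      (∀ c : Fin m → Fq, (∃ y ∈ P.O, ∑ j, algebraMap Fq Q (c j) * o j = x * y) → c = 0) ∧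
      ∀ q ∈ P.O, ∃ c : Fin m → Fq, ∃ y ∈ P.O, q = ∑ j, algebraMap Fq Q (c j) * o j + x * y := by
  classical
  let p : ℕ → Prop := fun m => ∃ o : Fin m → Q, (∀ j, o j ∈ P.O) ∧
      (∀ c : Fin m → Fq, (∃ y ∈ P.O, ∑ j, algebraMap Fq Q (c j) * o j = x * y) → c = 0)
  have hp0 : p 0 := ⟨Fin.elim0, fun j => j.elim0, fun c _ => Subsingleton.elim _ _⟩
  have hple : ∀ m, p m → m ≤ Module.finrank (Fq⟮x⟯) Q := by
    rintro m ⟨o, ho, hind⟩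
    simpa using (P.linearIndependent_of_residue hx hx0 ho hind).fintype_card_le_finrank
  obtain ⟨m, hm⟩ : ∃ m, m = Nat.findGreatest p (Module.finrank (Fq⟮x⟯) Q) := ⟨_, rfl⟩
  obtain ⟨o, ho, hind⟩ : p m := hm ▸ Nat.findGreatest_spec (Nat.zero_le _) hp0
  refine ⟨m, o, ho, hind, fun q hq => ?_⟩
  have hnot : ¬ p (m + 1) := fun h =>
    Nat.findGreatest_is_greatest (hm ▸ Nat.lt_succ_self m) (hple _ h) h
  simp only [p, not_exists, not_and] at hnot
  have h1 := hnot (Fin.cons q o) (fun j => by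
    refine Fin.cases ?_ (fun j => ?_) j
    · exact hq
    · exact ho j)
  push Not at h1
  obtain ⟨c, ⟨y, hy, hc⟩, hc0⟩ := h1
  rw [Fin.sum_univ_succ] at hc
  simp only [Fin.cons_zero, Fin.cons_succ] at hc
  have hc1 : c 0 ≠ 0 := by
    intro h
    rw [h, map_zero, zero_mul, zero_add] at hc
    have h2 := hind (fun j => c j.succ) ⟨y, hy, hc⟩
    refine hc0 (funext fun j => ?_)
    refine Fin.cases h (fun j => ?_) j
    exact congrFun h2 j
  have hc1' : algebraMap Fq Q (c 0) ≠ 0 := by simpa using hc1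
  refine ⟨fun j => -((c 0)⁻¹ * c j.succ), algebraMap Fq Q (c 0)⁻¹ * y,
    mul_mem (P.algebraMap_mem _) hy, ?_⟩
  have h3 : ∑ j : Fin m, algebraMap Fq Q (-((c 0)⁻¹ * c j.succ)) * o j =
      - (algebraMap Fq Q (c 0))⁻¹ * ∑ j : Fin m, algebraMap Fq Q (c j.succ) * o j := by
    rw [Finset.mul_sum]
    refine Finset.sum_congr rfl fun j _ => ?_
    rw [map_neg, map_mul, map_inv₀]; ring
  rw [h3, map_inv₀]
  field_simp
  linear_combination hc

/-- A function `t` on the affine curve over whose field of rational functions `Q` is finite. -/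
theorem PlaceAtInfty.exists_coordinate :
    ∃ t : A, algebraMap A Q t ≠ 0 ∧ P.O.valuation (algebraMap A Q t)⁻¹ < 1 ∧
      FiniteDimensional (Fq⟮(algebraMap A Q t)⁻¹⟯) Q := by
  obtain ⟨t, ht⟩ := exists_integral_coordinate Fq A
  have h1 := P.coordinate_notMem ht
  have h0 : algebraMap A Q t ≠ 0 := fun h => h1 (h ▸ P.O.zero_mem)
  refine ⟨t, h0, ?_, ?_⟩
  · rw [← P.O.valuation_le_one_iff, not_le] at h1
    rw [map_inv₀]
    exact inv_lt_one_of_one_lt₀ h1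
  · have h2 : Fq⟮(algebraMap A Q t)⁻¹⟯ = Fq⟮algebraMap A Q t⟯ := by
      refine le_antisymm (adjoin_simple_le_iff.2 (inv_mem (mem_adjoin_simple_self Fq _)))
        (adjoin_simple_le_iff.2 ?_)
      have := inv_mem (mem_adjoin_simple_self Fq (algebraMap A Q t)⁻¹)
      rwa [inv_inv] at this
    rw [h2]
    exact finiteDimensional_of_coordinate ht

omit [IsDedekindDomain A] [Algebra.FiniteType Fq A] [IsFractionRing A Q] [Algebra Fq A]
  [IsScalarTower Fq A Q] in
open scoped algebraAdjoinAdjoin in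
-- An algebraic equation of y over Fq[x] with nonzero constant term makes this constant term a
-- multiple of y in O, and the constant term is a power of x up to a unit.
theorem PlaceAtInfty.dvd_pow (hx : P.O.valuation x < 1) [FiniteDimensional (Fq⟮x⟯) Q] {y : Q}
    (hy : y ∈ P.O) (hy0 : y ≠ 0) : ∃ k : ℕ, ∃ w ∈ P.O, x ^ k = y * w := by
  have hxO : x ∈ P.O := (P.O.valuation_le_one_iff _).1 hx.le
  have h1 : Algebra.IsAlgebraic (Algebra.adjoin Fq {x}) Q :=
    IsFractionRing.comap_isAlgebraic_iff.2
      (inferInstance : Algebra.IsAlgebraic (Fq⟮x⟯) Q)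
  obtain ⟨q, hq0, hq⟩ := (h1.isAlgebraic y).exists_nonzero_coeff_and_aeval_eq_zero
    (mem_nonZeroDivisors_of_ne_zero hy0)
  have hR : ∀ r : Algebra.adjoin Fq {x}, (r : Q) ∈ P.O := by
    intro r
    obtain ⟨p, hp⟩ := (Algebra.adjoin_singleton_eq_range_aeval Fq x).le r.2
    rw [← hp]
    change aeval x p ∈ P.O
    rw [aeval_eq_sum_range]
    refine sum_mem fun i _ => ?_
    rw [Algebra.smul_def]
    exact mul_mem (P.algebraMap_mem _) (pow_mem hxO _)
  have hw : aeval y q.divX ∈ P.O := by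
    rw [aeval_eq_sum_range]
    refine sum_mem fun i _ => ?_
    rw [Algebra.smul_def]
    exact mul_mem (hR _) (pow_mem hy _)
  have h2 : ((q.coeff 0 : Algebra.adjoin Fq {x}) : Q) = y * -aeval y q.divX := by
    have h3 : aeval y q = y * aeval y q.divX + ((q.coeff 0 : Algebra.adjoin Fq {x}) : Q) := by
      conv_lhs => rw [← divX_mul_X_add q]
      rw [map_add, map_mul, aeval_X, aeval_C, mul_comm]; rfl
    rw [hq] at h3
    linear_combination -h3
  obtain ⟨p, hp⟩ := (Algebra.adjoin_singleton_eq_range_aeval Fq x).le (q.coeff 0).2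
  replace hp : aeval x p = ((q.coeff 0 : Algebra.adjoin Fq {x}) : Q) := hp
  have hp0 : p ≠ 0 := by
    rintro rfl
    rw [map_zero] at hp
    exact hq0 (Subtype.ext hp.symm)
  obtain ⟨k, u, -, -, -, -, -, hu, hpu⟩ := P.aeval_eq hx hp0
  have hu0 : u ≠ 0 := by rintro rfl; simp at hu
  refine ⟨k, -aeval y q.divX * u⁻¹, mul_mem (neg_mem hw) ?_, ?_⟩
  · rw [← P.O.valuation_le_one_iff, map_inv₀, hu, inv_one]
  · rw [← mul_assoc, ← h2, ← hp, hpu, mul_assoc, mul_inv_cancel₀ hu0, mul_one]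

omit [IsDedekindDomain A] [Algebra.FiniteType Fq A] [IsFractionRing A Q] [Algebra Fq A]
  [IsScalarTower Fq A Q] in
/-- The ring `O / x` has `q ^ m` elements if it has an `Fq`-basis of length `m`. -/
theorem PlaceAtInfty.card_quotient (hx : P.O.valuation x < 1) {m : ℕ} {o : Fin m → Q}
    (ho : ∀ j, o j ∈ P.O)
    (hind : ∀ c : Fin m → Fq, (∃ y ∈ P.O, ∑ j, algebraMap Fq Q (c j) * o j = x * y) → c = 0)
    (hspan : ∀ q ∈ P.O, ∃ c : Fin m → Fq, ∃ y ∈ P.O,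
      q = ∑ j, algebraMap Fq Q (c j) * o j + x * y) :
    Nat.card (P.O ⧸ Ideal.span {(⟨x, (P.O.valuation_le_one_iff _).1 hx.le⟩ : P.O)}) =
      Fintype.card Fq ^ m := by
  let F : (Fin m → Fq) → P.O ⧸ Ideal.span {(⟨x, (P.O.valuation_le_one_iff _).1 hx.le⟩ : P.O)} :=
    fun c => Ideal.Quotient.mk _ ⟨∑ j, algebraMap Fq Q (c j) * o j,
      sum_mem fun j _ => mul_mem (P.algebraMap_mem _) (ho j)⟩
  have hF : Function.Bijective F := by
    refine ⟨fun c c' h => ?_, fun q => ?_⟩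
    · obtain ⟨y, hy⟩ := Ideal.mem_span_singleton.1 (Ideal.Quotient.eq.1 h)
      refine sub_eq_zero.1 (hind (c - c') ⟨y, y.2, ?_⟩)
      refine Eq.trans ?_ (congrArg Subtype.val hy)
      simp only [Pi.sub_apply, map_sub, sub_mul, Finset.sum_sub_distrib]
      rfl
    · obtain ⟨q, rfl⟩ := Ideal.Quotient.mk_surjective q
      obtain ⟨c, y, hy, hq⟩ := hspan q q.2
      refine ⟨c, (Ideal.Quotient.eq.2 (Ideal.mem_span_singleton.2 ⟨⟨y, hy⟩, ?_⟩)).symm⟩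
      refine Subtype.ext ?_
      change (q : Q) - _ = x * y
      rw [hq]; ring
  rw [← Nat.card_congr (Equiv.ofBijective F hF)]
  simp [Nat.card_eq_fintype_card]

/-- All quotients O / x^k are finite, and every nonzero ideal contains some x^k by
`PlaceAtInfty.dvd_pow`; hence ideals are finitely generated. A noetherian valuation ring that is not
a field is discrete. -/
theorem PlaceAtInfty.isDiscreteValuationRing : IsDiscreteValuationRing P.O := by
  obtain ⟨t, h0, hx, hfd⟩ := P.exists_coordinate
  obtain ⟨x, hxdef⟩ : ∃ x, x = (algebraMap A Q t)⁻¹ := ⟨_, rfl⟩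
  rw [← hxdef] at hx hfd
  have hx0 : x ≠ 0 := hxdef ▸ inv_ne_zero h0
  obtain ⟨m, o, ho, hind, hspan⟩ := P.exists_residue_basis hx hx0
  have hcard := P.card_quotient hx ho hind hspan
  obtain ⟨X', hX'⟩ : ∃ X' : P.O, X' = ⟨x, (P.O.valuation_le_one_iff _).1 hx.le⟩ := ⟨_, rfl⟩
  rw [← hX'] at hcard
  have hfin : Finite (P.O ⧸ Ideal.span {X'}) :=
    Nat.finite_of_card_ne_zero (hcard ▸ pow_ne_zero _ Fintype.card_ne_zero)
  have hN : IsNoetherianRing P.O := by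
    refine ⟨fun I => ?_⟩
    by_cases hI : I = ⊥
    · rw [hI]; exact Submodule.fg_bot
    obtain ⟨y, hyI, hy0⟩ := Submodule.exists_mem_ne_zero_of_ne_bot hI
    obtain ⟨k, w, hw, hk⟩ := P.dvd_pow hx y.2 (fun h => hy0 (Subtype.ext h))
    have hkI : Ideal.span {X'} ^ k ≤ I := by
      rw [Ideal.span_singleton_pow, Ideal.span_singleton_le_iff_mem]
      have : X' ^ k = ⟨w, hw⟩ * y := by
        refine Subtype.ext ?_
        rw [hX']
        exact hk.trans (mul_comm _ _)
      rw [this]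
      exact I.smul_mem _ hyI
    have hfin' : Finite (P.O ⧸ Ideal.span {X'} ^ k) :=
      Ideal.finite_quotient_pow ⟨{X'}, by simp⟩ k
    refine Submodule.fg_of_fg_map_of_fg_inf_ker (Submodule.mkQ (Ideal.span {X'} ^ k)) ?_ ?_
    · exact Submodule.FG.of_finite
    · rw [Submodule.ker_mkQ, inf_eq_right.2 hkI, Ideal.span_singleton_pow]
      exact ⟨{X' ^ k}, by simp⟩
  have hne : IsLocalRing.maximalIdeal P.O ≠ ⊥ := by
    intro h
    have h1 : X' ∈ IsLocalRing.maximalIdeal P.O := by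
      rw [P.O.valuation_lt_one_iff, hX']; exact hx
    rw [h, Ideal.mem_bot, hX'] at h1
    exact hx0 (congrArg Subtype.val h1)
  exact { not_a_field' := hne }

end Curve

/-! ### Lattices as R-modules -/

section Lattices

variable {R Q L U : Type u} [CommRing R] [IsDomain R] [Field Q] [Algebra R Q] [IsFractionRing R Q]
  [Field L] [AddCommGroup U] [Module Q U] [Module L U] [SMulCommClass Q L U]

omit [IsDomain R] [IsFractionRing R Q] in
-- As L is finite, the L-multiples of the finitely many generators over R ⊗ L form a finite set of
-- generators over R.
theorem BiSub.IsLattice.finite [Finite L] {N : BiSub R Q L U} (h : N.IsLattice) :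
    Module.Finite R N.toSubmodule := by
  classical
  obtain ⟨S, hS⟩ := h.1
  have hSN : ∀ s ∈ S, s ∈ N.toSubmodule := fun s hs => by
    rw [hS]
    exact Submodule.subset_span ⟨1, s, hs, by rw [map_one, one_smul]⟩
  let T : Set N.toSubmodule := Set.range fun p : L × S =>
    ⟨p.1 • p.2, N.toSubmodule.smul_mem _ (hSN p.2 p.2.2)⟩
  refine ⟨(Submodule.fg_def).2 ⟨T, Set.finite_range _, ?_⟩⟩
  rw [eq_top_iff]
  rintro ⟨x, hx⟩ -
  have hx' := hx
  rw [hS, ← Submodule.mem_toAddSubmonoid, Submodule.span_eq_closure] at hx'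
  suffices H : ∃ y ∈ Submodule.span R T, (y : U) = x by
    obtain ⟨y, hy, rfl⟩ := H
    exact hy
  clear hx
  induction hx' using AddSubmonoid.closure_induction with
  | mem x hx =>
    obtain ⟨b, -, _, ⟨a, s, hs, rfl⟩, rfl⟩ := hx
    exact ⟨a • ⟨b • s, N.toSubmodule.smul_mem _ (hSN s hs)⟩,
      Submodule.smul_mem _ _ (Submodule.subset_span ⟨(b, ⟨s, hs⟩), rfl⟩), by
        rw [BiSub.coe_smulR, smul_comm]⟩
  | zero => exact ⟨0, Submodule.zero_mem _, rfl⟩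
  | add x y _ _ hx hy =>
    obtain ⟨x', hx', rfl⟩ := hx
    obtain ⟨y', hy', rfl⟩ := hy
    exact ⟨x' + y', Submodule.add_mem _ hx' hy', rfl⟩

theorem BiSub.IsLattice.exists_smul_mem {N : BiSub R Q L U} (h : N.IsLattice) (y : U) :
    ∃ s : R, s ≠ 0 ∧ algebraMap R Q s • y ∈ N.toSubmodule := by
  have hy : y ∈ Submodule.span L {y : U | ∃ a : Q, ∃ x ∈ N.toSubmodule, y = a • x} :=
    h.2 ▸ Submodule.mem_top
  induction hy using Submodule.span_induction with
  | mem x hx =>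
    obtain ⟨q, x, hx, rfl⟩ := hx
    obtain ⟨a, s, hs, rfl⟩ := IsFractionRing.div_surjective (A := R) q
    have hs0 : s ≠ 0 := nonZeroDivisors.ne_zero hs
    refine ⟨s, hs0, ?_⟩
    rw [smul_smul, mul_div_cancel₀ _ (by rwa [Ne, IsFractionRing.to_map_eq_zero_iff])]
    exact N.r_smul_mem a x hx
  | zero => exact ⟨1, one_ne_zero, by rw [smul_zero]; exact N.toSubmodule.zero_mem⟩
  | add x y _ _ hx hy =>
    obtain ⟨s, hs, hx⟩ := hx
    obtain ⟨s', hs', hy⟩ := hy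
    refine ⟨s * s', mul_ne_zero hs hs', ?_⟩
    rw [smul_add]
    refine N.toSubmodule.add_mem ?_ ?_
    · rw [mul_comm, map_mul, mul_smul]
      exact N.r_smul_mem _ _ hx
    · rw [map_mul, mul_smul]
      exact N.r_smul_mem _ _ hy
  | smul b x _ hx =>
    obtain ⟨s, hs, hx⟩ := hx
    exact ⟨s, hs, by rw [smul_comm]; exact N.toSubmodule.smul_mem b hx⟩

omit [IsFractionRing R Q] [SMulCommClass Q L U] in
/-- A family of finitely many vectors has a common denominator. -/
theorem exists_common_denominator {N : BiSub R Q L U}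
    (h : ∀ y : U, ∃ s : R, s ≠ 0 ∧ algebraMap R Q s • y ∈ N.toSubmodule) (T : Finset U) :
    ∃ s : R, s ≠ 0 ∧ ∀ y ∈ T, algebraMap R Q s • y ∈ N.toSubmodule := by
  classical
  choose s hs hsy using h
  refine ⟨∏ y ∈ T, s y, Finset.prod_ne_zero_iff.2 fun y _ => hs y, fun y hy => ?_⟩
  rw [← Finset.prod_erase_mul T s hy, map_mul, mul_smul]
  exact N.r_smul_mem _ _ (hsy y)

theorem isLocalizedModule_of_injective {M : Type u} [AddCommGroup M] [Module R M] [Module R U]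
    [IsScalarTower R Q U] (ι : M →ₗ[R] U) (hι : Function.Injective ι)
    (h : ∀ y : U, ∃ s : R, s ≠ 0 ∧ ∃ x : M, algebraMap R Q s • y = ι x) :
    IsLocalizedModule R⁰ ι where
  map_units s := by
    have hs : algebraMap R Q s ≠ 0 := by
      rw [Ne, IsFractionRing.to_map_eq_zero_iff]
      exact nonZeroDivisors.ne_zero s.2
    rw [Module.End.isUnit_iff]
    refine ⟨fun x y hxy => ?_, fun y => ⟨(algebraMap R Q s)⁻¹ • y, ?_⟩⟩
    · simp only [Module.algebraMap_end_apply] at hxy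
      have e : ∀ z : U, (s : R) • z = algebraMap R Q s • z := fun z => (algebraMap_smul Q _ z).symm
      rw [e, e] at hxy
      exact smul_right_injective _ hs hxy
    · rw [Module.algebraMap_end_apply, ← algebraMap_smul Q, smul_smul, mul_inv_cancel₀ hs, one_smul]
  surj y := by
    obtain ⟨s, hs, x, hx⟩ := h y
    refine ⟨(x, ⟨s, mem_nonZeroDivisors_of_ne_zero hs⟩), ?_⟩
    rw [← hx, algebraMap_smul]; rfl
  exists_of_eq {x y} hxy := ⟨1, by rw [hι hxy]⟩

omit [SMulCommClass Q L U] [IsDomain R] in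
theorem finiteDimensional_of_finite (N : BiSub R Q L U) [Module.Finite R N.toSubmodule]
    (h : ∀ y : U, ∃ s : R, s ≠ 0 ∧ algebraMap R Q s • y ∈ N.toSubmodule) :
    FiniteDimensional Q U := by
  obtain ⟨T, hT⟩ := Module.Finite.fg_top (R := R) (M := N.toSubmodule)
  classical
  refine ⟨⟨T.image Subtype.val, eq_top_iff.2 fun y _ => ?_⟩⟩
  have h1 : ∀ x : N.toSubmodule, (x : U) ∈ Submodule.span Q (T.image Subtype.val : Set U) := by
    intro x
    have hx : x ∈ Submodule.span R (T : Set N.toSubmodule) := hT ▸ Submodule.mem_top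
    induction hx using Submodule.span_induction with
    | mem x hx => exact Submodule.subset_span (by simpa using hx)
    | zero => exact Submodule.zero_mem _
    | add x y _ _ hx hy => exact Submodule.add_mem _ hx hy
    | smul a x _ hx => rw [BiSub.coe_smulR]; exact Submodule.smul_mem _ _ hx
  obtain ⟨s, hs, hy⟩ := h y
  have hs' : algebraMap R Q s ≠ 0 := by rwa [Ne, IsFractionRing.to_map_eq_zero_iff]
  have h2 := Submodule.smul_mem _ (algebraMap R Q s)⁻¹ (h1 ⟨_, hy⟩)
  rwa [smul_smul, inv_mul_cancel₀ hs', one_smul] at h2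

omit [SMulCommClass Q L U] in
theorem BiSub.isTorsionFree (N : BiSub R Q L U) : Module.IsTorsionFree R N.toSubmodule := by
  refine ⟨fun r hr x y hxy => Subtype.ext ?_⟩
  have h := congrArg Subtype.val hxy
  simp only [BiSub.coe_smulR] at h
  have hr' : algebraMap R Q r ≠ 0 := by
    rw [Ne, IsFractionRing.to_map_eq_zero_iff]
    exact hr.ne_zero
  exact smul_right_injective U hr' h

end Lattices

/-! ### Tate modules of lattices -/

section Tate

variable {R Q L U : Type u} [CommRing R] [IsDedekindDomain R] [Field Q] [Algebra R Q]
  [IsFractionRing R Q] [Field L] [AddCommGroup U] [Module Q U] [Module L U] [SMulCommClass Q L U]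
  {Fq : Type u} [Field Fq] [Fintype Fq] [Algebra Fq L] [Finite L]
  [Infinite Q]

theorem BiSub.tate_free_and_det (N : BiSub R Q L U) [Module.Finite R N.toSubmodule]
    (hN : ∀ y : U, ∃ s : R, s ≠ 0 ∧ algebraMap R Q s • y ∈ N.toSubmodule)
    (I : Ideal R) [hI : I.IsMaximal] [Finite (R ⧸ I)] (h0 : I ≠ ⊥)
    (τ : N.toSubmodule →ₗ[R] N.toSubmodule)
    (hτ : ∀ (b : L) (x : N.toSubmodule), τ (b • x) = b ^ Fintype.card Fq • τ x)
    (hsurj : ∃ s ∉ I, ∀ x : N.toSubmodule, ∃ y, τ y = s • x) :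
    Module.Finite (ComplField Q I) (ratTateModule Q I τ hτ) ∧
    Module.Free (ComplField Q I) (ratTateModule Q I τ hτ) ∧
    Module.finrank Fq L * Module.finrank (ComplField Q I) (ratTateModule Q I τ hτ) =
      Module.finrank Q U ∧
    ∀ (g : N.toSubmodule →ₗ[R] N.toSubmodule) (hg : ∀ (b : L) (x), g (b • x) = b • g x)
      (hgτ : ∀ x, g (τ x) = τ (g x)) (s : R) (f : Module.End Q U) (p : Polynomial Q),
      s ≠ 0 → (∀ x, (g x : U) = algebraMap R Q s • f x) → p.eval 0 = 1 →
      (∀ q : Q, p.eval q ^ Module.finrank Fq L = LinearMap.det (1 + q • (f - 1))) →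
      LinearMap.det (ratTateMap Q I τ hτ g hg hgτ s) = toCompl Q I (p.eval 1) := by
  let _ : Module R U := Module.compHom U (algebraMap R Q)
  have : IsScalarTower R Q U := ⟨fun a q x => by rw [Algebra.smul_def, mul_smul]; rfl⟩
  let ι : N.toSubmodule →ₗ[R] U :=
    { toFun := Subtype.val, map_add' := fun _ _ => rfl, map_smul' := fun _ _ => rfl }
  have hι : IsLocalizedModule R⁰ ι := isLocalizedModule_of_injective (Q := Q) ι
    Subtype.val_injective (fun y => by
      obtain ⟨s, hs, hy⟩ := hN y
      exact ⟨s, hs, ⟨_, hy⟩, rfl⟩)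
  have := N.isTorsionFree
  have := finiteDimensional_of_finite N hN
  refine AndersonMotive.tate_free_and_det I h0 ι τ hτ fun n x => ?_
  obtain ⟨s, hs, hsx⟩ := hsurj
  -- An element s outside I is invertible modulo Iⁿ, so an image of τ containing all multiples of s
  -- is everything modulo Iⁿ.
  obtain ⟨a, i, hi, hai⟩ : ∃ a : R, ∃ i ∈ I ^ n, a * s + i = 1 := by
    have h1 : Ideal.span {s} ⊔ I = ⊤ := by
      by_contra hne
      refine hs ?_
      exact (hI.eq_of_le hne le_sup_right).ge
        (Ideal.mem_sup_left (Ideal.mem_span_singleton_self s))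
    have h2 : Ideal.span {s} ⊔ I ^ n = ⊤ := Ideal.sup_pow_eq_top h1
    obtain ⟨u, hu, i, hi, hui⟩ := Submodule.mem_sup.1 ((Ideal.eq_top_iff_one _).1 h2)
    obtain ⟨a, rfl⟩ := Ideal.mem_span_singleton'.1 hu
    exact ⟨a, i, hi, hui⟩
  obtain ⟨y, hy⟩ := hsx (a • x)
  refine ⟨y, ?_⟩
  have h3 : τ y - x = -(i • x) := by
    rw [hy, smul_smul, mul_comm, ← sub_eq_iff_eq_add.2 hai.symm]
    rw [sub_smul, one_smul]; abel
  rw [h3]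
  exact Submodule.neg_mem _ (Submodule.smul_mem_smul hi Submodule.mem_top)

end Tate

theorem finite_quotient_of_isMaximal (Fq : Type*) {A : Type*} [Field Fq] [Finite Fq] [CommRing A]
    [Algebra Fq A] [Algebra.FiniteType Fq A] (v : Ideal A) [hv : v.IsMaximal] :
    Finite (A ⧸ v) := by
  let _ : Field (A ⧸ v) := Ideal.Quotient.field v
  have : Algebra.FiniteType Fq (A ⧸ v) := .of_surjective (Ideal.Quotient.mkₐ Fq v)
    Ideal.Quotient.mk_surjective
  have : Module.Finite Fq (A ⧸ v) := finite_of_finite_type_of_isJacobsonRing Fq (A ⧸ v)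
  exact Module.finite_of_finite Fq

/-! ### Uniformizers, residue fields, and functions without poles -/

section Places

variable {Fq A Q : Type u} [Field Fq] [Fintype Fq] [CommRing A] [IsDedekindDomain A]
  [Algebra Fq A] [Algebra.FiniteType Fq A] [Field Q] [Algebra Fq Q] [Algebra A Q]
  [IsScalarTower Fq A Q] [IsFractionRing A Q]

namespace PlaceAtInfty

variable (P : PlaceAtInfty Fq A Q)

omit [Fintype Fq] [IsDedekindDomain A] [Algebra.FiniteType Fq A] [IsFractionRing A Q]
  [Algebra Fq A] [IsScalarTower Fq A Q] in
theorem mem_maximalIdeal_iff (x : P.O) :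
    x ∈ IsLocalRing.maximalIdeal P.O ↔ (x : Q) ∈ P.O.nonunits := by
  rw [P.O.valuation_lt_one_iff, ValuationSubring.mem_nonunits_iff]

omit [IsDedekindDomain A] [Algebra.FiniteType Fq A] [IsFractionRing A Q]
  [Algebra Fq A] [IsScalarTower Fq A Q] in
theorem card_residue :
    Nat.card (P.O ⧸ IsLocalRing.maximalIdeal P.O) = Fintype.card Fq := by
  let i : Fq →+* P.O := (algebraMap Fq Q).codRestrict P.O.toSubring P.algebraMap_mem
  have hs : Function.Surjective ((Ideal.Quotient.mk (IsLocalRing.maximalIdeal P.O)).comp i) := by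
    intro y
    obtain ⟨x, rfl⟩ := Ideal.Quotient.mk_surjective y
    obtain ⟨a, ha⟩ := P.rational x x.2
    exact ⟨a, (Ideal.Quotient.eq.2 ((P.mem_maximalIdeal_iff _).2 ha)).symm⟩
  rw [← Nat.card_congr (Equiv.ofBijective _ ⟨RingHom.injective _, hs⟩), Nat.card_eq_fintype_card]

omit [IsDedekindDomain A] [Algebra.FiniteType Fq A] [IsFractionRing A Q]
  [Algebra Fq A] [IsScalarTower Fq A Q] in
theorem finite_residue : Finite (P.O ⧸ IsLocalRing.maximalIdeal P.O) :=
  Nat.finite_of_card_ne_zero (P.card_residue ▸ Fintype.card_ne_zero)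

omit [Fintype Fq] [IsDedekindDomain A] [Algebra.FiniteType Fq A] [IsFractionRing A Q]
  [Algebra Fq A] [IsScalarTower Fq A Q] in
theorem IsUniformizer.maximalIdeal_eq {P : PlaceAtInfty Fq A Q} {z : Q} (hz : P.IsUniformizer z) :
    IsLocalRing.maximalIdeal P.O = Ideal.span {⟨z, ValuationSubring.nonunits_subset hz.1⟩} := by
  refine le_antisymm (fun x hx => ?_) ?_
  · obtain ⟨y, hy, hxy⟩ := hz.2 x ((P.mem_maximalIdeal_iff x).1 hx)
    exact Ideal.mem_span_singleton.2 ⟨⟨y, hy⟩, Subtype.ext hxy⟩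
  · rw [Ideal.span_singleton_le_iff_mem]
    exact (P.mem_maximalIdeal_iff _).2 hz.1

theorem exists_isUniformizer : ∃ z, P.IsUniformizer z := by
  have := P.isDiscreteValuationRing
  obtain ⟨ϖ, hϖ⟩ := IsDiscreteValuationRing.exists_irreducible P.O
  have h := hϖ.maximalIdeal_eq
  refine ⟨ϖ, (P.mem_maximalIdeal_iff ϖ).1 (h ▸ Ideal.mem_span_singleton_self ϖ), fun x hx => ?_⟩
  have h1 : (⟨x, ValuationSubring.nonunits_subset hx⟩ : P.O) ∈ IsLocalRing.maximalIdeal P.O :=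
    (P.mem_maximalIdeal_iff _).2 hx
  rw [h] at h1
  obtain ⟨y, hy⟩ := Ideal.mem_span_singleton.1 h1
  exact ⟨y, y.2, congrArg Subtype.val hy⟩

theorem maximalIdeal_ne_bot : IsLocalRing.maximalIdeal P.O ≠ ⊥ := by
  have := P.isDiscreteValuationRing
  exact IsDiscreteValuationRing.not_a_field P.O

omit [IsDedekindDomain A] [Algebra.FiniteType Fq A] [IsFractionRing A Q]
  [Algebra Fq A] [IsScalarTower Fq A Q] in
/-- There are no nonzero functions without poles that vanish at infinity. -/
theorem eq_zero_of_mem_nonunits {a : A} (ha : algebraMap A Q a ∈ P.O.nonunits) :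
    algebraMap A Q a = 0 := by
  have h1 : IsIntegral Fq (algebraMap A Q a) := by
    -- The element a lies in every valuation ring containing Fq: in O by assumption and in the
    -- others because they contain A. The intersection of these rings is the integral closure of Fq.
    have h2 : algebraMap A Q a ∈
        (⨅ V : {V : ValuationSubring Q // Set.range (algebraMap Fq Q) ⊆ V.toSubring},
          V.1.toSubring) := by
      refine Subring.mem_iInf.2 fun V => ?_
      by_cases hV : V.1 = ⊤
      · rw [hV]; trivial
      by_cases hO : V.1 = P.O
      · rw [hO]; exact ValuationSubring.nonunits_subset ha
      · exact (P.complement V.1 hV).1 hO a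
    rw [iInf_valuationSubring_superset] at h2
    have h3 : IsIntegral (Subring.closure (Set.range (algebraMap Fq Q))) (algebraMap A Q a) := h2
    let j : Fq →+* Subring.closure (Set.range (algebraMap Fq Q)) :=
      (algebraMap Fq Q).codRestrict _ fun c => Subring.subset_closure ⟨c, rfl⟩
    algebraize [j]
    have : IsScalarTower Fq (Subring.closure (Set.range (algebraMap Fq Q))) Q :=
      .of_algebraMap_eq fun _ => rfl
    have : Algebra.IsIntegral Fq (Subring.closure (Set.range (algebraMap Fq Q))) := by
      refine ⟨fun x => ?_⟩
      obtain ⟨c, hc⟩ := (show Subring.closure (Set.range (algebraMap Fq Q)) ≤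
        (algebraMap Fq Q).range from Subring.closure_le.2 (by rintro _ ⟨c, rfl⟩; exact ⟨c, rfl⟩)) x.2
      have : algebraMap Fq _ c = x := Subtype.ext hc
      exact this ▸ isIntegral_algebraMap
    exact isIntegral_trans _ h3
  obtain ⟨c, hc⟩ := P.exists_algebraMap_eq h1
  rw [← hc] at ha ⊢
  by_cases h0 : c = 0
  · rw [h0, map_zero]
  · rw [ValuationSubring.mem_nonunits_iff, valuation_algebraMap P h0] at ha
    exact (lt_irrefl _ ha).elim

end PlaceAtInfty

end Places

section Perfect

variable {Fq L V : Type u} [Field Fq] [Fintype Fq] [Field L] [Finite L] [Algebra Fq L]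
  [AddCommGroup V] [Module L V]

/-- Since `L` is perfect, the image of a Frobenius semilinear map is a subspace. -/
theorem exists_of_mem_span_image (φ : V →+ V)
    (hφ : ∀ (b : L) (x : V), φ (b • x) = b ^ Fintype.card Fq • φ x) (N : Submodule L V) {y : V}
    (hy : y ∈ Submodule.span L (φ '' (N : Set V))) : ∃ x ∈ N, φ x = y := by
  induction hy using Submodule.span_induction with
  | mem y hy => exact hy
  | zero => exact ⟨0, N.zero_mem, map_zero φ⟩
  | add y y' _ _ h h' =>
    obtain ⟨x, hx, rfl⟩ := h
    obtain ⟨x', hx', rfl⟩ := h'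
    exact ⟨x + x', N.add_mem hx hx', map_add φ x x'⟩
  | smul b y _ h =>
    obtain ⟨x, hx, rfl⟩ := h
    obtain ⟨b', hb'⟩ := (Finite.injective_iff_surjective.1
      (FiniteField.frobeniusAlgHom Fq L).injective) b
    exact ⟨b' • x, N.smul_mem _ hx, by rw [hφ, ← hb']; rfl⟩

end Perfect

section Lattices

variable {R Q L U U' : Type u} [CommRing R] [IsDomain R] [Field Q] [Algebra R Q]
  [IsFractionRing R Q] [Field L] [AddCommGroup U] [Module Q U] [Module L U] [SMulCommClass Q L U]
  [AddCommGroup U'] [Module Q U'] [Module L U'] [SMulCommClass Q L U']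

omit [SMulCommClass Q L U] in
/-- A map of generic fibres of lattices has a common denominator. -/
theorem BiSub.IsLattice.exists_smul_map_mem {N : BiSub R Q L U} {N' : BiSub R Q L U'}
    (h : N.IsLattice) (h' : N'.IsLattice) (f : U →ₗ[Q] U')
    (hf : ∀ (b : L) (x : U), f (b • x) = b • f x) :
    ∃ s : R, s ≠ 0 ∧ ∀ x ∈ N.toSubmodule, algebraMap R Q s • f x ∈ N'.toSubmodule := by
  classical
  obtain ⟨S, hS⟩ := h.1
  obtain ⟨s, hs, hsS⟩ := exists_common_denominator h'.exists_smul_mem (S.image f)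
  refine ⟨s, hs, fun x hx => ?_⟩
  rw [hS] at hx
  induction hx using Submodule.span_induction with
  | mem x hx =>
    obtain ⟨a, y, hy, rfl⟩ := hx
    rw [map_smul, smul_comm]
    exact N'.r_smul_mem _ _ (hsS _ (Finset.mem_image_of_mem f hy))
  | zero => rw [map_zero, smul_zero]; exact N'.toSubmodule.zero_mem
  | add x y _ _ hx hy => rw [map_add, smul_add]; exact N'.toSubmodule.add_mem hx hy
  | smul b x _ hx => rw [hf, smul_comm]; exact N'.toSubmodule.smul_mem b hx

omit [SMulCommClass Q L U] [Module L U] in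
theorem det_compLeft [FiniteDimensional Q U] {ι : Type*} [Fintype ι] (f : Module.End Q U) :
    LinearMap.det (f.compLeft ι) = LinearMap.det f ^ Fintype.card ι := by
  have := LinearMap.det_pi (fun _ : ι => f)
  rw [Finset.prod_const, Finset.card_univ] at this
  rw [← this]
  rfl

end Lattices

/-! ### Abelian τ-sheaves: quasi-endomorphisms and Tate modules -/

section Sheaves

variable {Fq A Q L : Type u} [Field Fq] [Fintype Fq] [CommRing A] [IsDedekindDomain A]
  [Algebra Fq A] [Algebra.FiniteType Fq A] [Field Q] [Algebra Fq Q] [Algebra A Q]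
  [IsScalarTower Fq A Q] [IsFractionRing A Q] [Field L] [Finite L] [Algebra Fq L]

namespace AbelianTauSheaf

variable {P : PlaceAtInfty Fq A Q} {c : Characteristic Fq A L} (F : AbelianTauSheaf P c)

omit [IsDedekindDomain A] [Algebra.FiniteType Fq A] [IsScalarTower Fq A Q] [IsFractionRing A Q]
  [Finite L] in
/-- Away from infinity all the sheaves agree. -/
theorem aff_eq (i : ℤ) : (F.aff i).toSubmodule = (F.aff 0).toSubmodule := by
  have h1 : ∀ i, (F.aff i).toSubmodule = (F.aff (i + 1)).toSubmodule := by
    intro i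
    refine le_antisymm (F.aff_mono i) ?_
    obtain ⟨k, l, -, hl, -, h⟩ := F.periodic
    obtain ⟨m, rfl⟩ : ∃ m, l = m + 1 := ⟨l - 1, by omega⟩
    have h2 := F.aff_le (i + 1) m
    have e : i + 1 + (m : ℤ) = i + ((m + 1 : ℕ) : ℤ) := by push_cast; ring
    rw [e, ← (h i).1] at h2
    exact h2
  induction i using Int.induction_on with
  | zero => rfl
  | succ i ih => rw [← h1, ih]
  | pred i ih => rw [h1, sub_add_cancel, ih]

omit [Finite L] in
/-- `Q ⊗ L`-linear maps between the generic fibres have bounded denominators. -/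
theorem mem_QEnd {f : Module.End Q F.V} (hf : f ∈ F.toFrobSpace.commutant) : f ∈ F.QEnd := by
  obtain ⟨s, hs, hsf⟩ := (F.aff_lattice 0).exists_smul_map_mem (F.aff_lattice 0) f hf.1
  choose t ht htf using fun i => (F.inf_lattice i).exists_smul_map_mem (F.inf_lattice i) f hf.1
  obtain ⟨k, l, hk, hl, hkl, h⟩ := F.periodic
  obtain ⟨z, hz⟩ := P.exists_isUniformizer
  refine ⟨hf.1, hf.2, s, hs, ∏ i ∈ Finset.range l, t i, Finset.prod_ne_zero_iff.2 fun i _ => ht i,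
    fun i => ⟨fun x hx => ?_, ?_⟩⟩
  · exact (F.aff_eq i).ge (hsf x ((F.aff_eq i).le hx))
  · obtain ⟨T, hT⟩ : ∃ T, T = ∏ i ∈ Finset.range l, t i := ⟨_, rfl⟩
    rw [← hT]
    -- The condition at infinity depends only on i modulo l, because a power of the uniformizer
    -- carries one lattice to the other. So the product of the l denominators for 0 ≤ i < l serves
    -- for all i.
    have hper : Function.Periodic (fun i : ℤ => ∀ x ∈ (F.inf i).toSubmodule,
        algebraMap P.O Q T • f x ∈ (F.inf i).toSubmodule) (l : ℤ) := by
      intro i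
      have hz0 : z ^ k ≠ 0 := pow_ne_zero _ hz.ne_zero
      refine propext ⟨fun H x hx => ?_, fun H x hx => ?_⟩
      · rw [(h i).2 z hz] at hx ⊢
        have := H _ hx
        rwa [map_smul, smul_comm] at this
      · have hx' : z ^ k • x ∈ (F.inf i).toSubmodule := by
          rw [(h i).2 z hz, smul_smul, inv_mul_cancel₀ hz0, one_smul]
          exact hx
        have := H _ hx'
        rwa [(h i).2 z hz, map_smul, smul_comm, smul_smul (z ^ k)⁻¹, inv_mul_cancel₀ hz0, one_smul] at this
    have h1 := (hper.int_mul (i / l)) (i % l)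
    rw [Int.cast_id, mul_comm, Int.emod_add_mul_ediv] at h1
    refine h1.mpr ?_
    obtain ⟨j, hj⟩ : ∃ j : ℕ, i % (l : ℤ) = j :=
      ⟨(i % l).toNat, (Int.toNat_of_nonneg (Int.emod_nonneg _ (by omega))).symm⟩
    have hjl : j < l := by
      have := Int.emod_lt_of_pos i (show (0 : ℤ) < l by omega)
      omega
    intro x hx
    rw [hj] at hx ⊢
    rw [hT, ← Finset.prod_erase_mul _ _ (Finset.mem_range.2 hjl), map_mul, mul_smul]
    exact (F.inf j).r_smul_mem _ _ (htf j x hx)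

omit [Finite L] in
theorem QEnd_eq : F.QEnd = F.toFrobSpace.commutant :=
  le_antisymm (fun _ hf => ⟨hf.1, hf.2.1⟩) fun _ hf => F.mem_QEnd hf

omit [IsDedekindDomain A] [Algebra.FiniteType Fq A] [IsScalarTower Fq A Q] [IsFractionRing A Q] in
theorem exists_φ_eq_of_mem_inf {c : A →ₐ[Fq] L} (F : AbelianTauSheaf P (.affine c)) (i : ℤ) {x : F.V}
    (hx : x ∈ (F.inf (i + 1)).toSubmodule) : ∃ y ∈ (F.inf i).toSubmodule, F.φ y = x :=
  exists_of_mem_span_image F.φ.toAddMonoidHom F.φ_smul _ ((F.annihilated i).2 hx)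

omit [IsDedekindDomain A] [Algebra.FiniteType Fq A] [IsScalarTower Fq A Q] [IsFractionRing A Q] in
-- If c(s) = 0, the generator s ⊗ 1 - 1 ⊗ c(s) of J is s itself, so s^d annihilates the cokernel of
-- τ.
theorem exists_affτ_eq_pow_smul {c : A →ₐ[Fq] L} (F : AbelianTauSheaf P (.affine c)) {s : A}
    (hs : c s = 0) (x : (F.aff 0).toSubmodule) : ∃ y, F.affτ y = s ^ F.dim • x := by
  have h1 := (F.annihilated 0).1 (fun _ => s) x (F.aff_mono 0 x.2)
  have h2 : ∀ n : ℕ, (List.ofFn fun _ : Fin n => s).foldr (fun b y => jAct (Q := Q) c b y) x.1 =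
      algebraMap A Q (s ^ n) • x.1 := by
    intro n
    induction n with
    | zero => simp
    | succ n ih =>
      rw [List.ofFn_succ, List.foldr_cons, ih, jAct, hs, zero_smul, sub_zero, smul_smul, ← map_mul,
        pow_succ']
  rw [h2] at h1
  obtain ⟨y, hy, hyx⟩ := exists_of_mem_span_image F.φ.toAddMonoidHom F.φ_smul _ h1
  exact ⟨⟨y, hy⟩, Subtype.ext hyx⟩

omit [IsDedekindDomain A] [Algebra.FiniteType Fq A] [IsScalarTower Fq A Q] [IsFractionRing A Q] in
theorem exists_affτ_eq (F : AbelianTauSheaf P (.infty : Characteristic Fq A L))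
    (x : (F.aff 0).toSubmodule) : ∃ y, F.affτ y = x := by
  obtain ⟨y, hy, hyx⟩ := exists_of_mem_span_image F.φ.toAddMonoidHom F.φ_smul _
    ((F.annihilated 0).1 (F.aff_mono 0 x.2))
  exact ⟨⟨y, hy⟩, Subtype.ext hyx⟩

omit [IsScalarTower Fq A Q] [IsFractionRing A Q] [Algebra.FiniteType Fq A] in
/-- `τ` is bijective at the places different from the characteristic. -/
theorem exists_affτ_eq_smul (v : IsDedekindDomain.HeightOneSpectrum A)
    (hv : ∀ c' : A →ₐ[Fq] L, c = .affine c' → v.asIdeal ≠ RingHom.ker c') :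
    ∃ s ∉ v.asIdeal, ∀ x : (F.aff 0).toSubmodule, ∃ y, F.affτ y = s • x := by
  cases c with
  | affine c =>
    have hm := v.isMaximal
    -- The quotient A / ker c embeds into the finite field L, so ker c is maximal and cannot be
    -- contained in a different maximal ideal v.
    obtain ⟨s, hs, hsv⟩ : ∃ s ∈ RingHom.ker c, s ∉ v.asIdeal := by
      by_contra! H
      have hk : (RingHom.ker c).IsMaximal := by
        have : IsDomain (A ⧸ RingHom.ker c) := by
          have : (RingHom.ker c).IsPrime := RingHom.ker_isPrime c.toRingHom
          exact Ideal.Quotient.isDomain _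
        have : Finite (A ⧸ RingHom.ker c) := .of_injective _ (RingHom.kerLift_injective c.toRingHom)
        exact Ideal.Quotient.maximal_of_isField _ (Finite.isField_of_domain _)
      exact hv c rfl (hk.eq_of_le hm.ne_top H).symm
    exact ⟨s ^ F.dim, fun h => hsv (v.isPrime.mem_of_pow_mem _ h),
      F.exists_affτ_eq_pow_smul hs⟩
  | infty =>
    exact ⟨1, (Ideal.ne_top_iff_one _).1 v.isPrime.ne_top, fun x => by
      rw [one_smul]; exact F.exists_affτ_eq x⟩

omit [IsDedekindDomain A] [Algebra.FiniteType Fq A] [IsScalarTower Fq A Q] [IsFractionRing A Q] in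
theorem exists_infτ_eq {c : A →ₐ[Fq] L} (F : AbelianTauSheaf P (.affine c)) {k l : ℕ} {z : Q}
    (h : F.IsPeriod k l) (hz : P.IsUniformizer z) (x : (F.bigInf l).toSubmodule) :
    ∃ y, F.infτ h hz y = x := by
  have hz0 : z ^ k ≠ 0 := pow_ne_zero _ hz.ne_zero
  -- The required value of φ at the component j: the component of x at the cyclic successor of j,
  -- where at the turn the factor z^k is taken off.
  let w : Fin l → F.V := fun j =>
    if hj : j.1 + 1 < l then x.1 ⟨j.1 + 1, hj⟩ else (z ^ k)⁻¹ • x.1 ⟨0, h.l_pos⟩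
  have hw : ∀ j : Fin l, w j ∈ (F.inf ((j : ℕ) + 1)).toSubmodule := by
    intro j
    by_cases hj : j.1 + 1 < l
    · simp only [w, dif_pos hj]
      exact x.2 ⟨j.1 + 1, hj⟩
    · simp only [w, dif_neg hj]
      have h1 := (h.inf_eq 0 z hz _).1 (x.2 ⟨0, h.l_pos⟩)
      have e : (0 : ℤ) + l = (j : ℕ) + 1 := by have := j.2; omega
      rwa [e] at h1
  choose y hy hyw using fun j => F.exists_φ_eq_of_mem_inf _ (hw j)
  refine ⟨⟨y, hy⟩, Subtype.ext (funext fun i => ?_)⟩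
  change F.bigφ k l z y i = x.1 i
  rw [bigφ_apply, hyw]
  by_cases hi : i.1 = 0
  · have hn : ¬ (prev i).1 + 1 < l := by simp only [prev, hi, if_true]; omega
    have ei : (⟨0, h.l_pos⟩ : Fin l) = i := Fin.ext hi.symm
    simp only [w, dif_neg hn, if_pos hi, ei]
    rw [smul_smul, mul_inv_cancel₀ hz0, one_smul]
  · have hn : (prev i).1 + 1 < l := by
      simp only [prev, hi, if_false]; have := i.2; omega
    have ei : (⟨(prev i).1 + 1, hn⟩ : Fin l) = i :=
      Fin.ext (by simp only [prev, hi, if_false]; omega)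
    simp only [w, dif_pos hn, if_neg hi, ei, one_smul]

omit [IsDedekindDomain A] [Algebra.FiniteType Fq A] [IsScalarTower Fq A Q] [IsFractionRing A Q] in
theorem bigInf_finite (l : ℕ) : Module.Finite P.O (F.bigInf l).toSubmodule := by
  have := fun i => (F.inf_lattice i).finite
  exact .of_surjective
    ({ toFun := fun x => ⟨fun i => (x i).1, fun i => (x i).2⟩
       map_add' := fun _ _ => rfl
       map_smul' := fun _ _ => rfl } :
      (∀ i : Fin l, (F.inf (i : ℕ)).toSubmodule) →ₗ[P.O] (F.bigInf l).toSubmodule)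
    fun y => ⟨fun i => ⟨y.1 i, y.2 i⟩, rfl⟩

omit [IsDedekindDomain A] [Algebra.FiniteType Fq A] [IsScalarTower Fq A Q] [IsFractionRing A Q]
  [Finite L] in
theorem exists_smul_mem_bigInf (l : ℕ) (y : Fin l → F.V) :
    ∃ s : P.O, s ≠ 0 ∧ algebraMap P.O Q s • y ∈ (F.bigInf l).toSubmodule := by
  choose s hs hsy using fun i : Fin l => (F.inf_lattice (i : ℕ)).exists_smul_mem (y i)
  refine ⟨∏ i, s i, Finset.prod_ne_zero_iff.2 fun i _ => hs i, fun i => ?_⟩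
  rw [← Finset.prod_erase_mul _ s (Finset.mem_univ i), map_mul, mul_smul]
  exact (F.inf (i : ℕ)).r_smul_mem _ _ (hsy i)

omit [IsScalarTower Fq A Q] in
/-- The reduced norm of a quasi-endomorphism `f` is the determinant of its action on the Tate modules;
here `p` is the polynomial `det (1 + q (f - 1))`. -/
theorem det_affTateMap (v : IsDedekindDomain.HeightOneSpectrum A)
    (hv : ∀ c' : A →ₐ[Fq] L, c = .affine c' → v.asIdeal ≠ RingHom.ker c') :
    Module.Finite (ComplField Q v.asIdeal) (F.affTate v.asIdeal) ∧
    Module.Free (ComplField Q v.asIdeal) (F.affTate v.asIdeal) ∧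
    Module.finrank (ComplField Q v.asIdeal) (F.affTate v.asIdeal) = F.rank ∧
    ∀ (f : F.QEnd) (p : Polynomial Q), p.eval 0 = 1 →
      (∀ q, p.eval q ^ Module.finrank Fq L = LinearMap.det (1 + q • (f.1 - 1))) →
      LinearMap.det (F.affTateMap v.asIdeal f) = toCompl Q v.asIdeal (p.eval 1) := by
  have : Infinite Q := P.infinite
  have hfin := (F.aff_lattice 0).finite
  have hm := v.isMaximal
  have := finite_quotient_of_isMaximal Fq v.asIdeal
  obtain ⟨h1, h2, h3, h4⟩ := (F.aff 0).tate_free_and_det (F.aff_lattice 0).exists_smul_mem v.asIdeal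
    v.ne_bot F.affτ F.affτ_smul (F.exists_affτ_eq_smul v hv)
  refine ⟨h1, h2, ?_, fun f p hp0 hpe => ?_⟩
  · rw [F.toFrobSpace.finrank_eq P, F.rank_eq] at h3
    exact Nat.eq_of_mul_eq_mul_left Module.finrank_pos h3
  · exact h4 (F.affMap f) _ _ (F.affDenom f) f.1 p (F.affDenom_ne_zero f) (fun x => rfl) hp0 hpe

set_option maxHeartbeats 400000 in
theorem det_infTateMap {c : A →ₐ[Fq] L} (F : AbelianTauSheaf P (.affine c)) {k l : ℕ} {z : Q}
    (h : F.IsPeriod k l) (hz : P.IsUniformizer z) :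
    Module.Finite (ComplField Q (IsLocalRing.maximalIdeal P.O)) (F.infTate h hz) ∧
    Module.Free (ComplField Q (IsLocalRing.maximalIdeal P.O)) (F.infTate h hz) ∧
    Module.finrank (ComplField Q (IsLocalRing.maximalIdeal P.O)) (F.infTate h hz) = l * F.rank ∧
    ∀ (f : F.QEnd) (p : Polynomial Q), p.eval 0 = 1 →
      (∀ q, p.eval q ^ Module.finrank Fq L = LinearMap.det (1 + q • (f.1 - 1))) →
      LinearMap.det (F.infTateMap h hz f) =
        toCompl Q (IsLocalRing.maximalIdeal P.O) (p.eval 1 ^ l) := by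
  have : Infinite Q := P.infinite
  have := (F.aff_lattice 0).finite
  have hQ : FiniteDimensional Q F.V :=
    finiteDimensional_of_finite (F.aff 0) (F.aff_lattice 0).exists_smul_mem
  have := F.bigInf_finite l
  have := P.finite_residue
  have := P.isDiscreteValuationRing
  obtain ⟨h1, h2, h3, h4⟩ := (F.bigInf l).tate_free_and_det (F.exists_smul_mem_bigInf l)
    (IsLocalRing.maximalIdeal P.O) P.maximalIdeal_ne_bot (F.infτ h hz) (F.infτ_smul h hz)
    ⟨1, (Ideal.ne_top_iff_one _).1 (IsLocalRing.maximalIdeal.isMaximal P.O).ne_top, fun x => by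
      rw [one_smul]; exact F.exists_infτ_eq h hz x⟩
  refine ⟨h1, h2, ?_, fun f p hp0 hpe => ?_⟩
  · have h5 : Module.finrank Q (Fin l → F.V) = l * Module.finrank Q F.V := by
      rw [Module.finrank_pi_fintype, Finset.sum_const, Finset.card_univ, Fintype.card_fin,
        smul_eq_mul]
    rw [h5, F.toFrobSpace.finrank_eq P, F.rank_eq, mul_left_comm] at h3
    exact Nat.eq_of_mul_eq_mul_left Module.finrank_pos h3
  · have key : ∀ q : Q, (p ^ l).eval q ^ Module.finrank Fq L =
        LinearMap.det (1 + q • (f.1.compLeft (Fin l) - 1)) := by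
      intro q
      have e : (1 + q • (f.1.compLeft (Fin l) - 1) : Module.End Q (Fin l → F.V)) =
          LinearMap.compLeft (1 + q • (f.1 - 1)) (Fin l) := rfl
      rw [Polynomial.eval_pow, pow_right_comm, hpe, e, det_compLeft, Fintype.card_fin]
    have h0 : (p ^ l).eval 0 = 1 := by rw [Polynomial.eval_pow, hp0, one_pow]
    exact (h4 (F.infMap f l) _ _ (F.infDenom f) _ (p ^ l) (F.infDenom_ne_zero f) (fun x => rfl) h0
      key).trans (congrArg _ (Polynomial.eval_pow l))

/-- The reduced norm is the value at `1` of the polynomial `det (1 + q (f - 1))`. -/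
theorem exists_reducedNorm_poly [IsSemisimpleRing F.QEnd] (f : F.QEnd) :
    ∃ p : Polynomial Q, (∀ x : Q, IsReducedNorm Q F.QEnd f x ↔ x = p.eval 1) ∧ p.eval 0 = 1 ∧
      ∀ q, p.eval q ^ Module.finrank Fq L = LinearMap.det (1 + q • (f.1 - 1)) := by
  have hfin := (F.aff_lattice 0).finite
  have hQ : FiniteDimensional Q F.V :=
    finiteDimensional_of_finite (F.aff 0) (F.aff_lattice 0).exists_smul_mem
  have : IsSemisimpleRing F.toFrobSpace.commutant := F.QEnd_eq ▸ inferInstance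
  obtain ⟨d, hd, hd1, hdp, -⟩ := F.toFrobSpace.exists_tensorDet P F.φ_injective
  have hfc : f.1 ∈ F.toFrobSpace.commutant := F.QEnd_eq ▸ f.2
  obtain ⟨p, hp⟩ := hdp f.1 hfc
  have hp0 : p.eval 0 = 1 := by rw [hp, zero_smul, add_zero, hd1]
  have hp1 : p.eval 1 = d f.1 := by rw [hp, one_smul, add_sub_cancel]
  have hpe : ∀ q, p.eval q ^ Module.finrank Fq L = LinearMap.det (1 + q • (f.1 - 1)) := by
    intro q
    rw [hp, ← hd]
    exact F.toFrobSpace.commutant.add_mem (Subalgebra.one_mem _)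
      (Subalgebra.smul_mem _ (Subalgebra.sub_mem _ hfc (Subalgebra.one_mem _)) q)
  refine ⟨p, fun x => ?_, hp0, hpe⟩
  rw [FrobSpace.isReducedNorm_congr (Subalgebra.equivOfEq _ _ F.QEnd_eq),
    F.toFrobSpace.isReducedNorm_iff P F.φ_injective hd hd1 hdp, hp1]
  rfl

set_option maxHeartbeats 400000 in
theorem reducedNorm_eq_det [IsSemisimpleRing F.QEnd] (f : F.QEnd) :
    ∃ n : Q, (∀ x : Q, IsReducedNorm Q F.QEnd f x ↔ x = n) ∧
      (∀ v : IsDedekindDomain.HeightOneSpectrum A,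
        (∀ c' : A →ₐ[Fq] L, c = .affine c' → v.asIdeal ≠ RingHom.ker c') →
        Module.Finite (ComplField Q v.asIdeal) (F.affTate v.asIdeal) ∧
        Module.Free (ComplField Q v.asIdeal) (F.affTate v.asIdeal) ∧
        Module.finrank (ComplField Q v.asIdeal) (F.affTate v.asIdeal) = F.rank ∧
        LinearMap.det (F.affTateMap v.asIdeal f) = toCompl Q v.asIdeal n) ∧
      (c ≠ .infty → ∀ (k l : ℕ) (z : Q) (h : F.IsPeriod k l) (hz : P.IsUniformizer z),
        Module.Finite (ComplField Q (IsLocalRing.maximalIdeal P.O)) (F.infTate h hz) ∧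
        Module.Free (ComplField Q (IsLocalRing.maximalIdeal P.O)) (F.infTate h hz) ∧
        Module.finrank (ComplField Q (IsLocalRing.maximalIdeal P.O)) (F.infTate h hz) =
          l * F.rank ∧
        LinearMap.det (F.infTateMap h hz f) =
          toCompl Q (IsLocalRing.maximalIdeal P.O) (n ^ l)) := by
  obtain ⟨p, hp, hp0, hpe⟩ := F.exists_reducedNorm_poly f
  refine ⟨p.eval 1, hp, fun v hv => ?_, fun hc k l z h hz => ?_⟩
  · obtain ⟨h1, h2, h3, h4⟩ := F.det_affTateMap v hv
    exact ⟨h1, h2, h3, h4 f p hp0 hpe⟩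
  · cases c with
    | infty => exact (hc rfl).elim
    | affine c =>
      obtain ⟨h1, h2, h3, h4⟩ := F.det_infTateMap h hz
      exact ⟨h1, h2, h3, h4 f p hp0 hpe⟩

end AbelianTauSheaf

end Sheaves

/-! ### Index computations along chains of subgroups -/

section Index

open AddSubgroup

variable {G : Type*} [AddCommGroup G]

theorem relIndex_succ_eq {φ : G →+ G} (hφ : Function.Injective φ) {B : ℕ → AddSubgroup G}
    (hφB : ∀ i, (B i).map φ = B (i + 1)) (i : ℕ) :
    (B i).relIndex (B (i + 1)) = (B 0).relIndex (B 1) := by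
  induction i with
  | zero => rfl
  | succ i ih =>
    have := relIndex_map_map_of_injective (B i) (B (i + 1)) hφ
    rwa [hφB, hφB, ih] at this

/-- If `H` and `B` are complementary at every level then the index of the image of an injective
endomorphism on `H` can be read off from `B`. -/
theorem relIndex_map_eq {φ : G →+ G} (hφ : Function.Injective φ) {H : AddSubgroup G}
    (hH : H.map φ ≤ H) {B : ℕ → AddSubgroup G} (hB : Monotone B) (hφB : ∀ i, (B i).map φ = B (i + 1))
    (hsup : H ⊔ B 0 = ⊤) (hunion : ∀ x, ∃ i, x ∈ B i)
    (hfin : ∀ i, Finite (H ⊓ B i : AddSubgroup G)) :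
    (H.map φ).relIndex H = (B 0).relIndex (B 1) := by
  have hconst := relIndex_succ_eq hφ hφB
  have hcard : ∀ i, Nat.card (H ⊓ B i : AddSubgroup G) ≠ 0 := fun i => Nat.card_pos.ne'
  have hmap : ∀ i, (H ⊓ B i).map φ = H.map φ ⊓ (H ⊓ B (i + 1)) := by
    intro i
    rw [AddSubgroup.map_inf _ _ _ hφ, hφB, ← inf_assoc, inf_eq_left.2 hH]
  -- The finite groups H ∩ B i and φ(H) ∩ B (i + 1) have the same order, so their indices in H ∩ B
  -- (i + 1) agree. For the former the index equals that of B i in B (i + 1), because H + B i is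
  -- everything.
  have hrel : ∀ i, (H.map φ).relIndex (H ⊓ B (i + 1)) = (B 0).relIndex (B 1) := by
    intro i
    have h1 : (⊥ : AddSubgroup G).relIndex (H ⊓ B i) * (H.map φ).relIndex (H ⊓ B (i + 1)) =
        (⊥ : AddSubgroup G).relIndex (H ⊓ B (i + 1)) := by
      rw [← inf_relIndex_right (H.map φ), ← hmap,
        ← relIndex_map_map_of_injective ⊥ (H ⊓ B i) hφ, AddSubgroup.map_bot]
      exact relIndex_mul_relIndex _ _ _ bot_le ((hmap i).le.trans inf_le_right)
    have h2 : (⊥ : AddSubgroup G).relIndex (H ⊓ B i) * (B i).relIndex (H ⊓ B (i + 1)) =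
        (⊥ : AddSubgroup G).relIndex (H ⊓ B (i + 1)) := by
      have e : (B i).relIndex (H ⊓ B (i + 1)) = (H ⊓ B i).relIndex (H ⊓ B (i + 1)) := by
        rw [← inf_relIndex_right (B i), ← inf_relIndex_right (H ⊓ B i)]
        congr 1
        ext x
        simp only [mem_inf]
        tauto
      rw [e]
      exact relIndex_mul_relIndex _ _ _ bot_le (inf_le_inf_left _ (hB (Nat.le_succ i)))
    have h3 : (B i).relIndex (H ⊓ B (i + 1)) = (B i).relIndex (B (i + 1)) := by
      rw [← relIndex_sup_right (H := H ⊓ B (i + 1)) (K := B i)]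
      congr 1
      have hle : B i ≤ B (i + 1) := hB (Nat.le_succ i)
      rw [inf_comm, inf_sup_assoc_of_le H hle, eq_top_iff.2 (hsup.ge.trans
        (sup_le_sup_left (hB (Nat.zero_le i)) H)), inf_top_eq]
    rw [relIndex_bot_left] at h1 h2
    rw [← hconst i, ← h3]
    exact Nat.eq_of_mul_eq_mul_left Nat.card_pos (h1.trans h2.symm)
  obtain ⟨X, hX⟩ : ∃ X, X = H.map φ := ⟨_, rfl⟩
  rw [← hX] at hrel hH ⊢
  have hpos : (B 0).relIndex (B 1) ≠ 0 := by
    rw [← hrel 0]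
    exact (index_ne_zero_of_finite)
  -- The index of φ(H) does not depend on the level, so these groups do not grow with i, and their
  -- union is H.
  have hY : ∀ i, (H ⊓ B (i + 1)) ⊔ X = (H ⊓ B 1) ⊔ X := by
    intro i
    induction i with
    | zero => rfl
    | succ i ih =>
      rw [← ih]
      have hle : (H ⊓ B (i + 1)) ⊔ X ≤ (H ⊓ B (i + 1 + 1)) ⊔ X :=
        sup_le_sup_right (inf_le_inf_left _ (hB (Nat.le_succ _))) _
      refine le_antisymm ?_ hle
      have h := relIndex_mul_relIndex X _ _ le_sup_right hle
      rw [relIndex_sup_right, relIndex_sup_right, hrel, hrel] at h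
      exact relIndex_eq_one.1 (by simpa [hpos] using h)
  have htop : H = (H ⊓ B 1) ⊔ X := by
    refine le_antisymm (fun x hx => ?_) (sup_le inf_le_left hH)
    obtain ⟨i, hi⟩ := hunion x
    rw [← hY i]
    exact mem_sup_left ⟨hx, hB (Nat.le_succ i) hi⟩
  conv_lhs => rw [htop]
  rw [relIndex_sup_right, hrel 0]

/-- Both sides are the index of B 0 in B l: it is reached from B 0 in l steps of constant index, and
B 0 is obtained from it by applying ζ k times. -/
theorem relIndex_pow_eq {φ ζ : G →+ G} (hφ : Function.Injective φ) (hζ : Function.Injective ζ)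
    {B : ℕ → AddSubgroup G} (hB : Monotone B) (hφB : ∀ i, (B i).map φ = B (i + 1)) {k l : ℕ}
    (hper : ∀ x, x ∈ B l ↔ (ζ)^[k] x ∈ B 0) (hζB : ∀ i, (B i).map ζ ≤ B i) (hζs : Function.Surjective ζ) {n : ℕ}
    (hn : ∀ i, ((B i).map ζ).relIndex (B i) = n) : (B 0).relIndex (B 1) ^ l = n ^ k := by
  have h1 : ∀ i, (B 0).relIndex (B i) = (B 0).relIndex (B 1) ^ i := by
    intro i
    induction i with
    | zero => rw [relIndex_self, pow_zero]
    | succ i ih =>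
      rw [← relIndex_mul_relIndex _ _ _ (hB (Nat.zero_le i)) (hB (Nat.le_add_right i 1)), ih,
        relIndex_succ_eq hφ hφB i, pow_succ]
  have h2 : ∀ j, (((AddSubgroup.map ζ)^[j]) (B l)).relIndex (B l) = n ^ j ∧
      ((AddSubgroup.map ζ)^[j]) (B l) ≤ B l := by
    intro j
    induction j with
    | zero => exact ⟨relIndex_self _, le_rfl⟩
    | succ j ih =>
      rw [Function.iterate_succ_apply']
      have hle := AddSubgroup.map_mono (f := ζ) ih.2
      exact ⟨by rw [← relIndex_mul_relIndex _ _ _ hle (hζB l), relIndex_map_map_of_injective _ _ hζ,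
        ih.1, hn, pow_succ], hle.trans (hζB l)⟩
  have h3 : ∀ j (x : G), x ∈ ((AddSubgroup.map ζ)^[j]) (B l) ↔ ∃ y ∈ B l, ζ^[j] y = x := by
    intro j
    induction j with
    | zero => intro x; simp
    | succ j ih =>
      intro x
      rw [Function.iterate_succ_apply', mem_map]
      simp only [ih, Function.iterate_succ_apply']
      constructor
      · rintro ⟨_, ⟨y, hy, rfl⟩, rfl⟩; exact ⟨y, hy, rfl⟩
      · rintro ⟨y, hy, rfl⟩; exact ⟨_, ⟨y, hy, rfl⟩, rfl⟩
  have h4 : ((AddSubgroup.map ζ)^[k]) (B l) = B 0 := by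
    ext x
    rw [h3]
    constructor
    · rintro ⟨y, hy, rfl⟩; exact (hper y).1 hy
    · intro hx
      obtain ⟨y, rfl⟩ := hζs.iterate k x
      exact ⟨y, (hper y).2 hx, rfl⟩
  rw [← h1, ← h4, (h2 k).1]

end Index

/-! ### Nilpotent operators on a cokernel -/

section Nilpotent

/-- In a product of commuting nilpotent operators the ranks decrease strictly. -/
theorem prod_eq_zero_or_finrank_range_add_length_le {L D : Type*} [Field L] [AddCommGroup D]
    [Module L D] [FiniteDimensional L D] (l : List (Module.End L D)) (hn : ∀ T ∈ l, IsNilpotent T)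
    (hc : ∀ T ∈ l, ∀ T' ∈ l, Commute T T') :
    l.prod = 0 ∨ Module.finrank L (LinearMap.range l.prod) + l.length ≤ Module.finrank L D := by
  induction l with
  | nil =>
    right
    exact (Nat.add_zero _).trans_le (Submodule.finrank_le _)
  | cons T l ih =>
    rw [List.prod_cons]
    rcases ih (fun T' h => hn T' (List.mem_cons_of_mem _ h))
      (fun T' h T'' h' => hc T' (List.mem_cons_of_mem _ h) T'' (List.mem_cons_of_mem _ h')) with h | h
    · left; rw [h, mul_zero]
    · by_cases hT : T * l.prod = 0
      · exact .inl hT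
      right
      have hcomm : Commute T l.prod := Commute.list_prod_right _ _ fun T' h' =>
        hc T List.mem_cons_self T' (List.mem_cons_of_mem _ h')
      have hle : LinearMap.range (T * l.prod) ≤ LinearMap.range l.prod := by
        rw [hcomm.eq]
        exact LinearMap.range_comp_le_range _ _
      -- If T left the range unchanged, so would all its powers, one of which is zero.
      have hlt : LinearMap.range (T * l.prod) < LinearMap.range l.prod := by
        refine lt_of_le_of_ne hle fun he => ?_
        obtain ⟨n, hTn⟩ := hn T List.mem_cons_self
        have h1 : ∀ j, LinearMap.range (T ^ j * l.prod) = LinearMap.range l.prod := by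
          intro j
          induction j with
          | zero => rw [pow_zero, one_mul]
          | succ j ih =>
            rw [pow_succ', mul_assoc, Module.End.mul_eq_comp, LinearMap.range_comp, ih,
              ← LinearMap.range_comp, ← Module.End.mul_eq_comp, he]
        have h2 := h1 n
        rw [hTn, zero_mul, LinearMap.range_zero] at h2
        refine hT ?_
        rw [LinearMap.range_eq_bot.1 h2.symm, mul_zero]
      have := Submodule.finrank_lt_finrank_of_lt hlt
      rw [List.length_cons]
      omega

/-- A finite dimensional quotient that is annihilated by products of commuting operators of some
length is annihilated by such products of length the dimension. -/
theorem foldr_mem_of_finrank {α L M : Type*} [Field L] [AddCommGroup M] [Module L M]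
    (N : Submodule L M) [FiniteDimensional L (M ⧸ N)] (T : α → Module.End L M)
    (hT : ∀ a b, Commute (T a) (T b)) (hN : ∀ a, ∀ x ∈ N, T a x ∈ N) {d : ℕ}
    (h : ∀ (a : Fin d → α) (x : M), (List.ofFn a).foldr (fun b y => T b y) x ∈ N)
    (a : Fin (Module.finrank L (M ⧸ N)) → α) (x : M) :
    (List.ofFn a).foldr (fun b y => T b y) x ∈ N := by
  let S : α → Module.End L (M ⧸ N) := fun a => N.mapQ N (T a) (hN a)
  have hS : ∀ (l : List α) (x : M), N.mkQ (l.foldr (fun b y => T b y) x) = (l.map S).prod (N.mkQ x) := by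
    intro l x
    induction l with
    | nil => rfl
    | cons b l ih =>
      rw [List.foldr_cons, List.map_cons, List.prod_cons, Module.End.mul_apply, ← ih]
      rfl
  have hnil : ∀ a, IsNilpotent (S a) := fun a => by
    refine ⟨d, LinearMap.ext fun y => ?_⟩
    obtain ⟨x, rfl⟩ := N.mkQ_surjective y
    have h1 := hS (List.ofFn fun _ : Fin d => a) x
    rw [List.ofFn_const, List.map_replicate, List.prod_replicate] at h1
    rw [← h1, LinearMap.zero_apply, Submodule.mkQ_apply, Submodule.Quotient.mk_eq_zero]
    simpa using h (fun _ => a) x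
  have hcomm : ∀ a b, Commute (S a) (S b) := fun a b => by
    refine LinearMap.ext fun y => ?_
    obtain ⟨x, rfl⟩ := N.mkQ_surjective y
    exact congrArg N.mkQ (LinearMap.congr_fun (hT a b) x)
  rw [← Submodule.Quotient.mk_eq_zero, ← Submodule.mkQ_apply, hS]
  rcases prod_eq_zero_or_finrank_range_add_length_le ((List.ofFn a).map S)
    (fun T hT => by obtain ⟨b, -, rfl⟩ := List.mem_map.1 hT; exact hnil b)
    (fun T hT T' hT' => by
      obtain ⟨b, -, rfl⟩ := List.mem_map.1 hT
      obtain ⟨b', -, rfl⟩ := List.mem_map.1 hT'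
      exact hcomm b b') with h0 | h0
  · rw [h0, LinearMap.zero_apply]
  · rw [List.length_map, List.length_ofFn] at h0
    have h1 : Module.finrank L (LinearMap.range ((List.ofFn a).map S).prod) = 0 := by omega
    rw [Submodule.finrank_eq_zero, LinearMap.range_eq_bot] at h1
    rw [h1, LinearMap.zero_apply]

end Nilpotent

section RelDim

variable {L U : Type u} [Field L] [AddCommGroup U] [Module L U]

theorem relIndex_eq_pow_relDim {N' N : Submodule L U}
    (h : N'.toAddSubgroup.relIndex N.toAddSubgroup ≠ 0) :
    FiniteDimensional L (N ⧸ N'.submoduleOf N) ∧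
      N'.toAddSubgroup.relIndex N.toAddSubgroup = Nat.card L ^ relDim N' N := by
  have e : N'.toAddSubgroup.relIndex N.toAddSubgroup = Nat.card (N ⧸ N'.submoduleOf N) := rfl
  rw [e] at h ⊢
  have : Finite (N ⧸ N'.submoduleOf N) := Nat.finite_of_card_ne_zero h
  exact ⟨inferInstance, Module.natCard_eq_pow_finrank⟩

end RelDim

/-! ### Semisimplicity of the commutant -/

section Semisimple

variable {Fq Q L : Type u} [Field Fq] [Fintype Fq] [Field Q] [Field L] [Algebra Fq Q] [Algebra Fq L]

namespace FrobSpace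

/-- The ring generated freely by `φ` and the elements of `L` acts on every `FrobSpace`. -/
noncomputable def freeAct (N : FrobSpace Fq Q L) : FreeAlgebra Q (Option L) →ₐ[Q] Module.End Q N.V :=
  FreeAlgebra.lift Q fun o => o.elim N.φ fun b =>
    { toFun := fun x => b • x
      map_add' := smul_add b
      map_smul' := fun q x => (smul_comm q b x).symm }

@[reducible] noncomputable def freeModule (N : FrobSpace Fq Q L) : Module (FreeAlgebra Q (Option L)) N.V :=
  Module.compHom N.V N.freeAct.toRingHom

theorem map_freeAct {N N' : FrobSpace Fq Q L} (f : N.V →ₗ[Q] N'.V)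
    (hL : ∀ (b : L) (x : N.V), f (b • x) = b • f x) (hφ : ∀ x, f (N.φ x) = N'.φ (f x))
    (r : FreeAlgebra Q (Option L)) (x : N.V) : f (N.freeAct r x) = N'.freeAct r (f x) := by
  induction r generalizing x with
  | grade0 q => simp
  | grade1 o =>
    cases o with
    | none => simpa [freeAct] using hφ x
    | some b => simpa [freeAct] using hL b x
  | mul r s hr hs => rw [map_mul, map_mul, Module.End.mul_apply, Module.End.mul_apply, hr, hs]
  | add r s hr hs => rw [map_add, map_add, LinearMap.add_apply, LinearMap.add_apply, map_add, hr, hs]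

/-- V is a finite semisimple module over the free algebra on φ and the elements of L, because
submodules are the subspaces stable under L and φ. Its endomorphism ring is semisimple, and this
ring is the commutant. -/
theorem isSemisimpleRing_commutant (N : FrobSpace Fq Q L) [FiniteDimensional Q N.V] {n : ℕ}
    (S : Fin n → FrobSpace Fq Q L) (f : N.V →ₗ[Q] ∀ j, (S j).V) (hf : Function.Bijective f)
    (hL : ∀ (b : L) (x : N.V), f (b • x) = b • f x) (hφ : ∀ x j, f (N.φ x) j = (S j).φ (f x j))
    (hS : ∀ j, Nontrivial (S j).V ∧ ∀ W : Submodule Q (S j).V, (∀ (b : L), ∀ x ∈ W, b • x ∈ W) →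
      (∀ x ∈ W, (S j).φ x ∈ W) → W = ⊥ ∨ W = ⊤) : IsSemisimpleRing N.commutant := by
  let _ := N.freeModule
  let _ := fun j => (S j).freeModule
  have hsm : ∀ (r : FreeAlgebra Q (Option L)) (x : N.V), r • x = N.freeAct r x := fun _ _ => rfl
  have hsm' : ∀ j (r : FreeAlgebra Q (Option L)) (x : (S j).V), r • x = (S j).freeAct r x :=
    fun _ _ _ => rfl
  have hι : ∀ (M : FrobSpace Fq Q L) (x : M.V), M.freeAct (FreeAlgebra.ι Q none) x = M.φ x :=
    fun M x => by simp [freeAct]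
  have hιL : ∀ (M : FrobSpace Fq Q L) (b : L) (x : M.V),
      M.freeAct (FreeAlgebra.ι Q (some b)) x = b • x := fun M b x => by simp [freeAct]
  have hsimple : ∀ j, IsSimpleModule (FreeAlgebra Q (Option L)) (S j).V := by
    intro j
    have := (hS j).1
    rw [isSimpleModule_iff]
    refine { exists_pair_ne := ⟨⊥, ⊤, bot_ne_top⟩, eq_bot_or_eq_top := fun W => ?_ }
    let W' : Submodule Q (S j).V :=
      { W.toAddSubmonoid with
        smul_mem' := fun q x hx => by
          have := W.smul_mem (algebraMap Q _ q) hx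
          rwa [hsm', AlgHom.commutes, Module.algebraMap_end_apply] at this }
    have hW : ∀ x, x ∈ W' ↔ x ∈ W := fun _ => Iff.rfl
    rcases (hS j).2 W' (fun b x hx => by
        have := W.smul_mem (FreeAlgebra.ι Q (some b)) hx
        rwa [hsm', hιL] at this)
      (fun x hx => by
        have := W.smul_mem (FreeAlgebra.ι Q none) hx
        rwa [hsm', hι] at this) with h | h
    · left
      ext x
      rw [← hW, h]; rfl
    · right
      ext x
      rw [← hW, h]; simp
  have e : N.V ≃ₗ[FreeAlgebra Q (Option L)] ∀ j, (S j).V :=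
    LinearEquiv.ofBijective
      { toFun := f
        map_add' := map_add f
        map_smul' := fun r x => funext fun j => by
          exact map_freeAct (LinearMap.proj j ∘ₗ f)
            (fun b x => congrFun (hL b x) j) (fun x => hφ x j) r x } hf
  have hss : IsSemisimpleModule (FreeAlgebra Q (Option L)) N.V := .congr e
  have hfin : Module.Finite (FreeAlgebra Q (Option L)) N.V := by
    have : IsScalarTower Q (FreeAlgebra Q (Option L)) N.V := ⟨fun q r x => by
      rw [hsm, hsm, map_smul, LinearMap.smul_apply]⟩
    exact Module.Finite.of_restrictScalars_finite Q _ _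
  have := IsSemisimpleRing.moduleEnd (FreeAlgebra Q (Option L)) N.V
  let i : Module.End (FreeAlgebra Q (Option L)) N.V ≃+* N.commutant :=
    { toFun := fun g => ⟨
        { toFun := g
          map_add' := map_add g
          map_smul' := fun q x => by
            have := g.map_smul (algebraMap Q _ q) x
            rwa [hsm, hsm, AlgHom.commutes, Module.algebraMap_end_apply,
              Module.algebraMap_end_apply] at this },
        fun b x => by
          have := g.map_smul (FreeAlgebra.ι Q (some b)) x
          rwa [hsm, hsm, hιL, hιL] at this,
        fun x => by
          have := g.map_smul (FreeAlgebra.ι Q none) x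
          rwa [hsm, hsm, hι, hι] at this⟩
      invFun := fun g =>
        { toFun := g.1
          map_add' := map_add g.1
          map_smul' := fun r x => map_freeAct g.1 g.2.1 g.2.2 r x }
      left_inv := fun _ => rfl
      right_inv := fun _ => rfl
      map_mul' := fun _ _ => rfl
      map_add' := fun _ _ => rfl }
  exact i.isSemisimpleRing

/-- The quotient of a `FrobSpace` by an invariant subspace. -/
theorem exists_quotient (N : FrobSpace Fq Q L) [FiniteDimensional Q N.V]
    (hinj : Function.Injective N.φ) (W : Submodule Q N.V) (hL : ∀ (b : L), ∀ x ∈ W, b • x ∈ W)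
    (hφ : ∀ x ∈ W, N.φ x ∈ W) :
    ∃ (N' : FrobSpace Fq Q L) (π : N.V →ₗ[Q] N'.V), Function.Surjective π ∧
      LinearMap.ker π = W ∧ (∀ (b : L) (x : N.V), π (b • x) = b • π x) ∧
      (∀ x, π (N.φ x) = N'.φ (π x)) ∧ Function.Injective N'.φ := by
  let ρ : L →+* Module.End Q (N.V ⧸ W) :=
    { toFun := fun b => W.mapQ W
        { toFun := fun x => b • x
          map_add' := smul_add b
          map_smul' := fun q x => (smul_comm q b x).symm } (hL b)
      map_one' := by ext x; simp
      map_zero' := by ext x; simp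
      map_add' := fun b b' => by ext x; simp [add_smul]
      map_mul' := fun b b' => by ext x; simp [mul_smul] }
  let _ : Module L (N.V ⧸ W) := Module.compHom _ ρ
  have hb : ∀ (b : L) (x : N.V), b • W.mkQ x = W.mkQ (b • x) := fun _ _ => rfl
  -- In finite dimension the injective φ maps W onto W, which makes the induced map on the quotient
  -- injective.
  have hmap : W.map N.φ = W := by
    refine Submodule.eq_of_le_of_finrank_eq (Submodule.map_le_iff_le_comap.2 hφ) ?_
    exact (Submodule.equivMapOfInjective N.φ hinj W).symm.finrank_eq
  let N' : FrobSpace Fq Q L :=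
    { V := N.V ⧸ W
      towerL := ⟨fun a b x => by
        obtain ⟨x, rfl⟩ := W.mkQ_surjective x
        change (a • b) • W.mkQ x = W.mkQ (a • (b • x))
        rw [hb, smul_assoc]⟩
      comm := ⟨fun q b x => by
        obtain ⟨x, rfl⟩ := W.mkQ_surjective x
        rw [hb, ← map_smul, ← map_smul, hb, smul_comm]⟩
      φ := W.mapQ W N.φ hφ
      φ_smul := fun b x => by
        obtain ⟨x, rfl⟩ := W.mkQ_surjective x
        rw [hb, Submodule.mkQ_apply, Submodule.mapQ_apply, N.φ_smul]
        rfl }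
  refine ⟨N', W.mkQ, W.mkQ_surjective, W.ker_mkQ, fun _ _ => rfl, fun _ => rfl, ?_⟩
  rw [injective_iff_map_eq_zero]
  intro x hx
  obtain ⟨x, rfl⟩ := W.mkQ_surjective x
  have h1 : N.φ x ∈ W := (Submodule.Quotient.mk_eq_zero W).1 hx
  rw [← hmap] at h1
  obtain ⟨y, hy, hyx⟩ := h1
  rw [← hinj hyx]
  exact (Submodule.Quotient.mk_eq_zero W).2 hy

end FrobSpace

end Semisimple

/-! ### Functions with prescribed pole order at infinity -/

section Places

variable {Fq A Q : Type u} [Field Fq] [Fintype Fq] [CommRing A] [IsDedekindDomain A]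
  [Algebra Fq A] [Algebra.FiniteType Fq A] [Field Q] [Algebra Fq Q] [Algebra A Q]
  [IsScalarTower Fq A Q] [IsFractionRing A Q] {P : PlaceAtInfty Fq A Q} {z : Q}

namespace PlaceAtInfty.IsUniformizer

omit [Fintype Fq] [IsDedekindDomain A] [Algebra Fq A] [Algebra.FiniteType Fq A]
  [IsScalarTower Fq A Q] [IsFractionRing A Q] in
theorem valuation_lt_one (hz : P.IsUniformizer z) : P.O.valuation z < 1 := by
  have h := hz.1
  rwa [ValuationSubring.mem_nonunits_iff] at h

omit [Fintype Fq] [IsDedekindDomain A] [Algebra Fq A] [Algebra.FiniteType Fq A]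
  [IsScalarTower Fq A Q] [IsFractionRing A Q] in
theorem valuation_pos (hz : P.IsUniformizer z) : 0 < P.O.valuation z :=
  zero_lt_iff.2 ((Valuation.ne_zero_iff _).2 hz.ne_zero)

theorem exists_valuation_eq_pow (hz : P.IsUniformizer z) {x : Q} (hx : x ∈ P.O) (hx0 : x ≠ 0) :
    ∃ n : ℕ, P.O.valuation x = P.O.valuation z ^ n := by
  have := P.isDiscreteValuationRing
  have hirr := (IsDiscreteValuationRing.irreducible_iff_uniformizer _).2 hz.maximalIdeal_eq
  have hx0' : (⟨x, hx⟩ : P.O) ≠ 0 := fun h => hx0 (congrArg Subtype.val h)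
  obtain ⟨n, u, hu⟩ := IsDiscreteValuationRing.associated_pow_irreducible hx0' hirr
  refine ⟨n, ?_⟩
  have h1 := congrArg (fun y : P.O => P.O.valuation (y : Q)) hu
  simpa [map_mul] using h1

theorem exists_valuation_eq_zpow (hz : P.IsUniformizer z) {x : Q} (hx0 : x ≠ 0) :
    ∃ n : ℤ, P.O.valuation x = P.O.valuation z ^ n := by
  rcases P.O.mem_or_inv_mem x with h | h
  · obtain ⟨n, hn⟩ := hz.exists_valuation_eq_pow h hx0
    exact ⟨n, by rw [hn, zpow_natCast]⟩
  · obtain ⟨n, hn⟩ := hz.exists_valuation_eq_pow h (inv_ne_zero hx0)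
    refine ⟨-n, ?_⟩
    rw [zpow_neg, zpow_natCast, ← hn, map_inv₀, inv_inv]

theorem exists_pow_mul_mem (hz : P.IsUniformizer z) (x : Q) : ∃ n : ℕ, z ^ n * x ∈ P.O := by
  by_cases hx : x = 0
  · exact ⟨0, by rw [hx, mul_zero]; exact P.O.zero_mem⟩
  rcases P.O.mem_or_inv_mem x with h | h
  · exact ⟨0, by rwa [pow_zero, one_mul]⟩
  · obtain ⟨n, hn⟩ := hz.exists_valuation_eq_pow h (inv_ne_zero hx)
    refine ⟨n, ?_⟩
    rw [← P.O.valuation_le_one_iff, map_mul, map_pow, ← hn, ← map_mul, inv_mul_cancel₀ hx, map_one]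

theorem exists_pow_eq_mul (hz : P.IsUniformizer z) {x : P.O} (hx : x ≠ 0) :
    ∃ n : ℕ, ∃ y ∈ P.O, z ^ n = y * x := by
  have hx0 : (x : Q) ≠ 0 := fun h => hx (Subtype.ext h)
  obtain ⟨n, hn⟩ := hz.exists_pow_mul_mem (x : Q)⁻¹
  exact ⟨n, _, hn, by rw [mul_assoc, inv_mul_cancel₀ hx0, mul_one]⟩

/-- There are functions on the affine curve with any pole order in a given residue class. -/
theorem exists_algebraMap_valuation (hz : P.IsUniformizer z) {m : ℕ} (hm : 0 < m) (r : ℕ) :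
    ∃ (g : ℕ) (a : A), P.O.valuation (algebraMap A Q a) = (P.O.valuation z ^ (r + g * m))⁻¹ := by
  obtain ⟨a, b, hb, hab⟩ := IsFractionRing.div_surjective (A := A) (z ^ r)⁻¹
  have hb0 : algebraMap A Q b ≠ 0 := by simpa using nonZeroDivisors.ne_zero hb
  obtain ⟨j, hj⟩ := hz.exists_valuation_eq_zpow hb0
  have hj0 : j ≤ 0 := by
    by_contra! h
    refine hb0 (P.eq_zero_of_mem_nonunits ?_)
    rw [ValuationSubring.mem_nonunits_iff, hj]
    exact zpow_lt_one₀ hz.valuation_pos hz.valuation_lt_one h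
  obtain ⟨g, rfl⟩ : ∃ g : ℕ, j = -g := ⟨(-j).toNat, by omega⟩
  obtain ⟨m, rfl⟩ : ∃ m', m = m' + 1 := ⟨m - 1, by omega⟩
  -- Here `m` is one less than the original modulus: a has a pole of order r + g and b one of order
  -- g, so the product has pole order r + g (m + 1).
  refine ⟨g, a * b ^ m, ?_⟩
  rw [div_eq_iff hb0] at hab
  rw [map_mul, hab, map_pow, mul_assoc, ← pow_succ', map_mul, map_inv₀, map_pow, map_pow, hj,
    zpow_neg, zpow_natCast, inv_pow, ← pow_mul, ← mul_inv, ← pow_add]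

/-- A coordinate t has a pole of some order m > 0. One function for each residue class modulo m,
multiplied by powers of t, yields all sufficiently large orders. -/
theorem exists_algebraMap_valuation_eq (hz : P.IsUniformizer z) :
    ∃ M : ℕ, ∀ n ≥ M, ∃ a : A, P.O.valuation (algebraMap A Q a) = (P.O.valuation z ^ n)⁻¹ := by
  obtain ⟨t, ht0, ht, -⟩ := P.exists_coordinate
  have hmem : (algebraMap A Q t)⁻¹ ∈ P.O := (P.O.valuation_le_one_iff _).1 ht.le
  obtain ⟨m, hm⟩ := hz.exists_valuation_eq_pow hmem (inv_ne_zero ht0)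
  have hm0 : 0 < m := by
    rcases Nat.eq_zero_or_pos m with rfl | h
    · rw [hm, pow_zero] at ht; exact (lt_irrefl _ ht).elim
    · exact h
  choose g a ha using fun r => hz.exists_algebraMap_valuation hm0 r
  refine ⟨(Finset.range m).sup fun r => r + g r * m, fun n hn => ?_⟩
  have hr := Nat.mod_lt n hm0
  have h1 := (Finset.le_sup (f := fun r => r + g r * m) (Finset.mem_range.2 hr)).trans hn
  have h2 : g (n % m) ≤ n / m := by
    rw [Nat.le_div_iff_mul_le hm0]
    omega
  refine ⟨t ^ (n / m - g (n % m)) * a (n % m), ?_⟩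
  rw [map_inv₀, inv_eq_iff_eq_inv] at hm
  rw [map_mul, map_mul, map_pow, map_pow, ha, hm, inv_pow, ← mul_inv, ← pow_mul, ← pow_add]
  congr 2
  rw [Nat.mul_sub, mul_comm (g _) m]
  have h3 := Nat.mul_le_mul_left m h2
  have h4 := Nat.div_add_mod n m
  omega

/-- The residue field at infinity is Fq, so a leading polar term of order above M is cancelled by a
constant multiple of a function in A of the same pole order. Thus Q = A + z^(-M) O, which is the
finiteness of the first cohomology of the curve. -/
theorem exists_sub_mem (hz : P.IsUniformizer z) :
    ∃ M : ℕ, ∀ y : Q, ∃ a : A, z ^ M * (y - algebraMap A Q a) ∈ P.O := by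
  obtain ⟨M, hM⟩ := hz.exists_algebraMap_valuation_eq
  have step : ∀ n ≥ M, ∀ y : Q, z ^ (n + 1) * y ∈ P.O →
      ∃ a : A, z ^ n * (y - algebraMap A Q a) ∈ P.O := by
    intro n hn y hy
    obtain ⟨a, ha⟩ := hM (n + 1) (by omega)
    obtain ⟨u, hu⟩ : ∃ u, u = z ^ (n + 1) * algebraMap A Q a := ⟨_, rfl⟩
    have hvu : P.O.valuation u = 1 := by
      rw [hu, map_mul, map_pow, ha, mul_inv_cancel₀ (pow_ne_zero _ hz.valuation_pos.ne')]
    have hu0 : u ≠ 0 := by rintro rfl; simp at hvu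
    obtain ⟨c, hc⟩ := P.rational (z ^ (n + 1) * y / u) (by
      rw [← P.O.valuation_le_one_iff, map_div₀, hvu, div_one]
      exact (P.O.valuation_le_one_iff _).2 hy)
    obtain ⟨w, hw, hzw⟩ := hz.2 (z ^ (n + 1) * y - algebraMap Fq Q c * u) (by
      rw [ValuationSubring.mem_nonunits_iff] at hc ⊢
      have e : z ^ (n + 1) * y - algebraMap Fq Q c * u =
          (z ^ (n + 1) * y / u - algebraMap Fq Q c) * u := by field_simp
      rwa [e, map_mul, hvu, mul_one])
    refine ⟨c • a, ?_⟩
    have e : z ^ n * (y - algebraMap A Q (c • a)) = w := by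
      refine mul_left_cancel₀ hz.ne_zero ?_
      rw [← hzw, hu, Algebra.smul_def, map_mul, ← IsScalarTower.algebraMap_apply]
      ring
    rwa [e]
  have main : ∀ (n : ℕ) (y : Q), z ^ (M + n) * y ∈ P.O →
      ∃ a : A, z ^ M * (y - algebraMap A Q a) ∈ P.O := by
    intro n
    induction n with
    | zero => exact fun y hy => ⟨0, by simpa using hy⟩
    | succ n ih =>
      intro y hy
      obtain ⟨a, ha⟩ := step (M + n) (by omega) y hy
      obtain ⟨a', ha'⟩ := ih _ ha
      exact ⟨a + a', by rwa [map_add, ← sub_sub]⟩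
  refine ⟨M, fun y => ?_⟩
  obtain ⟨n, hn⟩ := hz.exists_pow_mul_mem y
  exact main n y (by rw [pow_add, mul_assoc]; exact mul_mem (pow_mem (ValuationSubring.nonunits_subset hz.1) _) hn)

omit [IsDedekindDomain A] [Algebra.FiniteType Fq A] in
/-- The functions on the affine curve with bounded pole order at infinity are finite in number. -/
theorem finite_setOf_pow_mul_mem (hz : P.IsUniformizer z) (j : ℕ) :
    {a : A | z ^ j * algebraMap A Q a ∈ P.O}.Finite := by
  have hinj := IsFractionRing.injective A Q
  induction j with
  | zero =>
    refine (Set.finite_range (algebraMap Fq A)).subset fun a ha => ?_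
    obtain ⟨c, hc⟩ := P.rational _ ha
    refine ⟨c, hinj ?_⟩
    rw [pow_zero, one_mul, IsScalarTower.algebraMap_apply Fq A Q, ← map_sub] at hc
    have := P.eq_zero_of_mem_nonunits hc
    rw [map_sub, sub_eq_zero] at this
    exact this.symm
  | succ j ih =>
    have H : ∀ a : A, ∃ c : Fq, z ^ (j + 1) * algebraMap A Q a ∈ P.O →
        z ^ (j + 1) * algebraMap A Q a - algebraMap Fq Q c ∈ P.O.nonunits := fun a => by
      by_cases h : z ^ (j + 1) * algebraMap A Q a ∈ P.O
      · obtain ⟨c, hc⟩ := P.rational _ h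
        exact ⟨c, fun _ => hc⟩
      · exact ⟨0, fun h' => (h h').elim⟩
    -- Functions with the same leading coefficient ρ differ by a function of smaller pole order, so
    -- the fibres of ρ are finite by induction, and ρ takes values in the finite field Fq.
    choose ρ hρ using H
    refine Set.Finite.of_finite_fibers ρ (Set.toFinite _) ?_
    rintro _ ⟨a, ha, rfl⟩
    refine (ih.image fun b => a + b).subset ?_
    rintro b ⟨hb, hba⟩
    refine ⟨b - a, ?_, add_sub_cancel _ _⟩
    have h1 := hρ a ha
    have h2 := hρ b hb
    rw [Set.mem_preimage, Set.mem_singleton_iff] at hba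
    rw [hba] at h2
    obtain ⟨w, hw, hzw⟩ := hz.2 (z ^ (j + 1) * algebraMap A Q (b - a)) (by
      rw [ValuationSubring.mem_nonunits_iff] at h1 h2 ⊢
      have e : z ^ (j + 1) * algebraMap A Q (b - a) = (z ^ (j + 1) * algebraMap A Q b -
        algebraMap Fq Q (ρ a)) - (z ^ (j + 1) * algebraMap A Q a - algebraMap Fq Q (ρ a)) := by
        rw [map_sub]; ring
      rw [e]
      exact (Valuation.map_sub _ _ _).trans_lt (max_lt h2 h1))
    have e : z ^ j * algebraMap A Q (b - a) = w := by
      refine mul_left_cancel₀ hz.ne_zero ?_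
      rw [← hzw]; ring
    change z ^ j * algebraMap A Q (b - a) ∈ P.O
    rwa [e]

end PlaceAtInfty.IsUniformizer

end Places

section Lattices

variable {R Q L U U' : Type u} [CommRing R] [IsDomain R] [Field Q] [Algebra R Q]
  [IsFractionRing R Q] [Field L] [AddCommGroup U] [Module Q U] [Module L U] [SMulCommClass Q L U]
  [AddCommGroup U'] [Module Q U'] [Module L U'] [SMulCommClass Q L U']

/-- The image of a lattice under a homomorphism. -/
def BiSub.map (N : BiSub R Q L U) (π : U →ₗ[Q] U') (hπ : ∀ (b : L) (x : U), π (b • x) = b • π x) :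
    BiSub R Q L U' where
  carrier := π '' N.toSubmodule
  add_mem' := by
    rintro _ _ ⟨x, hx, rfl⟩ ⟨y, hy, rfl⟩
    exact ⟨x + y, N.add_mem hx hy, map_add π x y⟩
  zero_mem' := ⟨0, N.zero_mem, map_zero π⟩
  smul_mem' := by
    rintro b _ ⟨x, hx, rfl⟩
    exact ⟨b • x, N.smul_mem b hx, hπ b x⟩
  r_smul_mem := by
    rintro a _ ⟨x, hx, rfl⟩
    exact ⟨_, N.r_smul_mem a x hx, map_smul π _ x⟩

omit [IsDomain R] [IsFractionRing R Q] [SMulCommClass Q L U] [SMulCommClass Q L U'] in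
theorem BiSub.mem_map {N : BiSub R Q L U} {π : U →ₗ[Q] U'}
    {hπ : ∀ (b : L) (x : U), π (b • x) = b • π x} {y : U'} :
    y ∈ (N.map π hπ).toSubmodule ↔ ∃ x ∈ N.toSubmodule, π x = y := Iff.rfl

omit [IsDomain R] [IsFractionRing R Q] [SMulCommClass Q L U] [SMulCommClass Q L U'] in
theorem BiSub.IsLattice.map {N : BiSub R Q L U} (h : N.IsLattice) (π : U →ₗ[Q] U')
    (hπ : ∀ (b : L) (x : U), π (b • x) = b • π x) (hs : Function.Surjective π) :
    (N.map π hπ).IsLattice := by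
  classical
  let πL : U →ₗ[L] U' := { toFun := π, map_add' := map_add π, map_smul' := hπ }
  have hmap : (N.map π hπ).toSubmodule = N.toSubmodule.map πL := rfl
  obtain ⟨S, hS⟩ := h.1
  refine ⟨⟨S.image π, ?_⟩, ?_⟩
  · rw [hmap, hS, Submodule.map_span]
    congr 1
    ext y
    constructor
    · rintro ⟨_, ⟨a, s, hs, rfl⟩, rfl⟩
      exact ⟨a, π s, Finset.mem_image_of_mem π hs, map_smul π _ s⟩
    · rintro ⟨a, s, hs, rfl⟩
      obtain ⟨s, hsS, rfl⟩ := Finset.mem_image.1 hs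
      exact ⟨_, ⟨a, s, hsS, rfl⟩, map_smul π _ s⟩
  · rw [eq_top_iff, ← LinearMap.range_eq_top.2 (show Function.Surjective πL from hs),
      LinearMap.range_eq_map, ← h.2, Submodule.map_span]
    refine Submodule.span_mono ?_
    rintro _ ⟨_, ⟨a, x, hx, rfl⟩, rfl⟩
    exact ⟨a, π x, ⟨x, hx, rfl⟩, map_smul π a x⟩

omit [SMulCommClass Q L U] in
/-- Finitely many linear forms on a lattice have a common denominator. -/
theorem BiSub.exists_denominator (N : BiSub R Q L U) [Module.Finite R N.toSubmodule] {ι : Type*}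
    [Finite ι] (f : ι → U →ₗ[Q] Q) :
    ∃ s : R, s ≠ 0 ∧ ∀ x ∈ N.toSubmodule, ∀ i, ∃ r : R,
      algebraMap R Q s * f i x = algebraMap R Q r := by
  classical
  have := Fintype.ofFinite ι
  obtain ⟨T, hT⟩ := Module.Finite.fg_top (R := R) (M := N.toSubmodule)
  obtain ⟨s, hs⟩ := IsLocalization.exist_integer_multiples_of_finset R⁰
    ((T ×ˢ Finset.univ).image fun p : N.toSubmodule × ι => f p.2 p.1)
  refine ⟨s, nonZeroDivisors.ne_zero s.2, fun x hx i => ?_⟩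
  have hx' : (⟨x, hx⟩ : N.toSubmodule) ∈ Submodule.span R (T : Set N.toSubmodule) :=
    hT ▸ Submodule.mem_top
  suffices H : ∀ y : N.toSubmodule, y ∈ Submodule.span R (T : Set N.toSubmodule) →
      ∃ r : R, algebraMap R Q s * f i y = algebraMap R Q r from H _ hx'
  intro y hy
  induction hy using Submodule.span_induction with
  | mem y hy =>
    obtain ⟨r, hr⟩ := hs _ (Finset.mem_image_of_mem (fun p : N.toSubmodule × ι => f p.2 p.1)
      (show (y, i) ∈ T ×ˢ Finset.univ from Finset.mem_product.2 ⟨hy, Finset.mem_univ i⟩))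
    exact ⟨r, by rw [hr, Algebra.smul_def]⟩
  | zero => exact ⟨0, by simp⟩
  | add y y' _ _ h h' =>
    obtain ⟨r, hr⟩ := h
    obtain ⟨r', hr'⟩ := h'
    exact ⟨r + r', by rw [Submodule.coe_add, map_add, mul_add, hr, hr', map_add]⟩
  | smul a y _ h =>
    obtain ⟨r, hr⟩ := h
    exact ⟨a * r, by
      rw [BiSub.coe_smulR, map_smul, smul_eq_mul, mul_left_comm, hr, map_mul]⟩

end Lattices

/-! ### An affine lattice and a lattice at infinity in one space -/

section Adelic

variable {Fq A Q L U : Type u} [Field Fq] [Fintype Fq] [CommRing A] [IsDedekindDomain A]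
  [Algebra Fq A] [Algebra.FiniteType Fq A] [Field Q] [Algebra Fq Q] [Algebra A Q]
  [IsScalarTower Fq A Q] [IsFractionRing A Q] {P : PlaceAtInfty Fq A Q} {z : Q}
  [Field L] [AddCommGroup U] [Module Q U] [Module L U] [SMulCommClass Q L U]
  [FiniteDimensional Q U]

omit [SMulCommClass Q L U] in
-- The equality Q = A + z^(-M) O is applied to the coordinates in a basis whose multiples by s lie
-- in N; the extra exponent e absorbs the denominators with respect to B.
theorem exists_pow_smul_sub_mem (hz : P.IsUniformizer z) {N : BiSub A Q L U} {B : BiSub P.O Q L U}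
    (hN : ∀ y : U, ∃ s : A, s ≠ 0 ∧ algebraMap A Q s • y ∈ N.toSubmodule)
    (hB : ∀ y : U, ∃ s : P.O, s ≠ 0 ∧ algebraMap P.O Q s • y ∈ B.toSubmodule) :
    ∃ j : ℕ, ∀ y : U, ∃ x ∈ N.toSubmodule, z ^ j • (y - x) ∈ B.toSubmodule := by
  classical
  let b := Module.finBasis Q U
  obtain ⟨s, hs, hsb⟩ := exists_common_denominator hN (Finset.univ.image b)
  have hs0 : algebraMap A Q s ≠ 0 := by rwa [Ne, IsFractionRing.to_map_eq_zero_iff]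
  obtain ⟨t, ht, htb⟩ := exists_common_denominator hB
    (Finset.univ.image fun i => algebraMap A Q s • b i)
  obtain ⟨e, w, hw, hzw⟩ := hz.exists_pow_eq_mul ht
  obtain ⟨M, hM⟩ := hz.exists_sub_mem
  refine ⟨M + e, fun y => ?_⟩
  choose a ha using fun i => hM (b.repr y i / algebraMap A Q s)
  refine ⟨∑ i, algebraMap A Q (a i) • algebraMap A Q s • b i, sum_mem fun i _ =>
    N.r_smul_mem _ _ (hsb _ (Finset.mem_image_of_mem b (Finset.mem_univ i))), ?_⟩
  have hy : y = ∑ i, (b.repr y i / algebraMap A Q s) • algebraMap A Q s • b i := by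
    conv_lhs => rw [← b.sum_repr y]
    refine Finset.sum_congr rfl fun i _ => ?_
    rw [smul_smul, div_mul_cancel₀ _ hs0]
  have key : z ^ (M + e) • (y - ∑ i, algebraMap A Q (a i) • algebraMap A Q s • b i) =
      ∑ i, (z ^ M * (b.repr y i / algebraMap A Q s - algebraMap A Q (a i))) • w •
        (t : Q) • algebraMap A Q s • b i := by
    conv_lhs => rw [hy]
    rw [← Finset.sum_sub_distrib, Finset.smul_sum]
    refine Finset.sum_congr rfl fun i _ => ?_
    rw [← sub_smul, smul_smul w, ← hzw, smul_smul, smul_smul, smul_smul, smul_smul]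
    congr 1
    rw [pow_add]; ring
  rw [key]
  exact sum_mem fun i _ => B.r_smul_mem ⟨_, ha i⟩ _ (B.r_smul_mem ⟨w, hw⟩ _
    (htb _ (Finset.mem_image_of_mem _ (Finset.mem_univ i))))

omit [SMulCommClass Q L U] in
-- Up to common denominators the coordinates of such x are functions on the affine curve with
-- bounded pole order, of which there are finitely many.
theorem finite_setOf_mem_pow_smul_mem (hz : P.IsUniformizer z) (N : BiSub A Q L U)
    (B : BiSub P.O Q L U) [Module.Finite A N.toSubmodule] [Module.Finite P.O B.toSubmodule] (j : ℕ) :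
    {x : U | x ∈ N.toSubmodule ∧ z ^ j • x ∈ B.toSubmodule}.Finite := by
  let b := Module.finBasis Q U
  obtain ⟨s, hs, hsb⟩ := N.exists_denominator fun i => b.coord i
  obtain ⟨t, ht, htb⟩ := B.exists_denominator fun i => b.coord i
  have hs0 : algebraMap A Q s ≠ 0 := by rwa [Ne, IsFractionRing.to_map_eq_zero_iff]
  obtain ⟨e, w, hw, hzw⟩ := hz.exists_pow_eq_mul ht
  obtain ⟨g, hg⟩ := hz.exists_pow_mul_mem (algebraMap A Q s)
  have hfin := Set.Finite.pi (t := fun _ : Fin (Module.finrank Q U) =>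
    {a : A | z ^ (g + e + j) * algebraMap A Q a ∈ P.O}) fun _ =>
      hz.finite_setOf_pow_mul_mem (g + e + j)
  refine (hfin.image fun a => ∑ i, (algebraMap A Q (a i) / algebraMap A Q s) • b i).subset ?_
  rintro x ⟨hx, hxB⟩
  choose a ha using hsb x hx
  refine ⟨a, fun i _ => ?_, ?_⟩
  · obtain ⟨r, hr⟩ := htb _ hxB i
    have e1 : z ^ (g + e + j) * algebraMap A Q (a i) = (z ^ g * algebraMap A Q s) * (w * r) := by
      have : (r : Q) = t * (z ^ j * b.coord i x) := by
        rw [map_smul, smul_eq_mul] at hr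
        exact hr.symm
      rw [this, ← ha i, pow_add, pow_add, hzw]; ring
    change z ^ (g + e + j) * algebraMap A Q (a i) ∈ P.O
    rw [e1]
    exact mul_mem hg (mul_mem hw r.2)
  · conv_rhs => rw [← b.sum_repr x]
    refine Finset.sum_congr rfl fun i _ => ?_
    rw [← ha i, mul_div_cancel_left₀ _ hs0]; rfl

omit [SMulCommClass Q L U] [FiniteDimensional Q U] in
-- B is free over O of rank dim_Q U, and the residue field of O has q elements.
theorem relIndex_map_smul (hz : P.IsUniformizer z) (B : BiSub P.O Q L U)
    [Module.Finite P.O B.toSubmodule]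
    (hB : ∀ y : U, ∃ s : P.O, s ≠ 0 ∧ algebraMap P.O Q s • y ∈ B.toSubmodule) :
    (B.toSubmodule.toAddSubgroup.map (DistribSMul.toAddMonoidHom U z)).relIndex
      B.toSubmodule.toAddSubgroup = Fintype.card Fq ^ Module.finrank Q U := by
  have := P.isDiscreteValuationRing
  have := B.isTorsionFree
  have : Module.Free P.O B.toSubmodule := inferInstance
  let b := Module.finBasis P.O B.toSubmodule
  have hrank : Module.finrank P.O B.toSubmodule = Module.finrank Q U := by
    let _ : Module P.O U := Module.compHom U (algebraMap P.O Q)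
    have : IsScalarTower P.O Q U := ⟨fun a q x => by rw [Algebra.smul_def, mul_smul]; rfl⟩
    let ι : B.toSubmodule →ₗ[P.O] U :=
      { toFun := Subtype.val, map_add' := fun _ _ => rfl, map_smul' := fun _ _ => rfl }
    have hι : IsLocalizedModule P.O⁰ ι := isLocalizedModule_of_injective (Q := Q) ι
      Subtype.val_injective (fun y => by
        obtain ⟨s, hs, hy⟩ := hB y
        exact ⟨s, hs, ⟨_, hy⟩, rfl⟩)
    exact ((IsLocalization.finrank_eq Q P.O⁰ le_rfl).trans
      (IsLocalizedModule.finrank_eq P.O⁰ ι le_rfl)).symm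
  let ρ : B.toSubmodule →+ (Fin (Module.finrank P.O B.toSubmodule) →
      P.O ⧸ IsLocalRing.maximalIdeal P.O) :=
    { toFun := fun x i => Ideal.Quotient.mk _ (b.repr x i)
      map_zero' := by ext i; simp
      map_add' := fun x y => by ext i; simp }
  have hρ : Function.Surjective ρ := fun y => by
    choose x hx using fun i => Ideal.Quotient.mk_surjective (y i)
    refine ⟨b.equivFun.symm x, funext fun i => ?_⟩
    change Ideal.Quotient.mk _ (b.equivFun (b.equivFun.symm x) i) = _
    rw [LinearEquiv.apply_symm_apply, hx]
  have hker : (B.toSubmodule.toAddSubgroup.map (DistribSMul.toAddMonoidHom U z)).addSubgroupOf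
      B.toSubmodule.toAddSubgroup = ρ.ker := by
    refine AddSubgroup.ext fun (x : B.toSubmodule) => ?_
    rw [AddMonoidHom.mem_ker]
    constructor
    · rintro ⟨y, hy, hyx⟩
      have hx : x = (⟨z, ValuationSubring.nonunits_subset hz.1⟩ : P.O) • ⟨y, hy⟩ :=
        Subtype.ext hyx.symm
      funext i
      change Ideal.Quotient.mk _ (b.repr x i) = 0
      rw [hx, map_smul, Ideal.Quotient.eq_zero_iff_mem, Finsupp.smul_apply, smul_eq_mul,
        hz.maximalIdeal_eq]
      exact Ideal.mul_mem_right _ _ (Ideal.mem_span_singleton_self _)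
    · intro hx
      have h1 : ∀ i, ∃ y : P.O, b.repr x i = ⟨z, ValuationSubring.nonunits_subset hz.1⟩ * y := by
        intro i
        have := congrFun hx i
        change Ideal.Quotient.mk _ (b.repr x i) = 0 at this
        rw [Ideal.Quotient.eq_zero_iff_mem, hz.maximalIdeal_eq] at this
        exact Ideal.mem_span_singleton.1 this
      choose y hy using h1
      refine ⟨(∑ i, y i • b i : B.toSubmodule), (∑ i, y i • b i : B.toSubmodule).2, ?_⟩
      have h2 : x = (⟨z, ValuationSubring.nonunits_subset hz.1⟩ : P.O) • ∑ i, y i • b i := by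
        conv_lhs => rw [← b.sum_repr x]
        rw [Finset.smul_sum]
        refine Finset.sum_congr rfl fun i _ => ?_
        rw [hy, mul_smul]
      exact (congrArg Subtype.val h2).symm
  rw [AddSubgroup.relIndex, hker, AddSubgroup.index_ker, AddMonoidHom.range_eq_top.2 hρ,
    AddSubgroup.card_top, Nat.card_fun, Nat.card_fin, P.card_residue, hrank]

end Adelic

section RelDim

variable {L U : Type u} [Field L] [AddCommGroup U] [Module L U]

theorem relDim_eq_zero {N' N : Submodule L U} (h : N ≤ N') : relDim N' N = 0 := by
  have : Subsingleton (N ⧸ N'.submoduleOf N) := by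
    rw [Submodule.Quotient.subsingleton_iff, Submodule.submoduleOf_eq_top]
    exact h
  exact Module.finrank_zero_of_subsingleton

end RelDim

/-! ### Numerical invariants of chains of lattices -/

section Chain

variable {Fq A Q L : Type u} [Field Fq] [Fintype Fq] [CommRing A] [IsDedekindDomain A]
  [Algebra Fq A] [Algebra.FiniteType Fq A] [Field Q] [Algebra Fq Q] [Algebra A Q]
  [IsScalarTower Fq A Q] [IsFractionRing A Q] [Field L] [Finite L] [Algebra Fq L]
  {P : PlaceAtInfty Fq A Q}

omit [Fintype Fq] [IsDedekindDomain A] [Algebra Fq A] [Algebra.FiniteType Fq A]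
  [IsScalarTower Fq A Q] [IsFractionRing A Q] [Finite L] [Algebra Fq L] in
theorem mem_chain_iff {U : Type u} [AddCommGroup U] [Module Q U] [Module L U]
    (inf : ℤ → BiSub P.O Q L U) {k l : ℕ} {z : Q} (hz : P.IsUniformizer z)
    (hper : ∀ (i : ℤ) (x : U),
      x ∈ (inf i).toSubmodule ↔ (z ^ k)⁻¹ • x ∈ (inf (i + l)).toSubmodule) (j : ℕ) (x : U) :
    x ∈ (inf (l * j : ℕ)).toSubmodule ↔ z ^ (k * j) • x ∈ (inf 0).toSubmodule := by
  induction j generalizing x with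
  | zero => simp
  | succ j ih =>
    have hz0 : z ^ k ≠ 0 := pow_ne_zero _ hz.ne_zero
    have h1 := hper (l * j : ℕ) (z ^ k • x)
    rw [smul_smul, inv_mul_cancel₀ hz0, one_smul, ih, smul_smul, ← pow_add] at h1
    rw [show ((l * (j + 1) : ℕ) : ℤ) = ((l * j : ℕ) : ℤ) + l by push_cast; ring, ← h1, mul_add_one]

/-- The numerical invariants of a chain of lattices: the colengths at infinity determine the slope
and the colength of the image of `φ` away from infinity. -/
theorem relDim_chain {N : FrobSpace Fq Q L} (hinj : Function.Injective N.φ)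
    {aff : BiSub A Q L N.V} (haff : aff.IsLattice) (hφa : ∀ x ∈ aff.toSubmodule, N.φ x ∈ aff.toSubmodule)
    {inf : ℤ → BiSub P.O Q L N.V} (hinf : ∀ i, (inf i).IsLattice)
    (hmono : ∀ i, (inf i).toSubmodule ≤ (inf (i + 1)).toSubmodule)
    (hφ : ∀ i, ∀ x ∈ (inf i).toSubmodule, N.φ x ∈ (inf (i + 1)).toSubmodule)
    (hsurj : ∀ i, ∀ x ∈ (inf (i + 1)).toSubmodule, ∃ y ∈ (inf i).toSubmodule, N.φ y = x)
    {k l : ℕ} (hk : 0 < k) (hl : 0 < l)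
    (hper : ∀ i, ∀ z, P.IsUniformizer z → ∀ x : N.V,
      x ∈ (inf i).toSubmodule ↔ (z ^ k)⁻¹ • x ∈ (inf (i + l)).toSubmodule) :
    (∀ i, relDim (inf i).toSubmodule (inf (i + 1)).toSubmodule =
      relDim (inf 0).toSubmodule (inf 1).toSubmodule) ∧
    l * relDim (inf 0).toSubmodule (inf 1).toSubmodule = k * N.qlRank ∧
    FiniteDimensional L (aff.toSubmodule ⧸
      (Submodule.span L (N.φ '' (aff.toSubmodule : Set N.V))).submoduleOf aff.toSubmodule) ∧
    relDim (Submodule.span L (N.φ '' (aff.toSubmodule : Set N.V))) aff.toSubmodule =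
      relDim (inf 0).toSubmodule (inf 1).toSubmodule := by
  have := haff.finite
  have := fun i => (hinf i).finite
  have hQ : FiniteDimensional Q N.V := finiteDimensional_of_finite aff haff.exists_smul_mem
  obtain ⟨z, hz⟩ := P.exists_isUniformizer
  have hz0 : z ≠ 0 := hz.ne_zero
  let ψ : N.V →+ N.V := N.φ.toAddMonoidHom
  let ζ : N.V →+ N.V := DistribSMul.toAddMonoidHom N.V z
  have hζ : Function.Injective ζ := smul_right_injective N.V hz0
  have hζs : Function.Surjective ζ := fun x => ⟨z⁻¹ • x, by
    change z • z⁻¹ • x = x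
    rw [smul_smul, mul_inv_cancel₀ hz0, one_smul]⟩
  let C : ℤ → AddSubgroup N.V := fun i => (inf i).toSubmodule.toAddSubgroup
  have hψC : ∀ i, (C i).map ψ = C (i + 1) := by
    intro i
    refine le_antisymm ?_ fun x hx => ?_
    · rintro _ ⟨x, hx, rfl⟩
      exact hφ i x hx
    · obtain ⟨y, hy, rfl⟩ := hsurj i x hx
      exact ⟨y, hy, rfl⟩
  let B : ℕ → AddSubgroup N.V := fun j => C j
  have hB : Monotone B := monotone_nat_of_le_succ fun j => by
    have := hmono j
    exact this
  have hψB : ∀ j, (B j).map ψ = B (j + 1) := fun j => hψC j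
  have hmem : ∀ (j : ℕ) (x : N.V), x ∈ B (l * j) ↔ z ^ (k * j) • x ∈ B 0 :=
    mem_chain_iff inf hz fun i x => hper i z hz x
  have hup : ∀ (i j : ℕ) (x : N.V), z ^ i • x ∈ B 0 → i ≤ j → z ^ j • x ∈ B 0 := by
    intro i j x hx hij
    obtain ⟨m, rfl⟩ := Nat.exists_eq_add_of_le hij
    rw [add_comm, pow_add, mul_smul]
    exact (inf 0).r_smul_mem (⟨z, ValuationSubring.nonunits_subset hz.1⟩ ^ m) _ hx
  have hL : Nat.card L = Fintype.card Fq ^ Module.finrank Fq L := by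
    rw [Module.natCard_eq_pow_finrank (K := Fq), Nat.card_eq_fintype_card]
  have hq : 1 < Fintype.card Fq := Fintype.one_lt_card
  have hL1 : 1 < Nat.card L := by
    have : Nontrivial L := inferInstance
    exact Finite.one_lt_card
  -- The index of B 0 in B l computed in two ways. Comparing exponents of q and cancelling e gives l
  -- d = k r.
  have hpow : (B 0).relIndex (B 1) ^ l = (Fintype.card Fq ^ Module.finrank Q N.V) ^ k := by
    refine relIndex_pow_eq (ζ := ζ) hinj hζ hB hψB (fun x => ?_) (fun i => ?_) hζs fun i => ?_
    · have h1 := hmem 1 x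
      rw [mul_one, mul_one] at h1
      rw [h1]
      change _ ↔ (fun x => z • x)^[k] x ∈ B 0
      rw [smul_iterate]
    · rintro _ ⟨x, hx, rfl⟩
      exact (inf i).r_smul_mem ⟨z, ValuationSubring.nonunits_subset hz.1⟩ x hx
    · exact relIndex_map_smul hz (inf i) (hinf i).exists_smul_mem
  have hne : (B 0).relIndex (B 1) ≠ 0 := by
    intro h0
    rw [h0, zero_pow hl.ne'] at hpow
    exact (pow_ne_zero _ (pow_ne_zero _ (by omega))) hpow.symm
  have hC : ∀ i, (C i).relIndex (C (i + 1)) = (C 0).relIndex (C 1) := by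
    have hstep : ∀ i, (C i).relIndex (C (i + 1)) = (C (i + 1)).relIndex (C (i + 1 + 1)) := by
      intro i
      have := AddSubgroup.relIndex_map_map_of_injective (f := ψ) (C i) (C (i + 1)) hinj
      rw [← this, hψC, hψC]
    intro i
    induction i using Int.induction_on with
    | zero => rfl
    | succ i ih => rw [← hstep, ih]
    | pred i ih => rw [hstep, sub_add_cancel, ih]
  have hd0 := (relIndex_eq_pow_relDim (N' := (inf 0).toSubmodule) (N := (inf 1).toSubmodule) hne).2
  refine ⟨fun i => ?_, ?_, ?_⟩
  · have h1 := (relIndex_eq_pow_relDim (N' := (inf i).toSubmodule) (N := (inf (i + 1)).toSubmodule)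
      ((hC i).trans_ne hne)).2
    exact Nat.pow_right_injective hL1 (h1.symm.trans ((hC i).trans hd0))
  · have h1 : (B 0).relIndex (B 1) = Nat.card L ^ relDim (inf 0).toSubmodule (inf 1).toSubmodule := hd0
    rw [h1, hL, N.finrank_eq P, ← pow_mul, ← pow_mul, ← pow_mul] at hpow
    have h2 := Nat.pow_right_injective hq hpow
    have h3 : Module.finrank Fq L * (l * relDim (inf 0).toSubmodule (inf 1).toSubmodule) =
        Module.finrank Fq L * (k * N.qlRank) := by
      rw [mul_comm l, h2]; ring
    exact Nat.eq_of_mul_eq_mul_left Module.finrank_pos h3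
  · obtain ⟨j, hj⟩ := exists_pow_smul_sub_mem hz haff.exists_smul_mem (hinf 0).exists_smul_mem
    have hkj : ∀ i, i ≤ k * i := fun i => Nat.le_mul_of_pos_left i hk
    -- The chain is started at l j, far enough that its lattices together with the affine one span
    -- everything. Then `relIndex_map_eq` transfers the index from infinity to the affine part.
    have hindex : (aff.toSubmodule.toAddSubgroup.map ψ).relIndex aff.toSubmodule.toAddSubgroup =
        (B (l * j)).relIndex (B (l * j + 1)) := by
      have := relIndex_map_eq (φ := ψ) hinj (H := aff.toSubmodule.toAddSubgroup)
        (by rintro _ ⟨x, hx, rfl⟩; exact hφa x hx) (B := fun i => B (l * j + i))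
        (fun a b hab => hB (by omega)) (fun i => hψB _) ?_ ?_ ?_
      · exact this
      · rw [eq_top_iff]
        rintro y -
        obtain ⟨x, hx, hxy⟩ := hj y
        have h1 : y - x ∈ B (l * j) := (hmem j _).2 (hup _ _ _ hxy (hkj j))
        rw [← add_sub_cancel x y]
        exact AddSubgroup.add_mem_sup hx h1
      · intro x
        obtain ⟨s, hs, hsx⟩ := (hinf 0).exists_smul_mem x
        obtain ⟨e, w, hw, hzw⟩ := hz.exists_pow_eq_mul hs
        have h1 : z ^ e • x ∈ B 0 := by
          rw [hzw, mul_smul]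
          exact (inf 0).r_smul_mem ⟨w, hw⟩ _ hsx
        exact ⟨l * e, hB (Nat.le_add_left _ _) ((hmem e x).2 (hup _ _ _ h1 (hkj e)))⟩
      · intro i
        obtain ⟨m, hm⟩ : ∃ m, m = l * j + i := ⟨_, rfl⟩
        have hfin := finite_setOf_mem_pow_smul_mem hz aff (inf 0) (k * m)
        refine (hfin.subset ?_).to_subtype
        rintro x ⟨hx, hxB⟩
        refine ⟨hx, (hmem m x).1 (hB (Nat.le_mul_of_pos_left m hl) ?_)⟩
        rw [hm]; exact hxB
    have himg : (Submodule.span L (N.φ '' (aff.toSubmodule : Set N.V))).toAddSubgroup =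
        aff.toSubmodule.toAddSubgroup.map ψ := by
      refine le_antisymm (fun x hx => ?_) ?_
      · exact exists_of_mem_span_image ψ N.φ_smul aff.toSubmodule hx
      · rintro _ ⟨x, hx, rfl⟩
        exact Submodule.subset_span ⟨x, hx, rfl⟩
    rw [← himg] at hindex
    have hindex' := hindex.trans (hC (l * j : ℕ))
    obtain ⟨h1, h2⟩ := relIndex_eq_pow_relDim (hindex'.trans_ne hne)
    exact ⟨h1, Nat.pow_right_injective hL1 (h2.symm.trans (hindex'.trans hd0))⟩

end Chain

/-! ### Quotient τ-sheaves and simple generic fibres -/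

section Quotient

variable {Fq A Q L : Type u} [Field Fq] [Fintype Fq] [CommRing A] [IsDedekindDomain A]
  [Algebra Fq A] [Algebra.FiniteType Fq A] [Field Q] [Algebra Fq Q] [Algebra A Q]
  [IsScalarTower Fq A Q] [IsFractionRing A Q] [Field L] [Finite L] [Algebra Fq L]
  {P : PlaceAtInfty Fq A Q}

omit [IsDedekindDomain A] [Algebra.FiniteType Fq A] [IsScalarTower Fq A Q] [IsFractionRing A Q]
  [Finite L] in
/-- `J ^ d` annihilates the cokernel of `φ` if a power of `J` does, for `d` its dimension. -/
theorem foldr_jAct_mem_span {N : FrobSpace Fq Q L} (c : A →ₐ[Fq] L) (aff : BiSub A Q L N.V)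
    [FiniteDimensional L (aff.toSubmodule ⧸
      (Submodule.span L (N.φ '' (aff.toSubmodule : Set N.V))).submoduleOf aff.toSubmodule)]
    {d₀ : ℕ} (h : ∀ a : Fin d₀ → A, ∀ x ∈ aff.toSubmodule,
      (List.ofFn a).foldr (fun b y => jAct (Q := Q) c b y) x ∈
        Submodule.span L (N.φ '' (aff.toSubmodule : Set N.V))) {d : ℕ}
    (hd : relDim (Submodule.span L (N.φ '' (aff.toSubmodule : Set N.V))) aff.toSubmodule = d)
    (a : Fin d → A) {x : N.V} (hx : x ∈ aff.toSubmodule) :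
    (List.ofFn a).foldr (fun b y => jAct (Q := Q) c b y) x ∈
      Submodule.span L (N.φ '' (aff.toSubmodule : Set N.V)) := by
  subst hd
  have hst : ∀ (a : A), ∀ y ∈ Submodule.span L (N.φ '' (aff.toSubmodule : Set N.V)),
      algebraMap A Q a • y ∈ Submodule.span L (N.φ '' (aff.toSubmodule : Set N.V)) := by
    intro a y hy
    induction hy using Submodule.span_induction with
    | mem y hy =>
      obtain ⟨y, hy, rfl⟩ := hy
      rw [← map_smul]
      exact Submodule.subset_span ⟨_, aff.r_smul_mem a y hy, rfl⟩
    | zero => rw [smul_zero]; exact Submodule.zero_mem _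
    | add y y' _ _ h h' => rw [smul_add]; exact Submodule.add_mem _ h h'
    | smul b y _ h => rw [smul_comm]; exact Submodule.smul_mem _ _ h
  let T : A → Module.End L aff.toSubmodule := fun a =>
    { toFun := fun x => a • x - c a • x
      map_add' := fun x y => by rw [smul_add, smul_add]; abel
      map_smul' := fun b x => by
        rw [RingHom.id_apply, smul_sub, smul_comm a b, smul_comm (c a) b] }
  have hT : ∀ (l : List A) (x : aff.toSubmodule),
      ((l.foldr (fun b y => T b y) x : aff.toSubmodule) : N.V) =
        l.foldr (fun b y => jAct (Q := Q) c b y) x.1 := by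
    intro l x
    induction l with
    | nil => rfl
    | cons b l ih => rw [List.foldr_cons, List.foldr_cons, ← ih]; rfl
  have key := foldr_mem_of_finrank
    ((Submodule.span L (N.φ '' (aff.toSubmodule : Set N.V))).submoduleOf aff.toSubmodule) T
    (fun a b => LinearMap.ext fun x => by
      change a • (b • x - c b • x) - c a • (b • x - c b • x) =
        b • (a • x - c a • x) - c b • (a • x - c a • x)
      simp only [smul_sub, smul_comm a (c b) x, smul_comm b (c a) x, smul_smul, mul_comm a b,
        mul_comm (c a) (c b)]
      abel)
    (fun a x hx => by
      change ((a • x - c a • x : aff.toSubmodule) : N.V) ∈ Submodule.span L _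
      have hx' : (x : N.V) ∈ Submodule.span L (N.φ '' (aff.toSubmodule : Set N.V)) := hx
      exact Submodule.sub_mem _ (hst a _ hx') (Submodule.smul_mem _ _ hx'))
    (fun a x => by
      change ((_ : aff.toSubmodule) : N.V) ∈ Submodule.span L _
      rw [hT]
      exact h a x x.2) a ⟨x, hx⟩
  rw [← hT _ ⟨x, hx⟩]
  exact key

namespace AbelianTauSheaf

/-- A quotient of the generic fibre underlies a quotient `τ`-sheaf. -/
theorem exists_quotient {c : A →ₐ[Fq] L} (F : AbelianTauSheaf P (.affine c)) {N : FrobSpace Fq Q L}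
    (π : F.V →ₗ[Q] N.V) (hs : Function.Surjective π)
    (hπ : ∀ (b : L) (x : F.V), π (b • x) = b • π x) (hφ : ∀ x, π (F.φ x) = N.φ (π x))
    (hinj : Function.Injective N.φ) :
    ∃ (F' : AbelianTauSheaf P (.affine c)) (f : F.V →ₗ[Q] F'.V), IsMorphism F F' f ∧
      (∀ i, ∀ y ∈ (F'.aff i).toSubmodule, ∃ x ∈ (F.aff i).toSubmodule, f x = y) ∧
      (∀ i, ∀ y ∈ (F'.inf i).toSubmodule, ∃ x ∈ (F.inf i).toSubmodule, f x = y) ∧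
      LinearMap.ker f = LinearMap.ker π ∧ Function.Surjective f := by
  obtain ⟨k, l, hk, hl, hkl, h⟩ := F.periodic
  let aff : ℤ → BiSub A Q L N.V := fun i => (F.aff i).map π hπ
  let inf : ℤ → BiSub P.O Q L N.V := fun i => (F.inf i).map π hπ
  have haff : ∀ i, (aff i).IsLattice := fun i => (F.aff_lattice i).map π hπ hs
  have hinf : ∀ i, (inf i).IsLattice := fun i => (F.inf_lattice i).map π hπ hs
  have haff_eq : ∀ i, (aff i).toSubmodule = (aff 0).toSubmodule := by
    intro i
    ext y
    constructor
    · rintro ⟨x, hx, rfl⟩; exact ⟨x, (F.aff_eq i).le hx, rfl⟩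
    · rintro ⟨x, hx, rfl⟩; exact ⟨x, (F.aff_eq i).ge hx, rfl⟩
  have hφa : ∀ x ∈ (aff 0).toSubmodule, N.φ x ∈ (aff 0).toSubmodule := by
    rintro _ ⟨x, hx, rfl⟩
    exact ⟨F.φ x, F.φ_mem_aff_zero x hx, hφ x⟩
  have hmono : ∀ i, (inf i).toSubmodule ≤ (inf (i + 1)).toSubmodule := by
    rintro i _ ⟨x, hx, rfl⟩
    exact ⟨x, F.inf_mono i hx, rfl⟩
  have hφi : ∀ i, ∀ x ∈ (inf i).toSubmodule, N.φ x ∈ (inf (i + 1)).toSubmodule := by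
    rintro i _ ⟨x, hx, rfl⟩
    exact ⟨F.φ x, F.inf_φ i x hx, hφ x⟩
  have hsurj : ∀ i, ∀ x ∈ (inf (i + 1)).toSubmodule, ∃ y ∈ (inf i).toSubmodule, N.φ y = x := by
    rintro i _ ⟨x, hx, rfl⟩
    obtain ⟨y, hy, rfl⟩ := F.exists_φ_eq_of_mem_inf i hx
    exact ⟨π y, ⟨y, hy, rfl⟩, (hφ y).symm⟩
  have hper : ∀ i, ∀ z, P.IsUniformizer z → ∀ x : N.V,
      x ∈ (inf i).toSubmodule ↔ (z ^ k)⁻¹ • x ∈ (inf (i + l)).toSubmodule := by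
    intro i z hz x
    have hz0 : z ^ k ≠ 0 := pow_ne_zero _ hz.ne_zero
    constructor
    · rintro ⟨x, hx, rfl⟩
      exact ⟨(z ^ k)⁻¹ • x, ((h i).2 z hz x).1 hx, map_smul π _ x⟩
    · rintro ⟨y, hy, hyx⟩
      refine ⟨z ^ k • y, ((h i).2 z hz _).2 ?_, ?_⟩
      · rwa [smul_smul, inv_mul_cancel₀ hz0, one_smul]
      · rw [map_smul, hyx, smul_smul, mul_inv_cancel₀ hz0, one_smul]
  -- The dimension of the quotient is taken to be its colength at infinity; all other numerical
  -- axioms are then supplied by `relDim_chain`, which needs the characteristic to be away from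
  -- infinity.
  obtain ⟨h1, h2, h3, h4⟩ := relDim_chain hinj (haff 0) hφa hinf hmono hφi hsurj hk hl hper
  have hspan : ∀ i, (inf (i + 1)).toSubmodule ≤
      Submodule.span L (N.φ '' ((inf i).toSubmodule : Set N.V)) := by
    intro i x hx
    obtain ⟨y, hy, rfl⟩ := hsurj i x hx
    exact Submodule.subset_span ⟨y, hy, rfl⟩
  have hann : ∀ a : Fin F.dim → A, ∀ x ∈ (aff 0).toSubmodule,
      (List.ofFn a).foldr (fun b y => jAct (Q := Q) c b y) x ∈
        Submodule.span L (N.φ '' ((aff 0).toSubmodule : Set N.V)) := by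
    rintro a _ ⟨x, hx, rfl⟩
    have h5 : ∀ l : List A, l.foldr (fun b y => jAct (Q := Q) c b y) (π x) =
        π (l.foldr (fun b y => jAct (Q := Q) c b y) x) := by
      intro l
      induction l with
      | nil => rfl
      | cons b l ih =>
        rw [List.foldr_cons, List.foldr_cons, ih, jAct, jAct, map_sub, map_smul, hπ]
    rw [h5]
    obtain ⟨y, hy, hyx⟩ := exists_of_mem_span_image F.φ.toAddMonoidHom F.φ_smul _
      ((F.annihilated 0).1 a x (F.aff_mono 0 hx))
    rw [← hyx]
    refine Submodule.subset_span ⟨π y, ⟨y, hy, rfl⟩, (hφ y).symm⟩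
  let F' : AbelianTauSheaf P (.affine c) :=
    { toFrobSpace := N
      rank := N.qlRank
      dim := relDim (inf 0).toSubmodule (inf 1).toSubmodule
      aff := aff
      inf := inf
      aff_lattice := haff
      inf_lattice := hinf
      rank_eq := rfl
      φ_injective := hinj
      aff_mono := fun i => ((haff_eq i).trans (haff_eq (i + 1)).symm).le
      inf_mono := hmono
      aff_φ := fun i x hx => (haff_eq (i + 1)).ge (hφa x ((haff_eq i).le hx))
      inf_φ := hφi
      periodic := ⟨k, l, hk, hl, h2, fun i =>
        ⟨(haff_eq i).trans (haff_eq (i + l)).symm, fun z hz x => hper i z hz x⟩⟩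
      dim_coker_incl := fun i => by
        rw [relDim_eq_zero ((haff_eq (i + 1)).trans (haff_eq i).symm).le, zero_add, h1]
      dim_coker_τ := fun i => by
        rw [relDim_eq_zero (hspan i), add_zero, haff_eq i, haff_eq (i + 1), h4]
      annihilated := fun i => ⟨fun a x hx => by
        rw [haff_eq i]
        exact foldr_jAct_mem_span c (aff 0) hann h4 a ((haff_eq (i + 1)).le hx), hspan i⟩ }
  exact ⟨F', π, ⟨hπ, hφ, fun i x hx => ⟨x, hx, rfl⟩, fun i x hx => ⟨x, hx, rfl⟩⟩,
    fun i y hy => hy, fun i y hy => hy, rfl, hs⟩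

/-- The quotient of V by W underlies a quotient τ-sheaf, so simplicity makes the projection either
zero or injective. -/
theorem IsSimple.eq_bot_or_eq_top {c : A →ₐ[Fq] L} {F : AbelianTauSheaf P (.affine c)}
    (hF : F.IsSimple) {W : Submodule Q F.V} (hL : ∀ (b : L), ∀ x ∈ W, b • x ∈ W)
    (hφ : ∀ x ∈ W, F.φ x ∈ W) : W = ⊥ ∨ W = ⊤ := by
  have := (F.aff_lattice 0).finite
  have hQ : FiniteDimensional Q F.V :=
    finiteDimensional_of_finite (F.aff 0) (F.aff_lattice 0).exists_smul_mem
  obtain ⟨N, π, hs, hker, hπ, hπφ, hinj⟩ := F.toFrobSpace.exists_quotient F.φ_injective W hL hφ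
  obtain ⟨F', f, hf, h1, h2, hkf, hsf⟩ := F.exists_quotient π hs hπ hπφ hinj
  rw [hker] at hkf
  rcases hF.2 F' f hf h1 h2 with h | h
  · right
    rw [← hkf, eq_top_iff]
    exact fun x _ => Subsingleton.elim _ _
  · left
    rw [← hkf, LinearMap.ker_eq_bot.2 h]

/-- The quasi-endomorphism algebra of a semisimple `τ`-sheaf is semisimple if the characteristic is
different from infinity. -/
theorem IsSemisimple.isSemisimpleRing_QEnd {c : A →ₐ[Fq] L} {F : AbelianTauSheaf P (.affine c)}
    (hF : F.IsSemisimple) : IsSemisimpleRing F.QEnd := by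
  have := (F.aff_lattice 0).finite
  have hQ : FiniteDimensional Q F.V :=
    finiteDimensional_of_finite (F.aff 0) (F.aff_lattice 0).exists_smul_mem
  obtain ⟨n, S, f, hS, -, hf, hL, hφ, -⟩ := hF
  rw [F.QEnd_eq]
  exact F.toFrobSpace.isSemisimpleRing_commutant (fun j => (S j).toFrobSpace) f hf hL hφ fun j =>
    ⟨(hS j).1, fun W h1 h2 => (hS j).eq_bot_or_eq_top h1 h2⟩

end AbelianTauSheaf

end Quotient

/-! ### Extending maps to generic fibres -/

section Extension

variable {R Q M U U' : Type u} [CommRing R] [IsDomain R] [Field Q] [Algebra R Q]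
  [IsFractionRing R Q] [AddCommGroup M] [Module R M] [AddCommGroup U] [Module Q U]
  [AddCommGroup U'] [Module Q U']

omit [IsDomain R] in
omit [AddCommGroup M] [Module R M] in
theorem linearMap_eq_of_eqOn {ι : M → U}
    (hden : ∀ y : U, ∃ a : R, a ≠ 0 ∧ ∃ x : M, algebraMap R Q a • y = ι x) {F G : U →ₗ[Q] U'}
    (h : ∀ x, F (ι x) = G (ι x)) : F = G := by
  refine LinearMap.ext fun y => ?_
  obtain ⟨a, ha, x, hx⟩ := hden y
  have ha' : algebraMap R Q a ≠ 0 := by rwa [Ne, IsFractionRing.to_map_eq_zero_iff]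
  refine smul_right_injective U' ha' ?_
  change algebraMap R Q a • F y = algebraMap R Q a • G y
  rw [← map_smul, ← map_smul, hx, h]

theorem exists_extension (ι : M →+ U) (hι : Function.Injective ι)
    (hA : ∀ (a : R) (x : M), ι (a • x) = algebraMap R Q a • ι x)
    (hden : ∀ y : U, ∃ a : R, a ≠ 0 ∧ ∃ x : M, algebraMap R Q a • y = ι x) (g : M →+ U')
    (hg : ∀ (a : R) (x : M), g (a • x) = algebraMap R Q a • g x) :
    ∃ F : U →ₗ[Q] U', ∀ x, F (ι x) = g x := by
  let _ : Module R U := Module.compHom U (algebraMap R Q)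
  have : IsScalarTower R Q U := ⟨fun a q x => by rw [Algebra.smul_def, mul_smul]; rfl⟩
  let _ : Module R U' := Module.compHom U' (algebraMap R Q)
  have : IsScalarTower R Q U' := ⟨fun a q x => by rw [Algebra.smul_def, mul_smul]; rfl⟩
  let ιl : M →ₗ[R] U := { ι with map_smul' := hA }
  let gl : M →ₗ[R] U' := { g with map_smul' := hg }
  have : IsLocalizedModule R⁰ ιl := isLocalizedModule_of_injective ιl hι hden
  have hu : ∀ s : R⁰, IsUnit (algebraMap R (Module.End R U') s) := fun s => by
    have hs : algebraMap R Q s ≠ 0 := by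
      rw [Ne, IsFractionRing.to_map_eq_zero_iff]
      exact nonZeroDivisors.ne_zero s.2
    rw [Module.End.isUnit_iff]
    refine ⟨smul_right_injective U' hs, fun y => ⟨(algebraMap R Q s)⁻¹ • y, ?_⟩⟩
    change algebraMap R Q s • (algebraMap R Q s)⁻¹ • y = y
    rw [smul_smul, mul_inv_cancel₀ hs, one_smul]
  refine ⟨(IsLocalizedModule.lift R⁰ ιl gl hu).extendScalarsOfIsLocalization R⁰ Q, fun x => ?_⟩
  exact IsLocalizedModule.lift_apply R⁰ ιl gl hu x

end Extension

section Lattices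

variable {R Q L U : Type u} [CommRing R] [IsDomain R] [Field Q] [Algebra R Q] [IsFractionRing R Q]
  [Field L] [AddCommGroup U] [Module Q U] [Module L U] [SMulCommClass Q L U]

omit [IsDomain R] [SMulCommClass Q L U] in
theorem BiSub.isLattice_of_finite (N : BiSub R Q L U) [Module.Finite R N.toSubmodule]
    (h : ∀ y : U, ∃ s : R, s ≠ 0 ∧ algebraMap R Q s • y ∈ N.toSubmodule) : N.IsLattice := by
  classical
  obtain ⟨T, hT⟩ := Module.Finite.fg_top (R := R) (M := N.toSubmodule)
  refine ⟨⟨T.image Subtype.val, le_antisymm (fun x hx => ?_) (Submodule.span_le.2 ?_)⟩,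
    eq_top_iff.2 fun y _ => ?_⟩
  · have H : ∀ y ∈ Submodule.span R (T : Set N.toSubmodule), ∀ a : R, algebraMap R Q a • (y : U) ∈
        Submodule.span L {y : U | ∃ a : R, ∃ s ∈ T.image Subtype.val, y = algebraMap R Q a • s} := by
      intro y hy
      induction hy using Submodule.span_induction with
      | mem y hy => exact fun a => Submodule.subset_span ⟨a, y, Finset.mem_image_of_mem _ hy, rfl⟩
      | zero => exact fun a => by rw [ZeroMemClass.coe_zero, smul_zero]; exact Submodule.zero_mem _
      | add y y' _ _ h h' =>
        exact fun a => by
          rw [Submodule.coe_add, smul_add]; exact Submodule.add_mem _ (h a) (h' a)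
      | smul b y _ h =>
        exact fun a => by rw [BiSub.coe_smulR, smul_smul, ← map_mul]; exact h (a * b)
    have := H ⟨x, hx⟩ (hT ▸ Submodule.mem_top) 1
    rwa [map_one, one_smul] at this
  · rintro _ ⟨a, s, hs, rfl⟩
    obtain ⟨s, hs, rfl⟩ := Finset.mem_image.1 hs
    exact N.r_smul_mem a _ s.2
  · obtain ⟨s, hs, hy⟩ := h y
    have hs' : algebraMap R Q s ≠ 0 := by rwa [Ne, IsFractionRing.to_map_eq_zero_iff]
    exact Submodule.subset_span ⟨(algebraMap R Q s)⁻¹, _, hy, by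
      rw [smul_smul, inv_mul_cancel₀ hs', one_smul]⟩

end Lattices

/-! ### Generic fibres of pure Anderson motives -/

section Motives

variable {Fq A Q L : Type u} [Field Fq] [Fintype Fq] [CommRing A] [IsDedekindDomain A]
  [Algebra Fq A] [Algebra.FiniteType Fq A] [Field Q] [Algebra Fq Q] [Algebra A Q]
  [IsScalarTower Fq A Q] [IsFractionRing A Q] [Field L] [Finite L] [Algebra Fq L]
  {P : PlaceAtInfty Fq A Q} {c : A →ₐ[Fq] L}

namespace PureAndersonMotive

/-- `N` is the generic fibre of `M`. -/
structure IsGenericFibre (M : PureAndersonMotive P c) (N : FrobSpace Fq Q L) (ι : M.M →ₗ[L] N.V) :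
    Prop where
  injective : Function.Injective ι
  map_smul_A : ∀ (a : A) (x : M.M), ι (a • x) = algebraMap A Q a • ι x
  map_τ : ∀ x, ι (M.τ x) = N.φ (ι x)
  exists_smul_eq : ∀ y : N.V, ∃ a : A, a ≠ 0 ∧ ∃ x : M.M, algebraMap A Q a • y = ι x

omit [IsDedekindDomain A] [Algebra.FiniteType Fq A] [IsScalarTower Fq A Q] [IsFractionRing A Q] in
theorem module_finite (M : PureAndersonMotive P c) : Module.Finite A M.M := by
  let _ : Module (A ⊗[Fq] L) M.M := TensorProduct.Algebra.module
  have : IsScalarTower A (A ⊗[Fq] L) M.M := ⟨fun a t x => by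
    induction t with
    | zero => rw [smul_zero, zero_smul, smul_zero]
    | tmul a' b =>
      rw [TensorProduct.smul_tmul', TensorProduct.Algebra.smul_def, TensorProduct.Algebra.smul_def,
        smul_eq_mul, mul_smul]
    | add t t' h h' => rw [smul_add, add_smul, h, h', add_smul, smul_add]⟩
  have := M.locally_free.1
  exact Module.Finite.trans (A ⊗[Fq] L) M.M

namespace IsGenericFibre

variable {M : PureAndersonMotive P c} {N : FrobSpace Fq Q L} {ι : M.M →ₗ[L] N.V}
  (h : M.IsGenericFibre N ι)

include h

omit [Algebra.FiniteType Fq A] [IsScalarTower Fq A Q] [Finite L] in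
theorem isTorsionFree : Module.IsTorsionFree A M.M := by
  refine ⟨fun r hr x y hxy => h.injective ?_⟩
  have h1 := congrArg ι hxy
  simp only [h.map_smul_A] at h1
  have hr' : algebraMap A Q r ≠ 0 := by
    rw [Ne, IsFractionRing.to_map_eq_zero_iff]
    exact hr.ne_zero
  exact smul_right_injective N.V hr' h1

omit [IsDedekindDomain A] [Algebra.FiniteType Fq A] [IsScalarTower Fq A Q] [Finite L] in
theorem φ_injective : Function.Injective N.φ := by
  rw [injective_iff_map_eq_zero]
  intro y hy
  obtain ⟨a, ha, x, hx⟩ := h.exists_smul_eq y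
  have ha' : algebraMap A Q a ≠ 0 := by rwa [Ne, IsFractionRing.to_map_eq_zero_iff]
  have h1 : ι (M.τ x) = ι 0 := by rw [h.map_τ, ← hx, map_smul, hy, smul_zero, map_zero]
  have h2 : x = 0 := M.τ_injective ((h.injective h1).trans (map_zero M.τ).symm)
  rw [h2, map_zero] at hx
  exact (smul_eq_zero.1 hx).resolve_left ha'

omit [IsDedekindDomain A] [Algebra.FiniteType Fq A] [IsScalarTower Fq A Q] in
/-- The lattice `M` in its generic fibre. -/
theorem exists_lattice : ∃ X : BiSub A Q L N.V, X.IsLattice ∧ ∀ y, y ∈ X.toSubmodule ↔ ∃ x, ι x = y := by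
  have := M.module_finite
  obtain ⟨X, hX⟩ : ∃ X : BiSub A Q L N.V, ∀ y, y ∈ X.toSubmodule ↔ ∃ x, ι x = y :=
    ⟨{ LinearMap.range ι with
       r_smul_mem := by
        rintro a _ ⟨x, rfl⟩
        exact ⟨a • x, h.map_smul_A a x⟩ }, fun _ => Iff.rfl⟩
  have : Module.Finite A X.toSubmodule := .of_surjective
    ({ toFun := fun x => ⟨ι x, (hX _).2 ⟨x, rfl⟩⟩
       map_add' := fun x y => Subtype.ext (map_add ι x y)
       map_smul' := fun a x => Subtype.ext (h.map_smul_A a x) } : M.M →ₗ[A] X.toSubmodule)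
    (fun y => ((hX _).1 y.2).imp fun x hx => Subtype.ext hx)
  refine ⟨X, X.isLattice_of_finite fun y => ?_, hX⟩
  obtain ⟨a, ha, x, hx⟩ := h.exists_smul_eq y
  exact ⟨a, ha, (hX _).2 ⟨x, hx.symm⟩⟩

omit [Algebra.FiniteType Fq A] [IsScalarTower Fq A Q] in
theorem finiteDimensional : FiniteDimensional Q N.V := by
  obtain ⟨X, hX, -⟩ := h.exists_lattice
  have := hX.finite
  exact finiteDimensional_of_finite X hX.exists_smul_mem

omit [Algebra.FiniteType Fq A] [IsScalarTower Fq A Q] [Finite L] in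
/-- A morphism of motives extends to the generic fibres. -/
theorem exists_map {M' : PureAndersonMotive P c} {N' : FrobSpace Fq Q L} {ι' : M'.M →ₗ[L] N'.V}
    (h' : M'.IsGenericFibre N' ι') (f : M.M →ₗ[A] M'.M) (hL : ∀ (b : L) (x : M.M), f (b • x) = b • f x)
    (hτ : ∀ x, f (M.τ x) = M'.τ (f x)) :
    ∃ F : N.V →ₗ[Q] N'.V, (∀ x, F (ι x) = ι' (f x)) ∧ (∀ (b : L) (y : N.V), F (b • y) = b • F y) ∧
      ∀ y, F (N.φ y) = N'.φ (F y) := by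
  obtain ⟨F, hF⟩ := exists_extension (R := A) (Q := Q) ι.toAddMonoidHom h.injective h.map_smul_A
    h.exists_smul_eq (ι'.toAddMonoidHom.comp f.toAddMonoidHom)
    (fun a x => by
      change ι' (f (a • x)) = _ • ι' (f x)
      rw [map_smul, h'.map_smul_A])
  have hF' : ∀ x, F (ι x) = ι' (f x) := hF
  refine ⟨F, hF', fun b y => ?_, fun y => ?_⟩
  · let s : N.V →ₗ[Q] N.V :=
      { toFun := fun x => b • x, map_add' := smul_add b, map_smul' := fun q x => (smul_comm q b x).symm }
    let s' : N'.V →ₗ[Q] N'.V :=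
      { toFun := fun x => b • x, map_add' := smul_add b, map_smul' := fun q x => (smul_comm q b x).symm }
    refine LinearMap.congr_fun (linearMap_eq_of_eqOn (R := A) h.exists_smul_eq
      (F := F ∘ₗ s) (G := s' ∘ₗ F) fun x => ?_) y
    change F (b • ι x) = b • F (ι x)
    rw [← map_smul, hF', hF', hL, map_smul]
  · refine LinearMap.congr_fun (linearMap_eq_of_eqOn (R := A) h.exists_smul_eq
      (F := F ∘ₗ N.φ) (G := N'.φ ∘ₗ F) fun x => ?_) y
    change F (N.φ (ι x)) = N'.φ (F (ι x))
    rw [← h.map_τ, hF', hF', hτ, h'.map_τ]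

omit [Algebra.FiniteType Fq A] [IsScalarTower Fq A Q] in
/-- `Q ⊗ End(M)` is the endomorphism algebra of the generic fibre. -/
theorem exists_end_equiv :
    ∃ e : Q ⊗[A] M.End ≃ₐ[Q] N.commutant, ∀ (f : M.End) (x : M.M),
      (e (1 ⊗ₜ f)).1 (ι x) = ι (f.1 x) := by
  let _ : Algebra A N.commutant := Algebra.compHom N.commutant (algebraMap A Q)
  have : IsScalarTower A Q N.commutant := .of_algebraMap_eq fun _ => rfl
  choose E hE hEL hEφ using fun f : M.End => h.exists_map h f.1 f.2.1 f.2.2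
  have ext : ∀ {F G : N.commutant}, (∀ x, F.1 (ι x) = G.1 (ι x)) → F = G := fun H =>
    Subtype.ext (linearMap_eq_of_eqOn (R := A) h.exists_smul_eq H)
  let ρ : M.End →ₐ[A] N.commutant :=
    { toFun := fun f => ⟨E f, hEL f, hEφ f⟩
      map_one' := ext fun x => hE 1 x
      map_mul' := fun f g => ext fun x => by
        change E (f * g) (ι x) = E f (E g (ι x))
        rw [hE, hE, hE]; rfl
      map_zero' := ext fun x => by
        change E 0 (ι x) = 0
        rw [hE]; exact map_zero ι
      map_add' := fun f g => ext fun x => by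
        change E (f + g) (ι x) = E f (ι x) + E g (ι x)
        rw [hE, hE, hE]; exact map_add ι _ _
      commutes' := fun a => ext fun x => by
        change E _ (ι x) = algebraMap A Q a • ι x
        rw [hE, ← h.map_smul_A]; rfl }
  have hρ : ∀ f x, (ρ f).1 (ι x) = ι (f.1 x) := hE
  obtain ⟨Φ, hΦ⟩ : ∃ Φ : Q ⊗[A] M.End →ₐ[Q] N.commutant, ∀ q f, Φ (q ⊗ₜ f) = q • ρ f :=
    ⟨Algebra.TensorProduct.lift (Algebra.ofId Q N.commutant) ρ fun q f => Algebra.commutes q (ρ f),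
      fun q f => (Algebra.TensorProduct.lift_tmul _ _ _ q f).trans (Algebra.smul_def q (ρ f)).symm⟩
  have hinj : Function.Injective Φ := by
    rw [injective_iff_map_eq_zero]
    intro t ht
    obtain ⟨⟨f, s⟩, hs⟩ := IsLocalizedModule.surj A⁰ (TensorProduct.mk A Q M.End 1) t
    have hs0 : algebraMap A Q s ≠ 0 := by
      rw [Ne, IsFractionRing.to_map_eq_zero_iff]
      exact nonZeroDivisors.ne_zero s.2
    have hs' : algebraMap A Q s • t = 1 ⊗ₜ f := by
      rw [algebraMap_smul]; exact hs
    have h1 : ρ f = 0 := by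
      rw [← one_smul Q (ρ f), ← hΦ, ← hs', map_smul, ht, smul_zero]
    have h2 : f = 0 := Subtype.ext (LinearMap.ext fun x => h.injective (by
      rw [← hρ, h1]; exact (map_zero ι).symm))
    rw [h2, TensorProduct.tmul_zero] at hs'
    have := congrArg ((algebraMap A Q s)⁻¹ • ·) hs'
    simpa only [smul_smul, inv_mul_cancel₀ hs0, one_smul, smul_zero] using this
  have hsurj : Function.Surjective Φ := by
    intro g
    obtain ⟨X, hX, hXι⟩ := h.exists_lattice
    -- A multiple s g preserves the lattice M, so g is s⁻¹ times an endomorphism of the motive.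
    obtain ⟨s, hs, hsX⟩ := hX.exists_smul_map_mem hX g.1 g.2.1
    have hs0 : algebraMap A Q s ≠ 0 := by rwa [Ne, IsFractionRing.to_map_eq_zero_iff]
    choose f hf using fun x : M.M => (hXι _).1 (hsX (ι x) ((hXι _).2 ⟨x, rfl⟩))
    let f' : M.End := ⟨
      { toFun := f
        map_add' := fun x y => h.injective (by
          rw [hf, map_add, map_add, smul_add, map_add, hf, hf])
        map_smul' := fun a x => h.injective (by
          rw [hf, RingHom.id_apply, h.map_smul_A, h.map_smul_A, map_smul, smul_comm, hf]) },
      fun b x => h.injective (by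
        change ι (f (b • x)) = ι (b • f x)
        rw [hf, map_smul, g.2.1, map_smul, hf, smul_comm]),
      fun x => h.injective (by
        change ι (f (M.τ x)) = ι (M.τ (f x))
        rw [hf, h.map_τ, g.2.2, h.map_τ, hf, map_smul])⟩
    refine ⟨(algebraMap A Q s)⁻¹ ⊗ₜ f', ?_⟩
    rw [hΦ]
    refine ext fun x => ?_
    change (algebraMap A Q s)⁻¹ • (ρ f').1 (ι x) = _
    rw [hρ]
    change (algebraMap A Q s)⁻¹ • ι (f x) = _
    rw [hf, smul_smul, inv_mul_cancel₀ hs0, one_smul]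
  refine ⟨AlgEquiv.ofBijective Φ ⟨hinj, hsurj⟩, fun f x => ?_⟩
  change (Φ (1 ⊗ₜ f)).1 (ι x) = _
  rw [hΦ, one_smul, hρ]

end IsGenericFibre

end PureAndersonMotive

end Motives

/-! ### Modules over A ⊗ L: projectivity and rank -/

section TensorModules

variable {Fq A Q L : Type u} [Field Fq] [CommRing A] [Algebra Fq A] [Field Q] [Algebra Fq Q]
  [Algebra A Q] [IsScalarTower Fq A Q] [IsFractionRing A Q] [Field L] [Finite L] [Algebra Fq L]

theorem tensorMap_injective : Function.Injective
    (Algebra.TensorProduct.map (IsScalarTower.toAlgHom Fq A Q) (AlgHom.id Fq L)) :=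
  Module.Flat.rTensor_preserves_injective_linearMap (M := L)
    (IsScalarTower.toAlgHom Fq A Q).toLinearMap (IsFractionRing.injective A Q)

theorem PlaceAtInfty.isDomain_tensor [Fintype Fq] (P : PlaceAtInfty Fq A Q) :
    IsDomain (A ⊗[Fq] L) := by
  let := (P.isField_tensor (L := L)).toField
  have : IsDomain (Q ⊗[Fq] L) := inferInstance
  exact (tensorMap_injective (Fq := Fq) (A := A) (Q := Q) (L := L)).isDomain
    (Algebra.TensorProduct.map (IsScalarTower.toAlgHom Fq A Q) (AlgHom.id Fq L)).toRingHom

section Module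

variable {U : Type u} [AddCommGroup U] [Module A U] [Module L U] [Module Fq U]
  [IsScalarTower Fq A U] [IsScalarTower Fq L U] [SMulCommClass A L U]

attribute [local instance] TensorProduct.Algebra.module

omit [Finite L] in
theorem tmul_smul_eq (a : A) (b : L) (x : U) : (a ⊗ₜ[Fq] b) • x = a • b • x :=
  TensorProduct.Algebra.smul_def a b x

omit [Finite L] in
theorem isScalarTower_tensor : IsScalarTower A (A ⊗[Fq] L) U :=
  ⟨fun a t x => by
    induction t with
    | zero => rw [smul_zero, zero_smul, smul_zero]
    | tmul a' b => rw [TensorProduct.smul_tmul', tmul_smul_eq, tmul_smul_eq, smul_eq_mul, mul_smul]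
    | add t t' h h' => rw [smul_add, add_smul, h, h', add_smul, smul_add]⟩

/-- Finite torsion free modules over `A` are locally free over `A ⊗ L`. -/
theorem locally_free_of_isTorsionFree [Fintype Fq] [IsDedekindDomain A] (P : PlaceAtInfty Fq A Q)
    [Module.Finite A U] [Module.IsTorsionFree A U] :
    Module.Finite (A ⊗[Fq] L) U ∧ Module.Projective (A ⊗[Fq] L) U ∧
      ∀ p : PrimeSpectrum (A ⊗[Fq] L),
        Module.rankAtStalk (R := A ⊗[Fq] L) U p = Module.finrank (A ⊗[Fq] L) U := by
  have := P.isDomain_tensor (L := L)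
  have : IsScalarTower A (A ⊗[Fq] L) U := isScalarTower_tensor
  have : Module.FinitePresentation A U := Module.finitePresentation_of_finite A U
  have : Module.Projective A U := Module.Flat.projective_of_finitePresentation
  -- Since L is separable over Fq, a module over A ⊗ L that is projective over A is projective over
  -- A ⊗ L.
  have : Algebra.FormallyUnramified Fq L := Algebra.FormallyUnramified.of_isSeparable Fq L
  refine ⟨Module.Finite.of_restrictScalars_finite A _ _,
    Algebra.FormallyUnramified.projective_of_restrictScalars A _ U, fun p => ?_⟩
  have hp : p.asIdeal.primeCompl ≤ (A ⊗[Fq] L)⁰ := Ideal.primeCompl_le_nonZeroDivisors _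
  rw [Module.rankAtStalk, IsLocalization.finrank_eq (R := A ⊗[Fq] L) _ p.asIdeal.primeCompl hp,
    IsLocalizedModule.finrank_eq p.asIdeal.primeCompl
      (LocalizedModule.mkLinearMap p.asIdeal.primeCompl U) hp]

/-- The rank of a module over `A ⊗ L` is the dimension of its generic fibre over `Q ⊗ L`. -/
theorem finrank_genericFibre [Fintype Fq] [IsDomain A] (P : PlaceAtInfty Fq A Q) {V : Type u}
    [AddCommGroup V] [Module Q V] [Module L V] [Module Fq V] [IsScalarTower Fq Q V]
    [IsScalarTower Fq L V] [SMulCommClass Q L V] (ι : U →ₗ[L] V) (hι : Function.Injective ι)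
    (hA : ∀ (a : A) (x : U), ι (a • x) = algebraMap A Q a • ι x)
    (hden : ∀ y : V, ∃ a : A, a ≠ 0 ∧ ∃ x : U, algebraMap A Q a • y = ι x) :
    Module.finrank (Q ⊗[Fq] L) V = Module.finrank (A ⊗[Fq] L) U := by
  have := P.isDomain_tensor (L := L)
  let _ : Algebra (A ⊗[Fq] L) (Q ⊗[Fq] L) :=
    (Algebra.TensorProduct.map (IsScalarTower.toAlgHom Fq A Q) (AlgHom.id Fq L)).toRingHom.toAlgebra
  have hmap : ∀ (a : A) (b : L), algebraMap (A ⊗[Fq] L) (Q ⊗[Fq] L) (a ⊗ₜ b) =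
    algebraMap A Q a ⊗ₜ b := fun _ _ => rfl
  have : IsScalarTower A (A ⊗[Fq] L) (Q ⊗[Fq] L) := .of_algebraMap_eq fun a => rfl
  -- Q ⊗ L is the localization of A ⊗ L at the nonzero elements of A, and V is the corresponding
  -- localization of U; ranks do not change.
  have hloc := IsLocalization.tensorProduct_tensorProduct Fq L A⁰ Q (RingHom.ext fun b => by
    change algebraMap A Q 1 ⊗ₜ[Fq] b = 1 ⊗ₜ b
    rw [map_one])
  have hle : Algebra.algebraMapSubmonoid (A ⊗[Fq] L) A⁰ ≤ (A ⊗[Fq] L)⁰ := by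
    rintro _ ⟨a, ha, rfl⟩
    refine mem_nonZeroDivisors_of_ne_zero fun h0 => ?_
    have h1 := congrArg (algebraMap (A ⊗[Fq] L) (Q ⊗[Fq] L)) h0
    rw [map_zero, ← IsScalarTower.algebraMap_apply, IsScalarTower.algebraMap_apply A Q,
      ← map_zero (algebraMap Q (Q ⊗[Fq] L))] at h1
    exact nonZeroDivisors.ne_zero ha (IsFractionRing.injective A Q
      ((FaithfulSMul.algebraMap_injective Q (Q ⊗[Fq] L) h1).trans (map_zero _).symm))
  let _ : Module (A ⊗[Fq] L) V := Module.compHom V (algebraMap (A ⊗[Fq] L) (Q ⊗[Fq] L))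
  have : IsScalarTower (A ⊗[Fq] L) (Q ⊗[Fq] L) V :=
    ⟨fun t s x => by rw [Algebra.smul_def, mul_smul]; rfl⟩
  have hsm : ∀ (a : A) (b : L) (y : V), (a ⊗ₜ[Fq] b : A ⊗[Fq] L) • y = algebraMap A Q a • b • y :=
    fun a b y => tmul_smul_eq (algebraMap A Q a) b y
  let ιR : U →ₗ[A ⊗[Fq] L] V :=
    { toFun := ι
      map_add' := map_add ι
      map_smul' := fun t x => by
        rw [RingHom.id_apply]
        induction t with
        | zero => rw [zero_smul, zero_smul, map_zero]
        | tmul a b => rw [tmul_smul_eq, hA, map_smul, hsm]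
        | add t t' h h' => rw [add_smul, add_smul, map_add, h, h'] }
  have hlm : IsLocalizedModule (Algebra.algebraMapSubmonoid (A ⊗[Fq] L) A⁰) ιR := by
    refine ⟨?_, ?_, ?_⟩
    · rintro ⟨_, a, ha, rfl⟩
      have ha' : algebraMap A Q a ≠ 0 := by
        rw [Ne, IsFractionRing.to_map_eq_zero_iff]; exact nonZeroDivisors.ne_zero ha
      have hact : ∀ y : V, algebraMap A (A ⊗[Fq] L) a • y = algebraMap A Q a • y := fun y => by
        rw [Algebra.TensorProduct.algebraMap_apply, Algebra.algebraMap_self, RingHom.id_apply, hsm,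
          one_smul]
      rw [Module.End.isUnit_iff]
      refine ⟨fun y y' h => ?_, fun y => ⟨(algebraMap A Q a)⁻¹ • y, ?_⟩⟩
      · have h' : algebraMap A (A ⊗[Fq] L) a • y = algebraMap A (A ⊗[Fq] L) a • y' := h
        rw [hact, hact] at h'
        exact smul_right_injective V ha' h'
      · change algebraMap A (A ⊗[Fq] L) a • (algebraMap A Q a)⁻¹ • y = y
        rw [hact, smul_smul, mul_inv_cancel₀ ha', one_smul]
    · intro y
      obtain ⟨a, ha, x, hx⟩ := hden y
      refine ⟨⟨x, algebraMap A _ a, a, mem_nonZeroDivisors_of_ne_zero ha, rfl⟩, ?_⟩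
      change algebraMap A (A ⊗[Fq] L) a • y = ι x
      rw [Algebra.TensorProduct.algebraMap_apply, Algebra.algebraMap_self, RingHom.id_apply, hsm,
          one_smul, hx]
    · intro x x' h
      exact ⟨1, by rw [hι h]⟩
  rw [IsLocalization.finrank_eq (R := A ⊗[Fq] L) _ _ hle, IsLocalizedModule.finrank_eq _ ιR hle]

end Module

end TensorModules

/-! ### Quotient motives and simple generic fibres -/

section Quotients

variable {Fq A Q L : Type u} [Field Fq] [Fintype Fq] [CommRing A] [IsDedekindDomain A]
  [Algebra Fq A] [Algebra.FiniteType Fq A] [Field Q] [Algebra Fq Q] [Algebra A Q]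
  [IsScalarTower Fq A Q] [IsFractionRing A Q] [Field L] [Finite L] [Algebra Fq L]
  {P : PlaceAtInfty Fq A Q} {c : A →ₐ[Fq] L}

omit [IsDedekindDomain A] [Algebra Fq A] [Algebra.FiniteType Fq A] [IsScalarTower Fq A Q]
  [IsFractionRing A Q] [Finite L] in
theorem mem_span_iterate_map_iff {N N' : FrobSpace Fq Q L} {W : BiSub P.O Q L N.V}
    {π : N.V →ₗ[Q] N'.V} (hπ : ∀ (b : L) (x : N.V), π (b • x) = b • π x)
    (hφ : ∀ x, π (N.φ x) = N'.φ (π x)) {k l : ℕ} {z : Q} (hz : z ≠ 0)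
    (h : ∀ y : N.V, y ∈ Submodule.span L ((N.φ)^[l] '' (W.toSubmodule : Set N.V)) ↔
      z ^ k • y ∈ W.toSubmodule) (y : N'.V) :
    y ∈ Submodule.span L ((N'.φ)^[l] '' ((W.map π hπ).toSubmodule : Set N'.V)) ↔
      z ^ k • y ∈ (W.map π hπ).toSubmodule := by
  let πL : N.V →ₗ[L] N'.V := { toFun := π, map_add' := map_add π, map_smul' := hπ }
  have h1 : (N'.φ)^[l] '' ((W.map π hπ).toSubmodule : Set N'.V) =
      πL '' ((N.φ)^[l] '' (W.toSubmodule : Set N.V)) := by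
    have hsc : ∀ x, (N'.φ)^[l] (π x) = π ((N.φ)^[l] x) := fun x =>
      (Function.Semiconj.iterate_right (f := π) hφ l x).symm
    ext y
    constructor
    · rintro ⟨_, ⟨x, hx, rfl⟩, rfl⟩
      exact ⟨_, ⟨x, hx, rfl⟩, (hsc x).symm⟩
    · rintro ⟨_, ⟨x, hx, rfl⟩, rfl⟩
      exact ⟨_, ⟨x, hx, rfl⟩, hsc x⟩
  have hz' : z ^ k ≠ 0 := pow_ne_zero k hz
  rw [h1, ← Submodule.map_span]
  constructor
  · rintro ⟨x, hx, rfl⟩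
    exact ⟨z ^ k • x, (h x).1 hx, map_smul π _ x⟩
  · rintro ⟨x, hx, hxy⟩
    refine ⟨(z ^ k)⁻¹ • x, (h _).2 ?_, ?_⟩
    · rwa [smul_smul, mul_inv_cancel₀ hz', one_smul]
    · change π ((z ^ k)⁻¹ • x) = y
      rw [map_smul, hxy, smul_smul, inv_mul_cancel₀ hz', one_smul]

namespace PureAndersonMotive

omit [IsDedekindDomain A] [Algebra.FiniteType Fq A] [IsScalarTower Fq A Q] [IsFractionRing A Q]
  [Finite L] in
-- The cokernel of τ on U is a quotient of that on M, so J^d annihilates it for the old dimension d.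
-- By `foldr_mem_of_finrank` the new dimension suffices as exponent.
theorem foldr_mem_span_range (M : PureAndersonMotive P c) {U : Type u} [AddCommGroup U] [Module A U]
    [Module L U] [SMulCommClass A L U] (τ : U →ₗ[A] U) (f : M.M →ₗ[A] U)
    (hf : Function.Surjective f) (hL : ∀ (b : L) (x : M.M), f (b • x) = b • f x)
    (hτ : ∀ x, f (M.τ x) = τ (f x)) :
    FiniteDimensional L (U ⧸ Submodule.span L (Set.range τ)) ∧
      ∀ (a : Fin (Module.finrank L (U ⧸ Submodule.span L (Set.range τ))) → A) (x : U),
        (List.ofFn a).foldr (fun b y => b • y - c b • y) x ∈ Submodule.span L (Set.range τ) := by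
  let fL : M.M →ₗ[L] U := { toFun := f, map_add' := map_add f, map_smul' := hL }
  have hle : Submodule.span L (Set.range M.τ) ≤ (Submodule.span L (Set.range τ)).comap fL := by
    rw [Submodule.span_le]
    rintro _ ⟨x, rfl⟩
    exact Submodule.subset_span ⟨f x, (hτ x).symm⟩
  have := M.coker_finite
  have hfin : FiniteDimensional L (U ⧸ Submodule.span L (Set.range τ)) := by
    refine Module.Finite.of_surjective (Submodule.mapQ _ _ fL hle) fun y => ?_
    obtain ⟨y, rfl⟩ := Submodule.Quotient.mk_surjective _ y
    obtain ⟨x, rfl⟩ := hf y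
    exact ⟨Submodule.Quotient.mk x, rfl⟩
  let T : A → Module.End L U := fun a =>
    { toFun := fun x => a • x - c a • x
      map_add' := fun x y => by rw [smul_add, smul_add]; abel
      map_smul' := fun b x => by
        rw [RingHom.id_apply, smul_sub, smul_comm a b, smul_comm (c a) b] }
  refine ⟨hfin, foldr_mem_of_finrank _ T (fun a b => LinearMap.ext fun x => ?_)
    (fun a x hx => ?_) (d := M.dim) fun a x => ?_⟩
  · change a • (b • x - c b • x) - c a • (b • x - c b • x) =
      b • (a • x - c a • x) - c b • (a • x - c a • x)
    simp only [smul_sub, smul_comm a (c b) x, smul_comm b (c a) x, smul_smul, mul_comm a b,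
      mul_comm (c a) (c b)]
    abel
  · refine Submodule.sub_mem _ ?_ (Submodule.smul_mem _ _ hx)
    induction hx using Submodule.span_induction with
    | mem y hy =>
      obtain ⟨y, rfl⟩ := hy
      rw [← map_smul]
      exact Submodule.subset_span ⟨_, rfl⟩
    | zero => rw [smul_zero]; exact Submodule.zero_mem _
    | add y y' _ _ h h' => rw [smul_add]; exact Submodule.add_mem _ h h'
    | smul b y _ h => rw [smul_comm]; exact Submodule.smul_mem _ _ h
  · obtain ⟨x, rfl⟩ := hf x
    have h1 : ∀ l : List A, l.foldr (fun b y => T b y) (f x) =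
        f (l.foldr (fun b y => b • y - c b • y) x) := by
      intro l
      induction l with
      | nil => rfl
      | cons b l ih =>
        rw [List.foldr_cons, List.foldr_cons, ih, map_sub, map_smul, hL]
        rfl
    rw [h1]
    exact hle (M.annihilated a x)

omit [Algebra.FiniteType Fq A] in
/-- A quotient of the generic fibre underlies a quotient motive. -/
theorem exists_quotient (M : PureAndersonMotive P c) {N N' : FrobSpace Fq Q L} {ι : M.M →ₗ[L] N.V}
    (h : M.IsGenericFibre N ι) {W : BiSub P.O Q L N.V} (hW : W.IsLattice) {k l : ℕ} (hk : 0 < k)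
    (hl : 0 < l) (hpure : ∀ z, P.IsUniformizer z → ∀ y : N.V,
      y ∈ Submodule.span L ((N.φ)^[l] '' (W.toSubmodule : Set N.V)) ↔ z ^ k • y ∈ W.toSubmodule)
    (π : N.V →ₗ[Q] N'.V) (hs : Function.Surjective π)
    (hπ : ∀ (b : L) (x : N.V), π (b • x) = b • π x) (hφ : ∀ x, π (N.φ x) = N'.φ (π x))
    (hinj : Function.Injective N'.φ) :
    ∃ (M' : PureAndersonMotive P c) (f : M.M →ₗ[A] M'.M), IsMorphism M M' f ∧
      Function.Surjective f ∧ (∀ x, f x = 0 ↔ π (ι x) = 0) := by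
  obtain ⟨X, hX, hXι⟩ := h.exists_lattice
  obtain ⟨X', hX'⟩ : ∃ X', X' = X.map π hπ := ⟨_, rfl⟩
  have hXl : X'.IsLattice := hX' ▸ hX.map π hπ hs
  have hmem : ∀ y, y ∈ X'.toSubmodule ↔ ∃ x : M.M, π (ι x) = y := by
    intro y
    rw [hX', BiSub.mem_map]
    constructor
    · rintro ⟨x, hx, rfl⟩
      obtain ⟨x, rfl⟩ := (hXι x).1 hx
      exact ⟨x, rfl⟩
    · rintro ⟨x, rfl⟩
      exact ⟨_, (hXι _).2 ⟨x, rfl⟩, rfl⟩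
  have hτ : ∀ y ∈ X'.toSubmodule, N'.φ y ∈ X'.toSubmodule := by
    intro y hy
    obtain ⟨x, rfl⟩ := (hmem y).1 hy
    rw [← hφ, ← h.map_τ]
    exact (hmem _).2 ⟨_, rfl⟩
  have := hXl.finite
  have := X'.isTorsionFree
  have hA : IsScalarTower Fq A X'.toSubmodule := ⟨fun r a x => Subtype.ext (by
    change algebraMap A Q (r • a) • (x : N'.V) = r • algebraMap A Q a • (x : N'.V)
    rw [Algebra.smul_def, map_mul, mul_smul, ← IsScalarTower.algebraMap_apply, algebraMap_smul])⟩
  have hLt : IsScalarTower Fq L X'.toSubmodule := inferInstance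
  let τ : X'.toSubmodule →ₗ[A] X'.toSubmodule := X'.restrict N'.φ hτ
  let f : M.M →ₗ[A] X'.toSubmodule :=
    { toFun := fun x => ⟨π (ι x), (hmem _).2 ⟨x, rfl⟩⟩
      map_add' := fun x y => Subtype.ext (by
        change π (ι (x + y)) = π (ι x) + π (ι y)
        rw [map_add, map_add])
      map_smul' := fun a x => Subtype.ext (by
        change π (ι (a • x)) = algebraMap A Q a • π (ι x)
        rw [h.map_smul_A, map_smul]) }
  have hfs : Function.Surjective f := fun y => ((hmem _).1 y.2).imp fun x hx => Subtype.ext hx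
  have hfL : ∀ (b : L) (x : M.M), f (b • x) = b • f x := fun b x => Subtype.ext (by
    change π (ι (b • x)) = b • π (ι x)
    rw [map_smul, hπ])
  have hfτ : ∀ x, f (M.τ x) = τ (f x) := fun x => Subtype.ext (by
    change π (ι (M.τ x)) = N'.φ (π (ι x))
    rw [h.map_τ, hφ])
  obtain ⟨h1, h2⟩ := M.foldr_mem_span_range τ f hfs hfL hfτ
  obtain ⟨h3, h4, h5⟩ := locally_free_of_isTorsionFree (L := L) (U := X'.toSubmodule) P
  let M' : PureAndersonMotive P c :=
    { M := X'.toSubmodule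
      rank := _
      dim := _
      τ := τ
      τ_smul := fun b x => Subtype.ext (N'.φ_smul b x)
      τ_injective := fun x y hxy => Subtype.ext (hinj (congrArg Subtype.val hxy))
      locally_free := ⟨h3, h4, h5⟩
      coker_finite := h1
      dim_coker := rfl
      annihilated := h2
      pure := ⟨N', X'.toSubmodule.subtype, Subtype.val_injective, fun a x => rfl, fun x => rfl,
        fun y => by
          obtain ⟨s, hs, hy⟩ := hXl.exists_smul_mem y
          exact ⟨s, hs, ⟨_, hy⟩, rfl⟩,
        W.map π hπ, hW.map π hπ hs, k, l, hk, hl, fun z hz =>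
          mem_span_iterate_map_iff hπ hφ hz.ne_zero (hpure z hz)⟩ }
  exact ⟨M', f, ⟨hfL, hfτ⟩, hfs, fun x => Subtype.ext_iff⟩

omit [Algebra.FiniteType Fq A] in
/-- The generic fibre of a simple motive is simple. -/
theorem IsSimple.eq_bot_or_eq_top {M : PureAndersonMotive P c} (hM : M.IsSimple)
    {N : FrobSpace Fq Q L} {ι : M.M →ₗ[L] N.V} (h : M.IsGenericFibre N ι) {W : BiSub P.O Q L N.V}
    (hW : W.IsLattice) {k l : ℕ} (hk : 0 < k) (hl : 0 < l)
    (hpure : ∀ z, P.IsUniformizer z → ∀ y : N.V,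
      y ∈ Submodule.span L ((N.φ)^[l] '' (W.toSubmodule : Set N.V)) ↔ z ^ k • y ∈ W.toSubmodule)
    {U : Submodule Q N.V} (hL : ∀ (b : L), ∀ x ∈ U, b • x ∈ U) (hφ : ∀ x ∈ U, N.φ x ∈ U) :
    U = ⊥ ∨ U = ⊤ := by
  have := h.finiteDimensional
  obtain ⟨N', π, hs, hker, hπ, hπφ, hinj⟩ := N.exists_quotient h.φ_injective U hL hφ
  obtain ⟨M', f, hf, hfs, hf0⟩ := M.exists_quotient h hW hk hl hpure π hs hπ hπφ hinj
  have hmem : ∀ y, y ∈ U ↔ ∃ a : A, a ≠ 0 ∧ ∃ x : M.M, algebraMap A Q a • y = ι x ∧ f x = 0 := by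
    intro y
    constructor
    · intro hy
      obtain ⟨a, ha, x, hx⟩ := h.exists_smul_eq y
      refine ⟨a, ha, x, hx, (hf0 x).2 ?_⟩
      rw [← hx, map_smul, show π y = 0 from hker.ge hy, smul_zero]
    · rintro ⟨a, ha, x, hx, hfx⟩
      have ha' : algebraMap A Q a ≠ 0 := by rwa [Ne, IsFractionRing.to_map_eq_zero_iff]
      rw [hf0, ← hx, map_smul] at hfx
      exact hker.le ((smul_eq_zero.1 hfx).resolve_left ha')
  rcases hM.2 M' f hf hfs with hsub | hfi
  · right
    refine eq_top_iff.2 fun y _ => (hmem y).2 ?_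
    obtain ⟨a, ha, x, hx⟩ := h.exists_smul_eq y
    exact ⟨a, ha, x, hx, Subsingleton.elim _ _⟩
  · left
    refine eq_bot_iff.2 fun y hy => ?_
    obtain ⟨a, ha, x, hx, hfx⟩ := (hmem y).1 hy
    have ha' : algebraMap A Q a ≠ 0 := by rwa [Ne, IsFractionRing.to_map_eq_zero_iff]
    rw [hfi (hfx.trans (map_zero f).symm), map_zero] at hx
    exact (smul_eq_zero.1 hx).resolve_left ha'

end PureAndersonMotive

end Quotients

/-! ### Semisimplicity of the commutant for motives -/

section Semisimple

attribute [local instance] TensorProduct.Algebra.module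

theorem map_tensor_smul {Fq R R' L U V : Type u} [Field Fq] [CommRing R] [CommRing R'] [Field L]
    [Algebra Fq R] [Algebra Fq R'] [Algebra Fq L] [AddCommGroup U] [Module R U] [Module L U]
    [Module Fq U] [IsScalarTower Fq R U] [IsScalarTower Fq L U] [SMulCommClass R L U]
    [AddCommGroup V] [Module R' V] [Module L V] [Module Fq V] [IsScalarTower Fq R' V]
    [IsScalarTower Fq L V] [SMulCommClass R' L V] (ψ : R →ₐ[Fq] R') (g : U →+ V)
    (hR : ∀ (r : R) (x : U), g (r • x) = ψ r • g x) (hL : ∀ (b : L) (x : U), g (b • x) = b • g x)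
    (t : R ⊗[Fq] L) (x : U) :
    g (t • x) = Algebra.TensorProduct.map ψ (AlgHom.id Fq L) t • g x := by
  induction t with
  | zero => rw [zero_smul, map_zero, map_zero, zero_smul]
  | tmul r b =>
    rw [Algebra.TensorProduct.map_tmul, tmul_smul_eq, tmul_smul_eq, hR, hL]
    rfl
  | add t t' h h' => rw [add_smul, map_add, map_add, add_smul, h, h']

variable {Fq A Q L : Type u} [Field Fq] [Fintype Fq] [CommRing A] [IsDedekindDomain A]
  [Algebra Fq A] [Algebra.FiniteType Fq A] [Field Q] [Algebra Fq Q] [Algebra A Q]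
  [IsScalarTower Fq A Q] [IsFractionRing A Q] [Field L] [Finite L] [Algebra Fq L]
  {P : PlaceAtInfty Fq A Q} {c : A →ₐ[Fq] L}

omit [Algebra.FiniteType Fq A] in
theorem exists_tensor_mul_eq_one (P : PlaceAtInfty Fq A Q) {t : A ⊗[Fq] L} (ht : t ∈ (A ⊗[Fq] L)⁰) :
    ∃ u : Q ⊗[Fq] L,
      u * Algebra.TensorProduct.map (IsScalarTower.toAlgHom Fq A Q) (AlgHom.id Fq L) t = 1 := by
  have := P.isDomain_tensor (L := L)
  have ht0 : Algebra.TensorProduct.map (IsScalarTower.toAlgHom Fq A Q) (AlgHom.id Fq L) t ≠ 0 :=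
    fun h => nonZeroDivisors.ne_zero ht (tensorMap_injective (h.trans (map_zero _).symm))
  obtain ⟨u, hu⟩ := (P.isField_tensor (L := L)).mul_inv_cancel ht0
  exact ⟨u, by rw [mul_comm, hu]⟩

omit [Algebra.FiniteType Fq A] in
-- The isogeny to a sum of simple motives becomes an isomorphism of generic fibres, and the generic
-- fibres of the summands are simple.
theorem PureAndersonMotive.IsSemisimple.isSemisimpleRing_commutant {M : PureAndersonMotive P c}
    (hM : M.IsSemisimple) {N : FrobSpace Fq Q L} {ι : M.M →ₗ[L] N.V} (h : M.IsGenericFibre N ι) :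
    IsSemisimpleRing N.commutant := by
  have := h.finiteDimensional
  obtain ⟨n, S, f, hS, hfL, hfτ, hf, hcoker⟩ := hM
  choose N' ι' h1 h2 h3 h4 W hW k l hk hl hpure using fun j => (S j).pure
  have hgen : ∀ j, (S j).IsGenericFibre (N' j) (ι' j) := fun j => ⟨h1 j, h2 j, h3 j, h4 j⟩
  choose F hF hFL hFφ using fun j => h.exists_map (hgen j) (LinearMap.proj j ∘ₗ f)
    (fun b x => congrFun (hfL b x) j) (fun x => hfτ x j)
  have hF' : ∀ j x, F j (ι x) = ι' j (f x j) := hF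
  refine N.isSemisimpleRing_commutant N' (LinearMap.pi F) ⟨?_, fun y => ?_⟩
    (fun b x => funext fun j => hFL j b x) (fun x j => hFφ j x) fun j => ⟨?_, fun U hL hφ =>
      (hS j).eq_bot_or_eq_top (hgen j) (hW j) (hk j) (hl j) (hpure j) hL hφ⟩
  · rw [injective_iff_map_eq_zero]
    intro y hy
    obtain ⟨a, ha, x, hx⟩ := h.exists_smul_eq y
    have ha' : algebraMap A Q a ≠ 0 := by rwa [Ne, IsFractionRing.to_map_eq_zero_iff]
    have hx0 : x = 0 := (map_eq_zero_iff f hf).1 (funext fun j => h1 j (by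
      rw [← hF', ← hx, map_smul, show F j y = 0 from congrFun hy j, smul_zero]
      exact (map_zero (ι' j)).symm))
    rw [hx0, map_zero] at hx
    exact (smul_eq_zero.1 hx).resolve_left ha'
  · choose a ha x hx using fun j => (hgen j).exists_smul_eq (y j)
    obtain ⟨b, hb⟩ : ∃ b : A, b = ∏ j, a j := ⟨_, rfl⟩
    have hb0 : algebraMap A Q b ≠ 0 := by
      rw [Ne, IsFractionRing.to_map_eq_zero_iff, hb]
      exact Finset.prod_ne_zero_iff.2 fun j _ => ha j
    have hbx : ∀ j, ∃ w : (S j).M, algebraMap A Q b • y j = ι' j w := fun j => by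
      obtain ⟨e, he⟩ : a j ∣ b := hb ▸ Finset.dvd_prod_of_mem a (Finset.mem_univ j)
      exact ⟨e • x j, by rw [h2, ← hx, smul_smul, ← map_mul, he, mul_comm]⟩
    choose w hw using hbx
    -- The torsion of the cokernel is killed by an element t of A ⊗ L, which becomes invertible in
    -- the field Q ⊗ L.
    obtain ⟨t, ht, m, hm⟩ := hcoker w
    obtain ⟨u, hu⟩ := exists_tensor_mul_eq_one P ht
    refine ⟨(algebraMap A Q b)⁻¹ • u • ι m, funext fun j => ?_⟩
    have hm' : f m j = t • w j := by
      have e0 := map_tensor_smul (AlgHom.id Fq A) (Pi.evalAddMonoidHom (fun j => (S j).M) j)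
        (fun _ _ => rfl) (fun _ _ => rfl) t w
      rw [Algebra.TensorProduct.map_id, AlgHom.id_apply] at e0
      exact (congrFun hm j).trans e0
    have e1 := map_tensor_smul (AlgHom.id Fq Q) (F j).toAddMonoidHom (fun q x => map_smul (F j) q x)
      (hFL j) u (ι m)
    rw [Algebra.TensorProduct.map_id, AlgHom.id_apply] at e1
    have e2 := map_tensor_smul (IsScalarTower.toAlgHom Fq A Q) (ι' j).toAddMonoidHom (h2 j)
      (fun b x => map_smul (ι' j) b x) t (w j)
    have e1' : F j (u • ι m) = u • F j (ι m) := e1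
    have e2' : ι' j (t • w j) = _ • ι' j (w j) := e2
    change F j ((algebraMap A Q b)⁻¹ • u • ι m) = y j
    rw [map_smul, e1', hF', hm', e2', smul_smul, hu, one_smul, ← hw, smul_smul, inv_mul_cancel₀ hb0,
      one_smul]
  · have := (hS j).1
    exact (h1 j).nontrivial

end Semisimple

open Polynomial

/-! ### Integrality of characteristic polynomials -/

section Charpoly

theorem X_pow_mul_charpoly_comp {K V W : Type*} [Field K] [AddCommGroup V] [Module K V]
    [FiniteDimensional K V] [AddCommGroup W] [Module K W] [FiniteDimensional K W] (F : V →ₗ[K] W)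
    (G : W →ₗ[K] V) : (X : K[X]) ^ Module.finrank K W * (G ∘ₗ F).charpoly =
      X ^ Module.finrank K V * (F ∘ₗ G).charpoly := by
  let b := Module.finBasis K V
  let b' := Module.finBasis K W
  rw [← LinearMap.charpoly_toMatrix _ b, ← LinearMap.charpoly_toMatrix _ b',
    LinearMap.toMatrix_comp b b' b, LinearMap.toMatrix_comp b' b b']
  simpa using Matrix.charpoly_mul_comm' (LinearMap.toMatrix b' b G) (LinearMap.toMatrix b b' F)

variable {R K M V : Type u} [CommRing R] [IsDomain R] [IsIntegrallyClosed R] [Field K]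
  [Algebra R K] [IsFractionRing R K] [AddCommGroup M] [Module R M] [Module.Finite R M]
  [Module.Projective R M] [AddCommGroup V] [Module K V] [FiniteDimensional K V]

/-- The factors of the characteristic polynomial of an endomorphism of a finite projective module
have integral coefficients. -/
theorem exists_map_eq_of_dvd_charpoly (ι : M →+ V) (hι : Function.Injective ι)
    (hR : ∀ (a : R) (x : M), ι (a • x) = algebraMap R K a • ι x)
    (hden : ∀ y : V, ∃ a : R, a ≠ 0 ∧ ∃ x : M, algebraMap R K a • y = ι x) (f : M →ₗ[R] M)
    (F : V →ₗ[K] V) (hF : ∀ x, F (ι x) = ι (f x)) {χ : K[X]} (hm : χ.Monic) (hχ : χ ∣ F.charpoly) :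
    ∃ χ' : R[X], χ'.map (algebraMap R K) = χ := by
  -- M is a direct summand of R^m. Over K the inclusion S and the projection G satisfy G S = 1, and
  -- S F G has the integral matrix B, whose characteristic polynomial is that of F up to powers of
  -- X. Monic factors of an integral monic polynomial are integral.
  obtain ⟨m, g, s, -, -, hgs⟩ := Module.Finite.exists_comp_eq_id_of_projective R M
  obtain ⟨S, hS⟩ := exists_extension (U' := Fin m → K) ι hι hR hden
    (AddMonoidHom.mk' (fun x i => algebraMap R K (s x i)) fun x y => funext fun i => by
      rw [map_add, Pi.add_apply, map_add]; rfl)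
    (fun a x => funext fun i => by
      change algebraMap R K (s (a • x) i) = algebraMap R K a • algebraMap R K (s x i)
      rw [map_smul, Pi.smul_apply, smul_eq_mul, map_mul, smul_eq_mul])
  have hS' : ∀ x i, S (ι x) i = algebraMap R K (s x i) := fun x i => congrFun (hS x) i
  let G : (Fin m → K) →ₗ[K] V := Fintype.linearCombination K fun i => ι (g (Pi.single i 1))
  have hG : ∀ w : Fin m → R, G (fun i => algebraMap R K (w i)) = ι (g w) := fun w => by
    rw [Fintype.linearCombination_apply, pi_eq_sum_univ' w, map_sum, map_sum]
    refine Finset.sum_congr rfl fun i _ => ?_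
    rw [map_smul, hR, ← pi_eq_sum_univ' w]
  have hGS : G ∘ₗ S = LinearMap.id := linearMap_eq_of_eqOn hden fun x => by
    change G (S (ι x)) = ι x
    rw [show S (ι x) = fun i => algebraMap R K (s x i) from funext (hS' x), hG]
    exact congrArg ι (LinearMap.congr_fun hgs x)
  obtain ⟨B, hB0⟩ : ∃ B : Matrix (Fin m) (Fin m) R, ∀ i j, B i j = s (f (g (Pi.single j 1))) i :=
    ⟨Matrix.of fun i j => s (f (g (Pi.single j 1))) i, fun _ _ => rfl⟩
  have hB : (S ∘ₗ F) ∘ₗ G = Matrix.toLin' (B.map (algebraMap R K)) := by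
    refine LinearMap.pi_ext' fun j => LinearMap.ext_ring (funext fun i => ?_)
    have h1 : G (Pi.single j 1) = ι (g (Pi.single j 1)) := by
      rw [← hG]
      congr 1
      ext i
      simp [Pi.single_apply, apply_ite (algebraMap R K)]
    change S (F (G (Pi.single j 1))) i = Matrix.toLin' (B.map (algebraMap R K)) (Pi.single j 1) i
    rw [h1, hF, hS', Matrix.toLin'_apply, Matrix.mulVec_single_one]
    change _ = algebraMap R K (B i j)
    rw [hB0]
  have h1 := X_pow_mul_charpoly_comp (S ∘ₗ F) G
  rw [← LinearMap.comp_assoc, hGS, LinearMap.id_comp, hB, Matrix.charpoly_toLin',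
    Matrix.charpoly_map] at h1
  have h2 : χ ∣ (X ^ Module.finrank K V * B.charpoly).map (algebraMap R K) := by
    rw [Polynomial.map_mul, Polynomial.map_pow, map_X, ← h1]
    exact hχ.mul_left _
  obtain ⟨χ', hχ'⟩ := IsIntegrallyClosed.eq_map_mul_C_of_dvd K
    ((monic_X_pow _).mul (Matrix.charpoly_monic B)) h2
  exact ⟨χ', by rw [← hχ', hm.leadingCoeff, map_one, mul_one]⟩

end Charpoly

/-! ### The norm of an endomorphism and its adjoint -/

namespace PureAndersonMotive

variable {Fq A Q L : Type u} [Field Fq] [Fintype Fq] [CommRing A] [IsDedekindDomain A]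
  [Algebra Fq A] [Algebra.FiniteType Fq A] [Field Q] [Algebra Fq Q] [Algebra A Q]
  [IsScalarTower Fq A Q] [IsFractionRing A Q] [Field L] [Finite L] [Algebra Fq L]
  {P : PlaceAtInfty Fq A Q} {c : A →ₐ[Fq] L}

omit [Algebra.FiniteType Fq A] [IsScalarTower Fq A Q] in
/-- The reduced norm of an endomorphism of a semisimple motive, and its adjoint. -/
theorem IsGenericFibre.exists_norm {M : PureAndersonMotive P c} {N : FrobSpace Fq Q L}
    {ι : M.M →ₗ[L] N.V} (h : M.IsGenericFibre N ι) [IsSemisimpleRing N.commutant] (f : M.End) :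
    ∃ n : A, (∀ x : Q, IsReducedNorm Q (Q ⊗[A] M.End) (1 ⊗ₜ[A] f) x ↔ x = algebraMap A Q n) ∧
      (∀ F : N.V →ₗ[Q] N.V, (∀ x, F (ι x) = ι (f.1 x)) →
        LinearMap.det F = algebraMap A Q n ^ Module.finrank Fq L) ∧
      ∃ g : M.End, f * g = algebraMap A M.End n ∧ g * f = algebraMap A M.End n := by
  have := h.finiteDimensional
  have := M.module_finite
  have := h.isTorsionFree
  have : Module.FinitePresentation A M.M := Module.finitePresentation_of_finite A M.M
  have : Module.Projective A M.M := Module.Flat.projective_of_finitePresentation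
  obtain ⟨e, he⟩ := h.exists_end_equiv
  obtain ⟨d, hd, hd1, hdp, hdχ⟩ := N.exists_tensorDet P h.φ_injective
  obtain ⟨χ, hm, hχe, hχ0, hdf⟩ := hdχ _ (e (1 ⊗ₜ f)).2
  have he0 : Module.finrank Fq L ≠ 0 := Module.finrank_pos.ne'
  -- The characteristic polynomial χ over Q ⊗ L divides the one over Q, which is χ^e, and so has
  -- coefficients in A.
  obtain ⟨χ', hχ'⟩ := exists_map_eq_of_dvd_charpoly ι.toAddMonoidHom h.injective h.map_smul_A
    h.exists_smul_eq f.1 (e (1 ⊗ₜ f)).1 (he f) hm (hχe ▸ dvd_pow_self χ he0)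
  let ψ : M.End →+* Module.End Q N.V := (N.commutant.val.toRingHom.comp e.toRingEquiv.toRingHom).comp
    (Algebra.TensorProduct.includeRight : M.End →ₐ[A] Q ⊗[A] M.End).toRingHom
  have hψ : ∀ (g : M.End) (x : M.M), ψ g (ι x) = ι (g.1 x) := he
  have hψi : Function.Injective ψ := fun g g' hg => Subtype.ext (LinearMap.ext fun x =>
    h.injective (by rw [← hψ, hg, hψ]))
  have hψA : ψ.comp (algebraMap A M.End) = (algebraMap Q (Module.End Q N.V)).comp (algebraMap A Q) :=
    RingHom.ext fun a => linearMap_eq_of_eqOn h.exists_smul_eq fun x => by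
      change ψ (algebraMap A M.End a) (ι x) = algebraMap A Q a • ι x
      rw [hψ, ← h.map_smul_A]
      rfl
  have hf0 : aeval f χ' = 0 := hψi (by
    rw [aeval_def, hom_eval₂, hψA, map_zero, ← eval₂_map, hχ']
    exact hχ0)
  obtain ⟨k, hk⟩ : ∃ k, k = χ.natDegree := ⟨_, rfl⟩
  -- Cayley–Hamilton with the constant term split off: the remaining polynomial in f is, up to sign,
  -- the adjoint of f.
  have h1 : aeval f χ'.divX * f + algebraMap A M.End (χ'.coeff 0) = 0 := by
    rw [← hf0]
    conv_rhs => rw [← divX_mul_X_add χ']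
    rw [map_add, map_mul, aeval_X, aeval_C]
  have hcomm : f * aeval f χ'.divX = aeval f χ'.divX * f := by
    have := congrArg (aeval f) (mul_comm X χ'.divX)
    rwa [map_mul, map_mul, aeval_X] at this
  have hn : algebraMap A Q ((-1) ^ k * χ'.coeff 0) = d (e (1 ⊗ₜ f)).1 := by
    rw [hdf, map_mul, map_pow, map_neg, map_one, ← hk, ← hχ', coeff_map]
  have h2 : aeval f χ'.divX * f = algebraMap A M.End (-χ'.coeff 0) := by
    rw [map_neg]
    exact eq_neg_of_add_eq_zero_left h1
  refine ⟨(-1) ^ k * χ'.coeff 0, fun x => ?_, fun F hF => ?_, (-(-1) ^ k : A) • aeval f χ'.divX, ?_, ?_⟩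
  · rw [FrobSpace.isReducedNorm_congr e, N.isReducedNorm_iff P h.φ_injective hd hd1 hdp, hn]
  · have : F = (e (1 ⊗ₜ f)).1 := linearMap_eq_of_eqOn h.exists_smul_eq fun x => by rw [hF, he]
    rw [this, hd _ (e (1 ⊗ₜ f)).2, hn]
  · rw [mul_smul_comm, hcomm, h2, Algebra.smul_def, ← map_mul, neg_mul_neg]
  · rw [smul_mul_assoc, h2, Algebra.smul_def, ← map_mul, neg_mul_neg]

end PureAndersonMotive

/-! ### The index of the image and the determinant -/

section Index

/-- The index of an ideal generated by a product. -/
theorem index_span_mul {R : Type*} [CommRing R] [IsDomain R] {a : R} (ha : a ≠ 0) (b : R) :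
    (Ideal.span {a * b}).toAddSubgroup.index =
      (Ideal.span {a}).toAddSubgroup.index * (Ideal.span {b}).toAddSubgroup.index := by
  have hmap : ∀ c : R, (Ideal.span {c}).toAddSubgroup.map (AddMonoidHom.mulLeft a) =
      (Ideal.span {a * c}).toAddSubgroup := by
    intro c
    ext x
    constructor
    · rintro ⟨y, hy, rfl⟩
      obtain ⟨z, rfl⟩ := Ideal.mem_span_singleton'.1 hy
      exact Ideal.mem_span_singleton'.2 ⟨z, mul_left_comm z a c⟩
    · intro hx
      obtain ⟨z, rfl⟩ := Ideal.mem_span_singleton'.1 hx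
      exact ⟨z * c, Ideal.mem_span_singleton'.2 ⟨z, rfl⟩, (mul_left_comm z a c).symm⟩
  have h1 : (Ideal.span {1} : Ideal R).toAddSubgroup = ⊤ := by
    rw [Ideal.span_singleton_one]; rfl
  have h2 := AddSubgroup.relIndex_map_map_of_injective (f := AddMonoidHom.mulLeft a)
    (Ideal.span {b}).toAddSubgroup (Ideal.span {1} : Ideal R).toAddSubgroup
    (mul_right_injective₀ ha)
  rw [hmap, hmap, h1, AddSubgroup.relIndex_top_right, mul_one] at h2
  have h3 : (Ideal.span {a * b}).toAddSubgroup ≤ (Ideal.span {a}).toAddSubgroup :=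
    Ideal.span_singleton_le_span_singleton.2 (dvd_mul_right a b)
  rw [← AddSubgroup.relIndex_mul_index h3, h2, mul_comm]

theorem index_span_prod {R ι : Type*} [CommRing R] [IsDomain R] (s : Finset ι) {a : ι → R}
    (ha : ∀ i, a i ≠ 0) : (Ideal.span {∏ i ∈ s, a i}).toAddSubgroup.index =
      ∏ i ∈ s, (Ideal.span {a i}).toAddSubgroup.index := by
  classical
  induction s using Finset.induction_on with
  | empty => rw [Finset.prod_empty, Finset.prod_empty, Ideal.span_singleton_one]
             exact AddSubgroup.index_top
  | insert i s hi ih => rw [Finset.prod_insert hi, Finset.prod_insert hi, index_span_mul (ha i), ih]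

theorem index_span_pow {R : Type*} [CommRing R] [IsDomain R] {a : R} (ha : a ≠ 0) (k : ℕ) :
    (Ideal.span {a ^ k}).toAddSubgroup.index = (Ideal.span {a}).toAddSubgroup.index ^ k := by
  have := index_span_prod (Finset.range k) fun _ => ha
  simpa using this

/-- The cokernel of an injective endomorphism of a free module over a principal ideal domain has
the cardinality of the quotient by its determinant. -/
theorem index_range_eq {R M : Type*} [CommRing R] [IsDomain R] [IsPrincipalIdealRing R]
    [AddCommGroup M] [Module R M] [Module.Free R M] [Module.Finite R M] {f : M →ₗ[R] M}
    (hf : Function.Injective f) :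
    (LinearMap.range f).toAddSubgroup.index =
      (Ideal.span {LinearMap.det f}).toAddSubgroup.index := by
  let b := Module.Free.chooseBasis R M
  let e₀ : M ≃ₗ[R] LinearMap.range f := LinearEquiv.ofInjective f hf
  have h : Module.finrank R (LinearMap.range f) = Module.finrank R M := e₀.symm.finrank_eq
  let a := Submodule.smithNormalFormCoeffs b h
  let b' := Submodule.smithNormalFormTopBasis b h
  let ab := Submodule.smithNormalFormBotBasis b h
  have ab_eq := Submodule.smithNormalFormBotBasis_def b h
  let e' : M ≃ₗ[R] LinearMap.range f := b'.equiv ab (Equiv.refl _)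
  -- By Smith normal form some isomorphism e' of M onto the image is diagonal with entries a i; it
  -- differs from f by an automorphism, so the determinants agree up to a unit.
  have hdet : Associated (LinearMap.det f) (∏ i, a i) := by
    have h1 := LinearMap.associated_det_comp_equiv (LinearMap.range f).subtype e₀ e'
    have h2 : (LinearMap.range f).subtype ∘ₗ e₀.toLinearMap = f := LinearMap.ext fun x => rfl
    rw [h2] at h1
    have h3 : LinearMap.det ((LinearMap.range f).subtype ∘ₗ e'.toLinearMap) = ∏ i, a i := by
      rw [← LinearMap.det_toMatrix b', ← Matrix.det_diagonal]
      congr 1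
      ext i j
      have h4 : ((LinearMap.range f).subtype ∘ₗ e'.toLinearMap) (b' j) = a j • b' j := by
        change ((b'.equiv ab (Equiv.refl _) (b' j) : LinearMap.range f) : M) = _
        rw [Module.Basis.equiv_apply, Equiv.refl_apply]
        exact ab_eq j
      rw [LinearMap.toMatrix_apply, h4, map_smul, Module.Basis.repr_self, Finsupp.smul_single,
        smul_eq_mul, mul_one]
      by_cases hij : i = j
      · rw [hij, Matrix.diagonal_apply_eq, Finsupp.single_eq_same]
      · rw [Matrix.diagonal_apply_ne _ hij, Finsupp.single_eq_of_ne hij]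
    rwa [h3] at h1
  rw [Ideal.span_singleton_eq_span_singleton.2 hdet,
    index_span_prod _ fun i => Submodule.smithNormalFormCoeffs_ne_zero b h i]
  change Nat.card (M ⧸ LinearMap.range f) = ∏ i, Nat.card (R ⧸ Ideal.span {a i})
  rw [Nat.card_congr (Submodule.quotientEquivPiSpan (LinearMap.range f) b h).toEquiv, Nat.card_pi]

end Index

/-! ### Cokernels after localization -/

section Localization

variable {A Q M V : Type u} [CommRing A] [IsDomain A] [Field Q] [Algebra A Q] [IsFractionRing A Q]
  [AddCommGroup M] [Module A M] [Module.Finite A M] [AddCommGroup V] [Module Q V]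

/-- The part of the cokernel of an endomorphism that survives in a localization which is a principal
ideal domain. -/
theorem relIndex_range_eq (ι : M →+ V) (hι : Function.Injective ι)
    (hA : ∀ (a : A) (x : M), ι (a • x) = algebraMap A Q a • ι x)
    (hden : ∀ y : V, ∃ a : A, a ≠ 0 ∧ ∃ x : M, algebraMap A Q a • y = ι x) {f : M →ₗ[A] M}
    {F : V →ₗ[Q] V} (hF : ∀ x, F (ι x) = ι (f x)) (hinj : Function.Injective F) {δ : A}
    (hδ : LinearMap.det F = algebraMap A Q δ) {S : Submonoid A} (hS : S ≤ A⁰) (R : Type u)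
    [CommRing R] [IsDomain R] [IsPrincipalIdealRing R] [Algebra A R] [IsLocalization S R]
    (X : AddSubgroup M)
    (h1 : ∀ x ∈ X, ∀ s ∈ S, s • x ∈ Set.range f → x ∈ Set.range f)
    (h2 : ∀ x, ∃ s ∈ S, s • x ∈ X)
    (h3 : ∀ x ∈ X, ∀ s ∈ S, ∃ y ∈ X, s • y - x ∈ Set.range f) :
    (LinearMap.range f).toAddSubgroup.relIndex X =
      (Ideal.span {algebraMap A R δ}).toAddSubgroup.index := by
  let _ : Algebra R Q := IsLocalization.localizationAlgebraOfSubmonoidLe R Q S A⁰ hS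
  have : IsScalarTower A R Q := IsLocalization.localization_isScalarTower_of_submonoid_le R Q S A⁰ hS
  have hfrac : IsFractionRing R Q := IsFractionRing.isFractionRing_of_isDomain_of_isLocalization S R Q
  let _ : Module R V := Module.compHom V (algebraMap R Q)
  have : IsScalarTower R Q V := ⟨fun a q x => by rw [Algebra.smul_def, mul_smul]; rfl⟩
  have hRV : ∀ (r : R) (y : V), r • y = algebraMap R Q r • y := fun _ _ => rfl
  have hS0 : ∀ s ∈ S, algebraMap A Q s ≠ 0 := fun s hs => by
    rw [Ne, IsFractionRing.to_map_eq_zero_iff]; exact nonZeroDivisors.ne_zero (hS hs)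
  -- Y is the localization of M at S, realized inside V. It is free over the principal ideal domain
  -- R, and F acts on it.
  obtain ⟨Y, hY⟩ : ∃ Y : Submodule R V,
      ∀ y, y ∈ Y ↔ ∃ s ∈ S, ∃ x, algebraMap A Q s • y = ι x := by
    refine ⟨{ carrier := {y | ∃ s ∈ S, ∃ x, algebraMap A Q s • y = ι x}, add_mem' := ?_,
              zero_mem' := ?_, smul_mem' := ?_ }, fun _ => Iff.rfl⟩
    · rintro y y' ⟨s, hs, x, hx⟩ ⟨s', hs', x', hx'⟩
      refine ⟨s * s', S.mul_mem hs hs', s' • x + s • x', ?_⟩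
      rw [map_add, hA, hA, ← hx, ← hx', smul_smul, smul_smul, ← map_mul, ← map_mul, mul_comm s' s,
        smul_add]
    · exact ⟨1, S.one_mem, 0, by rw [smul_zero, map_zero]⟩
    · rintro r y ⟨s, hs, x, hx⟩
      obtain ⟨a, t, rfl⟩ := IsLocalization.exists_mk'_eq S r
      refine ⟨s * t, S.mul_mem hs t.2, a • x, ?_⟩
      have h4 : algebraMap A Q t * algebraMap R Q (IsLocalization.mk' R a t) = algebraMap A Q a := by
        rw [IsScalarTower.algebraMap_apply A R Q, ← map_mul, mul_comm, IsLocalization.mk'_spec,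
          ← IsScalarTower.algebraMap_apply]
      rw [hRV, map_mul, mul_smul, smul_smul (algebraMap A Q t), h4, smul_comm, hx, hA]
  have hιY : ∀ x, ι x ∈ Y := fun x => (hY _).2 ⟨1, S.one_mem, x, by rw [map_one, one_smul]⟩
  have hFY : ∀ y ∈ Y, F y ∈ Y := by
    intro y hy
    obtain ⟨s, hs, x, hx⟩ := (hY y).1 hy
    exact (hY _).2 ⟨s, hs, f x, by rw [← map_smul, hx, hF]⟩
  have hAR : ∀ (a : A) (y : V), algebraMap A R a • y = algebraMap A Q a • y := fun a y => by
    rw [hRV, ← IsScalarTower.algebraMap_apply]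
  have hYfin : Module.Finite R Y := by
    obtain ⟨T, hT⟩ := Module.Finite.fg_top (R := A) (M := M)
    classical
    refine Module.Finite.iff_fg.2 ⟨T.image ι, le_antisymm (Submodule.span_le.2 ?_) fun y hy => ?_⟩
    · intro y hy
      obtain ⟨x, -, rfl⟩ := Finset.mem_image.1 hy
      exact hιY x
    · obtain ⟨s, hs, x, hx⟩ := (hY y).1 hy
      have h4 : ι x ∈ Submodule.span R (T.image ι : Set V) := by
        clear hx
        have hx : x ∈ Submodule.span A (T : Set M) := hT ▸ Submodule.mem_top
        induction hx using Submodule.span_induction with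
        | mem x hx => exact Submodule.subset_span (Finset.mem_image_of_mem _ hx)
        | zero => rw [map_zero]; exact Submodule.zero_mem _
        | add x x' _ _ h h' => rw [map_add]; exact Submodule.add_mem _ h h'
        | smul a x _ h => rw [hA, ← hAR]; exact Submodule.smul_mem _ _ h
      have h5 : y = IsLocalization.mk' R 1 ⟨s, hs⟩ • ι x := by
        rw [← hx, ← hAR, smul_smul, IsLocalization.mk'_spec, map_one, one_smul]
      rw [h5]
      exact Submodule.smul_mem _ _ h4
  have htf : Module.IsTorsionFree R V := .trans_faithfulSMul R Q V
  have : Module.Free R Y := inferInstance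
  let g : Y →ₗ[R] Y := (F.restrictScalars R).restrict hFY
  have hg : ∀ y : Y, (g y : V) = F y := fun _ => rfl
  have hginj : Function.Injective g := fun y y' h => Subtype.ext (hinj (congrArg Subtype.val h))
  have hdet : LinearMap.det g = algebraMap A R δ := by
    have hloc : IsLocalizedModule R⁰ Y.subtype :=
      isLocalizedModule_of_injective (Q := Q) Y.subtype Subtype.val_injective fun y => by
        obtain ⟨a, ha, x, hx⟩ := hden y
        refine ⟨algebraMap A R a, fun h0 => ha ?_, ⟨ι x, hιY x⟩, ?_⟩
        · exact IsLocalization.injective R hS (h0.trans (map_zero _).symm)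
        · rw [← IsScalarTower.algebraMap_apply]; exact hx
    have hbc : IsBaseChange Q Y.subtype := (isLocalizedModule_iff_isBaseChange R⁰ Q _).1 hloc
    have hconj : hbc.equiv.toLinearMap ∘ₗ g.baseChange Q ∘ₗ hbc.equiv.symm.toLinearMap = F := by
      refine hbc.algHom_ext _ _ fun y => ?_
      change hbc.equiv (g.baseChange Q (hbc.equiv.symm (Y.subtype y))) = F y
      rw [hbc.equiv_symm_apply, LinearMap.baseChange_tmul, hbc.equiv_tmul, one_smul]
      rfl
    refine IsFractionRing.injective R Q ?_
    rw [← LinearMap.det_baseChange, ← IsScalarTower.algebraMap_apply, ← hδ, ← hconj,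
      LinearMap.det_conj]
  rw [← hdet, ← index_range_eq hginj]
  -- X maps to the cokernel of the localized map. By `h1` the kernel is the part of X in the image
  -- of f; `h2` and `h3` give surjectivity.
  let θ : X →+ Y ⧸ LinearMap.range g := AddMonoidHom.mk'
    (fun x => Submodule.Quotient.mk ⟨ι x, hιY x⟩) fun x x' => by
      rw [← Submodule.Quotient.mk_add]
      exact congrArg _ (Subtype.ext (map_add ι (x : M) x'))
  have hθ : ∀ x : X, θ x = 0 ↔ ∃ y : Y, F y = ι x := fun x => by
    change Submodule.Quotient.mk _ = _ ↔ _
    rw [Submodule.Quotient.mk_eq_zero]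
    exact ⟨fun ⟨y, hy⟩ => ⟨y, congrArg Subtype.val hy⟩, fun ⟨y, hy⟩ => ⟨y, Subtype.ext hy⟩⟩
  have hker : θ.ker = (LinearMap.range f).toAddSubgroup.addSubgroupOf X := by
    ext x
    rw [AddMonoidHom.mem_ker, hθ, AddSubgroup.mem_addSubgroupOf]
    constructor
    · rintro ⟨y, hy⟩
      obtain ⟨s, hs, m, hm⟩ := (hY _).1 y.2
      refine h1 x x.2 s hs ⟨m, hι ?_⟩
      rw [← hF, ← hm, map_smul, hy, hA]
    · rintro ⟨m, hm⟩
      exact ⟨⟨ι m, hιY m⟩, by rw [← hm, ← hF]⟩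
  have hsurj : Function.Surjective θ := by
    intro y
    obtain ⟨y, rfl⟩ := Submodule.Quotient.mk_surjective _ y
    obtain ⟨s, hs, m, hm⟩ := (hY _).1 y.2
    obtain ⟨s', hs', hx⟩ := h2 m
    obtain ⟨x', hx', w, hw⟩ := h3 _ hx (s' * s) (S.mul_mem hs' hs)
    refine ⟨⟨x', hx'⟩, (Submodule.Quotient.eq _).2 ?_⟩
    have ht : algebraMap A Q (s' * s) ≠ 0 := hS0 _ (S.mul_mem hs' hs)
    refine ⟨⟨(algebraMap A Q (s' * s))⁻¹ • ι w, (hY _).2 ⟨s' * s, S.mul_mem hs' hs, w, by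
      rw [smul_smul, mul_inv_cancel₀ ht, one_smul]⟩⟩, Subtype.ext ?_⟩
    change F ((algebraMap A Q (s' * s))⁻¹ • ι w) = ι x' - y
    refine smul_right_injective V ht ?_
    change algebraMap A Q (s' * s) • F ((algebraMap A Q (s' * s))⁻¹ • ι w) =
      algebraMap A Q (s' * s) • (ι x' - y)
    rw [map_smul, smul_smul, mul_inv_cancel₀ ht, one_smul, hF, hw, map_sub, hA, hA, smul_sub, ← hm,
      smul_smul, ← map_mul]
  have h4 := AddSubgroup.index_ker θ
  rw [hker, AddMonoidHom.range_eq_top.2 hsurj] at h4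
  exact h4.trans (Nat.card_congr AddSubgroup.topEquiv.toEquiv)

end Localization

open IsDedekindDomain

/-! ### Localizations of Dedekind domains -/

section Dedekind

variable {A : Type u} [CommRing A] [IsDedekindDomain A]

theorem finite_quotient_of_ne_bot (Fq : Type*) [Field Fq] [Finite Fq] [Algebra Fq A]
    [Algebra.FiniteType Fq A] {I : Ideal A} (hI : I ≠ ⊥) : Finite (A ⧸ I) := by
  induction I using UniqueFactorizationMonoid.induction_on_prime with
  | h₁ => exact absurd rfl hI
  | h₂ I h =>
    rw [Ideal.isUnit_iff] at h
    have := Ideal.Quotient.subsingleton_iff.2 h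
    infer_instance
  | h₃ J v hJ hv ih =>
    have := Ideal.isPrime_of_prime hv
    have : v.IsMaximal := Ring.DimensionLEOne.maximalOfPrime hv.ne_zero this
    have := finite_quotient_of_isMaximal Fq v
    have := ih hJ
    exact Submodule.finite_quotient_smul v (N := J) (IsNoetherian.noetherian J)

theorem HeightOneSpectrum.exists_eq_pow_mul (v : HeightOneSpectrum A) {I : Ideal A} (hI : I ≠ 0) :
    ∃ J : Ideal A, ¬ J ≤ v.asIdeal ∧
      I = v.asIdeal ^ (Associates.mk v.asIdeal).count (Associates.mk I).factors * J := by
  obtain ⟨k, J, hJ, rfl⟩ := WfDvdMonoid.max_power_factor hI v.irreducible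
  have hv := v.associates_irreducible
  have hJ0 : J ≠ 0 := right_ne_zero_of_mul hI
  have hk : (Associates.mk v.asIdeal).count (Associates.mk (v.asIdeal ^ k * J)).factors = k := by
    rw [← Associates.mk_mul_mk, Associates.count_mul (by simpa using left_ne_zero_of_mul hI)
      (by simpa using hJ0) hv, Associates.mk_pow, Associates.count_pow (by simpa using v.ne_bot) hv,
      Associates.count_self hv, mul_one,
      not_not.1 (mt (Associates.count_ne_zero_iff_dvd hJ0 v.irreducible).1 hJ), add_zero]
  refine ⟨J, fun h => hJ (Ideal.dvd_iff_le.2 h), by rw [hk]⟩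

/-- In the discrete valuation ring at v, the ideal generated by n is the power of the maximal ideal
given by the multiplicity of v in (n), and the residue field is A / v. -/
theorem index_span_atPrime (v : HeightOneSpectrum A) {n : A} (hn : n ≠ 0) :
    (Ideal.span {algebraMap A (Localization.AtPrime v.asIdeal) n}).toAddSubgroup.index =
      Nat.card (A ⧸ v.asIdeal) ^
        (Associates.mk v.asIdeal).count (Associates.mk (Ideal.span {n})).factors := by
  have := v.isMaximal
  obtain ⟨J, hJ, hI⟩ := HeightOneSpectrum.exists_eq_pow_mul v
    (mt Ideal.span_singleton_eq_bot.1 hn : Ideal.span {n} ≠ ⊥)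
  obtain ⟨k, hk⟩ : ∃ k, k = (Associates.mk v.asIdeal).count (Associates.mk (Ideal.span {n})).factors :=
    ⟨_, rfl⟩
  rw [← hk] at hI ⊢
  have := IsLocalization.AtPrime.isDiscreteValuationRing_of_dedekind_domain A v.ne_bot
    (Localization.AtPrime v.asIdeal)
  have hJ1 : J.map (algebraMap A (Localization.AtPrime v.asIdeal)) = ⊤ := by
    obtain ⟨j, hj, hjv⟩ := SetLike.not_le_iff_exists.1 hJ
    exact Ideal.eq_top_of_isUnit_mem _ (Ideal.mem_map_of_mem _ hj)
      (IsLocalization.map_units (M := v.asIdeal.primeCompl) _ ⟨j, hjv⟩)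
  have h1 : Ideal.span {algebraMap A (Localization.AtPrime v.asIdeal) n} =
      IsLocalRing.maximalIdeal (Localization.AtPrime v.asIdeal) ^ k := by
    rw [← Set.image_singleton, ← Ideal.map_span, hI, Ideal.map_mul, Ideal.map_pow, hJ1,
      Ideal.mul_top, Localization.AtPrime.map_eq_maximalIdeal]
  rw [h1]
  have h2 := cardQuot_pow_of_prime (P := IsLocalRing.maximalIdeal (Localization.AtPrime v.asIdeal))
    (IsDiscreteValuationRing.not_a_field _) (i := k)
  refine h2.trans (congrArg (· ^ k) ?_)
  exact (Nat.card_congr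
    (IsLocalization.AtPrime.equivQuotMaximalIdeal v.asIdeal (Localization.AtPrime v.asIdeal)).toEquiv).symm

/-- A semilocal principal ideal domain in which the units modulo `n` are invertible. -/
theorem exists_localization_isPrincipalIdealRing {n : A} (hn : n ≠ 0) :
    ∃ S : Submonoid A, S ≤ A⁰ ∧ IsDomain (Localization S) ∧ IsPrincipalIdealRing (Localization S) ∧
      ∀ s ∈ S, ∃ u w : A, u * s = 1 + n * w := by
  -- S consists of the nonzero elements that are invertible modulo n. The nonzero primes surviving
  -- in the localization divide n, so there are finitely many, and a semilocal Dedekind domain is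
  -- principal.
  let S : Submonoid A :=
    (IsUnit.submonoid (A ⧸ Ideal.span {n})).comap (Ideal.Quotient.mk (Ideal.span {n})) ⊓ A⁰
  have hS : S ≤ A⁰ := inf_le_right
  have hmem : ∀ s, s ≠ 0 → ∀ u w, u * s = 1 + n * w → s ∈ S := fun s hs u w h =>
    ⟨IsUnit.of_mul_eq_one (Ideal.Quotient.mk _ u) (by
      rw [← map_mul, ← map_one (Ideal.Quotient.mk (Ideal.span {n})), Ideal.Quotient.eq,
        Ideal.mem_span_singleton]
      exact ⟨w, by rw [mul_comm, h]; ring⟩), mem_nonZeroDivisors_of_ne_zero hs⟩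
  have hdom : IsDomain (Localization S) := IsLocalization.isDomain_localization hS
  have hded : IsDedekindDomain (Localization S) := IsLocalization.isDedekindDomain A hS _
  refine ⟨S, hS, hdom, ?_, ?_⟩
  · refine IsPrincipalIdealRing.of_finite_primes ?_
    have hfin : ({⊥} ∪ HeightOneSpectrum.asIdeal '' {v : HeightOneSpectrum A |
        v.asIdeal ∣ Ideal.span {n}} : Set (Ideal A)).Finite :=
      (Set.finite_singleton _).union
        ((Ideal.finite_factors (mt Ideal.span_singleton_eq_bot.1 hn)).image _)
    refine Set.Finite.of_injOn (f := IsLocalization.orderEmbedding S (Localization S)) ?_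
      (IsLocalization.orderEmbedding S (Localization S)).injective.injOn hfin
    intro I hI
    have hI : I.IsPrime := hI
    have hp : (I.under A).IsPrime := inferInstance
    have hdisj : ∀ s ∈ S, s ∉ I.under A := fun s hs hsI =>
      hI.ne_top (Ideal.eq_top_of_isUnit_mem _ hsI (IsLocalization.map_units (M := S) _ ⟨s, hs⟩))
    change I.under A ∈ _
    by_cases h0 : I.under A = ⊥
    · exact Or.inl h0
    refine Or.inr ⟨⟨I.under A, hp, h0⟩, ?_, rfl⟩
    change I.under A ∣ _
    rw [Ideal.dvd_span_singleton]
    by_contra hnI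
    have hmax : (I.under A).IsMaximal := Ring.DimensionLEOne.maximalOfPrime h0 hp
    obtain ⟨y, i, hi, hy⟩ := hmax.exists_inv hnI
    -- A prime not containing n contains some i congruent to 1 modulo n, which lies in S unless it
    -- is 0. In that case n is a unit and S contains every nonzero element.
    by_cases hi0 : i = 0
    · obtain ⟨p, hp, hp0⟩ := Submodule.exists_mem_ne_zero_of_ne_bot h0
      rw [hi0, add_zero] at hy
      exact hdisj p (hmem p hp0 0 (-y) (by linear_combination hy)) hp
    · exact hdisj i (hmem i hi0 1 (-y) (by linear_combination hy)) hi
  · rintro s ⟨hs, -⟩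
    obtain ⟨u, hu⟩ := IsUnit.exists_left_inv hs
    obtain ⟨u, rfl⟩ := Ideal.Quotient.mk_surjective u
    rw [← map_mul, ← map_one (Ideal.Quotient.mk (Ideal.span {n})), Ideal.Quotient.eq,
        Ideal.mem_span_singleton] at hu
    obtain ⟨w, hw⟩ := hu
    exact ⟨u, w, by rw [← hw]; ring⟩

end Dedekind

open IsDedekindDomain

/-! ### Cokernels and degrees of isogenies -/

namespace PureAndersonMotive

variable {Fq A Q L : Type u} [Field Fq] [Fintype Fq] [CommRing A] [IsDedekindDomain A]
  [Algebra Fq A] [Algebra.FiniteType Fq A] [Field Q] [Algebra Fq Q] [Algebra A Q]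
  [IsScalarTower Fq A Q] [IsFractionRing A Q] [Field L] [Finite L] [Algebra Fq L]
  {P : PlaceAtInfty Fq A Q} {c : A →ₐ[Fq] L} {M : PureAndersonMotive P c}

omit [IsScalarTower Fq A Q] [IsFractionRing A Q] in
-- The cokernel is a quotient of M / n M, and A / n is finite.
theorem finite_coker {n : A} (hn : n ≠ 0) (f : M.End) (hf : ∀ x, n • x ∈ M.image f) :
    Finite (M.Coker f) := by
  have := M.module_finite
  have := finite_quotient_of_ne_bot Fq (mt Ideal.span_singleton_eq_bot.1 hn)
  have h1 : Finite (M.M ⧸ Ideal.span {n} • (⊤ : Submodule A M.M)) :=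
    Submodule.finite_quotient_smul _ Module.Finite.fg_top
  have h2 : ∀ x ∈ Ideal.span {n} • (⊤ : Submodule A M.M), x ∈ M.image f := fun x hx =>
    Submodule.smul_induction_on hx (fun a ha y _ => by
      obtain ⟨b, rfl⟩ := Ideal.mem_span_singleton'.1 ha
      rw [mul_comm, mul_smul]
      exact hf _) fun _ _ => add_mem
  have h3 : Finite (M.M ⧸ (Ideal.span {n} • (⊤ : Submodule A M.M)).toAddSubgroup) := h1
  exact Finite.of_surjective (β := M.M ⧸ (M.image f).toAddSubgroup) (QuotientAddGroup.map
    (Ideal.span {n} • (⊤ : Submodule A M.M)).toAddSubgroup (M.image f).toAddSubgroup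
    (AddMonoidHom.id M.M) h2) fun y => by
      obtain ⟨x, rfl⟩ := QuotientAddGroup.mk_surjective y
      exact ⟨QuotientAddGroup.mk x, rfl⟩

namespace IsGenericFibre

variable {N : FrobSpace Fq Q L} {ι : M.M →ₗ[L] N.V} (h : M.IsGenericFibre N ι)

include h

omit [Algebra.FiniteType Fq A] in
theorem finrank_eq : Module.finrank Q N.V = Module.finrank Fq L * M.rank := by
  have := M.module_finite
  have := h.isTorsionFree
  have := P.isDomain_tensor (L := L)
  rw [N.finrank_eq P]
  congr 1
  obtain ⟨p⟩ : Nonempty (PrimeSpectrum (A ⊗[Fq] L)) := inferInstance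
  have h1 := finrank_genericFibre P ι h.injective h.map_smul_A h.exists_smul_eq
  have h2 := (locally_free_of_isTorsionFree (L := L) (U := M.M) P).2.2 p
  exact h1.trans (h2.symm.trans (M.locally_free.2.2 p))

omit [IsDedekindDomain A] [Algebra.FiniteType Fq A] [IsScalarTower Fq A Q] [Finite L] in
theorem injective_of_injective {f : M.M →ₗ[A] M.M} (hf : Function.Injective f)
    {F : N.V →ₗ[Q] N.V} (hF : ∀ x, F (ι x) = ι (f x)) : Function.Injective F := by
  rw [injective_iff_map_eq_zero]
  intro y hy
  obtain ⟨a, ha, x, hx⟩ := h.exists_smul_eq y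
  have ha' : algebraMap A Q a ≠ 0 := by rwa [Ne, IsFractionRing.to_map_eq_zero_iff]
  have h1 : ι (f x) = ι (f 0) := by rw [← hF, ← hx, map_smul, hy, smul_zero, map_zero, map_zero]
  rw [hf (h.injective h1), map_zero] at hx
  exact (smul_eq_zero.1 hx).resolve_left ha'

/-- The dimension of the cokernel of `n` if `n` is the norm of `f`. -/
theorem finrank_coker {n : A} (hn : n ≠ 0) {f g : M.End} (hf : Function.Injective f.1)
    (hfg : f * g = algebraMap A M.End n) {F : N.V →ₗ[Q] N.V} (hF : ∀ x, F (ι x) = ι (f.1 x))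
    (hdet : LinearMap.det F = algebraMap A Q n ^ Module.finrank Fq L) :
    Module.finrank L (M.Coker (algebraMap A M.End n)) = M.rank * Module.finrank L (M.Coker f) := by
  have := M.module_finite
  have hfin := h.finiteDimensional
  have hfgx : ∀ x, n • x = f.1 (g.1 x) := fun x =>
    (LinearMap.congr_fun (congrArg Subtype.val hfg) x).symm
  have hn' : algebraMap A Q n ≠ 0 := by rwa [Ne, IsFractionRing.to_map_eq_zero_iff]
  obtain ⟨S, hS, hdom, hpid, hSn⟩ := exists_localization_isPrincipalIdealRing hn
  -- The cokernel of a map dividing n is killed by n, so the elements of S already act bijectively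
  -- on it. Hence its cardinality can be computed after localization, where it is the index of the
  -- determinant.
  have key : ∀ (f' g' : M.M →ₗ[A] M.M) (F' : N.V →ₗ[Q] N.V), (∀ x, F' (ι x) = ι (f' x)) →
      Function.Injective F' → (∀ x, n • x = f' (g' x)) → ∀ k : ℕ,
      LinearMap.det F' = algebraMap A Q n ^ k → (LinearMap.range f').toAddSubgroup.index =
        (Ideal.span {algebraMap A (Localization S) n}).toAddSubgroup.index ^ k := by
    intro f' g' F' hF' hinj' hfg' k hk
    have h0 : algebraMap A (Localization S) n ≠ 0 := fun h0 =>
      hn (IsLocalization.injective _ hS (h0.trans (map_zero _).symm))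
    rw [← index_span_pow h0, ← map_pow, ← AddSubgroup.relIndex_top_right]
    refine relIndex_range_eq ι.toAddMonoidHom h.injective h.map_smul_A h.exists_smul_eq hF' hinj'
      (hk.trans (map_pow _ _ _).symm) hS (Localization S) ⊤ ?_ (fun x => ⟨1, S.one_mem, trivial⟩) ?_
    · rintro x - s hs ⟨y, hy⟩
      obtain ⟨u, w, hu⟩ := hSn s hs
      refine ⟨u • y - w • g' x, ?_⟩
      rw [map_sub, map_smul, map_smul, hy, ← hfg', smul_smul, smul_smul, hu, ← sub_smul,
        mul_comm w, add_sub_cancel_right, one_smul]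
    · rintro x - s hs
      obtain ⟨u, w, hu⟩ := hSn s hs
      refine ⟨u • x, trivial, w • g' x, ?_⟩
      rw [map_smul, ← hfg', smul_smul, smul_smul, mul_comm s, hu, add_smul, one_smul,
        add_sub_cancel_left, mul_comm w]
  have h1 := key f.1 g.1 F hF (h.injective_of_injective hf hF) hfgx _ hdet
  -- The determinant of f over Q is n^e, while that of multiplication by n is n to the power dim_Q V
  -- = e r. The index for n is therefore the r-th power of the index for f.
  have h2 := key (algebraMap A M.End n).1 1 (algebraMap A Q n • 1) (fun x => (h.map_smul_A n x).symm)
    (smul_right_injective N.V hn') (fun x => rfl) (Module.finrank Fq L * M.rank) (by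
      rw [LinearMap.det_smul, ← h.finrank_eq, map_one, mul_one])
  rw [pow_mul, ← h1] at h2
  have h3 : Finite (M.Coker f) := finite_coker hn f fun x => ⟨g.1 x, (hfgx x).symm⟩
  have h4 : Finite (M.Coker (algebraMap A M.End n)) := finite_coker hn _ fun x => ⟨x, rfl⟩
  have h5 : Nat.card (M.Coker (algebraMap A M.End n)) = Nat.card (M.Coker f) ^ M.rank := h2
  rw [Module.natCard_eq_pow_finrank (K := L), Module.natCard_eq_pow_finrank (K := L) (V := M.Coker f),
    ← pow_mul] at h5
  rw [Nat.pow_right_injective (Finite.one_lt_card (α := L)) h5, mul_comm]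

omit [IsScalarTower Fq A Q] in
/-- The dimension of the primary parts of the cokernel of an endomorphism of norm `n`. -/
theorem relDim_primary {n : A} (hn : n ≠ 0) {f g : M.End} (hf : Function.Injective f.1)
    (hfg : f * g = algebraMap A M.End n) {F : N.V →ₗ[Q] N.V} (hF : ∀ x, F (ι x) = ι (f.1 x))
    (hdet : LinearMap.det F = algebraMap A Q n ^ Module.finrank Fq L) (v : HeightOneSpectrum A) :
    relDim (M.image f) (M.primary f v.asIdeal) / Module.finrank Fq (A ⧸ v.asIdeal) =
      (Associates.mk v.asIdeal).count (Associates.mk (Ideal.span {n})).factors := by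
  have := M.module_finite
  have := h.finiteDimensional
  have hv := v.isMaximal
  have hfgx : ∀ x, n • x = f.1 (g.1 x) := fun x =>
    (LinearMap.congr_fun (congrArg Subtype.val hfg) x).symm
  have hdvr := IsLocalization.AtPrime.isDiscreteValuationRing_of_dedekind_domain A v.ne_bot
    (Localization.AtPrime v.asIdeal)
  have hle := v.asIdeal.primeCompl_le_nonZeroDivisors
  -- An element outside v is invertible modulo v^m, so it acts bijectively on elements of the
  -- cokernel killed by v^m.
  have hinv : ∀ (m : ℕ), ∀ s ∈ v.asIdeal.primeCompl, ∃ u, ∃ p ∈ v.asIdeal ^ m, p + u * s = 1 := by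
    intro m s hs
    obtain ⟨y, i, hi, hy⟩ := hv.exists_inv hs
    have h1 : IsCoprime (v.asIdeal ^ m) (Ideal.span {s}) := IsCoprime.pow_left
      (Ideal.isCoprime_iff_exists.2 ⟨i, hi, y * s, Ideal.mem_span_singleton'.2 ⟨y, rfl⟩,
        (add_comm _ _).trans hy⟩)
    obtain ⟨p, hp, q, hq, hpq⟩ := Ideal.isCoprime_iff_exists.1 h1
    obtain ⟨u, rfl⟩ := Ideal.mem_span_singleton'.1 hq
    exact ⟨u, p, hp, hpq⟩
  have h0 : algebraMap A (Localization.AtPrime v.asIdeal) n ≠ 0 := fun h0 =>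
    hn (IsLocalization.injective _ hle (h0.trans (map_zero _).symm))
  have key := relIndex_range_eq ι.toAddMonoidHom h.injective h.map_smul_A h.exists_smul_eq hF
    (h.injective_of_injective hf hF) (hdet.trans (map_pow _ _ _).symm) hle
    (Localization.AtPrime v.asIdeal) (M.primary f v.asIdeal).toAddSubgroup ?_ ?_ ?_
  · rw [map_pow, index_span_pow h0, index_span_atPrime v hn] at key
    have := finite_quotient_of_isMaximal Fq v.asIdeal
    have hne : (M.image f).toAddSubgroup.relIndex (M.primary f v.asIdeal).toAddSubgroup ≠ 0 :=
      key.trans_ne (pow_ne_zero _ (pow_ne_zero _ Nat.card_pos.ne'))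
    have h1 := (relIndex_eq_pow_relDim hne).2.symm.trans key
    have : Module.Finite Fq (A ⧸ v.asIdeal) := Module.Finite.of_finite
    rw [Module.natCard_eq_pow_finrank (K := Fq) (V := L),
      Module.natCard_eq_pow_finrank (K := Fq) (V := A ⧸ v.asIdeal), ← pow_mul, ← pow_mul,
      ← pow_mul] at h1
    have h2 := Nat.pow_right_injective (Finite.one_lt_card (α := Fq)) h1
    -- The factor e occurs on both sides, once as the degree of L and once as the exponent in det F
    -- = n^e, and cancels. The division by the degree of v is then exact.
    have h3 : Module.finrank Fq L * relDim (M.image f) (M.primary f v.asIdeal) =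
        Module.finrank Fq L * (Module.finrank Fq (A ⧸ v.asIdeal) *
          (Associates.mk v.asIdeal).count (Associates.mk (Ideal.span {n})).factors) := by
      refine Eq.trans ?_ (h2.trans ?_) <;> ring
    rw [Nat.eq_of_mul_eq_mul_left Module.finrank_pos h3, Nat.mul_div_cancel_left _ Module.finrank_pos]
  · rintro x ⟨m, hx⟩ s hs ⟨y, hy⟩
    obtain ⟨u, p, hp, hpu⟩ := hinv m s hs
    obtain ⟨w, hw⟩ := hx p hp
    exact ⟨w + u • y, by rw [map_add, map_smul, hw, hy, smul_smul, ← add_smul, hpu, one_smul]⟩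
  · intro x
    obtain ⟨J, hJ, hI⟩ := HeightOneSpectrum.exists_eq_pow_mul v
      (mt Ideal.span_singleton_eq_bot.1 hn : Ideal.span {n} ≠ ⊥)
    -- Multiplication by an element j of the prime-to-v part of (n) moves everything into the
    -- v-primary part.
    obtain ⟨j, hj, hjv⟩ := SetLike.not_le_iff_exists.1 hJ
    refine ⟨j, hjv, show j • x ∈ M.primary f v.asIdeal from
      ⟨(Associates.mk v.asIdeal).count (Associates.mk (Ideal.span {n})).factors, fun a ha => ?_⟩⟩
    obtain ⟨w, hw⟩ := Ideal.mem_span_singleton'.1 (hI.ge (Ideal.mul_mem_mul ha hj))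
    exact ⟨g.1 (w • x), by rw [← hfgx, smul_smul, smul_smul, ← hw, mul_comm]⟩
  · rintro x ⟨m, hx⟩ s hs
    obtain ⟨u, p, hp, hpu⟩ := hinv m s hs
    obtain ⟨w, hw⟩ := hx p hp
    refine ⟨u • x, ⟨m, fun a ha => ?_⟩, -w, ?_⟩
    · obtain ⟨y, hy⟩ := hx a ha
      exact ⟨u • y, by rw [map_smul, hy, smul_comm]⟩
    · rw [map_neg, hw, smul_smul, mul_comm s, neg_eq_iff_add_eq_zero, ← add_sub_assoc, ← add_smul, hpu,
        one_smul, sub_self]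

omit [IsScalarTower Fq A Q] in
/-- The degree of an isogeny is generated by its norm. -/
theorem deg_eq {n : A} (hn : n ≠ 0) {f g : M.End} (hf : Function.Injective f.1)
    (hfg : f * g = algebraMap A M.End n) {F : N.V →ₗ[Q] N.V} (hF : ∀ x, F (ι x) = ι (f.1 x))
    (hdet : LinearMap.det F = algebraMap A Q n ^ Module.finrank Fq L) :
    M.deg f = Ideal.span {n} := by
  rw [← Ideal.finprod_heightOneSpectrum_factorization
    (mt Ideal.span_singleton_eq_bot.1 hn : Ideal.span {n} ≠ ⊥), deg]
  exact finprod_congr fun v => by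
    rw [h.relDim_primary hn hf hfg hF hdet v, HeightOneSpectrum.maxPowDividing]

end IsGenericFibre

end PureAndersonMotive

/-! ### Nonvanishing of the norm and the dual isogeny -/

namespace PureAndersonMotive

variable {Fq A Q L : Type u} [Field Fq] [Fintype Fq] [CommRing A] [IsDedekindDomain A]
  [Algebra Fq A] [Algebra.FiniteType Fq A] [Field Q] [Algebra Fq Q] [Algebra A Q]
  [IsScalarTower Fq A Q] [IsFractionRing A Q] [Field L] [Finite L] [Algebra Fq L]
  {P : PlaceAtInfty Fq A Q} {c : A →ₐ[Fq] L} (M : PureAndersonMotive P c)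

omit [Algebra.FiniteType Fq A] [IsScalarTower Fq A Q] in
theorem IsGenericFibre.norm_ne_zero {M : PureAndersonMotive P c} {N : FrobSpace Fq Q L}
    {ι : M.M →ₗ[L] N.V} (h : M.IsGenericFibre N ι) {n : A} {f : M.M →ₗ[A] M.M}
    (hf : Function.Injective f) {F : N.V →ₗ[Q] N.V} (hF : ∀ x, F (ι x) = ι (f x))
    (hdet : LinearMap.det F = algebraMap A Q n ^ Module.finrank Fq L) : n ≠ 0 := by
  rintro rfl
  have := h.finiteDimensional
  have : Module.Finite Fq L := Module.Finite.of_finite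
  rw [map_zero, zero_pow Module.finrank_pos.ne'] at hdet
  exact (LinearMap.bot_lt_ker_of_det_eq_zero hdet).ne'
    (LinearMap.ker_eq_bot.2 (h.injective_of_injective hf hF))

omit [Algebra.FiniteType Fq A] in
-- From f g = n and torsion-freeness g is injective, and from g f = n the element n ⊗ 1 annihilates
-- its cokernel.
theorem isIsogeny_of_mul_eq [Module.IsTorsionFree A M.M] {n : A} (hn : n ≠ 0) {f g : M.End}
    (hfg : f * g = algebraMap A M.End n) (hgf : g * f = algebraMap A M.End n) : M.IsIsogeny g := by
  have hfgx : ∀ x, n • x = f.1 (g.1 x) := fun x =>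
    (LinearMap.congr_fun (congrArg Subtype.val hfg) x).symm
  refine ⟨(injective_iff_map_eq_zero _).2 fun x hx => ?_, fun y => ⟨n ⊗ₜ 1, ?_, f.1 y, ?_⟩⟩
  · have := hfgx x
    rw [hx, map_zero] at this
    exact (smul_eq_zero.1 this).resolve_left hn
  · have := P.isDomain_tensor (L := L)
    refine mem_nonZeroDivisors_of_ne_zero fun h0 => hn ?_
    exact Algebra.TensorProduct.includeLeft_injective (S := Fq) (R := Fq) (A := A) (B := L)
      (algebraMap Fq L).injective (h0.trans (map_zero _).symm)
  · rw [tmul_smul_eq, one_smul]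
    exact LinearMap.congr_fun (congrArg Subtype.val hgf) y

end PureAndersonMotive

end AndersonMotive

/-! ### The two theorems -/

theorem mainTheorem9 {Fq A Q L : Type u} [Field Fq] [Fintype Fq] [CommRing A] [IsDedekindDomain A]
    [Algebra Fq A] [Algebra.FiniteType Fq A] [Field Q] [Algebra Fq Q] [Algebra A Q]
    [IsScalarTower Fq A Q] [IsFractionRing A Q] [Field L] [Finite L] [Algebra Fq L]
    (P : AndersonMotive.PlaceAtInfty Fq A Q) :
    (∀ (c : AndersonMotive.Characteristic Fq A L) (F : AndersonMotive.AbelianTauSheaf P c),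
      F.IsSemisimple → (c = .infty → IsSemisimpleRing F.QEnd) →
      ∀ f : F.QEnd, F.IsQuasiIsogeny f →
      ∃ n : Q, (∀ x : Q, AndersonMotive.IsReducedNorm Q F.QEnd f x ↔ x = n) ∧
        (∀ v : IsDedekindDomain.HeightOneSpectrum A,
          (∀ c' : A →ₐ[Fq] L, c = .affine c' → v.asIdeal ≠ RingHom.ker c') →
          Module.Finite (AndersonMotive.ComplField Q v.asIdeal) (F.affTate v.asIdeal) ∧
          Module.Free (AndersonMotive.ComplField Q v.asIdeal) (F.affTate v.asIdeal) ∧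
          Module.finrank (AndersonMotive.ComplField Q v.asIdeal) (F.affTate v.asIdeal) = F.rank ∧
          LinearMap.det (F.affTateMap v.asIdeal f) = AndersonMotive.toCompl Q v.asIdeal n) ∧
        (c ≠ .infty → ∀ (k l : ℕ) (z : Q) (h : F.IsPeriod k l) (hz : P.IsUniformizer z),
          Module.Finite (AndersonMotive.ComplField Q (IsLocalRing.maximalIdeal P.O))
            (F.infTate h hz) ∧
          Module.Free (AndersonMotive.ComplField Q (IsLocalRing.maximalIdeal P.O))
            (F.infTate h hz) ∧
          Module.finrank (AndersonMotive.ComplField Q (IsLocalRing.maximalIdeal P.O))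
            (F.infTate h hz) = l * F.rank ∧
          LinearMap.det (F.infTateMap h hz f) =
            AndersonMotive.toCompl Q (IsLocalRing.maximalIdeal P.O) (n ^ l))) ∧
    (∀ (c : A →ₐ[Fq] L) (M : AndersonMotive.PureAndersonMotive P c), M.IsSemisimple →
      ∀ f : M.End, M.IsIsogeny f →
      ∃ n : A,
        (∀ x : Q, AndersonMotive.IsReducedNorm Q (Q ⊗[A] M.End) (1 ⊗ₜ[A] f) x ↔
          x = algebraMap A Q n) ∧
        FiniteDimensional L (M.Coker f) ∧
        FiniteDimensional L (M.Coker (algebraMap A M.End n)) ∧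
        Module.finrank L (M.Coker (algebraMap A M.End n)) =
          M.rank * Module.finrank L (M.Coker f) ∧
        M.deg f = Ideal.span {n} ∧
        ∃ g : M.End, M.IsIsogeny g ∧ f * g = algebraMap A M.End n ∧
          g * f = algebraMap A M.End n ∧
          ∀ g' : M.End, f * g' = algebraMap A M.End n → g' * f = algebraMap A M.End n → g' = g) := by
  refine ⟨fun c F hF hE f _ => ?_, fun c M hM f hf => ?_⟩
  · have : IsSemisimpleRing F.QEnd := by
      cases c with
      | affine c => exact hF.isSemisimpleRing_QEnd
      | infty => exact hE rfl
    exact F.reducedNorm_eq_det f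
  · obtain ⟨N, ι, h1, h2, h3, h4, -⟩ := M.pure
    have h : M.IsGenericFibre N ι := ⟨h1, h2, h3, h4⟩
    have := hM.isSemisimpleRing_commutant h
    have := h.isTorsionFree
    obtain ⟨n, hnorm, hdet, g, hfg, hgf⟩ := h.exists_norm f
    obtain ⟨F, hF, -⟩ := h.exists_map h f.1 f.2.1 f.2.2
    have hn := h.norm_ne_zero hf.1 hF (hdet F hF)
    have hfgx : ∀ x, n • x = f.1 (g.1 x) := fun x =>
      (LinearMap.congr_fun (congrArg Subtype.val hfg) x).symm
    have := M.finite_coker hn f fun x => ⟨g.1 x, (hfgx x).symm⟩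
    have := M.finite_coker hn (algebraMap A M.End n) fun x => ⟨x, rfl⟩
    exact ⟨n, hnorm, .of_finite, .of_finite, h.finrank_coker hn hf.1 hfg hF (hdet F hF),
      h.deg_eq hn hf.1 hfg hF (hdet F hF), g, M.isIsogeny_of_mul_eq hn hfg hgf, hfg, hgf,
      -- Uniqueness of the dual needs only one of the two relations, because f is injective and can
      -- be cancelled on the left.
      fun g' hg' _ => Subtype.ext (LinearMap.ext fun x => hf.1
        (LinearMap.congr_fun (congrArg Subtype.val (hg'.trans hfg.symm)) x))⟩
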